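/- Let $G$ be a compact simply connected Lie group with Lie algebra $\mathfrak g=\mathfrak g_1\oplus\dots\oplus\mathfrak g_s$ (simple ideals), $T\subset G$ a maximal torus with Lie algebra $\mathfrak t$, and $\Lambda=\ker(\exp:\mathfrak t\to T)$. Fix a system of positive roots (a root $\alpha\in\mathfrak t^*$ is normalised so that $\exp\zeta$ acts on its root space by $e^{2\pi i\alpha(\zeta)}$). Let $B^{G_j}$ be the basic inner product of $\mathfrak g_j$, i.e. the invariant inner product with $B^{G_j}(h,h)=2$ for $h$ the coroot of the highest root of $\mathfrak g_j$, extended by $0$ to the other factors; for $l\in\mathbb Z^s$ put $B_l=\sum_j l_jB^{G_j}$. Fix $f>1$ and let $LG$ be the Banach Lie group of loops $\mathbb R/\mathbb Z\to G$ of Sobolev class $f+\frac12$, with Lie algebra $L\mathfrak g$. Let $LT\subset LG$ be the loops with values in $T$, $\Omega T\subset LT$ those with value $1$ at $0$, and embed $\Lambda\subset\Omega T$ by $\xi\mapsto(s\mapsto\exp(-s\xi))$. Let $1\to U(1)\to\widehat{LG}\to LG\to1$ be the level $l$ central extension: the central extension of Banach Lie groups integrating the Lie algebra extension $L\mathfrak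 g\oplus\mathbb R$ (with $\mathbb R\to U(1)$, $r\mapsto e^{2\pi ir}$) defined by $B_l$, with the sign for which the coadjoint action is $g\cdot(\mu,\tau)=(\mathrm{Ad}_g^*\mu-\tau B_l^\flat(dg\,g^{-1}),\tau)$, that is, with bracket $[(\xi,a),(\eta,b)]=([\xi,\eta],\int_{S^1}B_l(\eta,d\xi))$. For a subgroup $H\subset LG$ let $\widehat H$ be its preimage in $\widehat{LG}$. (a) For $\xi,\xi'\in\Lambda$ the number $B_l(\xi,\xi')$ is an integer, and arbitrary lifts $\hat\xi,\hat\xi'\in\widehat\Lambda$ satisfy $\hat\xi\hat\xi'\hat\xi^{-1}\hat\xi'^{-1}=(-1)^{B_l(\xi,\xi')}$. If all $l_j$ are even, the central extension $\widehat\Lambda$ of $\Lambda$ is trivial, i.e. $\Lambda\to LG$ lifts to a homomorphism $\Lambda\to\widehat{LG}$. The inclusion of $G$ in $LG$ as the constant loops lifts to a smooth homomorphism $j:G\to\widehat{LG}$, and for every such $j$ the following hold. (b) $\widehat{LT}=T\ltimes\widehat{\Omega T}$: $T$ acts on $\widehat{\Omega T}$ by conjugation through $j$, and multiplication $(x,t)\mapsto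 x\,j(t)$ is an isomorphism of the semidirect product onto $\widehat{LT}$ and a homeomorphism. For $\xi\in\Lambda$, the element $t=\exp\zeta$, $\zeta\in\mathfrak t$, acts on the part of $\widehat{\Omega T}$ over the connected component of $\Omega T$ containing $\xi$ by multiplication with $t^{B_l^\flat(\xi)}=e^{2\pi iB_l(\xi,\zeta)}\in U(1)$. (c) Suppose all $l_j>0$, and let $T_l=\{\exp\zeta:\zeta\in\mathfrak t,\ B_l(\zeta,\Lambda)\subset\mathbb Z\}$. Then $\widehat{T_l\times\Omega T}=T_l\times\widehat{\Omega T}$: the map $(t,x)\mapsto j(t)x$ is an isomorphism of topological groups from $T_l\times\widehat{\Omega T}$ onto $\widehat{T_l\times\Omega T}$. -/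

import Mathlib

open scoped Manifold ContDiff ENNReal

set_option linter.unusedSectionVars false

noncomputable section

instance leInfty_minSmoothness_three : ENat.LEInfty (minSmoothness ℝ 3) := ⟨by
  rw [minSmoothness_of_isRCLikeNormedField]; exact ENat.LEInfty.out⟩

/-- The Lie algebra of a (possibly infinite-dimensional) real Lie group `G` modelled on `V`. -/
abbrev LieAlg (V : Type*) [NormedAddCommGroup V] [NormedSpace ℝ V]
    (G : Type*) [TopologicalSpace G] [ChartedSpace V G] [Group G] : Type _ :=
  GroupLieAlgebra 𝓘(ℝ, V) G

section Exponential

variable {V : Type*} [NormedAddCommGroup V] [NormedSpace ℝ V] [CompleteSpace V]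
  {G : Type*} [TopologicalSpace G] [ChartedSpace V G] [Group G] [LieGroup 𝓘(ℝ, V) ∞ G]

/-- `c` is the one-parameter subgroup `t ↦ exp (t x)`: the integral curve through `1` of the
left-invariant vector field defined by `x`. -/
structure IsOneParam (c : ℝ → G) (x : LieAlg V G) : Prop where
  zero : c 0 = 1
  curve : IsMIntegralCurve c (mulInvariantVectorField (I := 𝓘(ℝ, V)) x)

theorem contMDiff_field (x : LieAlg V G) : ContMDiff 𝓘(ℝ, V) 𝓘(ℝ, V).tangent 1
    (fun g : G => (⟨g, mulInvariantVectorField x g⟩ : TangentBundle 𝓘(ℝ, V) G)) :=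
  (contMDiff_mulInvariantVectorField x).of_le (by simp)

theorem IsOneParam.unique [T2Space G] {c c' : ℝ → G} {x : LieAlg V G}
    (h : IsOneParam c x) (h' : IsOneParam c' x) : c = c' := by
  have : IsManifold 𝓘(ℝ, V) 1 G := inferInstance
  exact isMIntegralCurve_Ioo_eq_of_contMDiff_boundaryless (t₀ := 0) (contMDiff_field x)
    h.curve h'.curve (h.zero.trans h'.zero.symm)

theorem IsOneParam.smul {c : ℝ → G} {x : LieAlg V G} (h : IsOneParam c x) (a : ℝ) :
    IsOneParam (fun t => c (t * a)) (a • x) := by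
  refine ⟨by simpa using h.zero, ?_⟩
  rw [mulInvariantVectorField_smul]
  exact h.curve.comp_mul a


theorem mfderiv_mul_left_field (y : LieAlg V G) (a b : G) :
    mfderiv 𝓘(ℝ, V) 𝓘(ℝ, V) (fun z => a * z) b (mulInvariantVectorField y b)
        = mulInvariantVectorField y (a * b) := by
  have hd : ∀ (a b : G), MDifferentiableAt 𝓘(ℝ, V) 𝓘(ℝ, V) (fun z : G => a * z) b :=
    fun a b => (contMDiff_mul_left (I := 𝓘(ℝ, V)) (n := ∞)).mdifferentiableAt (by simp)
  have e : (fun z : G => a * b * z) = (fun z => a * z) ∘ fun z => b * z := by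
    funext z; simp [mul_assoc]
  have h := mfderiv_comp (I := 𝓘(ℝ, V)) (I' := 𝓘(ℝ, V)) (I'' := 𝓘(ℝ, V)) (1 : G)
    (hd a (b * 1)) (hd b 1)
  rw [← e] at h
  unfold mulInvariantVectorField
  rw [h]
  have hb : ∀ b' : G, b' = b → ∀ w : V,
      (mfderiv 𝓘(ℝ, V) 𝓘(ℝ, V) (fun z : G => a * z) b w : V)
        = mfderiv 𝓘(ℝ, V) 𝓘(ℝ, V) (fun z : G => a * z) b' w := by
    rintro _ rfl w; rfl
  exact hb (b * 1) (mul_one b) _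

theorem IsOneParam.mul {c c' : ℝ → G} {x x' : LieAlg V G} (h : IsOneParam c x)
    (h' : IsOneParam c' x') (hc : ∀ s t, c s * c' t = c' t * c s) :
    IsOneParam (fun t => c t * c' t) (x + x') := by
  refine ⟨by simp [h.zero, h'.zero], fun t => ?_⟩
  have hL : ∀ (a b : G), MDifferentiableAt 𝓘(ℝ, V) 𝓘(ℝ, V) (fun z : G => a * z) b :=
    fun a b => (contMDiff_mul_left (I := 𝓘(ℝ, V)) (n := ∞)).mdifferentiableAt (by simp)
  have hR : ∀ (a b : G), MDifferentiableAt 𝓘(ℝ, V) 𝓘(ℝ, V) (fun z : G => z * a) b :=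
    fun a b => (contMDiff_mul_right (I := 𝓘(ℝ, V)) (n := ∞)).mdifferentiableAt (by simp)
  have hM : MDifferentiableAt (𝓘(ℝ, V).prod 𝓘(ℝ, V)) 𝓘(ℝ, V) (fun p : G × G => p.1 * p.2)
      (c t, c' t) := (contMDiff_mul 𝓘(ℝ, V) ∞).mdifferentiableAt (by simp)
  have hp := hM.hasMFDerivAt.comp t ((h.curve t).prodMk (h'.curve t))
  have h1 := (hR (c' t) (c t)).hasMFDerivAt.comp t (h.curve t)
  have h2 := (hL (c' t) (c t)).hasMFDerivAt.comp t (h.curve t)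
  have e : (fun z : G => z * c' t) ∘ c = (fun z : G => c' t * z) ∘ c := by
    funext s; exact hc s t
  rw [e] at h1
  have h3 := hasMFDerivAt_unique h1 h2
  have h4 : mfderiv 𝓘(ℝ, V) 𝓘(ℝ, V) (fun z : G => z * c' t) (c t)
      (mulInvariantVectorField x (c t)) = (mulInvariantVectorField x (c t * c' t) : V) := by
    have := DFunLike.congr_fun h3 (1 : ℝ)
    have h5 : mfderiv 𝓘(ℝ, V) 𝓘(ℝ, V) (fun z : G => z * c' t) (c t)
      (mulInvariantVectorField x (c t)) = (mfderiv 𝓘(ℝ, V) 𝓘(ℝ, V) (fun z : G => c' t * z) (c t)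
      (mulInvariantVectorField x (c t)) : V) := by
      have h6 : mfderiv 𝓘(ℝ, V) 𝓘(ℝ, V) (fun z : G => z * c' t) (c t)
        ((1 : ℝ) • mulInvariantVectorField x (c t)) = (mfderiv 𝓘(ℝ, V) 𝓘(ℝ, V)
          (fun z : G => c' t * z) (c t) ((1 : ℝ) • mulInvariantVectorField x (c t)) : V) := this
      rwa [one_smul] at h6
    rw [h5, mfderiv_mul_left_field, hc t t]
  have h7 : (ContinuousLinearMap.smulRight (1 : ℝ →L[ℝ] ℝ)
        (mulInvariantVectorField (x + x') (c t * c' t)) : ℝ →L[ℝ] V) =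
      (mfderiv (𝓘(ℝ, V).prod 𝓘(ℝ, V)) 𝓘(ℝ, V) (fun p : G × G => p.1 * p.2) (c t, c' t)).comp
        ((ContinuousLinearMap.smulRight (1 : ℝ →L[ℝ] ℝ) (mulInvariantVectorField x (c t))).prod
          (ContinuousLinearMap.smulRight (1 : ℝ →L[ℝ] ℝ)
            (mulInvariantVectorField x' (c' t)))) := by
    refine ContinuousLinearMap.ext_ring ?_
    have h8 := mfderiv_prod_eq_add_apply (v := (show V × V from ((1 : ℝ) • mulInvariantVectorField x (c t),
      (1 : ℝ) • mulInvariantVectorField x' (c' t)))) hM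
    refine Eq.trans ?_ h8.symm
    rw [mulInvariantVectorField_add]
    simp only [one_smul]
    refine Eq.trans ?_ (congrArg₂ (fun a b : V => a + b) h4.symm
      (mfderiv_mul_left_field x' (c t) (c' t)).symm)
    exact one_smul ℝ _
  exact h7 ▸ hp

open Classical in
/-- The exponential map of a Lie group: the value at time `1` of the one-parameter subgroup
generated by `x`. -/
def lieExp (x : LieAlg V G) : G :=
  if h : ∃ c : ℝ → G, IsOneParam c x then h.choose 1 else 1

variable [T2Space G]

theorem IsOneParam.lieExp_eq {c : ℝ → G} {x : LieAlg V G} (h : IsOneParam c x) :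
    lieExp x = c 1 := by
  have hx : ∃ c : ℝ → G, IsOneParam c x := ⟨c, h⟩
  rw [lieExp, dif_pos hx, hx.choose_spec.unique h]

theorem IsOneParam.lieExp_smul {c : ℝ → G} {x : LieAlg V G} (h : IsOneParam c x) (r : ℝ) :
    lieExp (r • x) = c r := by
  rw [(h.smul r).lieExp_eq, one_mul]

theorem IsOneParam.continuous {c : ℝ → G} {x : LieAlg V G} (h : IsOneParam c x) :
    Continuous c :=
  continuous_iff_continuousAt.2 fun t => (h.curve t).continuousAt

end Exponential

/-- A maximal torus of a compact Lie group: a maximal closed connected commutative subgroup. -/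
structure MaximalTorus (G : Type*) [TopologicalSpace G] [Group G] where
  /-- the underlying subgroup -/
  toSubgroup : Subgroup G
  isClosed : IsClosed (toSubgroup : Set G)
  isConnected : IsConnected (toSubgroup : Set G)
  comm : ∀ a ∈ toSubgroup, ∀ b ∈ toSubgroup, a * b = b * a
  maximal : ∀ S : Subgroup G, IsClosed (S : Set G) → IsConnected (S : Set G) →
    (∀ a ∈ S, ∀ b ∈ S, a * b = b * a) → toSubgroup ≤ S → S = toSubgroup

namespace MaximalTorus

variable {V : Type*} [NormedAddCommGroup V] [NormedSpace ℝ V] [CompleteSpace V]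
  {G : Type*} [TopologicalSpace G] [ChartedSpace V G] [Group G] [LieGroup 𝓘(ℝ, V) ∞ G]
  [T2Space G] [IsTopologicalGroup G]

/-- The Lie algebra `𝔱 ⊆ 𝔤` of the maximal torus. -/
def lieAlgebra (V : Type*) [NormedAddCommGroup V] [NormedSpace ℝ V] [CompleteSpace V]
    [ChartedSpace V G] [LieGroup 𝓘(ℝ, V) ∞ G] (T : MaximalTorus G) :
    Submodule ℝ (LieAlg V G) where
  carrier := {x | ∃ c : ℝ → G, IsOneParam c x ∧ ∀ t, c t ∈ T.toSubgroup}
  add_mem' := by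
    rintro x y ⟨c, hc, hcT⟩ ⟨d, hd, hdT⟩
    exact ⟨_, hc.mul hd fun s t => T.comm _ (hcT s) _ (hdT t),
      fun t => mul_mem (hcT t) (hdT t)⟩
  zero_mem' := by
    refine ⟨fun _ => 1, ⟨rfl, isMIntegralCurve_const ?_⟩, fun _ => one_mem _⟩
    exact map_zero _
  smul_mem' := by
    rintro a x ⟨c, hc, hcT⟩
    exact ⟨_, hc.smul a, fun t => hcT _⟩

theorem lieExp_add (T : MaximalTorus G) {x y : LieAlg V G} (hx : x ∈ T.lieAlgebra V)
    (hy : y ∈ T.lieAlgebra V) : lieExp (x + y) = lieExp x * lieExp y := by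
  obtain ⟨c, hc, hcT⟩ := hx
  obtain ⟨d, hd, hdT⟩ := hy
  rw [(hc.mul hd fun s t => T.comm _ (hcT s) _ (hdT t)).lieExp_eq, hc.lieExp_eq, hd.lieExp_eq]

theorem lieExp_zero : lieExp (0 : LieAlg V G) = (1 : G) := by
  have h : IsOneParam (fun _ => (1 : G)) (0 : LieAlg V G) :=
    ⟨rfl, isMIntegralCurve_const (map_zero _)⟩
  exact h.lieExp_eq

theorem lieExp_neg (T : MaximalTorus G) {x : LieAlg V G} (hx : x ∈ T.lieAlgebra V) :
    lieExp (-x) = (lieExp x)⁻¹ := by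
  refine eq_inv_of_mul_eq_one_left ?_
  rw [← T.lieExp_add (neg_mem hx) hx, neg_add_cancel, lieExp_zero]

/-- The integral lattice `Λ = ker (exp : 𝔱 → T)`. -/
def lattice (V : Type*) [NormedAddCommGroup V] [NormedSpace ℝ V] [CompleteSpace V]
    [ChartedSpace V G] [LieGroup 𝓘(ℝ, V) ∞ G] (T : MaximalTorus G) :
    AddSubgroup (LieAlg V G) where
  carrier := {x | x ∈ T.lieAlgebra V ∧ lieExp x = 1}
  add_mem' := by
    rintro x y ⟨hx, hx'⟩ ⟨hy, hy'⟩
    exact ⟨add_mem hx hy, by rw [T.lieExp_add hx hy, hx', hy', one_mul]⟩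
  zero_mem' := ⟨zero_mem _, lieExp_zero⟩
  neg_mem' := by
    rintro x ⟨hx, hx'⟩
    exact ⟨neg_mem hx, by rw [T.lieExp_neg hx, hx', inv_one]⟩

theorem lieExp_periodic (T : MaximalTorus G) (ξ : T.lattice V) :
    Function.Periodic (fun r : ℝ => lieExp (-(r • (ξ : LieAlg V G)))) 1 := by
  intro r
  have hm : ∀ a : ℝ, -(a • (ξ : LieAlg V G)) ∈ T.lieAlgebra V := fun a =>
    neg_mem (Submodule.smul_mem _ _ ξ.2.1)
  have h : -((r + 1) • (ξ : LieAlg V G)) = -(r • (ξ : LieAlg V G)) + -(ξ : LieAlg V G) := by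
    rw [add_smul, one_smul, neg_add]
  simp only
  rw [h, T.lieExp_add (hm r) (neg_mem ξ.2.1), T.lieExp_neg ξ.2.1, ξ.2.2, inv_one, mul_one]

theorem lieExp_line_continuous (T : MaximalTorus G) (ξ : T.lattice V) :
    Continuous (fun r : ℝ => lieExp (-(r • (ξ : LieAlg V G)))) := by
  obtain ⟨c, hc, -⟩ := ξ.2.1
  have h : (fun r : ℝ => lieExp (-(r • (ξ : LieAlg V G)))) = fun r => c (-r) := by
    funext r
    rw [← neg_smul, hc.lieExp_smul]
  rw [h]
  exact hc.continuous.comp continuous_neg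

/-- The embedding of the lattice `Λ` into the loops: `ξ` goes to the loop `s ↦ exp (-s ξ)`,
`s ∈ ℝ/ℤ`. -/
def latticeLoop (V : Type*) [NormedAddCommGroup V] [NormedSpace ℝ V] [CompleteSpace V]
    [ChartedSpace V G] [LieGroup 𝓘(ℝ, V) ∞ G] (T : MaximalTorus G) :
    Multiplicative (T.lattice V) →* C(UnitAddCircle, G) where
  toFun ξ := ⟨(T.lieExp_periodic ξ.toAdd).lift,
    continuous_coinduced_dom.2 (T.lieExp_line_continuous ξ.toAdd)⟩
  map_one' := by
    ext s
    induction s using QuotientAddGroup.induction_on with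
    | H r =>
      change lieExp (-(r • (0 : LieAlg V G))) = 1
      rw [smul_zero, neg_zero, lieExp_zero]
  map_mul' ξ η := by
    ext s
    induction s using QuotientAddGroup.induction_on with
    | H r =>
      have hm : ∀ ζ : T.lattice V, -(r • (ζ : LieAlg V G)) ∈ T.lieAlgebra V := fun ζ =>
        neg_mem (Submodule.smul_mem _ _ ζ.2.1)
      change lieExp (-(r • ((ξ.toAdd : LieAlg V G) + (η.toAdd : LieAlg V G)))) =
        lieExp (-(r • (ξ.toAdd : LieAlg V G))) * lieExp (-(r • (η.toAdd : LieAlg V G)))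
      rw [smul_add, neg_add, T.lieExp_add (hm ξ.toAdd) (hm η.toAdd)]

/-- The subgroup `T_l = B^♯(Λ^*)/Λ` of `T = 𝔱/Λ`: all `exp ζ` with `ζ ∈ 𝔱` such that `B^♭(ζ)`
is integral on `Λ`. -/
def dualSubgroup (T : MaximalTorus G) (B : LinearMap.BilinForm ℝ (LieAlg V G)) : Subgroup G where
  carrier := {g | ∃ ζ ∈ T.lieAlgebra V,
    (∀ ξ ∈ T.lattice V, ∃ n : ℤ, B ζ ξ = n) ∧ lieExp ζ = g}
  mul_mem' := by
    rintro _ _ ⟨x, hx, hxB, rfl⟩ ⟨y, hy, hyB, rfl⟩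
    refine ⟨x + y, add_mem hx hy, fun ξ hξ => ?_, T.lieExp_add hx hy⟩
    obtain ⟨m, hm⟩ := hxB ξ hξ
    obtain ⟨n, hn⟩ := hyB ξ hξ
    exact ⟨m + n, by rw [map_add, LinearMap.add_apply, hm, hn]; push_cast; rfl⟩
  one_mem' := ⟨0, zero_mem _, fun ξ _ => ⟨0, by simp⟩, lieExp_zero⟩
  inv_mem' := by
    rintro _ ⟨x, hx, hxB, rfl⟩
    refine ⟨-x, neg_mem hx, fun ξ hξ => ?_, T.lieExp_neg hx⟩
    obtain ⟨m, hm⟩ := hxB ξ hξ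
    exact ⟨-m, by rw [map_neg, LinearMap.neg_apply, hm]; push_cast; rfl⟩

/-! ### Roots and invariant forms -/

/-- `X, Y ∈ I` are real root vectors for `α`: the torus element `exp H` rotates the plane
spanned by `X, Y` by the angle `2π α(H)`. -/
structure IsRootPair (T : MaximalTorus G) (I : LieIdeal ℝ (LieAlg V G))
    (α : Module.Dual ℝ (T.lieAlgebra V)) (X Y : LieAlg V G) : Prop where
  mem_left : X ∈ I
  mem_right : Y ∈ I
  ne_zero : X ≠ 0
  lie_left : ∀ H : T.lieAlgebra V, ⁅(H : LieAlg V G), X⁆ = (2 * Real.pi * α H) • Y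
  lie_right : ∀ H : T.lieAlgebra V, ⁅(H : LieAlg V G), Y⁆ = -((2 * Real.pi * α H) • X)

/-- `α` is a (real) root of the ideal `I`, so that `t = exp H` acts on the corresponding complex
root space by `t^α = exp (2π i α(H))`. -/
def IsRoot (T : MaximalTorus G) (I : LieIdeal ℝ (LieAlg V G))
    (α : Module.Dual ℝ (T.lieAlgebra V)) : Prop :=
  α ≠ 0 ∧ ∃ X Y, T.IsRootPair I α X Y

/-- `h` is the coroot of the root `α` of `I`: the element with
`α(h) = 2` of the real line in `𝔱` that is spanned by the bracket of real root vectors for `α`,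
that is, of the intersection of `𝔱` with the bracket of the complex root spaces of `α`, `-α`. -/
def IsCoroot (T : MaximalTorus G) (I : LieIdeal ℝ (LieAlg V G))
    (α : Module.Dual ℝ (T.lieAlgebra V)) (h : T.lieAlgebra V) : Prop :=
  α h = 2 ∧ ∃ X Y, T.IsRootPair I α X Y ∧ ∃ r : ℝ, (h : LieAlg V G) = r • ⁅X, Y⁆

/-- `α` is the highest root of the simple ideal `I`, where the positive roots are those
positive on `δ`. -/
def IsHighestRoot (T : MaximalTorus G) (I : LieIdeal ℝ (LieAlg V G)) (δ : T.lieAlgebra V)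
    (α : Module.Dual ℝ (T.lieAlgebra V)) : Prop :=
  T.IsRoot I α ∧ 0 < α δ ∧ ∀ β, T.IsRoot I β → 0 < β δ → ¬ T.IsRoot I (α + β)

/-- `b` is the basic inner product of the simple factor `𝔤 j`, extended by zero to the other
simple factors: the invariant inner product normalised by `b(h, h) = 2` for the coroot `h` of the
highest root. -/
structure IsBasicForm (T : MaximalTorus G) {s : ℕ} (𝔤 : Fin s → LieIdeal ℝ (LieAlg V G))
    (δ : T.lieAlgebra V) (j : Fin s) (b : LinearMap.BilinForm ℝ (LieAlg V G)) : Prop where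
  symm : ∀ x y, b x y = b y x
  invariant : ∀ x y z, b ⁅x, y⁆ z = b x ⁅y, z⁆
  off : ∀ k, k ≠ j → ∀ x ∈ 𝔤 k, ∀ y, b x y = 0
  pos : ∀ x ∈ 𝔤 j, x ≠ 0 → 0 < b x x
  normalized : ∃ α h, T.IsHighestRoot (𝔤 j) δ α ∧ T.IsCoroot (𝔤 j) α h ∧
    b (h : LieAlg V G) (h : LieAlg V G) = 2

end MaximalTorus

/-- The decomposition `𝔤 = 𝔤_1 ⊕ ⋯ ⊕ 𝔤_s` of a Lie algebra into simple ideals. -/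
structure IsSimpleDecomposition {L : Type*} [LieRing L] [LieAlgebra ℝ L] {s : ℕ}
    (𝔤 : Fin s → LieIdeal ℝ L) : Prop where
  simple : ∀ j, LieAlgebra.IsSimple ℝ (𝔤 j)
  indep : iSupIndep 𝔤
  span : ⨆ j, 𝔤 j = ⊤

/-- The invariant form `B_l = ∑ l_j B^{G_j}`. -/
def levelForm {L : Type*} [AddCommGroup L] [Module ℝ L] {s : ℕ}
    (b : Fin s → LinearMap.BilinForm ℝ L) (l : Fin s → ℤ) : LinearMap.BilinForm ℝ L :=
  ∑ j, (l j : ℝ) • b j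

/-! ### Loops of Sobolev class -/

/-- The weighted Fourier coefficients `(1 + n²)^{σ/2} û(n)` of a real function on `ℝ/ℤ`. The
function is of Sobolev class `σ` if this sequence is square-summable, and its Sobolev norm is
then the `ℓ²` norm of the sequence. -/
def sobolevCoeff (σ : ℝ) (u : UnitAddCircle → ℝ) (n : ℤ) : ℂ :=
  (((1 + (n : ℝ) ^ 2) ^ (σ / 2) : ℝ) : ℂ) * fourierCoeff (fun s => (u s : ℂ)) n

section Loops

variable (V : Type*) [NormedAddCommGroup V] [NormedSpace ℝ V]
  {G : Type*} [TopologicalSpace G] [ChartedSpace V G]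

/-- The loop `γ : ℝ/ℤ → G` is of Sobolev class `σ`: so is `φ ∘ γ` for every smooth real function
`φ` on `G`. -/
def IsSobolevLoop (σ : ℝ) (γ : C(UnitAddCircle, G)) : Prop :=
  ∀ φ : C^∞⟮𝓘(ℝ, V), G; ℝ⟯, Memℓp (sobolevCoeff σ (fun s => φ (γ s))) 2

variable (G) in
/-- The set `LG` of loops of Sobolev class `σ`. Its group structure is that of
`C(UnitAddCircle, G)`. -/
def SobolevLoop (σ : ℝ) : Type _ := {γ : C(UnitAddCircle, G) // IsSobolevLoop V σ γ}

variable {V}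

/-- The function `φ ∘ γ`, as an element of the Sobolev space of order `σ`, which is identified
with a closed subspace of `ℓ²(ℤ)` by `sobolevCoeff`. -/
def SobolevLoop.comp {σ : ℝ} (φ : C^∞⟮𝓘(ℝ, V), G; ℝ⟯) (γ : SobolevLoop V G σ) :
    lp (fun _ : ℤ => ℂ) 2 :=
  ⟨sobolevCoeff σ (fun s => φ (γ.1 s)), γ.2 φ⟩

/-- The topology of `LG`: the coarsest one for which all maps `γ ↦ φ ∘ γ` to the Sobolev space
of order `σ` are continuous. -/
instance {σ : ℝ} : TopologicalSpace (SobolevLoop V G σ) :=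
  ⨅ φ : C^∞⟮𝓘(ℝ, V), G; ℝ⟯, TopologicalSpace.induced (SobolevLoop.comp φ) inferInstance

end Loops

section LoopAlgebra

variable {L : Type*} [AddCommGroup L] [Module ℝ L] [TopologicalSpace L]

/-- `ξ : ℝ/ℤ → L` is a continuous map of Sobolev class `σ` to the finite-dimensional space `L`. -/
def IsSobolevMap (σ : ℝ) (ξ : UnitAddCircle → L) : Prop :=
  Continuous ξ ∧ ∀ p : L →L[ℝ] ℝ, Memℓp (sobolevCoeff σ (fun s => p (ξ s))) 2

/-- The cocycle `𝔠(ξ, η) = ∫_{S¹} B(ξ, dη)`. -/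
def loopCocycle (B : LinearMap.BilinForm ℝ L) (ξ η : UnitAddCircle → L) : ℝ :=
  ∫ s in (0 : ℝ)..1, B (ξ s) (deriv (fun r : ℝ => η r) s)

end LoopAlgebra

section LoopSubgroups

variable {G : Type*} [TopologicalSpace G] [Group G] [IsTopologicalGroup G]

/-- Loops with values in the subgroup `T`. -/
def loopsIn (T : Subgroup G) : Subgroup C(UnitAddCircle, G) where
  carrier := {γ | ∀ s, γ s ∈ T}
  mul_mem' h h' s := mul_mem (h s) (h' s)
  one_mem' _ := one_mem T
  inv_mem' h s := inv_mem (h s)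

/-- Loops `γ` with values in `T` whose base point `γ 0` lies in `S`. For `S = 1` these are the
based loops in `T`; for `S ⊆ T` this is the product of the group `S` of constant loops and the
group of based loops in `T`. -/
def loopsInFrom (T S : Subgroup G) : Subgroup C(UnitAddCircle, G) where
  carrier := {γ | (∀ s, γ s ∈ T) ∧ γ 0 ∈ S}
  mul_mem' h h' := ⟨fun s => mul_mem (h.1 s) (h'.1 s), mul_mem h.2 h'.2⟩
  one_mem' := ⟨fun _ => one_mem T, one_mem S⟩
  inv_mem' h := ⟨fun s => inv_mem (h.1 s), inv_mem h.2⟩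

/-- Based loops in `T`. -/
abbrev basedLoopsIn (T : Subgroup G) : Subgroup C(UnitAddCircle, G) := loopsInFrom T ⊥

end LoopSubgroups

/-! ### Central extensions of the loop group -/

section Extension

variable {V : Type*} [NormedAddCommGroup V] [NormedSpace ℝ V]
  {G : Type*} [TopologicalSpace G] [ChartedSpace V G] [Group G]
  {W : Type*} [NormedAddCommGroup W] [NormedSpace ℝ W]
  {E : Type*} [TopologicalSpace E] [ChartedSpace W E] [Group E]

/-- The derivative at `1` of a homomorphism from `E` to loops in `G`. (The loop of `1` is the
constant loop `1`, so the values do lie in the Lie algebra of `G`.) -/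
def loopDeriv [IsTopologicalGroup G] (π : E →* C(UnitAddCircle, G)) (X : LieAlg W E) :
    UnitAddCircle → LieAlg V G :=
  fun s => (show V from mfderiv 𝓘(ℝ, W) 𝓘(ℝ, V) (fun x : E => π x s) 1 X)

/-- The image in the Lie algebra of `E` of the generator `d/dr|_{r=0} exp (2π i r)` of the Lie
algebra `ℝ` of `U(1)`. -/
def centralGenerator (ι : Circle →* E) : LieAlg W E :=
  (show W from mfderiv 𝓘(ℝ, ℝ) 𝓘(ℝ, W) (fun r : ℝ => ι (Circle.exp (2 * Real.pi * r))) 0 (1 : ℝ))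

/-- `E` is a central extension `1 → U(1) → E → LG → 1` of Banach Lie groups, where `LG` is the
group of loops in `G` of Sobolev class `σ`, which integrates the central extension
`L𝔤 ⊕ ℝ` of the Lie algebra `L𝔤` that the form `B` defines.

The sign of the bracket on `L𝔤 ⊕ ℝ` is the one for which the coadjoint action of `LG` is
`g · (μ, τ) = (Ad_g^* μ - τ B^♭(dg g⁻¹), τ)`, that is,
`[(ξ, a), (η, b)] = ([ξ, η], 𝔠(η, ξ))`. -/
structure LoopExtension [IsTopologicalGroup G]
    (W : Type*) [NormedAddCommGroup W] [NormedSpace ℝ W] [CompleteSpace W]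
    (E : Type*) [TopologicalSpace E] [ChartedSpace W E] [Group E] [LieGroup 𝓘(ℝ, W) ∞ E]
    (B : LinearMap.BilinForm ℝ (LieAlg V G)) (σ : ℝ) where
  /-- the inclusion of the centre -/
  ι : Circle →* E
  /-- the projection to the loop group -/
  π : E →* C(UnitAddCircle, G)
  ι_injective : Function.Injective ι
  ι_central : ∀ z x, ι z * x = x * ι z
  ι_smooth : ContMDiff (𝓡 1) 𝓘(ℝ, W) ∞ ι
  exact_group : π.ker = ι.range
  range_eq : Set.range π = {γ | IsSobolevLoop V σ γ}
  /-- `π` is smooth as a map to `LG`: its composition with each map `γ ↦ φ ∘ γ` to the Sobolev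
  space is smooth. -/
  π_smooth : ∀ φ : C^∞⟮𝓘(ℝ, V), G; ℝ⟯, ContMDiff 𝓘(ℝ, W) 𝓘(ℝ, lp (fun _ : ℤ => ℂ) 2) ∞
    fun x => SobolevLoop.comp φ (⟨π x, range_eq.subset ⟨x, rfl⟩⟩ : SobolevLoop V G σ)
  /-- exactness of `0 → ℝ → Lie E → L𝔤 → 0` -/
  exact_algebra : ∀ X : LieAlg W E,
    loopDeriv (V := V) π X = 0 ↔ ∃ a : ℝ, X = a • centralGenerator ι
  deriv_surjective : ∀ ξ : UnitAddCircle → LieAlg V G, IsSobolevMap σ ξ →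
    ∃ X : LieAlg W E, loopDeriv π X = ξ
  /-- There is a splitting `Lie E = L𝔤 ⊕ ℝ`, with projection `α` to `ℝ`, for which the bracket
  is given by the cocycle. -/
  bracket : ∃ α : LieAlg W E →L[ℝ] ℝ, α (centralGenerator ι) = 1 ∧
    ∀ X Y : LieAlg W E, α ⁅X, Y⁆ = loopCocycle B (loopDeriv π Y) (loopDeriv π X)

namespace LoopExtension

variable [IsTopologicalGroup G] [CompleteSpace W] [LieGroup 𝓘(ℝ, W) ∞ E]
  {B : LinearMap.BilinForm ℝ (LieAlg V G)} {σ : ℝ}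

/-- The projection to the loop group, with values in the loops of Sobolev class. -/
def loop (L : LoopExtension W E B σ) (x : E) : SobolevLoop V G σ :=
  ⟨L.π x, L.range_eq.subset ⟨x, rfl⟩⟩

/-- The restriction of the central extension to a group `H` of loops. -/
def restrict (L : LoopExtension W E B σ) (H : Subgroup C(UnitAddCircle, G)) : Subgroup E :=
  H.comap L.π

/-- `j : G → E` is a trivialization of the extension over the group `G` of constant loops. -/
structure IsConstLift (L : LoopExtension W E B σ) (j : G →* E) : Prop where
  smooth : ContMDiff 𝓘(ℝ, V) 𝓘(ℝ, W) ∞ j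
  lift : ∀ g, L.π (j g) = ContinuousMap.const _ g

end LoopExtension

end Extension

end

/-! ### The chart at the identity and the adjoint action. -/

noncomputable section

open scoped Manifold ContDiff ENNReal Topology
open VectorField Set Filter
variable {V : Type*} [NormedAddCommGroup V] [NormedSpace ℝ V] [CompleteSpace V]
  {G : Type*} [TopologicalSpace G] [ChartedSpace V G] [Group G] [LieGroup 𝓘(ℝ, V) ∞ G]

/-! Everything rests on the central component of the adjoint action of `E`. Let `α : Lie E → ℝ` be
the projection for which the bracket is given by the cocycle. If `x` lies over the loop `γ` and `X`
over `ξ`, then `α (Ad x X) = α X + ∫ B(γ⁻¹γ', ξ)` (`alpha_Ad`). On brackets this is the cocycle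
formula combined with the invariance of `B`; since `𝔤 = [𝔤, 𝔤]`, brackets and the central generator
span `Lie E`. Hence, if `Ad γ` fixes `ξ`, conjugation by `x` multiplies `exp X` by the phase `exp
(2πi ∫ B(γ⁻¹γ', ξ))` (`conj_lieExp_of_fixed`). Sobolev order above `3/2` makes all loops `C¹`, so
these integrals make sense.

Simple connectedness of `G` enters through factorization: a smooth loop based at `1` is a finite
product of curves `exp (f_k(s) X_k)` with `f_k` vanishing at both ends (`exists_factorization`).
Lifting the factors shows that relations between exponentials in `G` persist in `E`, which yields
the lift `j` of the constant loops (`exists_isConstLift`).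

For a loop `γ` in `T` and constant `ξ = ζ ∈ 𝔱` the phase depends only on the winding `-∫ γ⁻¹γ'`, an
element of `Λ` that is constant on components of the based loops. This is the action in (b). The
phase is trivial for `exp ζ ∈ T_l`, which gives (c). Taking `ζ ∈ Λ`, where `exp ζ = 1`, gives the
integrality in (a).

For the commutator of lifts of `ξ` and `ξ'`, multiply them by exponentials of loops in `𝔱` so that
they lie over `exp (-ρ₁ ξ)` and `exp (-ρ₂ ξ')`, where `ρ₁` and `ρ₂` climb from `0` to `1` on
disjoint halves of the interval. By factorization these modified lifts are products of exponentials
of loops with disjoint supports, so they commute. Undoing the modifications costs three phases whose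
product is `exp (πi B(ξ, ξ'))` (`commutator_lattice`).

For even levels it remains to see that each basic form is integral on `Λ`. Two facts are needed.
First, `Λ` is spanned by coroots (`mem_corootLattice`): affine reflections move `ζ₀ + ξ` into the
alcove of a small regular `ζ₀`, and in a simply connected group two points of one alcove with
conjugate exponentials coincide (`eq_of_conj_lieExp`). The latter holds because `G/T × T → G` is a
covering away from a singular set of codimension three, which a contraction of a loop can avoid.
Second, `b_j(h, h)` is an even integer for every coroot `h` of the factor (`half_form_coroot`),
because the highest root is long; then `b_j(h, ξ') = ½ b_j(h, h) α(ξ')` is an integer. So all lifts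
of `Λ` commute, and since `Λ` is free the extension over it splits. -/

theorem hasMFDerivAt_extChartAt_self (M : Type*) [TopologicalSpace M] [ChartedSpace V M] (x : M) :
    HasMFDerivAt 𝓘(ℝ, V) 𝓘(ℝ, V) (extChartAt 𝓘(ℝ, V) x) x (ContinuousLinearMap.id ℝ V) := by
  refine ⟨continuousAt_extChartAt x, ?_⟩
  have h : writtenInExtChartAt 𝓘(ℝ, V) 𝓘(ℝ, V) x (extChartAt 𝓘(ℝ, V) x)
      =ᶠ[𝓝 (extChartAt 𝓘(ℝ, V) x x)] id := by
    filter_upwards [extChartAt_target_mem_nhds (I := 𝓘(ℝ, V)) x] with a ha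
    exact (extChartAt 𝓘(ℝ, V) x).right_inv ha
  exact ((hasFDerivAt_id (𝕜 := ℝ) _).congr_of_eventuallyEq h).hasFDerivWithinAt

/-- The multiplication of `G` in the chart at `1`. -/
def chartMul (V G : Type*) [NormedAddCommGroup V] [NormedSpace ℝ V] [TopologicalSpace G]
    [ChartedSpace V G] [Group G]
    (p : V × V) : V :=
  extChartAt 𝓘(ℝ, V) (1 : G) ((extChartAt 𝓘(ℝ, V) (1 : G)).symm p.1 * (extChartAt 𝓘(ℝ, V) (1 : G)).symm p.2)

/-- Conjugation in the chart at `1`. -/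
def chartConj (V G : Type*) [NormedAddCommGroup V] [NormedSpace ℝ V] [TopologicalSpace G]
    [ChartedSpace V G] [Group G]
    (p : V × V) : V :=
  extChartAt 𝓘(ℝ, V) (1 : G) ((extChartAt 𝓘(ℝ, V) (1 : G)).symm p.1 *
    (extChartAt 𝓘(ℝ, V) (1 : G)).symm p.2 * ((extChartAt 𝓘(ℝ, V) (1 : G)).symm p.1)⁻¹)

def chartOne (V G : Type*) [NormedAddCommGroup V] [NormedSpace ℝ V] [TopologicalSpace G]
    [ChartedSpace V G] [Group G] : V :=
  extChartAt 𝓘(ℝ, V) (1 : G) 1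

local notation "φ" => extChartAt 𝓘(ℝ, V) (1 : G)

theorem contMDiffAt_chart_symm : ContMDiffAt 𝓘(ℝ, V) 𝓘(ℝ, V) ∞ (φ).symm (chartOne V G) :=
  (contMDiffOn_extChartAt_symm (n := ∞) (1 : G)).contMDiffAt (extChartAt_target_mem_nhds (1 : G))

theorem chart_symm_one : (φ).symm (chartOne V G) = 1 := extChartAt_to_inv (I := 𝓘(ℝ, V)) (1 : G)

theorem contDiffAt_chartMul : ContDiffAt ℝ ∞ (chartMul V G) (chartOne V G, chartOne V G) := by
  rw [← contMDiffAt_iff_contDiffAt]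
  have h1 : ContMDiffAt 𝓘(ℝ, V × V) 𝓘(ℝ, V) ∞ (fun p : V × V => (φ).symm p.1) (chartOne V G, chartOne V G) :=
    ContMDiffAt.comp _ contMDiffAt_chart_symm contDiffAt_fst.contMDiffAt
  have h2 : ContMDiffAt 𝓘(ℝ, V × V) 𝓘(ℝ, V) ∞ (fun p : V × V => (φ).symm p.2) (chartOne V G, chartOne V G) :=
    ContMDiffAt.comp _ contMDiffAt_chart_symm contDiffAt_snd.contMDiffAt
  refine ContMDiffAt.comp _ (g := φ) ?_ (h1.mul h2)
  simp only [chart_symm_one, mul_one]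
  exact contMDiffAt_extChartAt

theorem contDiffAt_chartConj : ContDiffAt ℝ ∞ (chartConj V G) (chartOne V G, chartOne V G) := by
  rw [← contMDiffAt_iff_contDiffAt]
  have h1 : ContMDiffAt 𝓘(ℝ, V × V) 𝓘(ℝ, V) ∞ (fun p : V × V => (φ).symm p.1) (chartOne V G, chartOne V G) :=
    ContMDiffAt.comp _ contMDiffAt_chart_symm contDiffAt_fst.contMDiffAt
  have h2 : ContMDiffAt 𝓘(ℝ, V × V) 𝓘(ℝ, V) ∞ (fun p : V × V => (φ).symm p.2) (chartOne V G, chartOne V G) :=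
    ContMDiffAt.comp _ contMDiffAt_chart_symm contDiffAt_snd.contMDiffAt
  refine ContMDiffAt.comp _ (g := φ) ?_ ((h1.mul h2).mul h1.inv)
  simp only [chart_symm_one, mul_one, inv_one]
  exact contMDiffAt_extChartAt

/-- The adjoint action of `g` on the Lie algebra. -/
def Ad (g : G) (X : LieAlg V G) : LieAlg V G :=
  (show V from mfderiv 𝓘(ℝ, V) 𝓘(ℝ, V) (fun x : G => g * x * g⁻¹) 1 X)

theorem hasMFDerivAt_mul_left (g h : G) : HasMFDerivAt 𝓘(ℝ, V) 𝓘(ℝ, V) (fun x : G => g * x) h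
    (mfderiv 𝓘(ℝ, V) 𝓘(ℝ, V) (fun x : G => g * x) h) :=
  ((contMDiff_mul_left (I := 𝓘(ℝ, V)) (n := ∞)).mdifferentiableAt (by simp)).hasMFDerivAt

theorem mdifferentiableAt_conj (g h : G) :
    MDifferentiableAt 𝓘(ℝ, V) 𝓘(ℝ, V) (fun x : G => g * x * g⁻¹) h :=
  ((contMDiff_mul_right (I := 𝓘(ℝ, V)) (n := ∞)).comp (contMDiff_mul_left (I := 𝓘(ℝ, V)) (n := ∞))).mdifferentiableAt (by simp)

/-- The chart at `1` has identity derivative at `1` by the definition of tangent spaces, so no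
correction term appears. The identity is confined to `g` near `1`, where `g` is recovered from its
coordinate. -/
theorem Ad_eq_fderiv : ∀ᶠ g in 𝓝 (1 : G), ∀ X : LieAlg V G,
    (Ad g X : V) = fderiv ℝ (chartConj V G) (φ g, chartOne V G) (0, X) := by
  have hd : ∀ᶠ p in 𝓝 (chartOne V G, chartOne V G), DifferentiableAt ℝ (chartConj V G) p := by
    have := (contDiffAt_chartConj (V := V) (G := G)).of_le (m := 1) (by simp)
    exact (this.eventually (by simp)).mono fun p hp => hp.differentiableAt (by simp)
  have hc : ContinuousAt (fun g : G => (φ g, chartOne V G)) 1 :=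
    (continuousAt_extChartAt (1 : G)).prodMk continuousAt_const
  filter_upwards [hc.eventually hd, extChartAt_source_mem_nhds (I := 𝓘(ℝ, V)) (1 : G)] with g hg hgs X
  have h1 : HasMFDerivAt 𝓘(ℝ, V) 𝓘(ℝ, V) (fun x : G => g * x * g⁻¹) 1
      ((fderiv ℝ (chartConj V G) (φ g, chartOne V G)).comp (ContinuousLinearMap.inr ℝ V V)) := by
    refine ⟨(mdifferentiableAt_conj (V := V) g 1).continuousAt, ?_⟩
    have h2 : HasFDerivAt (fun b : V => chartConj V G (φ g, b))
      ((fderiv ℝ (chartConj V G) (φ g, chartOne V G)).comp (ContinuousLinearMap.inr ℝ V V)) (chartOne V G) :=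
      HasFDerivAt.comp (chartOne V G) (f := fun b : V => (φ g, b)) hg.hasFDerivAt (hasFDerivAt_prodMk_right _ _)
    refine HasFDerivAt.hasFDerivWithinAt ?_
    refine h2.congr_of_eventuallyEq (Eventually.of_forall fun b => ?_)
    simp only [writtenInExtChartAt, chartConj, Function.comp_apply]
    rw [(extChartAt 𝓘(ℝ, V) (1 : G)).left_inv hgs]
    simp
  have h3 := DFunLike.congr_fun h1.mfderiv X
  exact h3

end

/-! ### The Lie bracket as the derivative of the adjoint action. -/

noncomputable section

open scoped Manifold ContDiff ENNReal Topology
open VectorField Set Filter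
variable {V : Type*} [NormedAddCommGroup V] [NormedSpace ℝ V] [CompleteSpace V]
  {G : Type*} [TopologicalSpace G] [ChartedSpace V G] [Group G] [LieGroup 𝓘(ℝ, V) ∞ G]
local notation "φ" => extChartAt 𝓘(ℝ, V) (1 : G)

/-- A left-invariant field at `g` is the derivative at `1` of `x ↦ g x`. Pulling it back through the
chart turns it into a partial derivative of the multiplication, so that brackets become second
derivatives. -/
theorem fderiv_chartMul_right :
    ∀ᶠ a in 𝓝 (chartOne V G), ∀ X : LieAlg V G,
    (mpullbackWithin 𝓘(ℝ, V) 𝓘(ℝ, V) (φ).symm (mulInvariantVectorField X) (range 𝓘(ℝ, V)) a : V)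
      = fderiv ℝ (chartMul V G) (a, chartOne V G) (0, X) := by
  have hd : ∀ᶠ p in 𝓝 (chartOne V G, chartOne V G), DifferentiableAt ℝ (chartMul V G) p := by
    have := (contDiffAt_chartMul (V := V) (G := G)).of_le (m := 1) (by simp)
    exact (this.eventually (by simp)).mono fun p hp => hp.differentiableAt (by simp)
  have hc : ContinuousAt (fun a : V => (a, chartOne V G)) (chartOne V G) := by fun_prop
  filter_upwards [hc.eventually hd, extChartAt_target_mem_nhds (I := 𝓘(ℝ, V)) (1 : G)] with a ha hat X
  set g : G := (φ).symm a with hg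
  have hgs : g ∈ (φ).source := (φ).map_target hat
  have h1 : HasMFDerivAt 𝓘(ℝ, V) 𝓘(ℝ, V) (fun x : G => φ (g * x)) 1
      ((fderiv ℝ (chartMul V G) (a, chartOne V G)).comp (ContinuousLinearMap.inr ℝ V V)) := by
    have hcc : ContinuousAt (fun x : G => φ (g * x)) 1 := by
      refine ContinuousAt.comp (g := φ) (f := fun x => g * x) ?_ (hasMFDerivAt_mul_left (V := V) g 1).continuousAt
      rw [mul_one]
      exact continuousAt_extChartAt' hgs
    refine ⟨hcc, ?_⟩
    have h2 : HasFDerivAt (fun b : V => chartMul V G (a, b))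
      ((fderiv ℝ (chartMul V G) (a, chartOne V G)).comp (ContinuousLinearMap.inr ℝ V V)) (chartOne V G) :=
      HasFDerivAt.comp (chartOne V G) (f := fun b : V => (a, b)) ha.hasFDerivAt (hasFDerivAt_prodMk_right _ _)
    exact h2.hasFDerivWithinAt
  have h3 : HasMFDerivAt 𝓘(ℝ, V) 𝓘(ℝ, V) (fun x : G => φ (g * x)) 1
      ((mfderiv 𝓘(ℝ, V) 𝓘(ℝ, V) φ (g * 1)).comp (mfderiv 𝓘(ℝ, V) 𝓘(ℝ, V) (fun x : G => g * x) 1)) := by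
    refine HasMFDerivAt.comp (1 : G) (g := φ) ?_ (hasMFDerivAt_mul_left (V := V) g 1)
    refine MDifferentiableAt.hasMFDerivAt ?_
    rw [mul_one]
    exact (contMDiffAt_extChartAt' (n := ∞) ((extChartAt_source 𝓘(ℝ, V) (1 : G)) ▸ hgs)).mdifferentiableAt (by simp)
  have h4 := DFunLike.congr_fun (hasMFDerivAt_unique h1 h3) X
  refine Eq.trans ?_ h4.symm
  have h5 := ContinuousLinearMap.inverse_eq (mfderivWithin_extChartAt_symm_comp_mfderiv_extChartAt (I := 𝓘(ℝ, V)) (x := (1 : G)) hat)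
    (mfderiv_extChartAt_comp_mfderivWithin_extChartAt_symm hat)
  rw [mpullbackWithin_apply, h5]
  have h6 : ∀ g' : G, g' = g → ∀ w : V,
      (mfderiv 𝓘(ℝ, V) 𝓘(ℝ, V) φ g w : V) = mfderiv 𝓘(ℝ, V) 𝓘(ℝ, V) φ g' w := by
    rintro _ rfl w; rfl
  exact h6 (g * 1) (mul_one g) _

/-- The Lie bracket of the Lie algebra of `G`, as an operation on the model space. -/
def bracketModel (V G : Type*) [NormedAddCommGroup V] [NormedSpace ℝ V] [TopologicalSpace G]
    [ChartedSpace V G] [Group G] (X Y : V) : V :=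
  let X' : LieAlg V G := X
  let Y' : LieAlg V G := Y
  let Z : LieAlg V G := ⁅X', Y'⁆
  Z

theorem mulInvariantVectorField_one (X : LieAlg V G) :
    (mulInvariantVectorField X (1 : G) : V) = X := by
  unfold mulInvariantVectorField
  have h8 : HasMFDerivAt 𝓘(ℝ, V) 𝓘(ℝ, V) (fun x : G => 1 * x) 1 (ContinuousLinearMap.id ℝ V) := by
    exact (hasMFDerivAt_id (I := 𝓘(ℝ, V)) (1 : G)).congr_of_eventuallyEq
            (Eventually.of_forall fun x => one_mul x)
  exact DFunLike.congr_fun h8.mfderiv X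

/-- Both fields are partial derivatives of the chart multiplication, and at the identity they take
the values `X` and `Y`; hence only mixed second derivatives at `(1, 1)` survive in `DY(X) - DX(Y)`.
-/
theorem bracket_eq_chart (X Y : V) : bracketModel V G X Y =
    fderiv ℝ (fderiv ℝ (chartMul V G)) (chartOne V G, chartOne V G) (X, 0) (0, Y)
    - fderiv ℝ (fderiv ℝ (chartMul V G)) (chartOne V G, chartOne V G) (Y, 0) (0, X) := by
  have hD : DifferentiableAt ℝ (fderiv ℝ (chartMul V G)) (chartOne V G, chartOne V G) := by
    have := (contDiffAt_chartMul (V := V) (G := G)).fderiv_right (m := 1) (by rw [one_add_one_eq_two]; exact ENat.LEInfty.out)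
    exact this.differentiableAt (by simp)
  have hF : ∀ X : V, HasFDerivAt (fun a : V => fderiv ℝ (chartMul V G) (a, chartOne V G) (0, X))
      (((fderiv ℝ (fderiv ℝ (chartMul V G)) (chartOne V G, chartOne V G)).flip (0, X)).comp
        (ContinuousLinearMap.inl ℝ V V)) (chartOne V G) := by
    intro X
    have h1 : HasFDerivAt (fun a : V => fderiv ℝ (chartMul V G) (a, chartOne V G))
      ((fderiv ℝ (fderiv ℝ (chartMul V G)) (chartOne V G, chartOne V G)).comp
        (ContinuousLinearMap.inl ℝ V V)) (chartOne V G) :=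
      HasFDerivAt.comp (chartOne V G) (f := fun a : V => (a, chartOne V G)) hD.hasFDerivAt (hasFDerivAt_prodMk_left _ _)
    exact h1.clm_apply (hasFDerivAt_const ((0, X) : V × V) _) |>.congr_fderiv (by ext; simp)
  have hone : ∀ X : V, fderiv ℝ (chartMul V G) (chartOne V G, chartOne V G) (0, X) = (X : V) := by
    intro X
    have h1 := (fderiv_chartMul_right (V := V) (G := G)).self_of_nhds X
    rw [← h1, mpullbackWithin_apply]
    have ht : chartOne V G ∈ (φ).target := mem_extChartAt_target 1
    have h5 := ContinuousLinearMap.inverse_eq (mfderivWithin_extChartAt_symm_comp_mfderiv_extChartAt (I := 𝓘(ℝ, V)) (x := (1 : G)) ht)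
      (mfderiv_extChartAt_comp_mfderivWithin_extChartAt_symm ht)
    rw [h5]
    have h6 : ∀ g : G, g = 1 → (mfderiv 𝓘(ℝ, V) 𝓘(ℝ, V) φ g (mulInvariantVectorField X g) : V) = X := by
      rintro _ rfl
      have h9 := DFunLike.congr_fun (hasMFDerivAt_extChartAt_self (V := V) G 1).mfderiv
      exact (h9 _).trans (mulInvariantVectorField_one X)
    exact h6 _ (chart_symm_one (V := V) (G := G))
  change (mlieBracketWithin 𝓘(ℝ, V) (mulInvariantVectorField (show LieAlg V G from X))
    (mulInvariantVectorField (show LieAlg V G from Y)) univ (1 : G) : V) = _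
  have h1 : ((φ).symm ⁻¹' univ ∩ range 𝓘(ℝ, V)) = univ := by simp
  have h2 := (fderiv_chartMul_right (V := V) (G := G))
  have h3 : lieBracket ℝ (mpullbackWithin 𝓘(ℝ, V) 𝓘(ℝ, V) (φ).symm (mulInvariantVectorField (show LieAlg V G from X)) (range 𝓘(ℝ, V)))
      (mpullbackWithin 𝓘(ℝ, V) 𝓘(ℝ, V) (φ).symm (mulInvariantVectorField (show LieAlg V G from Y)) (range 𝓘(ℝ, V))) (chartOne V G)
      = lieBracket ℝ (fun a : V => fderiv ℝ (chartMul V G) (a, chartOne V G) (0, X))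
        (fun a : V => fderiv ℝ (chartMul V G) (a, chartOne V G) (0, Y)) (chartOne V G) :=
    Filter.EventuallyEq.lieBracket_vectorField_eq (h2.mono fun a ha => ha X) (h2.mono fun a ha => ha Y)
  rw [lieBracket, (hF X).fderiv, (hF Y).fderiv, hone X, hone Y] at h3
  rw [mlieBracketWithin_apply, h1]
  have h4 := (congrFun (lieBracketWithin_univ (𝕜 := ℝ)
    (V := mpullbackWithin 𝓘(ℝ, V) 𝓘(ℝ, V) (φ).symm (mulInvariantVectorField (show LieAlg V G from X)) (range 𝓘(ℝ, V)))
    (W := mpullbackWithin 𝓘(ℝ, V) 𝓘(ℝ, V) (φ).symm (mulInvariantVectorField (show LieAlg V G from Y)) (range 𝓘(ℝ, V))))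
    (chartOne V G)).trans h3
  have h0 : (mfderiv 𝓘(ℝ, V) 𝓘(ℝ, V) φ 1).inverse = (ContinuousLinearMap.id ℝ V) := by
    rw [(hasMFDerivAt_extChartAt_self (V := V) G 1).mfderiv]
    exact ContinuousLinearMap.inverse_id
  exact (DFunLike.congr_fun h0 _).trans h4

/-- Differentiate `a b = (a b a⁻¹) a` first in `b` and then in `a`, both at `1`. This expresses the
derivative of `Ad` as a difference of two mixed second derivatives of the multiplication, and
symmetry of the second derivative identifies the difference with the bracket. -/
theorem Ad_chart_deriv (X Y : V) :
    ∃ K : V →L[ℝ] V, HasFDerivAt (fun a => fderiv ℝ (chartConj V G) (a, chartOne V G) (0, Y)) K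
    (chartOne V G)
      ∧ K X = bracketModel V G X Y := by
  set o := chartOne V G with ho
  set m := chartMul V G with hm
  set k := chartConj V G with hk
  have hkd : DifferentiableAt ℝ (fderiv ℝ k) (o, o) := by
    have := (contDiffAt_chartConj (V := V) (G := G)).fderiv_right (m := 1) (by rw [one_add_one_eq_two]; exact ENat.LEInfty.out)
    exact this.differentiableAt (by simp)
  have hmd : DifferentiableAt ℝ (fderiv ℝ m) (o, o) := by
    have := (contDiffAt_chartMul (V := V) (G := G)).fderiv_right (m := 1) (by rw [one_add_one_eq_two]; exact ENat.LEInfty.out)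
    exact this.differentiableAt (by simp)
  have hK : ∃ K : V →L[ℝ] V, HasFDerivAt (fun a => fderiv ℝ k (a, o) (0, Y)) K o := by
    have h1 : DifferentiableAt ℝ (fun a : V => fderiv ℝ k (a, o)) o :=
      DifferentiableAt.comp o (f := fun a : V => (a, o)) hkd (by fun_prop)
    exact ⟨_, (h1.clm_apply (differentiableAt_const ((0, Y) : V × V))).hasFDerivAt⟩
  obtain ⟨K, hK⟩ := hK
  refine ⟨K, hK, ?_⟩
  have hmdd : ∀ᶠ p in 𝓝 (o, o), DifferentiableAt ℝ m p := by
    have := (contDiffAt_chartMul (V := V) (G := G)).of_le (m := 1) (by simp)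
    exact (this.eventually (by simp)).mono fun p hp => hp.differentiableAt (by simp)
  have hkdd : ∀ᶠ p in 𝓝 (o, o), DifferentiableAt ℝ k p := by
    have := (contDiffAt_chartConj (V := V) (G := G)).of_le (m := 1) (by simp)
    exact (this.eventually (by simp)).mono fun p hp => hp.differentiableAt (by simp)
  have hs : ContinuousAt (φ).symm o := (contMDiffAt_chart_symm (V := V) (G := G)).continuousAt
  have := topologicalGroup_of_lieGroup 𝓘(ℝ, V) ∞ (G := G)
  have hsrc : ∀ᶠ p : V × V in 𝓝 (o, o), (φ).symm p.1 * (φ).symm p.2 * ((φ).symm p.1)⁻¹ ∈ (φ).source := by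
    have h1 : ContinuousAt (fun p : V × V => (φ).symm p.1) (o, o) :=
      ContinuousAt.comp (g := (φ).symm) (f := Prod.fst) hs continuousAt_fst
    have h2 : ContinuousAt (fun p : V × V => (φ).symm p.2) (o, o) :=
      ContinuousAt.comp (g := (φ).symm) (f := Prod.snd) hs continuousAt_snd
    have h3 : ContinuousAt (fun p : V × V => (φ).symm p.1 * (φ).symm p.2 * ((φ).symm p.1)⁻¹) (o, o) :=
      (h1.mul h2).mul h1.inv
    refine h3.eventually_mem ?_
    have : (φ).symm o * (φ).symm o * ((φ).symm o)⁻¹ = 1 := by rw [ho, chart_symm_one]; simp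
    rw [this]
    exact extChartAt_source_mem_nhds 1
  have hid : ∀ᶠ p : V × V in 𝓝 (o, o), m p = m (k p, p.1) := by
    filter_upwards [hsrc] with p hp
    simp only [hm, hk, chartMul, chartConj]
    rw [(φ).left_inv hp]
    congr 1
    group
  have hko : ∀ᶠ a in 𝓝 o, k (a, o) = o := by
    refine Eventually.of_forall fun a => ?_
    simp only [hk, chartConj, ho, chart_symm_one, mul_one, mul_inv_cancel]
    rfl
  have e1 : ContinuousAt (fun a : V => (a, o)) o := by fun_prop
  have e2 : ContinuousAt (fun a : V => (o, a)) o := by fun_prop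
  have hfd : ∀ᶠ a in 𝓝 o, fderiv ℝ m (a, o) (0, Y) = fderiv ℝ m (o, a) (fderiv ℝ k (a, o) (0, Y), 0) := by
    filter_upwards [e1.eventually hid.eventually_nhds, e1.eventually hmdd, e1.eventually hkdd,
      e2.eventually hmdd, hko] with a h1 h2 h3 h4 h5
    have A : HasFDerivAt (fun b : V => m (a, b)) ((fderiv ℝ m (a, o)).comp (ContinuousLinearMap.inr ℝ V V)) o :=
      HasFDerivAt.comp o (f := fun b : V => (a, b)) h2.hasFDerivAt (hasFDerivAt_prodMk_right _ _)
    have B : HasFDerivAt (fun b : V => k (a, b)) ((fderiv ℝ k (a, o)).comp (ContinuousLinearMap.inr ℝ V V)) o :=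
      HasFDerivAt.comp o (f := fun b : V => (a, b)) h3.hasFDerivAt (hasFDerivAt_prodMk_right _ _)
    have C : HasFDerivAt (fun b : V => m (k (a, b), a)) ((fderiv ℝ m (o, a)).comp
        (((fderiv ℝ k (a, o)).comp (ContinuousLinearMap.inr ℝ V V)).prod 0)) o := by
      have h6 : HasFDerivAt m (fderiv ℝ m (o, a)) (k (a, o), a) := by rw [h5]; exact h4.hasFDerivAt
      exact HasFDerivAt.comp o (f := fun b : V => (k (a, b), a)) h6 (B.prodMk (hasFDerivAt_const a o))
    have D : (fun b : V => m (a, b)) =ᶠ[𝓝 o] fun b : V => m (k (a, b), a) := by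
      have : ContinuousAt (fun b : V => (a, b)) o := by fun_prop
      exact this.eventually h1
    have := DFunLike.congr_fun (A.unique (C.congr_of_eventuallyEq D)) Y
    simpa using this
  have hone : ∀ v : V, fderiv ℝ m (o, o) (v, 0) = v := by
    intro v
    have A : HasFDerivAt (fun b : V => m (b, o)) ((fderiv ℝ m (o, o)).comp (ContinuousLinearMap.inl ℝ V V)) o :=
      HasFDerivAt.comp o (f := fun b : V => (b, o)) hmdd.self_of_nhds.hasFDerivAt (hasFDerivAt_prodMk_left _ _)
    have B : (fun b : V => m (b, o)) =ᶠ[𝓝 o] id := by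
      filter_upwards [extChartAt_target_mem_nhds (I := 𝓘(ℝ, V)) (1 : G)] with b hb
      simp only [hm, chartMul, ho, chart_symm_one, mul_one]
      exact (φ).right_inv hb
    have := DFunLike.congr_fun (A.unique ((hasFDerivAt_id o).congr_of_eventuallyEq B)) v
    simpa using this
  have hkY : fderiv ℝ k (o, o) (0, Y) = (Y : V) := by
    have A : HasFDerivAt (fun b : V => k (o, b)) ((fderiv ℝ k (o, o)).comp (ContinuousLinearMap.inr ℝ V V)) o :=
      HasFDerivAt.comp o (f := fun b : V => (o, b)) hkdd.self_of_nhds.hasFDerivAt (hasFDerivAt_prodMk_right _ _)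
    have B : (fun b : V => k (o, b)) =ᶠ[𝓝 o] id := by
      filter_upwards [extChartAt_target_mem_nhds (I := 𝓘(ℝ, V)) (1 : G)] with b hb
      simp only [hk, chartConj, ho, chart_symm_one, one_mul, inv_one, mul_one]
      exact (φ).right_inv hb
    have := DFunLike.congr_fun (A.unique ((hasFDerivAt_id o).congr_of_eventuallyEq B)) Y
    simpa using this
  have L1 : HasFDerivAt (fun a : V => fderiv ℝ m (a, o)) ((fderiv ℝ (fderiv ℝ m) (o, o)).comp
      (ContinuousLinearMap.inl ℝ V V)) o :=
    HasFDerivAt.comp o (f := fun a : V => (a, o)) hmd.hasFDerivAt (hasFDerivAt_prodMk_left _ _)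
  have L2 : HasFDerivAt (fun a : V => fderiv ℝ m (o, a)) ((fderiv ℝ (fderiv ℝ m) (o, o)).comp
      (ContinuousLinearMap.inr ℝ V V)) o :=
    HasFDerivAt.comp o (f := fun a : V => (o, a)) hmd.hasFDerivAt (hasFDerivAt_prodMk_right _ _)
  have R1 := L1.clm_apply (hasFDerivAt_const ((0, Y) : V × V) o)
  have R2 := L2.clm_apply (hK.prodMk (hasFDerivAt_const (0 : V) o))
  have E := DFunLike.congr_fun (R1.unique (R2.congr_of_eventuallyEq hfd)) X
  have hsymm := ((contDiffAt_chartMul (V := V) (G := G)).isSymmSndFDerivAt (by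
    rw [minSmoothness_of_isRCLikeNormedField]; exact ENat.LEInfty.out)).eq ((0, X) : V × V) ((Y, 0) : V × V)
  rw [bracket_eq_chart]
  have E' : (fderiv ℝ (fderiv ℝ m) (o, o)) (X, 0) (0, Y) = K X + (fderiv ℝ (fderiv ℝ m) (o, o)) (0, X) (Y, 0) := by
    simpa [hkY, hone] using E
  rw [hsymm] at E'
  exact (sub_eq_of_eq_add E').symm

end

/-! ### Calculus of left logarithmic derivatives. -/

noncomputable section

open scoped Manifold ContDiff ENNReal Topology
open VectorField Set Filter
variable {V : Type*} [NormedAddCommGroup V] [NormedSpace ℝ V] [CompleteSpace V]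
  {G : Type*} [TopologicalSpace G] [ChartedSpace V G] [Group G] [LieGroup 𝓘(ℝ, V) ∞ G]

/-- The curve `c` in `G` is differentiable at `t`, with left logarithmic derivative `X`. -/
def HasLogDerivAt (c : ℝ → G) (X : LieAlg V G) (t : ℝ) : Prop :=
  HasMFDerivAt 𝓘(ℝ, ℝ) 𝓘(ℝ, V) c t
    ((1 : ℝ →L[ℝ] ℝ).smulRight (mulInvariantVectorField X (c t)))

theorem isOneParam_of_hasLogDerivAt {c : ℝ → G} {X : LieAlg V G} (h0 : c 0 = 1)
    (h : ∀ t, HasLogDerivAt c X t) : IsOneParam c X := ⟨h0, h⟩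

theorem Ad_add (g : G) (X Y : LieAlg V G) : Ad g (X + Y) = Ad g X + Ad g Y :=
  map_add (mfderiv 𝓘(ℝ, V) 𝓘(ℝ, V) (fun x : G => g * x * g⁻¹) 1) X Y

theorem Ad_smul (g : G) (r : ℝ) (X : LieAlg V G) : Ad g (r • X) = r • Ad g X :=
  map_smul (mfderiv 𝓘(ℝ, V) 𝓘(ℝ, V) (fun x : G => g * x * g⁻¹) 1) r X

/-- The adjoint action as a continuous linear map. -/
def AdL (g : G) : V →L[ℝ] V := mfderiv 𝓘(ℝ, V) 𝓘(ℝ, V) (fun x : G => g * x * g⁻¹) 1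

section Model
variable {V₁ V₂ V₃ : Type*} [NormedAddCommGroup V₁] [NormedSpace ℝ V₁]
    [NormedAddCommGroup V₂] [NormedSpace ℝ V₂] [NormedAddCommGroup V₃] [NormedSpace ℝ V₃]
    {M₁ M₂ M₃ : Type*} [TopologicalSpace M₁] [ChartedSpace V₁ M₁] [TopologicalSpace M₂]
    [ChartedSpace V₂ M₂] [TopologicalSpace M₃] [ChartedSpace V₃ M₃]

/-- The derivative of a map of manifolds, as a map of the model spaces. -/
def modelDeriv (V₁ V₂ : Type*) [NormedAddCommGroup V₁] [NormedSpace ℝ V₁]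
    [NormedAddCommGroup V₂] [NormedSpace ℝ V₂] {M₁ M₂ : Type*} [TopologicalSpace M₁]
    [ChartedSpace V₁ M₁] [TopologicalSpace M₂] [ChartedSpace V₂ M₂] (f : M₁ → M₂) (x : M₁) :
    V₁ →L[ℝ] V₂ := mfderiv 𝓘(ℝ, V₁) 𝓘(ℝ, V₂) f x

theorem hasMFDerivAt_of_eq {f : M₁ → M₂} {x : M₁} {D D' : V₁ →L[ℝ] V₂}
    (h : HasMFDerivAt 𝓘(ℝ, V₁) 𝓘(ℝ, V₂) f x D) (e : D = D') :
    HasMFDerivAt 𝓘(ℝ, V₁) 𝓘(ℝ, V₂) f x D' := e ▸ h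

theorem modelDeriv_comp {f : M₁ → M₂} {g : M₂ → M₃} {x : M₁} {y : M₂} (hy : f x = y)
    (hg : MDifferentiableAt 𝓘(ℝ, V₂) 𝓘(ℝ, V₃) g y) (hf : MDifferentiableAt 𝓘(ℝ, V₁) 𝓘(ℝ, V₂) f x)
    (X : V₁) : modelDeriv V₁ V₃ (fun z => g (f z)) x X
      = modelDeriv V₂ V₃ g y (modelDeriv V₁ V₂ f x X) := by
  subst hy
  exact DFunLike.congr_fun (mfderiv_comp x hg hf) X

theorem modelDeriv_eq_self {f : M₁ → M₁} (hf : ∀ x, f x = x) (x : M₁) (X : V₁) :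
    modelDeriv V₁ V₁ f x X = X := by
  obtain rfl : f = id := funext hf
  exact DFunLike.congr_fun (mfderiv_id (I := 𝓘(ℝ, V₁)) (x := x)) X

end Model

theorem Ad_mul (g h : G) (X : LieAlg V G) : Ad (g * h) X = Ad g (Ad h X) := by
  have h1 := modelDeriv_comp (V₁ := V) (V₂ := V) (V₃ := V) (f := fun x : G => h * x * h⁻¹) (g := fun x : G => g * x * g⁻¹)
    (x := 1) (y := 1) (by simp) (mdifferentiableAt_conj (V := V) g 1)
    (mdifferentiableAt_conj (V := V) h 1) X
  have : (fun x : G => g * h * x * (g * h)⁻¹) = fun x => g * (h * x * h⁻¹) * g⁻¹ := by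
    funext x; group
  rw [← this] at h1
  exact h1

@[simp] theorem Ad_one (X : LieAlg V G) : Ad (1 : G) X = X := by
  have h8 : HasMFDerivAt 𝓘(ℝ, V) 𝓘(ℝ, V) (fun x : G => 1 * x * 1⁻¹) 1 (ContinuousLinearMap.id ℝ V) := by
    exact (hasMFDerivAt_id (I := 𝓘(ℝ, V)) (1 : G)).congr_of_eventuallyEq
            (Eventually.of_forall fun x => by simp)
  exact DFunLike.congr_fun h8.mfderiv X

theorem Ad_inv_Ad (g : G) (X : LieAlg V G) : Ad g⁻¹ (Ad g X) = X := by
  rw [← Ad_mul, inv_mul_cancel, Ad_one]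

theorem Ad_Ad_inv (g : G) (X : LieAlg V G) : Ad g (Ad g⁻¹ X) = X := by
  rw [← Ad_mul, mul_inv_cancel, Ad_one]

theorem mdiff_mul_left (a b : G) : MDifferentiableAt 𝓘(ℝ, V) 𝓘(ℝ, V) (fun z : G => a * z) b :=
  (contMDiff_mul_left (I := 𝓘(ℝ, V)) (n := ∞)).mdifferentiableAt (by simp)

theorem mdiff_mul_right (a b : G) : MDifferentiableAt 𝓘(ℝ, V) 𝓘(ℝ, V) (fun z : G => z * a) b :=
  (contMDiff_mul_right (I := 𝓘(ℝ, V)) (n := ∞)).mdifferentiableAt (by simp)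

/-- From `b x a = (b a)(a⁻¹ x a)`: right translation is left translation after conjugation by `a⁻¹`.
-/
theorem mfderiv_mul_right_field (X : LieAlg V G) (a b : G) :
    modelDeriv V V (fun z => z * a) b (mulInvariantVectorField X b)
        = mulInvariantVectorField (Ad a⁻¹ X) (b * a) := by
  have h1 := modelDeriv_comp (V₁ := V) (V₂ := V) (V₃ := V) (f := fun x : G => b * x) (g := fun x : G => x * a)
    (x := 1) (y := b) (by simp) (mdiff_mul_right (V := V) a b)
    (mdiff_mul_left (V := V) b 1) X
  have h2 := modelDeriv_comp (V₁ := V) (V₂ := V) (V₃ := V) (f := fun x : G => a⁻¹ * x * a⁻¹⁻¹) (g := fun x : G => b * a * x)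
    (x := 1) (y := 1) (by simp) (mdiff_mul_left (V := V) (b * a) 1)
    (mdifferentiableAt_conj (V := V) a⁻¹ 1) X
  have e : (fun x : G => b * x * a) = fun x => b * a * (a⁻¹ * x * a⁻¹⁻¹) := by funext x; group
  rw [e] at h1
  exact h1.symm.trans h2

theorem HasLogDerivAt.mdifferentiableAt {c : ℝ → G} {X : LieAlg V G} {t : ℝ}
    (h : HasLogDerivAt c X t) :
    MDifferentiableAt 𝓘(ℝ, ℝ) 𝓘(ℝ, V) c t := HasMFDerivAt.mdifferentiableAt h

theorem HasLogDerivAt.continuousAt {c : ℝ → G} {X : LieAlg V G} {t : ℝ} (h : HasLogDerivAt c X t) :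
    ContinuousAt c t := HasMFDerivAt.continuousAt h

theorem hasLogDerivAt_const (g : G) (t : ℝ) : HasLogDerivAt (fun _ => g) (0 : LieAlg V G) t := by
  have h := hasMFDerivAt_const (I := 𝓘(ℝ, ℝ)) (I' := 𝓘(ℝ, V)) g t
  have e : ((1 : ℝ →L[ℝ] ℝ).smulRight (mulInvariantVectorField (0 : LieAlg V G) g) : ℝ →L[ℝ] V) = 0 := by
    have : (mulInvariantVectorField (0 : LieAlg V G) g : V) = 0 :=
      map_zero (mfderiv 𝓘(ℝ, V) 𝓘(ℝ, V) (fun x : G => g * x) 1)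
    refine ContinuousLinearMap.ext_ring ?_
    exact (congrArg (fun v : V => (1 : ℝ) • v) this).trans (smul_zero (A := V) (1 : ℝ))
  exact hasMFDerivAt_of_eq h e.symm

theorem HasLogDerivAt.const_mul {c : ℝ → G} {X : LieAlg V G} {t : ℝ} (h : HasLogDerivAt c X t)
    (g : G) :
    HasLogDerivAt (fun s => g * c s) X t := by
  have h1 := HasMFDerivAt.comp t (hasMFDerivAt_mul_left (V := V) g (c t)) h
  have e : (((mfderiv 𝓘(ℝ, V) 𝓘(ℝ, V) (fun x : G => g * x) (c t)).comp
      ((1 : ℝ →L[ℝ] ℝ).smulRight (mulInvariantVectorField X (c t)))) : ℝ →L[ℝ] V) =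
      ((1 : ℝ →L[ℝ] ℝ).smulRight (mulInvariantVectorField X (g * c t)) : ℝ →L[ℝ] V) := by
    refine ContinuousLinearMap.ext_ring ?_
    have e1 := map_smul (mfderiv 𝓘(ℝ, V) 𝓘(ℝ, V) (fun x : G => g * x) (c t)) (1 : ℝ) (mulInvariantVectorField X (c t))
    refine Eq.trans e1 ?_
    exact congrArg (fun v : V => (1 : ℝ) • v) (mfderiv_mul_left_field X g (c t))
  exact hasMFDerivAt_of_eq h1 e

theorem mulInvariantVectorField_injective {X Y : LieAlg V G} {g : G}
    (h : (mulInvariantVectorField X g : V) = mulInvariantVectorField Y g) : X = Y := by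
  have h1 := mfderiv_mul_left_field X g⁻¹ g
  have h2 := mfderiv_mul_left_field Y g⁻¹ g
  have h3 : (mulInvariantVectorField X (g⁻¹ * g) : V) = mulInvariantVectorField Y (g⁻¹ * g) :=
    h1.symm.trans ((congrArg (fun v : V => (mfderiv 𝓘(ℝ, V) 𝓘(ℝ, V) (fun z => g⁻¹ * z) g v : V)) h).trans h2)
  rw [inv_mul_cancel] at h3
  exact (mulInvariantVectorField_one X).symm.trans (h3.trans (mulInvariantVectorField_one Y))

theorem mulInvariantVectorField_surjective (g : G) (v : V) :
    ∃ X : LieAlg V G, (mulInvariantVectorField X g : V) = v := by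
  refine ⟨modelDeriv V V (fun z => g⁻¹ * z) g v, ?_⟩
  have h1 := modelDeriv_comp (V₁ := V) (V₂ := V) (V₃ := V) (f := fun x : G => g⁻¹ * x) (g := fun x : G => g * x)
    (x := g) (y := 1) (by simp) (mdiff_mul_left (V := V) g 1)
    (mdiff_mul_left (V := V) g⁻¹ g) v
  exact h1.symm.trans (modelDeriv_eq_self (fun x => mul_inv_cancel_left g x) g v)

theorem HasLogDerivAt.unique {c : ℝ → G} {X Y : LieAlg V G} {t : ℝ} (h : HasLogDerivAt c X t)
    (h' : HasLogDerivAt c Y t) : X = Y := by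
  have h1 := DFunLike.congr_fun (hasMFDerivAt_unique h h') (1 : ℝ)
  have h2 : ((1 : ℝ) • (mulInvariantVectorField X (c t) : V)) = (1 : ℝ) • (mulInvariantVectorField Y (c t) : V) := h1
  rw [one_smul, one_smul] at h2
  exact mulInvariantVectorField_injective h2

theorem exists_hasLogDerivAt {c : ℝ → G} {t : ℝ} (h : MDifferentiableAt 𝓘(ℝ, ℝ) 𝓘(ℝ, V) c t) :
    ∃ X : LieAlg V G, HasLogDerivAt c X t := by
  obtain ⟨X, hX⟩ := mulInvariantVectorField_surjective (c t) (modelDeriv ℝ V c t 1)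
  refine ⟨X, ?_⟩
  have h1 := h.hasMFDerivAt
  have e : (mfderiv 𝓘(ℝ, ℝ) 𝓘(ℝ, V) c t : ℝ →L[ℝ] V) =
      ((1 : ℝ →L[ℝ] ℝ).smulRight (mulInvariantVectorField X (c t)) : ℝ →L[ℝ] V) := by
    refine ContinuousLinearMap.ext_ring ?_
    exact hX.symm.trans (one_smul ℝ (mulInvariantVectorField X (c t) : V)).symm
  exact hasMFDerivAt_of_eq h1 e

theorem HasLogDerivAt.mul {c d : ℝ → G} {X Y : LieAlg V G} {t : ℝ} (h : HasLogDerivAt c X t)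
    (h' : HasLogDerivAt d Y t) : HasLogDerivAt (fun s => c s * d s) (Ad (d t)⁻¹ X + Y) t := by
  have hM : MDifferentiableAt (𝓘(ℝ, V).prod 𝓘(ℝ, V)) 𝓘(ℝ, V) (fun p : G × G => p.1 * p.2)
      (c t, d t) := (contMDiff_mul 𝓘(ℝ, V) ∞).mdifferentiableAt (by simp)
  have hp := hM.hasMFDerivAt.comp t (HasMFDerivAt.prodMk h h')
  have h7 : (ContinuousLinearMap.smulRight (1 : ℝ →L[ℝ] ℝ)
        (mulInvariantVectorField (Ad (d t)⁻¹ X + Y) (c t * d t)) : ℝ →L[ℝ] V) =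
      (mfderiv (𝓘(ℝ, V).prod 𝓘(ℝ, V)) 𝓘(ℝ, V) (fun p : G × G => p.1 * p.2) (c t, d t)).comp
        ((ContinuousLinearMap.smulRight (1 : ℝ →L[ℝ] ℝ) (mulInvariantVectorField X (c t))).prod
          (ContinuousLinearMap.smulRight (1 : ℝ →L[ℝ] ℝ)
            (mulInvariantVectorField Y (d t)))) := by
    refine ContinuousLinearMap.ext_ring ?_
    have h8 := mfderiv_prod_eq_add_apply (v := (show V × V from ((1 : ℝ) • mulInvariantVectorField X (c t),
      (1 : ℝ) • mulInvariantVectorField Y (d t)))) hM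
    refine Eq.trans ?_ h8.symm
    rw [mulInvariantVectorField_add]
    simp only [one_smul]
    refine Eq.trans ?_ (congrArg₂ (fun a b : V => a + b) (mfderiv_mul_right_field X (d t) (c t)).symm
      (mfderiv_mul_left_field Y (c t) (d t)).symm)
    exact one_smul ℝ _
  exact hasMFDerivAt_of_eq hp h7.symm

theorem HasLogDerivAt.congr {c d : ℝ → G} {X : LieAlg V G} {t : ℝ} (h : HasLogDerivAt c X t)
    (e : d =ᶠ[𝓝 t] c) : HasLogDerivAt d X t := by
  have h1 := HasMFDerivAt.congr_of_eventuallyEq h e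
  have h2 : d t = c t := e.self_of_nhds
  unfold HasLogDerivAt
  have : ∀ g : G, g = c t → ((1 : ℝ →L[ℝ] ℝ).smulRight (mulInvariantVectorField X (c t)) : ℝ →L[ℝ] V)
    = ((1 : ℝ →L[ℝ] ℝ).smulRight (mulInvariantVectorField X g) : ℝ →L[ℝ] V) := by rintro _ rfl; rfl
  exact hasMFDerivAt_of_eq h1 (this _ h2)

/-- The inverse curve is differentiable, hence has some logarithmic derivative; the product rule for
`c c⁻¹ = 1` then determines it. -/
theorem HasLogDerivAt.inv {c : ℝ → G} {X : LieAlg V G} {t : ℝ} (h : HasLogDerivAt c X t) :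
    HasLogDerivAt (fun s => (c s)⁻¹) (-Ad (c t) X) t := by
  have h1 : MDifferentiableAt 𝓘(ℝ, ℝ) 𝓘(ℝ, V) (fun s => (c s)⁻¹) t :=
    MDifferentiableAt.comp t (g := fun x : G => x⁻¹)
      ((contMDiff_inv 𝓘(ℝ, V) ∞).mdifferentiableAt (by simp)) h.mdifferentiableAt
  obtain ⟨Y, hY⟩ := exists_hasLogDerivAt h1
  have h2 := h.mul hY
  have h3 : HasLogDerivAt (fun s => c s * (c s)⁻¹) (0 : LieAlg V G) t :=
    (hasLogDerivAt_const 1 t).congr (Eventually.of_forall fun s => mul_inv_cancel _)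
  have h4 := h2.unique h3
  rw [inv_inv] at h4
  rwa [← eq_neg_of_add_eq_zero_right h4]

theorem HasLogDerivAt.scomp {c : ℝ → G} {X : LieAlg V G} {f : ℝ → ℝ} {f' t : ℝ}
    (h : HasLogDerivAt c X (f t)) (hf : HasDerivAt f f' t) :
    HasLogDerivAt (fun s => c (f s)) (f' • X) t := by
  have h1 := HasMFDerivAt.comp t h hf.hasFDerivAt.hasMFDerivAt
  have e : ((((1 : ℝ →L[ℝ] ℝ).smulRight (mulInvariantVectorField X (c (f t)))).comp
      (ContinuousLinearMap.toSpanSingleton ℝ f')) : ℝ →L[ℝ] V) =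
      ((1 : ℝ →L[ℝ] ℝ).smulRight (mulInvariantVectorField (f' • X) (c (f t))) : ℝ →L[ℝ] V) := by
    refine ContinuousLinearMap.ext_ring ?_
    rw [mulInvariantVectorField_smul]
    change ((1 : ℝ) • f') • (mulInvariantVectorField X (c (f t)) : V) = (1 : ℝ) • (f' • (mulInvariantVectorField X (c (f t)) : V))
    simp
  exact hasMFDerivAt_of_eq h1 e

section Hom
variable {W : Type*} [NormedAddCommGroup W] [NormedSpace ℝ W] [CompleteSpace W]
  {H : Type*} [TopologicalSpace H] [ChartedSpace W H] [Group H] [LieGroup 𝓘(ℝ, W) ∞ H]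

/-- The derivative at `1` of a homomorphism of Lie groups. -/
def lieMap (F : G →* H) (X : LieAlg V G) : LieAlg W H :=
  modelDeriv V W F 1 X

theorem lieMap_add (F : G →* H) (X Y : LieAlg V G) :
    (lieMap F (X + Y) : LieAlg W H) = lieMap F X + lieMap F Y :=
  map_add (mfderiv 𝓘(ℝ, V) 𝓘(ℝ, W) F 1) X Y

theorem lieMap_smul (F : G →* H) (r : ℝ) (X : LieAlg V G) :
    (lieMap F (r • X) : LieAlg W H) = r • lieMap F X :=
  map_smul (mfderiv 𝓘(ℝ, V) 𝓘(ℝ, W) F 1) r X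

theorem mfderiv_hom_field {F : G →* H} (hF : ContMDiff 𝓘(ℝ, V) 𝓘(ℝ, W) ∞ F) (X : LieAlg V G)
    (g : G) :
    modelDeriv V W F g (mulInvariantVectorField X g)
      = mulInvariantVectorField (lieMap F X : LieAlg W H) (F g) := by
  have hd : ∀ g, MDifferentiableAt 𝓘(ℝ, V) 𝓘(ℝ, W) F g := fun g => hF.mdifferentiableAt (by simp)
  have h1 := modelDeriv_comp (V₁ := V) (V₂ := V) (V₃ := W) (f := fun x : G => g * x) (g := F)
    (x := 1) (y := g) (by simp) (hd g) (mdiff_mul_left (V := V) g 1) X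
  have h2 := modelDeriv_comp (V₁ := V) (V₂ := W) (V₃ := W) (f := F) (g := fun x : H => F g * x)
    (x := 1) (y := 1) (by simp) (mdiff_mul_left (V := W) (F g) 1) (hd 1) X
  have e : (fun x : G => F (g * x)) = fun x => F g * F x := by funext x; simp
  rw [e] at h1
  exact h1.symm.trans h2

theorem HasLogDerivAt.hom {F : G →* H} (hF : ContMDiff 𝓘(ℝ, V) 𝓘(ℝ, W) ∞ F) {c : ℝ → G}
    {X : LieAlg V G} {t : ℝ}
    (h : HasLogDerivAt c X t) : HasLogDerivAt (fun s => F (c s)) (lieMap F X : LieAlg W H) t := by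
  have h1 := HasMFDerivAt.comp t ((hF.mdifferentiableAt (by simp)).hasMFDerivAt (x := c t)) h
  have e : (((mfderiv 𝓘(ℝ, V) 𝓘(ℝ, W) F (c t)).comp
      ((1 : ℝ →L[ℝ] ℝ).smulRight (mulInvariantVectorField X (c t)))) : ℝ →L[ℝ] W) =
      ((1 : ℝ →L[ℝ] ℝ).smulRight (mulInvariantVectorField (lieMap F X : LieAlg W H) (F (c t))) : ℝ →L[ℝ] W) := by
    refine ContinuousLinearMap.ext_ring ?_
    have e1 := map_smul (mfderiv 𝓘(ℝ, V) 𝓘(ℝ, W) F (c t)) (1 : ℝ) (mulInvariantVectorField X (c t))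
    refine Eq.trans e1 ?_
    exact congrArg (fun v : W => (1 : ℝ) • v) (mfderiv_hom_field hF X (c t))
  exact hasMFDerivAt_of_eq h1 e

theorem lieMap_Ad {F : G →* H} (hF : ContMDiff 𝓘(ℝ, V) 𝓘(ℝ, W) ∞ F) (g : G) (X : LieAlg V G) :
    (lieMap F (Ad g X) : LieAlg W H) = Ad (F g) (lieMap F X) := by
  have hd : ∀ g, MDifferentiableAt 𝓘(ℝ, V) 𝓘(ℝ, W) F g := fun g => hF.mdifferentiableAt (by simp)
  have h1 := modelDeriv_comp (V₁ := V) (V₂ := V) (V₃ := W) (f := fun x : G => g * x * g⁻¹) (g := F)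
    (x := 1) (y := 1) (by simp) (hd 1) (mdifferentiableAt_conj (V := V) g 1) X
  have h2 := modelDeriv_comp (V₁ := V) (V₂ := W) (V₃ := W) (f := F) (g := fun x : H => F g * x * (F g)⁻¹)
    (x := 1) (y := 1) (by simp) (mdifferentiableAt_conj (V := W) (F g) 1) (hd 1) X
  have e : (fun x : G => F (g * x * g⁻¹)) = fun x => F g * F x * (F g)⁻¹ := by funext x; simp
  rw [e] at h1
  exact h1.symm.trans h2

end Hom

end

/-! ### One-parameter subgroups, exponentials and homomorphisms. -/

noncomputable section

open scoped Manifold ContDiff ENNReal Topology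
open VectorField Set Filter
variable {V : Type*} [NormedAddCommGroup V] [NormedSpace ℝ V] [CompleteSpace V]
  {G : Type*} [TopologicalSpace G] [ChartedSpace V G] [Group G] [LieGroup 𝓘(ℝ, V) ∞ G]
local notation "φ" => extChartAt 𝓘(ℝ, V) (1 : G)

/-- A topological group is Hausdorff once it is `T0`. Inseparable points lie in a common chart
domain, where the Hausdorff model space forces them to coincide. This applies to the extension `E`,
whose separation is not part of the data. -/
theorem t2Space_of_lieGroup (V : Type*) [NormedAddCommGroup V] [NormedSpace ℝ V]
    (G : Type*) [TopologicalSpace G] [ChartedSpace V G] [Group G] [LieGroup 𝓘(ℝ, V) ∞ G] :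
    T2Space G := by
  have := topologicalGroup_of_lieGroup 𝓘(ℝ, V) ∞ (G := G)
  have h1 : T0Space G := by
    rw [t0Space_iff_inseparable]
    intro x y hxy
    have hU := (chartAt V x).open_source
    have hx : x ∈ (chartAt V x).source := mem_chart_source V x
    have hy : y ∈ (chartAt V x).source := (hxy.mem_open_iff hU).1 hx
    have hi : Inseparable (chartAt V x x) (chartAt V x y) := by
      have h2 : ContinuousOn (chartAt V x) (chartAt V x).source := (chartAt V x).continuousOn
      rw [inseparable_iff_forall_isOpen]
      intro s hs
      have h3 := (hxy.mem_open_iff (h2.isOpen_inter_preimage hU hs))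
      simpa [hx, hy] using h3
    exact (chartAt V x).injOn hx hy hi.eq
  infer_instance

theorem HasLogDerivAt.hasDerivAt_chart_of_eq_one {c : ℝ → G} {X : V} {t : ℝ}
    (h : HasLogDerivAt c (X : LieAlg V G) t) (h1 : c t = 1) :
    HasDerivAt (fun s => φ (c s)) X t := by
  have h : HasMFDerivAt 𝓘(ℝ, ℝ) 𝓘(ℝ, V) c t
    ((1 : ℝ →L[ℝ] ℝ).smulRight (mulInvariantVectorField (I := 𝓘(ℝ, V)) (X : LieAlg V G) (c t))) := h
  have h2 : HasMFDerivAt 𝓘(ℝ, V) 𝓘(ℝ, V) φ (c t) (ContinuousLinearMap.id ℝ V) := by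
    rw [h1]; exact hasMFDerivAt_extChartAt_self (V := V) G 1
  have h3 := HasMFDerivAt.comp t h2 h
  have h4 : HasFDerivAt (fun s => φ (c s)) ((ContinuousLinearMap.id ℝ V).comp
      ((1 : ℝ →L[ℝ] ℝ).smulRight (mulInvariantVectorField (I := 𝓘(ℝ, V)) (X : LieAlg V G) (c t) : V))) t :=
    hasMFDerivAt_iff_hasFDerivAt.1 h3
  have h5 := HasFDerivAt.hasDerivAt h4
  have e : (mulInvariantVectorField (I := 𝓘(ℝ, V)) (X : LieAlg V G) (c t) : V) = X := by
    rw [h1]; exact mulInvariantVectorField_one (V := V) (X : LieAlg V G)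
  have h6 : ((ContinuousLinearMap.id ℝ V).comp
      ((1 : ℝ →L[ℝ] ℝ).smulRight (mulInvariantVectorField (I := 𝓘(ℝ, V)) (X : LieAlg V G) (c t) : V))) 1 = X := by
    change (1 : ℝ) • (mulInvariantVectorField (I := 𝓘(ℝ, V)) (X : LieAlg V G) (c t) : V) = X
    rw [one_smul]; exact e
  exact h6 ▸ h5

/-- Translating the curve to the identity and multiplying back inside the chart exhibits it as a
solution of an ordinary differential equation with smooth coefficients. This is the form used for
bootstrapping regularity. -/
theorem HasLogDerivAt.hasDerivAt_chart : ∀ᶠ g in 𝓝 (1 : G), ∀ (c : ℝ → G) (X : V) (t : ℝ), c t = g →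
    HasLogDerivAt c (X : LieAlg V G) t →
    HasDerivAt (fun s => φ (c s)) (fderiv ℝ (chartMul V G) (φ g, chartOne V G) (0, X)) t := by
  have := topologicalGroup_of_lieGroup 𝓘(ℝ, V) ∞ (G := G)
  have hd : ∀ᶠ p in 𝓝 (chartOne V G, chartOne V G), DifferentiableAt ℝ (chartMul V G) p := by
    have := (contDiffAt_chartMul (V := V) (G := G)).of_le (m := 1) (by simp)
    exact (this.eventually (by simp)).mono fun p hp => hp.differentiableAt (by simp)
  have hc : ContinuousAt (fun g : G => (φ g, chartOne V G)) 1 :=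
    (continuousAt_extChartAt (1 : G)).prodMk continuousAt_const
  filter_upwards [hc.eventually hd, extChartAt_source_mem_nhds (I := 𝓘(ℝ, V)) (1 : G)]
    with g hg hgs c X t hct hX
  have h1 := (HasLogDerivAt.const_mul (V := V) hX g⁻¹).hasDerivAt_chart_of_eq_one (by simp [hct])
  have e0 : φ (g⁻¹ * c t) = chartOne V G := by rw [hct, inv_mul_cancel]; rfl
  have h2 : HasDerivAt (fun s => ((φ g, φ (g⁻¹ * c s)) : V × V)) (0, X) t :=
    (hasDerivAt_const t _).prodMk h1
  have h3 := HasFDerivAt.comp_hasDerivAt t (f := fun s => ((φ g, φ (g⁻¹ * c s)) : V × V))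
    (l := chartMul V G) (by rw [e0]; exact hg.hasFDerivAt) h2
  refine (h3.congr_of_eventuallyEq ?_)
  have h4 : ∀ᶠ s in 𝓝 t, g⁻¹ * c s ∈ (φ).source := by
    have : ContinuousAt (fun s => g⁻¹ * c s) t := continuousAt_const.mul hX.continuousAt
    refine this.eventually_mem ?_
    rw [hct, inv_mul_cancel]
    exact extChartAt_source_mem_nhds 1
  filter_upwards [h4] with s hs
  simp only [Function.comp_apply, chartMul]
  rw [(φ).left_inv hgs, (φ).left_inv hs, mul_inv_cancel_left]

/-- Translation by `(c t)⁻¹` moves the base point to `1`, where the derivative is the bracket by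
`Ad_chart_deriv`; multiplicativity of `Ad` moves it back. -/
theorem HasLogDerivAt.hasDerivAt_Ad {c : ℝ → G} {X : V} {t : ℝ}
    (h : HasLogDerivAt c (X : LieAlg V G) t) (Y : V) :
    HasDerivAt (fun s => AdL (c s) Y) (AdL (c t) (bracketModel V G X Y)) t := by
  have h1 := h.const_mul (c t)⁻¹
  have e1 : (c t)⁻¹ * c t = 1 := inv_mul_cancel _
  have h2 := h1.hasDerivAt_chart_of_eq_one e1
  obtain ⟨K, hK, hKX⟩ := Ad_chart_deriv (V := V) (G := G) X Y
  have e0 : φ ((c t)⁻¹ * c t) = chartOne V G := by rw [inv_mul_cancel]; rfl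
  have h3 := HasFDerivAt.comp_hasDerivAt t (f := fun s => φ ((c t)⁻¹ * c s))
    (l := fun a => fderiv ℝ (chartConj V G) (a, chartOne V G) (0, Y)) (by rw [e0]; exact hK) h2
  rw [hKX] at h3
  have h4 : HasDerivAt (fun s => AdL ((c t)⁻¹ * c s) Y) (bracketModel V G X Y) t := by
    refine h3.congr_of_eventuallyEq ?_
    have hca := h1.continuousAt
    have hca : Tendsto (fun s => (c t)⁻¹ * c s) (𝓝 t) (𝓝 1) := by
      have := hca.tendsto
      simpa only [e1] using this
    filter_upwards [hca.eventually (Ad_eq_fderiv (V := V) (G := G))] with s hs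
    exact hs Y
  have h5 := (AdL (V := V) (c t)).hasFDerivAt.comp_hasDerivAt t h4
  refine h5.congr_of_eventuallyEq (Eventually.of_forall fun s => ?_)
  have := Ad_mul (V := V) (c t) ((c t)⁻¹ * c s) Y
  rw [mul_inv_cancel_left] at this
  exact this

/-- Left translates of one local integral curve through `1` are integral curves through every point
with the same lifetime, and a uniform lifetime implies completeness. -/
theorem exists_isOneParam (X : LieAlg V G) : ∃ c : ℝ → G, IsOneParam c X := by
  have := t2Space_of_lieGroup V G
  have hm : IsManifold 𝓘(ℝ, V) 1 G := inferInstance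
  obtain ⟨c, hc0, hc⟩ := exists_isMIntegralCurveAt_of_contMDiffAt_boundaryless 0
    (contMDiff_field X (1 : G))
  rw [isMIntegralCurveAt_iff'] at hc
  obtain ⟨ε, hε, hc⟩ := hc
  have h1 : ∀ g : G, ∃ γ : ℝ → G, γ 0 = g ∧ IsMIntegralCurveOn γ (mulInvariantVectorField X) (Ioo (-ε) ε) := by
    intro g
    refine ⟨fun s => g * c s, by simp [hc0], fun t ht => ?_⟩
    have h2 : Metric.ball (0 : ℝ) ε ∈ 𝓝 t := Metric.isOpen_ball.mem_nhds (by
      rw [mem_ball_zero_iff, Real.norm_eq_abs, abs_lt]; exact ht)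
    have h3 : HasLogDerivAt c X t := (hc t (mem_of_mem_nhds h2)).hasMFDerivAt h2
    exact HasMFDerivAt.hasMFDerivWithinAt (h3.const_mul g)
  obtain ⟨γ, hγ0, hγ⟩ := exists_isMIntegralCurve_of_isMIntegralCurveOn (contMDiff_field X) hε h1 1
  exact ⟨γ, hγ0, hγ⟩

section T2
variable [T2Space G]

theorem lieExp_zero_eq_one : lieExp (0 : LieAlg V G) = (1 : G) :=
  IsOneParam.lieExp_eq (c := fun _ => (1 : G)) ⟨rfl, isMIntegralCurve_const (map_zero _)⟩

theorem isOneParam_lieExp (X : LieAlg V G) : IsOneParam (fun t : ℝ => lieExp (t • X)) X := by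
  obtain ⟨c, hc⟩ := exists_isOneParam X
  have : (fun t : ℝ => lieExp (t • X)) = c := funext fun t => hc.lieExp_smul t
  rwa [this]

theorem hasLogDerivAt_lieExp (X : LieAlg V G) (t : ℝ) :
    HasLogDerivAt (fun t : ℝ => lieExp (t • X) : ℝ → G) X t := (isOneParam_lieExp X).curve t

theorem eq_of_hasLogDerivAt_zero {c : ℝ → G} (h : ∀ t, HasLogDerivAt c (0 : LieAlg V G) t)
    (s t : ℝ) :
    c s = c t := by
  have hm : IsManifold 𝓘(ℝ, V) 1 G := inferInstance
  have := isMIntegralCurve_Ioo_eq_of_contMDiff_boundaryless (t₀ := t) (contMDiff_field (0 : LieAlg V G))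
    h (γ' := fun _ => c t) (fun s => hasLogDerivAt_const (c t) s) rfl
  exact congrFun this s

/-- The curve `c d⁻¹` has logarithmic derivative zero, hence is constant. This uniqueness principle
replaces arguments with differential equations throughout. -/
theorem eq_of_hasLogDerivAt {c d : ℝ → G} {u : ℝ → LieAlg V G} (h : ∀ t, HasLogDerivAt c (u t) t)
    (h' : ∀ t, HasLogDerivAt d (u t) t) {t₀ : ℝ} (h0 : c t₀ = d t₀) : c = d := by
  funext s
  have h1 : ∀ t, HasLogDerivAt (fun s => c s * (d s)⁻¹) (0 : LieAlg V G) t := by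
    intro t
    have := (h t).mul (h' t).inv
    rwa [inv_inv, add_neg_cancel] at this
  have h2 := eq_of_hasLogDerivAt_zero h1 s t₀
  simp only [h0, mul_inv_cancel] at h2
  exact mul_inv_eq_one.1 h2

theorem hasLogDerivAt_of_hom {c : ℝ → G} {X : LieAlg V G} (hc : ∀ s t, c (s + t) = c s * c t)
    (h : HasLogDerivAt c X 0) (t : ℝ) : HasLogDerivAt c X t := by
  have h1 : HasLogDerivAt (fun s => c (s - t)) ((1 : ℝ) • X) t :=
    HasLogDerivAt.scomp (f := fun s => s - t) (by simpa using h) ((hasDerivAt_id t).sub_const t)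
  rw [one_smul] at h1
  refine (h1.const_mul (c t)).congr (Eventually.of_forall fun s => ?_)
  simp [← hc]

theorem lieExp_add_smul (X : LieAlg V G) (s t : ℝ) :
    (lieExp ((s + t) • X) : G) = lieExp (s • X) * lieExp (t • X) := by
  have h1 : ∀ r, HasLogDerivAt (fun r : ℝ => lieExp ((s + r) • X) : ℝ → G) X r := by
    intro r
    have := HasLogDerivAt.scomp (f := fun r => s + r) (hasLogDerivAt_lieExp (G := G) X (s + r))
      ((hasDerivAt_id r).const_add s)
    rwa [one_smul] at this
  have h2 : ∀ r, HasLogDerivAt (fun r : ℝ => lieExp (s • X) * lieExp (r • X) : ℝ → G) X r :=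
    fun r => (hasLogDerivAt_lieExp X r).const_mul _
  have := eq_of_hasLogDerivAt (u := fun _ => X) h1 h2 (t₀ := 0) (by simp [lieExp_zero_eq_one])
  exact congrFun this t

theorem lieExp_neg' (X : LieAlg V G) : (lieExp (-X) : G) = (lieExp X)⁻¹ := by
  refine eq_inv_of_mul_eq_one_left ?_
  have := lieExp_add_smul (G := G) X (-1) 1
  simpa [lieExp_zero_eq_one] using this.symm

section Hom
variable {W : Type*} [NormedAddCommGroup W] [NormedSpace ℝ W] [CompleteSpace W]
  {H : Type*} [TopologicalSpace H] [ChartedSpace W H] [Group H] [LieGroup 𝓘(ℝ, W) ∞ H] [T2Space H]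

theorem hom_lieExp {F : G →* H} (hF : ContMDiff 𝓘(ℝ, V) 𝓘(ℝ, W) ∞ F) (X : LieAlg V G) :
    F (lieExp X) = lieExp (lieMap F X : LieAlg W H) := by
  have h : IsOneParam (fun t : ℝ => F (lieExp (t • X))) (lieMap F X : LieAlg W H) :=
    isOneParam_of_hasLogDerivAt (by simp [lieExp_zero_eq_one])
      fun t => (hasLogDerivAt_lieExp X t).hom hF
  rw [h.lieExp_eq, one_smul]

/-- Both sides are derivatives at `s = 0` of the single curve `F_* (Ad (exp sX) Y) = Ad (F (exp sX))
(F_* Y)`. -/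
theorem lieMap_lie {F : G →* H} (hF : ContMDiff 𝓘(ℝ, V) 𝓘(ℝ, W) ∞ F) (X Y : LieAlg V G) :
    (lieMap F ⁅X, Y⁆ : LieAlg W H) = ⁅(lieMap F X : LieAlg W H), (lieMap F Y : LieAlg W H)⁆ := by
  have h1 := (hasLogDerivAt_lieExp (G := G) X 0).hasDerivAt_Ad Y
  have h2 := (modelDeriv V W F 1).hasFDerivAt.comp_hasDerivAt (0 : ℝ) h1
  have h3 := ((hasLogDerivAt_lieExp (G := G) X 0).hom hF).hasDerivAt_Ad (modelDeriv V W F 1 Y)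
  have h4 : (modelDeriv V W F 1) ∘ (fun s : ℝ => AdL (lieExp (s • X) : G) Y) =
      fun s : ℝ => AdL (F (lieExp (s • X))) (modelDeriv V W F 1 Y) := by
    funext s
    exact lieMap_Ad hF _ Y
  rw [h4] at h2
  have h5 := h2.unique h3
  have e : (lieExp ((0 : ℝ) • X) : G) = 1 := by rw [zero_smul, lieExp_zero_eq_one]
  rw [e, map_one] at h5
  have h6 := Ad_one (V := V) (G := G) (bracketModel V G X Y)
  have h7 := Ad_one (V := W) (G := H) (bracketModel W H (lieMap F X : LieAlg W H) (lieMap F Y : LieAlg W H))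
  exact (congrArg (modelDeriv V W F 1) h6).symm.trans (h5.trans h7)

end Hom

theorem contMDiff_conj (g : G) : ContMDiff 𝓘(ℝ, V) 𝓘(ℝ, V) ∞ (MulAut.conj g).toMonoidHom :=
  (contMDiff_mul_right (I := 𝓘(ℝ, V)) (n := ∞) (a := g⁻¹)).comp
    (contMDiff_mul_left (I := 𝓘(ℝ, V)) (n := ∞) (a := g))

theorem Ad_lie (g : G) (X Y : LieAlg V G) : Ad g ⁅X, Y⁆ = ⁅Ad g X, Ad g Y⁆ :=
  lieMap_lie (contMDiff_conj g) X Y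

theorem conj_lieExp (g : G) (X : LieAlg V G) : g * lieExp X * g⁻¹ = lieExp (Ad g X) :=
  hom_lieExp (contMDiff_conj g) X

theorem AdL_lieExp_of_bracket_eq_zero {X : LieAlg V G} {Y : V} (h : bracketModel V G X Y = 0)
    (t : ℝ) :
    AdL (lieExp (t • X) : G) Y = Y := by
  have h1 : ∀ t : ℝ, HasDerivAt (fun s : ℝ => AdL (lieExp (s • X) : G) Y) 0 t := by
    intro t
    have h1 := (hasLogDerivAt_lieExp (V := V) (G := G) X t).hasDerivAt_Ad Y
    rwa [h, map_zero] at h1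
  have h2 := is_const_of_deriv_eq_zero (fun t => (h1 t).differentiableAt) (fun t => (h1 t).deriv) t 0
  have h3 : AdL (lieExp ((0 : ℝ) • X) : G) Y = Y := by
    rw [zero_smul, lieExp_zero_eq_one]; exact Ad_one (V := V) (G := G) Y
  exact h2.trans h3

theorem Ad_lieExp_of_lie_eq_zero {X Y : LieAlg V G} (h : ⁅X, Y⁆ = 0) (t : ℝ) :
    Ad (lieExp (t • X) : G) Y = Y := AdL_lieExp_of_bracket_eq_zero (V := V) (G := G) h t

end T2

end

/-! ### Smoothness of one-parameter subgroups and coordinates of the second kind. -/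

noncomputable section

open scoped Manifold ContDiff ENNReal Topology
open VectorField Set Filter
variable {V : Type*} [NormedAddCommGroup V] [NormedSpace ℝ V] [CompleteSpace V]
  {G : Type*} [TopologicalSpace G] [ChartedSpace V G] [Group G] [LieGroup 𝓘(ℝ, V) ∞ G]
local notation "φ" => extChartAt 𝓘(ℝ, V) (1 : G)

/-- Bootstrapping: in the chart the curve solves an equation with smooth right-hand side, so being
`C^m` makes its derivative `C^m` and the curve `C^{m+1}`. -/
theorem contMDiffAt_of_hasLogDerivAt_of_eq_one {c : ℝ → G} {u : ℝ → V} (hu : ContDiff ℝ ∞ u)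
    (h : ∀ t, HasLogDerivAt c (u t : LieAlg V G) t) {t₀ : ℝ} (h1 : c t₀ = 1) :
    ContMDiffAt 𝓘(ℝ, ℝ) 𝓘(ℝ, V) ∞ c t₀ := by
  have hcc : Continuous c := continuous_iff_continuousAt.2 fun t => (h t).continuousAt
  have key : ContDiffAt ℝ ∞ (fun s => φ (c s)) t₀ := by
    rw [contDiffAt_infty]
    intro n
    -- A finite order is fixed first because only finite-order differentiability at a point
    -- propagates to a neighbourhood; the extra order pays for the derivative of the multiplication.
    have hm : ∀ᶠ p in 𝓝 (chartOne V G, chartOne V G), ContDiffAt ℝ ((n : WithTop ℕ∞) + 1) (chartMul V G) p := by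
      have := (contDiffAt_chartMul (V := V) (G := G)).of_le (m := (n : WithTop ℕ∞) + 1) (by
        exact_mod_cast (le_top : ((n + 1 : ℕ) : ℕ∞) ≤ ⊤))
      exact this.eventually (by exact_mod_cast WithTop.coe_ne_top)
    have hc : ContinuousAt (fun g : G => (φ g, chartOne V G)) 1 :=
      (continuousAt_extChartAt (1 : G)).prodMk continuousAt_const
    have hev : ∀ᶠ s in 𝓝 t₀, ContDiffAt ℝ ((n : WithTop ℕ∞) + 1) (chartMul V G) (φ (c s), chartOne V G) ∧
        HasDerivAt (fun s => φ (c s)) (fderiv ℝ (chartMul V G) (φ (c s), chartOne V G) (0, u s)) s := by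
      have hcc' : Tendsto c (𝓝 t₀) (𝓝 1) := h1 ▸ hcc.tendsto t₀
      filter_upwards [hcc'.eventually (hc.eventually hm),
        hcc'.eventually (HasLogDerivAt.hasDerivAt_chart (V := V) (G := G))] with s hs1 hs2
      exact ⟨hs1, hs2 c (u s) s rfl (h s)⟩
    obtain ⟨J, hJ, hJo, htJ⟩ := eventually_nhds_iff.1 hev
    have ind : ∀ m : ℕ, m ≤ n + 1 → ContDiffOn ℝ m (fun s => φ (c s)) J := by
      intro m
      induction m with
      | zero =>
        intro _
        exact contDiffOn_zero.2 fun s hs => ((hJ s hs).2.continuousAt).continuousWithinAt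
      | succ m ih =>
        intro hmn
        push_cast
        rw [contDiffOn_succ_iff_deriv_of_isOpen hJo]
        refine ⟨fun s hs => (hJ s hs).2.differentiableAt.differentiableWithinAt,
          fun h => absurd h (by exact_mod_cast WithTop.coe_ne_top), ?_⟩
        have h2 : ContDiffOn ℝ m (fun s => fderiv ℝ (chartMul V G) (φ (c s), chartOne V G) (0, u s)) J := by
          intro s hs
          have h3 : ContDiffWithinAt ℝ m (fun s => φ (c s)) J s := ih (by omega) s hs
          have h4 : ContDiffAt ℝ m (fderiv ℝ (chartMul V G)) (φ (c s), chartOne V G) :=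
            (hJ s hs).1.fderiv_right (by
              gcongr; exact_mod_cast (show m ≤ n by omega))
          have h5 : ContDiffWithinAt ℝ m (fun s => fderiv ℝ (chartMul V G) (φ (c s), chartOne V G)) J s :=
            h4.comp_contDiffWithinAt (f := fun s => (φ (c s), chartOne V G)) s (h3.prodMk contDiffWithinAt_const)
          exact h5.clm_apply (contDiffWithinAt_const.prodMk
            ((hu.of_le (by exact_mod_cast le_top)).contDiffAt.contDiffWithinAt))
        exact h2.congr fun s hs => (hJ s hs).2.deriv
    exact ((ind n (by omega)).contDiffAt (hJo.mem_nhds htJ))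
  have hsrc : ∀ᶠ s in 𝓝 t₀, c s ∈ (φ).source := by
    refine hcc.continuousAt.eventually_mem ?_
    rw [h1]; exact extChartAt_source_mem_nhds 1
  have h3 : ContMDiffAt 𝓘(ℝ, ℝ) 𝓘(ℝ, V) ∞ (fun s => (φ).symm (φ (c s))) t₀ := by
    refine ContMDiffAt.comp t₀ (g := (φ).symm) (f := fun s => φ (c s)) ?_ key.contMDiffAt
    rw [h1]; exact contMDiffAt_chart_symm
  exact h3.congr_of_eventuallyEq (hsrc.mono fun s hs => ((φ).left_inv hs).symm)

theorem contMDiff_of_hasLogDerivAt {c : ℝ → G} {u : ℝ → V} (hu : ContDiff ℝ ∞ u)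
    (h : ∀ t, HasLogDerivAt c (u t : LieAlg V G) t) : ContMDiff 𝓘(ℝ, ℝ) 𝓘(ℝ, V) ∞ c := by
  intro t₀
  have h1 := contMDiffAt_of_hasLogDerivAt_of_eq_one (V := V) hu
    (fun t => HasLogDerivAt.const_mul (V := V) (h t) (c t₀)⁻¹) (t₀ := t₀) (by simp)
  have h2 := (contMDiff_mul_left (I := 𝓘(ℝ, V)) (n := ∞) (a := c t₀)).contMDiffAt.comp t₀ h1
  exact h2.congr_of_eventuallyEq (Eventually.of_forall fun s => by simp)

theorem contMDiff_lieExp_smul [T2Space G] (X : LieAlg V G) :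
    ContMDiff 𝓘(ℝ, ℝ) 𝓘(ℝ, V) ∞ (fun t : ℝ => lieExp (t • X) : ℝ → G) :=
  contMDiff_of_hasLogDerivAt (V := V) (u := fun _ => X) contDiff_const fun t => hasLogDerivAt_lieExp X t

theorem continuous_lieExp_smul [T2Space G] (X : LieAlg V G) :
    Continuous (fun t : ℝ => lieExp (t • X) : ℝ → G) := (contMDiff_lieExp_smul X).continuous

/-- The product of one-parameter subgroups `exp (x₁ e₁) ⋯ exp (xₙ eₙ)`: coordinates of the second
kind if `e` is a basis. -/
def coordProd {n : ℕ} (e : Fin n → LieAlg V G) (x : Fin n → ℝ) : G :=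
  (List.ofFn fun i => (lieExp (x i • e i) : G)).prod

theorem coordProd_succ {n : ℕ} (e : Fin (n + 1) → LieAlg V G) (x : Fin (n + 1) → ℝ) :
    coordProd e x = lieExp (x 0 • e 0) * coordProd (fun i => e i.succ) (fun i => x i.succ) := by
  simp [coordProd, List.ofFn_succ]

section T2
variable [T2Space G]

theorem contMDiff_coordProd {n : ℕ} (e : Fin n → LieAlg V G) :
    ContMDiff 𝓘(ℝ, Fin n → ℝ) 𝓘(ℝ, V) ∞ (coordProd e : (Fin n → ℝ) → G) := by
  induction n with
  | zero =>
    have : (coordProd e : (Fin 0 → ℝ) → G) = fun _ => 1 := by funext x; simp [coordProd]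
    rw [this]; exact contMDiff_const
  | succ n ih =>
    have h1 : ContMDiff 𝓘(ℝ, Fin (n + 1) → ℝ) 𝓘(ℝ, V) ∞ (fun x => lieExp (x 0 • e 0) : (Fin (n + 1) → ℝ) → G) :=
      (contMDiff_lieExp_smul (e 0)).comp (contDiff_apply ℝ ℝ (0 : Fin (n + 1))).contMDiff
    have h2 : ContMDiff 𝓘(ℝ, Fin (n + 1) → ℝ) 𝓘(ℝ, V) ∞
        (fun x => coordProd (fun i => e i.succ) (fun i => x i.succ) : (Fin (n + 1) → ℝ) → G) :=
      (ih fun i => e i.succ).comp (contDiff_pi.2 fun i => contDiff_apply ℝ ℝ (Fin.succ i)).contMDiff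
    refine (h1.mul h2).congr fun x => coordProd_succ e x

theorem coordProd_single {n : ℕ} (e : Fin n → LieAlg V G) (i : Fin n) (t : ℝ) :
    (coordProd e (Pi.single i t) : G) = lieExp (t • e i) := by
  induction n with
  | zero => exact i.elim0
  | succ n ih =>
    rw [coordProd_succ]
    have hz : ∀ {n : ℕ} (e : Fin n → LieAlg V G), (coordProd e (fun _ => 0) : G) = 1 := by
      intro n e
      have : (fun i : Fin n => (lieExp ((0 : ℝ) • e i) : G)) = fun _ => 1 := by
        funext i; rw [zero_smul, lieExp_zero_eq_one]
      rw [coordProd, this]; simp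
    cases i using Fin.cases with
    | zero =>
      have : (fun i : Fin n => (Pi.single (M := fun _ => ℝ) (0 : Fin (n+1)) t) i.succ) = fun _ => 0 := by
        funext i; simp [Fin.succ_ne_zero]
      rw [this, hz, mul_one, Pi.single_eq_same]
    | succ i =>
      have : (fun k : Fin n => (Pi.single (M := fun _ => ℝ) i.succ t) k.succ) = Pi.single i t := by
        funext k; simp [Pi.single_apply]
      rw [this, ih, Pi.single_eq_of_ne (Fin.succ_ne_zero i).symm, zero_smul, lieExp_zero_eq_one, one_mul]

theorem coordProd_zero {n : ℕ} (e : Fin n → LieAlg V G) : (coordProd e 0 : G) = 1 := by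
  have : (fun i : Fin n => (lieExp ((0 : Fin n → ℝ) i • e i) : G)) = fun _ => 1 := by
    funext i; rw [Pi.zero_apply, zero_smul, lieExp_zero_eq_one]
  rw [coordProd, this]; simp

theorem modelDeriv_coordProd {n : ℕ} (e : Fin n → LieAlg V G) (i : Fin n) :
    modelDeriv (Fin n → ℝ) V (coordProd e : (Fin n → ℝ) → G) 0 (Pi.single i 1) = (e i : V) := by
  have h1 := modelDeriv_comp (V₁ := ℝ) (V₂ := Fin n → ℝ) (V₃ := V) (f := fun t : ℝ => (Pi.single i t : Fin n → ℝ))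
    (g := (coordProd e : (Fin n → ℝ) → G)) (x := 0) (y := 0) (by simp)
    ((contMDiff_coordProd e).mdifferentiableAt (by simp))
    ((ContinuousLinearMap.single ℝ (fun _ : Fin n => ℝ) i).differentiable 0).mdifferentiableAt 1
  have h2 : modelDeriv ℝ (Fin n → ℝ) (fun t : ℝ => (Pi.single i t : Fin n → ℝ)) 0 = ContinuousLinearMap.single ℝ (fun _ : Fin n => ℝ) i := by
    have := (ContinuousLinearMap.single ℝ (fun _ : Fin n => ℝ) i).hasFDerivAt (x := (0 : ℝ))
    exact this.hasMFDerivAt.mfderiv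
  rw [h2] at h1
  refine Eq.trans h1.symm ?_
  have h3 : (fun z : ℝ => (coordProd e (Pi.single i z) : G)) = fun t => lieExp (t • e i) := funext fun t => coordProd_single e i t
  rw [h3]
  have h4 := hasLogDerivAt_lieExp (G := G) (e i) 0
  have h5 := DFunLike.congr_fun (HasMFDerivAt.mfderiv h4) (1 : ℝ)
  refine Eq.trans h5 ?_
  refine Eq.trans (one_smul ℝ (mulInvariantVectorField (e i) (lieExp ((0 : ℝ) • e i) : G) : V)) ?_
  have : (lieExp ((0 : ℝ) • e i) : G) = 1 := by rw [zero_smul, lieExp_zero_eq_one]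
  rw [this]
  exact mulInvariantVectorField_one (e i)

/-- The inverse function theorem, followed by multiplication with a bump function. The cut-off makes
the inverse smooth on all of `G`, so compositions with arbitrary curves need no domain conditions.
-/
theorem exists_smooth_localInverse [FiniteDimensional ℝ V] {P : Type*} [NormedAddCommGroup P]
    [NormedSpace ℝ P] [FiniteDimensional ℝ P]
    {Θ : P → G} (hΘ : ContMDiff 𝓘(ℝ, P) 𝓘(ℝ, V) ∞ Θ) (h0 : Θ 0 = 1)
    (hb : Function.Bijective (modelDeriv P V Θ 0)) :
    ∃ κ : G → P, ContMDiff 𝓘(ℝ, V) 𝓘(ℝ, P) ∞ κ ∧ (∀ᶠ g in 𝓝 1, Θ (κ g) = g) ∧ ∀ᶠ x in 𝓝 0, κ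
    (Θ x) = x := by
  have : CompleteSpace P := FiniteDimensional.complete ℝ P
  set θ : P → V := fun x => φ (Θ x) with hθ
  have hcd : ∀ᶠ x in 𝓝 (0 : P), ContDiffAt ℝ ∞ θ x ∧ Θ x ∈ (φ).source := by
    have h1 : ∀ᶠ x in 𝓝 (0 : P), Θ x ∈ (φ).source := by
      refine hΘ.continuous.continuousAt.eventually_mem ?_
      rw [h0]; exact extChartAt_source_mem_nhds 1
    filter_upwards [h1] with x hx
    refine ⟨?_, hx⟩
    rw [← contMDiffAt_iff_contDiffAt]
    exact (contMDiffAt_extChartAt' (n := ∞) ((extChartAt_source 𝓘(ℝ, V) (1 : G)) ▸ hx)).comp x hΘ.contMDiffAt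
  let f' : P ≃L[ℝ] V := (LinearEquiv.ofBijective (modelDeriv P V Θ 0 : P →ₗ[ℝ] V) hb).toContinuousLinearEquiv
  have hf' : HasFDerivAt θ (f' : P →L[ℝ] V) 0 := by
    have h2 : HasMFDerivAt 𝓘(ℝ, V) 𝓘(ℝ, V) φ (Θ 0) (ContinuousLinearMap.id ℝ V) := by
      rw [h0]; exact hasMFDerivAt_extChartAt_self (V := V) G 1
    have h3 := HasMFDerivAt.comp 0 h2 ((hΘ.mdifferentiableAt (by simp)).hasMFDerivAt (x := 0))
    exact hasMFDerivAt_iff_hasFDerivAt.1 h3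
  have hθ0 := hcd.self_of_nhds.1
  set F := hθ0.toOpenPartialHomeomorph θ hf' (by simp) with hF
  have hFc : ∀ x, F x = θ x := fun x => rfl
  have h0s : (0 : P) ∈ F.source := hθ0.mem_toOpenPartialHomeomorph_source hf' (by simp)
  -- Invertibility of the derivative persists near `0`, which makes the inverse smooth on a
  -- neighbourhood and not only at one point.
  have hequiv : ∀ᶠ x in 𝓝 (0 : P), ∃ e : P ≃L[ℝ] V, HasFDerivAt θ (e : P →L[ℝ] V) x := by
    have h1 : ContinuousAt (fderiv ℝ θ) 0 := (hθ0.fderiv_right (m := 0) (by simp)).continuousAt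
    have h2 := ContinuousLinearEquiv.nhds f'
    rw [← hf'.fderiv] at h2
    filter_upwards [h1.eventually_mem h2, hcd] with x ⟨e, he⟩ hx
    exact ⟨e, he ▸ (hx.1.differentiableAt (by simp)).hasFDerivAt⟩
  have hθ00 : θ 0 = φ 1 := by simp [hθ, h0]
  have hs0 : F.symm (φ 1) = 0 := by rw [← hθ00, ← hFc]; exact F.left_inv h0s
  have ht0 : φ 1 ∈ F.target := by rw [← hθ00, ← hFc]; exact F.map_source h0s
  have hsc : ContinuousAt F.symm (φ (1 : G)) := F.symm.continuousAt ht0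
  have hev : ∀ᶠ v in 𝓝 (φ 1), ContDiffAt ℝ ∞ F.symm v ∧ v ∈ F.target := by
    have h1 : Tendsto F.symm (𝓝 (φ 1)) (𝓝 0) := hs0 ▸ hsc.tendsto
    filter_upwards [h1.eventually hequiv, h1.eventually hcd, F.open_target.mem_nhds ht0] with v ⟨e, he⟩ hv1 hv2
    exact ⟨F.contDiffAt_symm hv2 he hv1.1, hv2⟩
  set κ₀ : G → P := fun g => F.symm (φ g) with hκ₀
  have hφc : ContinuousAt φ (1 : G) := continuousAt_extChartAt (1 : G)
  have hgood : ∀ᶠ g in 𝓝 (1 : G), ContMDiffAt 𝓘(ℝ, V) 𝓘(ℝ, P) ∞ κ₀ g ∧ Θ (κ₀ g) = g := by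
    have h1 : Tendsto κ₀ (𝓝 1) (𝓝 0) := by
      have := ContinuousAt.tendsto (ContinuousAt.comp (g := F.symm) (f := φ) (x := (1 : G)) hsc hφc)
      rw [Function.comp_apply, hs0] at this
      exact this
    filter_upwards [hφc.eventually hev, extChartAt_source_mem_nhds (I := 𝓘(ℝ, V)) (1 : G), h1.eventually hcd] with g hg hgs hg2
    refine ⟨ContMDiffAt.comp g (g := F.symm) hg.1.contMDiffAt
      (contMDiffAt_extChartAt' (n := ∞) ((extChartAt_source 𝓘(ℝ, V) (1 : G)) ▸ hgs)), ?_⟩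
    refine (φ).injOn hg2.2 hgs ?_
    exact F.right_inv hg.2
  obtain ⟨β, -, hβ⟩ := (SmoothBumpFunction.nhds_basis_tsupport (I := 𝓘(ℝ, V)) (1 : G)).mem_iff.1 hgood
  refine ⟨fun g => β g • κ₀ g, ?_, ?_, ?_⟩
  · refine contMDiff_of_tsupport fun g hg => ?_
    have hg' : g ∈ tsupport β := tsupport_smul_subset_left _ _ hg
    exact β.contMDiff.contMDiffAt.smul (hβ hg').1
  · filter_upwards [hgood, β.eventuallyEq_one] with g hg hg1
    rw [hg1, Pi.one_apply, one_smul, hg.2]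
  · have h1 : Tendsto Θ (𝓝 0) (𝓝 1) := h0 ▸ hΘ.continuous.tendsto 0
    filter_upwards [h1.eventually β.eventuallyEq_one, F.open_source.mem_nhds h0s] with x hx hxs
    rw [hx, Pi.one_apply, one_smul]
    exact F.left_inv hxs

end T2

end

/-! ### Factorization of loops in a simply connected group. -/

noncomputable section

open scoped Manifold ContDiff ENNReal Topology
open VectorField Set Filter
variable {V : Type*} [NormedAddCommGroup V] [NormedSpace ℝ V] [CompleteSpace V]
  {G : Type*} [TopologicalSpace G] [ChartedSpace V G] [Group G] [LieGroup 𝓘(ℝ, V) ∞ G]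
local notation "φ" => extChartAt 𝓘(ℝ, V) (1 : G)

theorem contMDiff_Ad (Y : V) : ContMDiff 𝓘(ℝ, V) 𝓘(ℝ, V) ∞ (fun g : G => AdL g Y) := by
  have := topologicalGroup_of_lieGroup 𝓘(ℝ, V) ∞ (G := G)
  have h1 : ContMDiffAt 𝓘(ℝ, V) 𝓘(ℝ, V) ∞ (fun g : G => AdL g Y) 1 := by
    have h2 : ContDiffAt ℝ ∞ (fun a : V => fderiv ℝ (chartConj V G) (a, chartOne V G) (0, Y)) (chartOne V G) := by
      have h3 : ContDiffAt ℝ ∞ (fderiv ℝ (chartConj V G)) (chartOne V G, chartOne V G) :=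
        (contDiffAt_chartConj (V := V) (G := G)).fderiv_right (by simp)
      have h4 : ContDiffAt ℝ ∞ (fun a : V => fderiv ℝ (chartConj V G) (a, chartOne V G)) (chartOne V G) :=
        ContDiffAt.comp (chartOne V G) (f := fun a : V => (a, chartOne V G)) h3 (by fun_prop)
      exact h4.clm_apply contDiffAt_const
    have h3 : ContMDiffAt 𝓘(ℝ, V) 𝓘(ℝ, V) ∞ (fun g : G => fderiv ℝ (chartConj V G) (φ g, chartOne V G) (0, Y)) 1 :=
      ContMDiffAt.comp (1 : G) (g := fun a : V => fderiv ℝ (chartConj V G) (a, chartOne V G) (0, Y))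
        h2.contMDiffAt contMDiffAt_extChartAt
    exact h3.congr_of_eventuallyEq ((Ad_eq_fderiv (V := V) (G := G)).mono fun g hg => hg Y)
  intro g₀
  have h2 : ContMDiffAt 𝓘(ℝ, V) 𝓘(ℝ, V) ∞ (fun g : G => AdL (g₀⁻¹ * g) Y) g₀ := by
    refine ContMDiffAt.comp g₀ (g := fun g : G => AdL g Y) (f := fun g => g₀⁻¹ * g) ?_ contMDiff_mul_left.contMDiffAt
    rwa [inv_mul_cancel]
  have h3 := (AdL (V := V) g₀).contDiff.contMDiff.contMDiffAt.comp g₀ h2 (n := ∞)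
  refine h3.congr_of_eventuallyEq (Eventually.of_forall fun g => ?_)
  have := Ad_mul (V := V) g₀ (g₀⁻¹ * g) Y
  rw [mul_inv_cancel_left] at this
  exact this

/-- The left logarithmic derivative of a `C^{n+1}` curve is `C^n`. -/
theorem contDiff_of_hasLogDerivAt {n : WithTop ℕ∞} (hn : n + 1 ≤ (∞ : WithTop ℕ∞)) {c : ℝ → G}
    {u : ℝ → V}
    (hc : ContMDiff 𝓘(ℝ, ℝ) 𝓘(ℝ, V) (n + 1) c)
    (h : ∀ t, HasLogDerivAt c (u t : LieAlg V G) t) : ContDiff ℝ n u := by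
  have := topologicalGroup_of_lieGroup 𝓘(ℝ, V) ∞ (G := G)
  have : LieGroup 𝓘(ℝ, V) (n + 1) G := LieGroup.of_le hn
  rw [contDiff_iff_contDiffAt]
  intro t₀
  -- This two-variable function has the regularity of `c`, and the logarithmic derivative is its
  -- first partial derivative on the diagonal; this costs exactly one order.
  set F : ℝ × ℝ → V := fun p => φ ((c p.2)⁻¹ * c p.1) with hF
  have hFc : ∀ t, ContDiffAt ℝ (n + 1) F (t, t) := by
    intro t
    rw [← contMDiffAt_iff_contDiffAt]
    have h1 : ContMDiffAt 𝓘(ℝ, ℝ × ℝ) 𝓘(ℝ, V) (n + 1) (fun p : ℝ × ℝ => c p.1) (t, t) :=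
      ContMDiffAt.comp _ hc.contMDiffAt contDiffAt_fst.contMDiffAt
    have h2 : ContMDiffAt 𝓘(ℝ, ℝ × ℝ) 𝓘(ℝ, V) (n + 1) (fun p : ℝ × ℝ => c p.2) (t, t) :=
      ContMDiffAt.comp _ hc.contMDiffAt contDiffAt_snd.contMDiffAt
    refine ContMDiffAt.comp _ (g := φ) ?_ (h2.inv.mul h1)
    simp only [inv_mul_cancel]
    exact (contMDiffAt_extChartAt (n := ∞)).of_le hn
  have h2 : ∀ t, u t = fderiv ℝ F (t, t) (1, 0) := by
    intro t
    have h3 := (HasLogDerivAt.const_mul (V := V) (h t) (c t)⁻¹).hasDerivAt_chart_of_eq_one (inv_mul_cancel _)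
    have h4 : HasDerivAt (fun s => F (s, t)) (fderiv ℝ F (t, t) (1, 0)) t :=
      HasFDerivAt.comp_hasDerivAt t (f := fun s : ℝ => (s, t))
        ((hFc t).differentiableAt (by simp)).hasFDerivAt
        ((hasDerivAt_id t).prodMk (hasDerivAt_const t t))
    exact h3.unique h4
  have h3 : u = fun t => fderiv ℝ F (t, t) (1, 0) := funext h2
  rw [h3]
  have h4 : ContDiffAt ℝ n (fun t : ℝ => fderiv ℝ F (t, t)) t₀ :=
    ContDiffAt.comp t₀ (f := fun t : ℝ => (t, t)) ((hFc t₀).fderiv_right le_rfl) (by fun_prop)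
  exact h4.clm_apply contDiffAt_const

section Factorization
variable [T2Space G]

/-- The curves `s ↦ ∏ exp (f_k(s) X_k)` with smooth `f_k` vanishing at `0` and `1`. -/
def IsFactored (V : Type*) [NormedAddCommGroup V] [NormedSpace ℝ V] [CompleteSpace V]
    [ChartedSpace V G] [LieGroup 𝓘(ℝ, V) ∞ G] (l : List ((ℝ → ℝ) × LieAlg V G)) : Prop :=
  ∀ p ∈ l, ContDiff ℝ ∞ p.1 ∧ p.1 0 = 0 ∧ p.1 1 = 0

/-- The curve `s ↦ ∏ exp (f_k(s) X_k)`. -/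
def expProd (l : List ((ℝ → ℝ) × LieAlg V G)) (s : ℝ) : G :=
  (l.map fun p => (lieExp (p.1 s • p.2) : G)).prod

theorem expProd_append (l l' : List ((ℝ → ℝ) × LieAlg V G)) (s : ℝ) :
    (expProd (l ++ l') s : G) = expProd l s * expProd l' s := by simp [expProd]

theorem expProd_cons (p : (ℝ → ℝ) × LieAlg V G) (l : List ((ℝ → ℝ) × LieAlg V G)) (s : ℝ) :
    (expProd (p :: l) s : G) = lieExp (p.1 s • p.2) * expProd l s := by simp [expProd]

theorem contMDiff_expProd {l : List ((ℝ → ℝ) × LieAlg V G)} (h : ∀ p ∈ l, ContDiff ℝ ∞ p.1) :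
    ContMDiff 𝓘(ℝ, ℝ) 𝓘(ℝ, V) ∞ (expProd l : ℝ → G) := by
  induction l with
  | nil => exact (contMDiff_const (c := (1 : G))).congr fun s => by simp [expProd]
  | cons p l ih =>
    refine (((contMDiff_lieExp_smul p.2).comp (h p (by simp)).contMDiff).mul
      (ih fun q hq => h q (by simp [hq]))).congr fun s => expProd_cons p l s

theorem expProd_eq_one {l : List ((ℝ → ℝ) × LieAlg V G)} {s : ℝ} (h : ∀ p ∈ l, p.1 s = 0) :
    (expProd l s : G) = 1 := by
  induction l with
  | nil => simp [expProd]
  | cons p l ih =>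
    rw [expProd_cons, h p (by simp), zero_smul, lieExp_zero_eq_one, one_mul,
      ih fun q hq => h q (by simp [hq])]

/-- `γ` can be approximated by factored curves, uniformly on `[0, 1]`. -/
def IsApproxFactored (V : Type*) [NormedAddCommGroup V] [NormedSpace ℝ V] [CompleteSpace V]
    [ChartedSpace V G] [LieGroup 𝓘(ℝ, V) ∞ G] (γ : ℝ → G) : Prop :=
  ∀ U ∈ 𝓝 (1 : G), ∃ l : List ((ℝ → ℝ) × LieAlg V G), IsFactored V l ∧
    ∀ s ∈ Icc (0 : ℝ) 1, (expProd l s)⁻¹ * γ s ∈ U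

theorem coordProd_eq_expProd {n : ℕ} (e : Fin n → LieAlg V G) (y : ℝ → Fin n → ℝ) (s : ℝ) :
    (coordProd e (y s) : G) = expProd (List.ofFn fun i => ((fun r => y r i), e i)) s := by
  simp [coordProd, expProd, List.map_ofFn, Function.comp_def]

theorem isFactored_ofFn {n : ℕ} (e : Fin n → LieAlg V G) {y : ℝ → Fin n → ℝ} (hy : ContDiff ℝ ∞ y)
    (h0 : y 0 = 0) (h1 : y 1 = 0) :
    IsFactored (G := G) V (List.ofFn fun i => ((fun r => y r i), e i)) := by
  intro p hp
  obtain ⟨i, rfl⟩ := List.mem_ofFn.1 hp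
  exact ⟨contDiff_pi.1 hy i, by simp [h0], by simp [h1]⟩

/-- The error of the first factor gets conjugated by the approximant of the second. That approximant
is therefore chosen first; compactness of `[0, 1]` bounds the effect of the conjugation. -/
theorem IsApproxFactored.mul {γ δ : ℝ → G} (h : IsApproxFactored V γ) (h' : IsApproxFactored V δ) :
    IsApproxFactored V (fun s => γ s * δ s) := by
  have := topologicalGroup_of_lieGroup 𝓘(ℝ, V) ∞ (G := G)
  intro U hU
  obtain ⟨U₁, hU₁, hUU⟩ := exists_nhds_one_split hU
  obtain ⟨l₂, hl₂, hd⟩ := h' U₁ hU₁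
  have hc : Continuous (expProd l₂ : ℝ → G) := (contMDiff_expProd fun p hp => (hl₂ p hp).1).continuous
  have h2 : ∀ᶠ g in 𝓝 (1 : G), ∀ s ∈ Icc (0 : ℝ) 1, (expProd l₂ s)⁻¹ * g * expProd l₂ s ∈ U₁ := by
    refine isCompact_Icc.eventually_forall_of_forall_eventually fun s _ => ?_
    have : Continuous fun p : G × ℝ => (expProd l₂ p.2)⁻¹ * p.1 * expProd l₂ p.2 := by fun_prop
    refine this.continuousAt.eventually_mem ?_
    simpa using hU₁
  obtain ⟨l₁, hl₁, hg⟩ := h _ h2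
  refine ⟨l₁ ++ l₂, fun p hp => (List.mem_append.1 hp).elim (hl₁ p) (hl₂ p), fun s hs => ?_⟩
  have := hUU _ (hg s hs s hs) _ (hd s hs)
  rw [expProd_append]
  convert! this using 1
  group

theorem bijective_modelDeriv_coordProd {n : ℕ} (b : Module.Basis (Fin n) ℝ V)
    {e : Fin n → LieAlg V G}
    (he : ∀ i, (e i : V) = b i) :
    Function.Bijective (modelDeriv (Fin n → ℝ) V (coordProd e : (Fin n → ℝ) → G) 0) := by
  have h1 : (modelDeriv (Fin n → ℝ) V (coordProd e : (Fin n → ℝ) → G) 0 : (Fin n → ℝ) →ₗ[ℝ] V)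
      = b.equivFun.symm := by
    refine (Pi.basisFun ℝ (Fin n)).ext fun i => ?_
    rw [Pi.basisFun_apply]
    refine (modelDeriv_coordProd e i).trans ?_
    rw [he, LinearEquiv.coe_coe, b.equivFun_symm_apply]
    simp [Pi.single_apply]
  have h2 := b.equivFun.symm.bijective
  have h3 : ⇑(modelDeriv (Fin n → ℝ) V (coordProd e : (Fin n → ℝ) → G) 0) = b.equivFun.symm :=
    congrArg DFunLike.coe h1
  rwa [h3]

theorem exists_coordinates_of_basis [FiniteDimensional ℝ V] {n : ℕ} (b : Module.Basis (Fin n) ℝ V)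
    {e : Fin n → LieAlg V G}
    (he : ∀ i, (e i : V) = b i) : ∃ (κ : G → Fin n → ℝ),
    ContMDiff 𝓘(ℝ, V) 𝓘(ℝ, Fin n → ℝ) ∞ κ ∧ (∀ᶠ g in 𝓝 1, coordProd e (κ g) = g) ∧
      ∀ᶠ x in 𝓝 0, κ (coordProd e x) = x :=
  exists_smooth_localInverse (contMDiff_coordProd e) (coordProd_zero e)
    (bijective_modelDeriv_coordProd b he)

theorem exists_coordinates (V G : Type*) [NormedAddCommGroup V] [NormedSpace ℝ V] [CompleteSpace V]
    [TopologicalSpace G] [ChartedSpace V G] [Group G] [LieGroup 𝓘(ℝ, V) ∞ G] [T2Space G]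
    [FiniteDimensional ℝ V] : ∃ (n : ℕ) (e : Fin n → LieAlg V G) (κ : G → Fin n → ℝ),
    ContMDiff 𝓘(ℝ, V) 𝓘(ℝ, Fin n → ℝ) ∞ κ ∧ (∀ᶠ g in 𝓝 1, coordProd e (κ g) = g) ∧ κ 1 = 0 := by
  obtain ⟨κ, h1, h2, h3⟩ := exists_coordinates_of_basis (G := G) (e := fun i => Module.finBasis ℝ V i)
    (Module.finBasis ℝ V) (fun i => rfl)
  refine ⟨_, _, κ, h1, h2, ?_⟩
  exact (congrArg κ (coordProd_zero _)).symm.trans h3.self_of_nhds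

/-- Near `1`, coordinates of the second kind turn the loop into a curve in `ℝⁿ`, where the
Weierstrass theorem supplies polynomial approximations of the coordinate functions. -/
theorem exists_isApproxFactored_nhds (V : Type*) [NormedAddCommGroup V] [NormedSpace ℝ V]
    [CompleteSpace V]
    [ChartedSpace V G] [LieGroup 𝓘(ℝ, V) ∞ G] [FiniteDimensional ℝ V] : ∃ U ∈ 𝓝 (1 : G), ∀ γ :
    ℝ → G,
    Continuous γ → γ 0 = 1 → γ 1 = 1 → (∀ s ∈ Icc (0 : ℝ) 1, γ s ∈ U) → IsApproxFactored V γ := by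
  have := topologicalGroup_of_lieGroup 𝓘(ℝ, V) ∞ (G := G)
  obtain ⟨n, e, κ, hκ, hκ1, hκ0⟩ := exists_coordinates V G
  refine ⟨_, hκ1, fun γ hγ h0 h1 hU W hW => ?_⟩
  set y : ℝ → Fin n → ℝ := fun s => κ (γ s) with hy
  have hyc : Continuous y := hκ.continuous.comp hγ
  have hΨ : Continuous (coordProd e : (Fin n → ℝ) → G) := (contMDiff_coordProd e).continuous
  have h2 : ∀ᶠ a in 𝓝 (0 : Fin n → ℝ), ∀ s ∈ Icc (0 : ℝ) 1,
      (coordProd e (y s + a))⁻¹ * coordProd e (y s) ∈ W := by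
    refine isCompact_Icc.eventually_forall_of_forall_eventually fun s _ => ?_
    have : Continuous fun p : (Fin n → ℝ) × ℝ => (coordProd e (y p.2 + p.1))⁻¹ * (coordProd e (y p.2) : G) := by fun_prop
    refine this.continuousAt.eventually_mem ?_
    simpa using hW
  obtain ⟨ε, hε, hball⟩ := Metric.eventually_nhds_iff.1 h2
  have h3 : ∀ i, ∃ p : Polynomial ℝ, ∀ s ∈ Icc (0 : ℝ) 1, |p.eval s - y s i| < ε / 3 := fun i =>
    exists_polynomial_near_of_continuousOn 0 1 _ ((continuous_apply i).comp hyc).continuousOn _ (by positivity)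
  choose p hp using h3
  -- Subtracting the linear interpolation of the end values makes `q` vanish at `0` and `1`. Each of
  -- the two corrections is at most `ε / 3`, like the approximation error.
  set q : ℝ → Fin n → ℝ := fun s i => (p i).eval s - (p i).eval 0 * (1 - s) - (p i).eval 1 * s with hq
  have hqc : ContDiff ℝ ∞ q := by
    refine contDiff_pi.2 fun i => ?_
    have : ContDiff ℝ ∞ fun s => (p i).eval s := by
      simpa using (p i).contDiff_aeval (𝕜 := ℝ) ∞
    simp only [hq]
    fun_prop
  refine ⟨_, isFactored_ofFn e hqc (by ext i; simp [hq]) (by ext i; simp [hq]), fun s hs => ?_⟩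
  rw [← coordProd_eq_expProd]
  have h4 := hball (y := q s - y s) (by
    rw [dist_zero_right, pi_norm_lt_iff hε]
    intro i
    have a1 := hp i s hs
    have a2 := hp i 0 (by simp)
    have a3 := hp i 1 (by simp)
    have b2 : y 0 i = 0 := by simp [hy, h0, hκ0]
    have b3 : y 1 i = 0 := by simp [hy, h1, hκ0]
    rw [b2, sub_zero] at a2
    rw [b3, sub_zero] at a3
    have c2 : |(p i).eval 0 * (1 - s)| ≤ ε / 3 := by
      rw [abs_mul, abs_of_nonneg (a := 1 - s) (by linarith [hs.2])]
      nlinarith [abs_nonneg ((p i).eval 0), hs.1, hs.2]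
    have c3 : |(p i).eval 1 * s| ≤ ε / 3 := by
      rw [abs_mul, abs_of_nonneg (a := s) hs.1]
      nlinarith [abs_nonneg ((p i).eval 1), hs.1, hs.2]
    simp only [hq, Pi.sub_apply, Real.norm_eq_abs]
    rw [abs_lt] at a1 ⊢
    rw [abs_le] at c2 c3
    constructor <;> linarith [a1.1, a1.2, c2.1, c2.2, c3.1, c3.2]) s hs
  rw [add_sub_cancel] at h4
  have h5 : coordProd e (y s) = γ s := hU s hs
  rwa [h5] at h4

/-- After an approximation good enough, the remaining quotient is a smooth loop inside the
coordinate neighbourhood, so its coordinate functions supply the missing factors exactly. -/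
theorem IsApproxFactored.exists_eqOn [FiniteDimensional ℝ V] {γ : ℝ → G} (h : IsApproxFactored V γ)
    (hγ : ContMDiff 𝓘(ℝ, ℝ) 𝓘(ℝ, V) ∞ γ) (h0 : γ 0 = 1) (h1 : γ 1 = 1) :
    ∃ l : List ((ℝ → ℝ) × LieAlg V G), IsFactored V l ∧ EqOn γ (expProd l) (Icc 0 1) := by
  obtain ⟨n, e, κ, hκ, hκ1, hκ0⟩ := exists_coordinates V G
  obtain ⟨l, hl, hU⟩ := h _ hκ1
  set y : ℝ → Fin n → ℝ := fun s => κ ((expProd l s)⁻¹ * γ s) with hy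
  have hyc : ContDiff ℝ ∞ y := by
    rw [← contMDiff_iff_contDiff]
    exact hκ.comp ((contMDiff_expProd fun p hp => (hl p hp).1).inv.mul hγ)
  refine ⟨l ++ List.ofFn fun i => ((fun r => y r i), e i), fun p hp => (List.mem_append.1 hp).elim (hl p)
    (isFactored_ofFn e hyc ?_ ?_ p), fun s hs => ?_⟩
  · simp only [hy]; rw [expProd_eq_one fun p hp => (hl p hp).2.1, h0]; simpa using hκ0
  · simp only [hy]; rw [expProd_eq_one fun p hp => (hl p hp).2.2, h1]; simpa using hκ0
  · rw [expProd_append, ← coordProd_eq_expProd]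
    have : coordProd e (y s) = (expProd l s)⁻¹ * γ s := hU s hs
    rw [this, mul_inv_cancel_left]

/-- In a simply connected Lie group, a smooth loop based at `1` is a product of loops in
one-parameter subgroups. -/
theorem exists_factorization [FiniteDimensional ℝ V] [SimplyConnectedSpace G] {γ : ℝ → G}
    (hγ : ContMDiff 𝓘(ℝ, ℝ) 𝓘(ℝ, V) ∞ γ) (h0 : γ 0 = 1) (h1 : γ 1 = 1) :
    ∃ l : List ((ℝ → ℝ) × LieAlg V G), IsFactored V l ∧ EqOn γ (expProd l) (Icc 0 1) := by
  have := topologicalGroup_of_lieGroup 𝓘(ℝ, V) ∞ (G := G)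
  refine IsApproxFactored.exists_eqOn ?_ hγ h0 h1
  obtain ⟨U, hU, hgood⟩ := exists_isApproxFactored_nhds (G := G) V
  let p : Path (1 : G) 1 := ⟨⟨fun s => γ s, hγ.continuous.comp continuous_subtype_val⟩, by simpa using h0, by simpa using h1⟩
  obtain ⟨F⟩ := SimplyConnectedSpace.paths_homotopic (Path.refl (1 : G)) p
  set H : unitInterval → ℝ → G := fun t s => F (t, projIcc 0 1 zero_le_one s) with hH
  have hHc : Continuous fun q : unitInterval × ℝ => H q.1 q.2 := by
    simp only [hH]
    exact F.continuous.comp (continuous_fst.prodMk (continuous_projIcc.comp continuous_snd))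
  have hH0 : ∀ t, H t 0 = 1 := fun t => by
    simp only [hH, projIcc_left]
    exact F.source t
  have hH1 : ∀ t, H t 1 = 1 := fun t => by
    simp only [hH, projIcc_right]
    exact F.target t
  have hstep : ∀ t t', (∀ s ∈ Icc (0 : ℝ) 1, (H t s)⁻¹ * H t' s ∈ U) → IsApproxFactored V (H t) →
      IsApproxFactored V (H t') := by
    intro t t' hs ht
    have h2 := hgood (fun s => (H t s)⁻¹ * H t' s) (by fun_prop) (by simp [hH0]) (by simp [hH1]) hs
    have h3 := ht.mul h2
    simpa only [mul_inv_cancel_left] using h3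
  -- Neighbouring stages of the null-homotopy differ by a loop close to `1`, which can be
  -- approximated. Hence approximability is locally constant along the homotopy and passes from the
  -- constant loop to `γ`.
  have hlc : IsLocallyConstant fun t => IsApproxFactored V (H t) := by
    rw [IsLocallyConstant.iff_eventually_eq]
    intro t₀
    have h2 : ∀ᶠ t in 𝓝 t₀, ∀ s ∈ Icc (0 : ℝ) 1, (H t₀ s)⁻¹ * H t s ∈ U ∧ (H t s)⁻¹ * H t₀ s ∈ U := by
      refine isCompact_Icc.eventually_forall_of_forall_eventually fun s _ => ?_
      have c1 : Continuous fun p : unitInterval × ℝ => (H t₀ p.2)⁻¹ * H p.1 p.2 := by fun_prop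
      have c2 : Continuous fun p : unitInterval × ℝ => (H p.1 p.2)⁻¹ * H t₀ p.2 := by fun_prop
      exact (c1.continuousAt.eventually_mem (by simpa using hU)).and
        (c2.continuousAt.eventually_mem (by simpa using hU))
    filter_upwards [h2] with t ht
    exact propext ⟨hstep t t₀ fun s hs => (ht s hs).2, hstep t₀ t fun s hs => (ht s hs).1⟩
  have h3 : IsApproxFactored V (H 0) := by
    intro W hW
    refine ⟨[], by simp [IsFactored], fun s hs => ?_⟩
    have : H 0 s = 1 := by simp [hH]
    rw [this]
    simpa [expProd] using mem_of_mem_nhds hW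
  have h4 : IsApproxFactored V (H 1) := by
    rwa [← hlc.apply_eq_of_preconnectedSpace 0 1]
  intro W hW
  obtain ⟨l, hl, hl2⟩ := h4 W hW
  refine ⟨l, hl, fun s hs => ?_⟩
  have h5 : H 1 s = γ s := by
    simp only [hH]
    rw [F.apply_one, projIcc_of_mem _ hs]
    rfl
  rw [← h5]
  exact hl2 s hs

end Factorization

end

/-! ### Adapted coordinates, invariant forms and the Lie algebra of a maximal torus. -/

noncomputable section

open scoped Manifold ContDiff ENNReal Topology
open VectorField Set Filter
variable {V : Type*} [NormedAddCommGroup V] [NormedSpace ℝ V] [CompleteSpace V]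
  {G : Type*} [TopologicalSpace G] [ChartedSpace V G] [Group G] [LieGroup 𝓘(ℝ, V) ∞ G]

instance finiteDimensional_lieAlg [FiniteDimensional ℝ V] : FiniteDimensional ℝ (LieAlg V G) :=
  inferInstanceAs (FiniteDimensional ℝ V)

theorem modelDeriv_coordProd_apply [T2Space G] {n : ℕ} (e : Fin n → LieAlg V G) (w : Fin n → ℝ) :
    modelDeriv (Fin n → ℝ) V (coordProd e : (Fin n → ℝ) → G) 0 w =
    ((∑ i, w i • e i : LieAlg V G) : V) := by
  conv_lhs => rw [← Finset.univ_sum_single w, map_sum]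
  refine Finset.sum_congr rfl fun i _ => ?_
  have : (Pi.single i (w i) : Fin n → ℝ) = w i • Pi.single i 1 := by
    rw [← Pi.single_smul, smul_eq_mul, mul_one]
  rw [this, map_smul, modelDeriv_coordProd]
  rfl

theorem coordProd_append {r m : ℕ} (e : Fin r → LieAlg V G) (f : Fin m → LieAlg V G)
    (y : Fin r → ℝ) (z : Fin m → ℝ) :
    (coordProd (Fin.append e f) (Fin.append y z) : G) = coordProd e y * coordProd f z := by
  have : (fun i => (lieExp (Fin.append y z i • Fin.append e f i) : G)) =
      Fin.append (fun i => lieExp (y i • e i)) (fun i => lieExp (z i • f i)) := by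
    funext i
    refine Fin.addCases (fun i => ?_) (fun i => ?_) i <;> simp
  rw [coordProd, this, List.ofFn_fin_append, List.prod_append]
  rfl

/-- Coordinates of the second kind adapted to a subspace `S` of the Lie algebra. -/
structure AdaptedCoord (S : Submodule ℝ (LieAlg V G)) (r m : ℕ) where
  e : Fin r → LieAlg V G
  f : Fin m → LieAlg V G
  κ : G → Fin (r + m) → ℝ
  mem : ∀ i, e i ∈ S
  span : ∀ x ∈ S, ∃ y : Fin r → ℝ, x = ∑ i, y i • e i
  indep : ∀ y : Fin r → ℝ, ∑ i, y i • e i = 0 → y = 0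
  compl : ∀ z : Fin m → ℝ, ∑ i, z i • f i ∈ S → z = 0
  sup : ∀ x : LieAlg V G, ∃ (y : Fin r → ℝ) (z : Fin m → ℝ), x = ∑ i, y i • e i + ∑ i, z i • f i
  smooth : ContMDiff 𝓘(ℝ, V) 𝓘(ℝ, Fin (r + m) → ℝ) ∞ κ
  right_inv : ∀ᶠ g in 𝓝 (1 : G), coordProd (Fin.append e f) (κ g) = g
  left_inv : ∀ᶠ x in 𝓝 (0 : Fin (r + m) → ℝ), κ (coordProd (Fin.append e f) x) = x

theorem exists_adaptedCoord [T2Space G] [FiniteDimensional ℝ V] (S : Submodule ℝ (LieAlg V G)) :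
    ∃ r m, r = Module.finrank ℝ S ∧ r + m = Module.finrank ℝ V ∧ Nonempty (AdaptedCoord S r m) := by
  obtain ⟨S', hS⟩ := S.exists_isCompl
  let b₁ := Module.finBasis ℝ S
  let b₂ := Module.finBasis ℝ S'
  let b : Module.Basis (Fin _) ℝ (LieAlg V G) := ((b₁.prod b₂).map (Submodule.prodEquivOfIsCompl S S' hS)).reindex finSumFinEquiv
  let e : Fin _ → LieAlg V G := fun i => b₁ i
  let f : Fin _ → LieAlg V G := fun i => b₂ i
  have hb : ∀ i, Fin.append e f i = b i := by
    intro i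
    refine Fin.addCases (fun i => ?_) (fun i => ?_) i
    · simp [b, e, Submodule.coe_prodEquivOfIsCompl']
    · simp [b, f, Submodule.coe_prodEquivOfIsCompl']
  let b' : Module.Basis (Fin _) ℝ V := b
  obtain ⟨κ, h1, h2, h3⟩ := exists_coordinates_of_basis (G := G) (V := V) b' (e := Fin.append e f) hb
  have hsum : Module.finrank ℝ S + Module.finrank ℝ S' = Module.finrank ℝ V :=
    Submodule.finrank_add_eq_of_isCompl hS
  refine ⟨_, _, rfl, hsum, ⟨⟨e, f, κ, fun i => (b₁ i).2, ?_, ?_, ?_, ?_, h1, h2, h3⟩⟩⟩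
  · intro x hx
    refine ⟨b₁.equivFun ⟨x, hx⟩, ?_⟩
    have := congrArg S.subtype (b₁.sum_equivFun ⟨x, hx⟩)
    rw [map_sum] at this
    exact this.symm
  · intro y hy
    have : ∑ i, y i • b₁ i = 0 := Subtype.ext (by simpa [e] using hy)
    exact funext fun i => Fintype.linearIndependent_iff.1 b₁.linearIndependent y this i
  · intro z hz
    have h4 : ((∑ i, z i • b₂ i : S') : LieAlg V G) ∈ S := by simpa [f] using hz
    have h5 : ((∑ i, z i • b₂ i : S') : LieAlg V G) = 0 :=
      (Submodule.disjoint_def.1 hS.disjoint) _ h4 (Subtype.mem _)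
    exact funext fun i => Fintype.linearIndependent_iff.1 b₂.linearIndependent z (Subtype.ext h5) i
  · intro x
    refine ⟨fun i => b.equivFun x (Fin.castAdd _ i), fun i => b.equivFun x (Fin.natAdd _ i), ?_⟩
    conv_lhs => rw [← b.sum_equivFun x]
    rw [Fin.sum_univ_add]
    congr 1
    · refine Finset.sum_congr rfl fun i _ => ?_
      rw [← hb]; simp
    · refine Finset.sum_congr rfl fun i _ => ?_
      rw [← hb]; simp

section T2
variable [T2Space G]

/-- By coordinates of the second kind the generated subgroup contains a neighbourhood of `1`; it is
then open and closed in the connected group. -/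
theorem closure_range_lieExp [FiniteDimensional ℝ V] [ConnectedSpace G] :
    Subgroup.closure (Set.range fun X : LieAlg V G => (lieExp X : G)) = ⊤ := by
  have := topologicalGroup_of_lieGroup 𝓘(ℝ, V) ∞ (G := G)
  set K := Subgroup.closure (Set.range fun X : LieAlg V G => (lieExp X : G)) with hK
  obtain ⟨n, e, κ, hκ, hκ1, hκ0⟩ := exists_coordinates V G
  have h1 : (K : Set G) ∈ 𝓝 (1 : G) := by
    filter_upwards [hκ1] with g hg
    rw [← hg, coordProd]
    refine Subgroup.list_prod_mem _ fun x hx => ?_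
    obtain ⟨i, rfl⟩ := List.mem_ofFn.1 hx
    exact Subgroup.subset_closure ⟨_, rfl⟩
  have h2 : IsOpen (K : Set G) := K.isOpen_of_mem_nhds h1
  have h3 : IsClopen (K : Set G) := ⟨K.isClosed_of_isOpen h2, h2⟩
  exact SetLike.coe_injective (h3.eq_univ ⟨1, K.one_mem⟩)

/-- Along `exp (sZ)` the derivative of `B (Ad X) (Ad Y)` is zero by infinitesimal invariance.
Exponentials generate the connected group. -/
theorem Ad_invariant [FiniteDimensional ℝ V] [ConnectedSpace G]
    (B : LinearMap.BilinForm ℝ (LieAlg V G))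
    (hB : ∀ x y z, B ⁅x, y⁆ z = B x ⁅y, z⁆) (g : G) (X Y : LieAlg V G) :
    B (Ad g X) (Ad g Y) = B X Y := by
  have hg : g ∈ Subgroup.closure (Set.range fun X : LieAlg V G => (lieExp X : G)) := by
    rw [closure_range_lieExp]; trivial
  induction hg using Subgroup.closure_induction generalizing X Y with
  | mem x hx =>
    obtain ⟨Z, rfl⟩ := hx
    let B' : V →L[ℝ] V →L[ℝ] ℝ := LinearMap.toContinuousLinearMap
      ((LinearMap.toContinuousLinearMap : (V →ₗ[ℝ] ℝ) ≃ₗ[ℝ] V →L[ℝ] ℝ).toLinearMap ∘ₗ (B : V →ₗ[ℝ] V →ₗ[ℝ] ℝ))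
    have hB' : ∀ a b : LieAlg V G, B' a b = B a b := fun a b => rfl
    have hd : ∀ t : ℝ, HasDerivAt (fun s : ℝ => B' (AdL (lieExp (s • Z) : G) X) (AdL (lieExp (s • Z) : G) Y)) 0 t := by
      intro t
      have h1 := (hasLogDerivAt_lieExp (G := G) Z t).hasDerivAt_Ad X
      have h2 := (hasLogDerivAt_lieExp (G := G) Z t).hasDerivAt_Ad Y
      have h3 := B'.hasFDerivAt.comp_hasDerivAt t h1
      have h4 := h3.clm_apply h2
      have e : B' (AdL (lieExp (t • Z) : G) (bracketModel V G Z X)) (AdL (lieExp (t • Z) : G) Y)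
          + B' (AdL (lieExp (t • Z) : G) X) (AdL (lieExp (t • Z) : G) (bracketModel V G Z Y)) = 0 := by
        have e1 : AdL (lieExp (t • Z) : G) (bracketModel V G Z X) = (⁅Ad (lieExp (t • Z) : G) Z, Ad (lieExp (t • Z) : G) X⁆ : LieAlg V G) :=
          Ad_lie _ Z X
        have e2 : AdL (lieExp (t • Z) : G) (bracketModel V G Z Y) = (⁅Ad (lieExp (t • Z) : G) Z, Ad (lieExp (t • Z) : G) Y⁆ : LieAlg V G) :=
          Ad_lie _ Z Y
        rw [e1, e2]
        change B ⁅Ad (lieExp (t • Z) : G) Z, Ad (lieExp (t • Z) : G) X⁆ (Ad (lieExp (t • Z) : G) Y)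
          + B (Ad (lieExp (t • Z) : G) X) ⁅Ad (lieExp (t • Z) : G) Z, Ad (lieExp (t • Z) : G) Y⁆ = 0
        rw [← hB, ← lie_skew (Ad (lieExp (t • Z) : G) X), map_neg, LinearMap.neg_apply, add_neg_cancel]
      exact h4.congr_deriv (by simpa using e)
    have h2 := is_const_of_deriv_eq_zero (fun t => (hd t).differentiableAt) (fun t => (hd t).deriv) 1 0
    have h3 : B (Ad (lieExp ((1 : ℝ) • Z) : G) X) (Ad (lieExp ((1 : ℝ) • Z) : G) Y)
      = B (Ad (lieExp ((0 : ℝ) • Z) : G) X) (Ad (lieExp ((0 : ℝ) • Z) : G) Y) := h2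
    rwa [one_smul, zero_smul, lieExp_zero_eq_one, Ad_one, Ad_one] at h3
  | one => rw [Ad_one, Ad_one]
  | mul a b _ _ ha hb => rw [Ad_mul, Ad_mul, ha, hb]
  | inv a _ ha => rw [← ha, Ad_Ad_inv, Ad_Ad_inv]

end T2

namespace MaximalTorus
variable [T2Space G] [IsTopologicalGroup G] (T : MaximalTorus G)

theorem mem_lieAlgebra_iff {x : LieAlg V G} : x ∈ T.lieAlgebra V ↔ ∀ t :
    ℝ, lieExp (t • x) ∈ T.toSubgroup := by
  constructor
  · rintro ⟨c, hc, hcT⟩ t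
    rw [hc.lieExp_smul]; exact hcT t
  · intro h
    exact ⟨_, isOneParam_lieExp x, h⟩

theorem lieExp_mem {x : LieAlg V G} (hx : x ∈ T.lieAlgebra V) : lieExp x ∈ T.toSubgroup := by
  simpa using T.mem_lieAlgebra_iff.1 hx 1

theorem Ad_eq_of_mem {a : G} (ha : a ∈ T.toSubgroup) {x : LieAlg V G} (hx : x ∈ T.lieAlgebra V) :
    Ad a x = x := by
  have h1 := (hasLogDerivAt_lieExp (G := G) x 0).hom (contMDiff_conj a)
  have h2 : HasLogDerivAt (fun s : ℝ => (lieExp (s • x) : G)) (Ad a x) 0 := by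
    refine h1.congr (Eventually.of_forall fun s => ?_)
    have := T.comm a ha _ (T.mem_lieAlgebra_iff.1 hx s)
    simp [this]
  exact h2.unique (hasLogDerivAt_lieExp x 0)

/-- The closure of the group generated by `T` and `exp (ℝ v)` is closed, connected and commutative.
Maximality makes it equal to `T`. -/
theorem mem_lieAlgebra_of_Ad {v : LieAlg V G} (hv : ∀ a ∈ T.toSubgroup, Ad a v = v) :
    v ∈ T.lieAlgebra V := by
  have hcomm : ∀ a ∈ T.toSubgroup, ∀ t : ℝ, a * lieExp (t • v) = lieExp (t • v) * a := by
    intro a ha t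
    have := conj_lieExp a (t • v)
    rw [Ad_smul, hv a ha] at this
    exact mul_inv_eq_iff_eq_mul.1 this
  have hcomm' : ∀ s t : ℝ, (lieExp (s • v) : G) * lieExp (t • v) = lieExp (t • v) * lieExp (s • v) := by
    intro s t
    rw [← lieExp_add_smul, ← lieExp_add_smul, add_comm]
  let S₀ : Subgroup G :=
    { carrier := {g | ∃ a ∈ T.toSubgroup, ∃ t : ℝ, a * lieExp (t • v) = g}
      mul_mem' := by
        rintro _ _ ⟨a, ha, s, rfl⟩ ⟨b, hb, t, rfl⟩
        refine ⟨a * b, mul_mem ha hb, s + t, ?_⟩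
        rw [lieExp_add_smul, mul_assoc, mul_assoc, ← mul_assoc b, ← mul_assoc _ b, hcomm b hb s]
      one_mem' := ⟨1, one_mem _, 0, by rw [zero_smul, lieExp_zero_eq_one, one_mul]⟩
      inv_mem' := by
        rintro _ ⟨a, ha, s, rfl⟩
        refine ⟨a⁻¹, inv_mem ha, -s, ?_⟩
        rw [hcomm _ (inv_mem ha), mul_inv_rev, neg_smul, lieExp_neg'] }
  have hS₀ : ∀ a ∈ S₀, ∀ b ∈ S₀, a * b = b * a := by
    rintro _ ⟨a, ha, s, rfl⟩ _ ⟨b, hb, t, rfl⟩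
    calc a * lieExp (s • v) * (b * lieExp (t • v)) = a * (lieExp (s • v) * b) * lieExp (t • v) := by group
      _ = a * b * (lieExp (s • v) * lieExp (t • v)) := by rw [← hcomm b hb s]; group
      _ = b * (a * lieExp (t • v)) * lieExp (s • v) := by rw [T.comm a ha b hb, hcomm']; group
      _ = b * lieExp (t • v) * (a * lieExp (s • v)) := by rw [hcomm a ha t]; group
  have hconn : IsConnected (S₀ : Set G) := by
    have h1 : IsConnected ((T.toSubgroup : Set G) ×ˢ (Set.univ : Set ℝ)) := T.isConnected.prod isConnected_univ
    have h2 := h1.image (fun p : G × ℝ => p.1 * lieExp (p.2 • v))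
      (continuous_fst.mul ((continuous_lieExp_smul v).comp continuous_snd)).continuousOn
    convert h2 using 1
    ext g
    constructor
    · rintro ⟨a, ha, t, rfl⟩; exact ⟨(a, t), ⟨ha, trivial⟩, rfl⟩
    · rintro ⟨⟨a, t⟩, ⟨ha, -⟩, rfl⟩; exact ⟨a, ha, t, rfl⟩
  have hTS : T.toSubgroup ≤ S₀ := fun a ha => ⟨a, ha, 0, by rw [zero_smul, lieExp_zero_eq_one, mul_one]⟩
  have hS : S₀.topologicalClosure = T.toSubgroup := by
    refine T.maximal _ S₀.isClosed_topologicalClosure ?_ ?_ (hTS.trans S₀.le_topologicalClosure)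
    · exact hconn.closure
    · intro a ha b hb
      have h1 : ∀ a ∈ S₀, ∀ b ∈ closure (S₀ : Set G), a * b = b * a := by
        intro a ha b hb
        have : IsClosed {b | a * b = b * a} := isClosed_eq (by fun_prop) (by fun_prop)
        exact closure_minimal (fun b hb => hS₀ a ha b hb) this hb
      have : IsClosed {a | a * b = b * a} := isClosed_eq (by fun_prop) (by fun_prop)
      exact closure_minimal (fun a ha => h1 a ha b hb) this ha
  rw [mem_lieAlgebra_iff]
  intro t
  rw [← hS]
  exact S₀.le_topologicalClosure ⟨1, one_mem _, t, one_mul _⟩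

/-- Conjugation by `a ∈ T` fixes the curve pointwise, hence fixes its logarithmic derivative, and
`mem_lieAlgebra_of_Ad` applies. -/
theorem mem_lieAlgebra_of_hasLogDerivAt {c : ℝ → G} {u : LieAlg V G} {t : ℝ}
    (hc : ∀ s, c s ∈ T.toSubgroup) (h : HasLogDerivAt c u t) : u ∈ T.lieAlgebra V := by
  refine T.mem_lieAlgebra_of_Ad fun a ha => ?_
  have h1 := h.hom (contMDiff_conj a)
  have h2 : HasLogDerivAt c (Ad a u) t := by
    refine h1.congr (Eventually.of_forall fun s => ?_)
    have := T.comm a ha _ (hc s)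
    simp [this]
  exact h2.unique h

theorem lie_eq_zero {x y : LieAlg V G} (hx : x ∈ T.lieAlgebra V) (hy : y ∈ T.lieAlgebra V) :
    ⁅x, y⁆ = 0 := by
  have h1 := (hasLogDerivAt_lieExp (G := G) x 0).hasDerivAt_Ad y
  have h2 : HasDerivAt (F := V) (fun s : ℝ => AdL (V := V) (lieExp (s • x) : G) y) 0 (0 : ℝ) := by
    have : (fun s : ℝ => (AdL (V := V) (lieExp (s • x) : G) y : V)) = fun _ => (y : V) := by
      funext s
      exact T.Ad_eq_of_mem (T.mem_lieAlgebra_iff.1 hx s) hy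
    rw [this]
    exact hasDerivAt_const _ _
  have h3 := h1.unique h2
  have h4 : AdL (V := V) (lieExp ((0 : ℝ) • x) : G) (bracketModel V G x y) = bracketModel V G x y := by
    rw [zero_smul, lieExp_zero_eq_one]; exact Ad_one (V := V) (G := G) _
  exact h4.symm.trans h3

end MaximalTorus

end

/-! ### The exponential map of the torus and closed paths in it. -/

noncomputable section

open scoped Manifold ContDiff ENNReal Topology
open VectorField Set Filter
variable {V : Type*} [NormedAddCommGroup V] [NormedSpace ℝ V] [CompleteSpace V]
  {G : Type*} [TopologicalSpace G] [ChartedSpace V G] [Group G] [LieGroup 𝓘(ℝ, V) ∞ G]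

theorem AdaptedCoord.exists_proj [FiniteDimensional ℝ V] {S : Submodule ℝ (LieAlg V G)} {r m : ℕ}
    (A : AdaptedCoord S r m) : ∃ p : V →L[ℝ] (Fin r → ℝ), (∀ x ∈ S, x = ∑ i, p x i • A.e i) ∧
      ∀ y : Fin r → ℝ, p ((∑ i, y i • A.e i : LieAlg V G) : V) = y := by
  have hinj : LinearMap.ker (Fintype.linearCombination ℝ A.e) = ⊥ := by
    rw [LinearMap.ker_eq_bot']
    intro y hy
    exact A.indep y hy
  obtain ⟨p, hp⟩ := LinearMap.exists_leftInverse_of_injective _ hinj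
  have hp' : ∀ y : Fin r → ℝ, p (∑ i, y i • A.e i) = y := fun y => LinearMap.congr_fun hp y
  refine ⟨LinearMap.toContinuousLinearMap (E := V) p, fun x hx => ?_, hp'⟩
  obtain ⟨y, rfl⟩ := A.span x hx
  have := hp' y
  change _ = ∑ i, p (∑ i, y i • A.e i) i • A.e i
  rw [this]

theorem AdaptedCoord.κ_one [T2Space G] {S : Submodule ℝ (LieAlg V G)} {r m : ℕ}
    (A : AdaptedCoord S r m) : A.κ 1 = 0 :=
  (congrArg A.κ (coordProd_zero _)).symm.trans A.left_inv.self_of_nhds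

theorem tendsto_append_zero {r m : ℕ} :
    Tendsto (fun p : (Fin r → ℝ) × (Fin m → ℝ) => Fin.append p.1 p.2) (𝓝 (0, 0)) (𝓝 0) := by
  have h : Continuous fun p : (Fin r → ℝ) × (Fin m → ℝ) => Fin.append p.1 p.2 := by
    refine continuous_pi fun i => ?_
    refine Fin.addCases (fun i => ?_) (fun i => ?_) i <;> simp <;> fun_prop
  have := h.tendsto (0, 0)
  convert! this using 2
  ext i
  refine Fin.addCases (fun i => ?_) (fun i => ?_) i <;> simp

namespace MaximalTorus
variable [T2Space G] [IsTopologicalGroup G] (T : MaximalTorus G)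

theorem coordProd_mem {n : ℕ} {e : Fin n → LieAlg V G} (he : ∀ i, e i ∈ T.lieAlgebra V)
    (y : Fin n → ℝ) :
    coordProd e y ∈ T.toSubgroup := by
  refine Subgroup.list_prod_mem _ fun x hx => ?_
  obtain ⟨i, rfl⟩ := List.mem_ofFn.1 hx
  exact T.mem_lieAlgebra_iff.1 (he i) _

theorem lieExp_sum {n : ℕ} {e : Fin n → LieAlg V G} (he : ∀ i, e i ∈ T.lieAlgebra V)
    (y : Fin n → ℝ) :
    lieExp (∑ i, y i • e i) = coordProd e y := by
  induction n with
  | zero => simp only [Finset.univ_eq_empty, Finset.sum_empty]; rw [lieExp_zero_eq_one]; simp [coordProd]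
  | succ n ih =>
    rw [Fin.sum_univ_succ, T.lieExp_add (Submodule.smul_mem _ _ (he 0))
      (Submodule.sum_mem _ fun i _ => Submodule.smul_mem _ _ (he _)), coordProd_succ,
      ih (e := fun i => e i.succ) fun i => he i.succ]

theorem hasLogDerivAt_coordProd {n : ℕ} {e : Fin n → LieAlg V G} (he : ∀ i, e i ∈ T.lieAlgebra V)
    {y : ℝ → Fin n → ℝ} {y' : Fin n → ℝ} {t : ℝ} (hy : HasDerivAt y y' t) :
    HasLogDerivAt (fun s => coordProd e (y s)) (∑ i, y' i • e i) t := by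
  induction n with
  | zero =>
    simp only [Finset.univ_eq_empty, Finset.sum_empty]
    exact (hasLogDerivAt_const 1 t).congr (Eventually.of_forall fun s => by simp [coordProd])
  | succ n ih =>
    have h0 := hasDerivAt_pi.1 hy
    have h1 := HasLogDerivAt.scomp (f := fun s => y s 0) (hasLogDerivAt_lieExp (G := G) (e 0) (y t 0)) (h0 0)
    have h2 := ih (e := fun i => e i.succ) (fun i => he i.succ) (y := fun s i => y s i.succ)
      (y' := fun i => y' i.succ) (hasDerivAt_pi.2 fun i => h0 i.succ)
    have h3 := h1.mul h2
    rw [T.Ad_eq_of_mem (inv_mem (T.coordProd_mem (fun i => he (Fin.succ i)) _)) (Submodule.smul_mem _ _ (he 0)),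
      ← Fin.sum_univ_succ (fun i => y' i • e i)] at h3
    exact h3.congr (Eventually.of_forall fun s => coordProd_succ _ _)

variable [FiniteDimensional ℝ V]

/-- On the commutative algebra `𝔱` the exponential is a product of one-parameter subgroups along a
basis, so it can be differentiated factor by factor. -/
theorem hasLogDerivAt_lieExp_of_mem {U : ℝ → V} {U' : V} {t : ℝ} (hU : ∀ s, U s ∈ T.lieAlgebra V)
    (h : HasDerivAt U U' t) :
    HasLogDerivAt (fun s => lieExp (U s : LieAlg V G) : ℝ → G) (U' : LieAlg V G) t := by
  obtain ⟨r, m, -, -, ⟨A⟩⟩ := exists_adaptedCoord (T.lieAlgebra V)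
  obtain ⟨p, hp, -⟩ := A.exists_proj
  have h1 := p.hasFDerivAt.comp_hasDerivAt t h
  have h2 := T.hasLogDerivAt_coordProd A.mem h1
  have h3 : (fun s => lieExp (U s : LieAlg V G) : ℝ → G) = fun s => coordProd A.e ((p ∘ U) s) := by
    funext s
    rw [← T.lieExp_sum A.mem]
    exact congrArg _ (hp _ (hU s))
  rw [h3]
  have h4 : U' = ((∑ i, p U' i • A.e i : LieAlg V G) : V) := by
    let q : V →L[ℝ] V := ∑ i, ((ContinuousLinearMap.proj i).comp p).smulRight (A.e i : V)
    have hq : ∀ x, q x = ((∑ i, p x i • A.e i : LieAlg V G) : V) := by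
      intro x
      simp only [q, sum_apply]
      rfl
    have h5 := q.hasFDerivAt.comp_hasDerivAt t h
    have h6 : q ∘ U = U := by
      funext s
      exact (hq _).trans (hp _ (hU s)).symm
    rw [h6] at h5
    exact (h.unique h5).trans (hq _)
  exact h4 ▸ h2

/-- The torus meets a transverse slice near `1` only in `1`. Otherwise points of `T` on the slice
tend to `1`, with a limiting direction `w` of norm one. Conjugation by any `a ∈ T` fixes these
points, so `Ad a` fixes the limiting tangent vector, which thus lies in `𝔱`; but it also lies in a
complement of `𝔱`. -/
theorem eventually_eq_zero_of_coordProd_mem {r m : ℕ} (A : AdaptedCoord (T.lieAlgebra V) r m) :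
    ∀ᶠ z in 𝓝 (0 : Fin m → ℝ), coordProd A.f z ∈ T.toSubgroup → z = 0 := by
  by_contra hcon
  rw [not_eventually] at hcon
  obtain ⟨z, hz, hzT⟩ := exists_seq_forall_of_frequently hcon
  simp only [Classical.not_imp] at hzT
  have hsph : ∀ n, ‖z n‖⁻¹ • z n ∈ Metric.sphere (0 : Fin m → ℝ) 1 := by
    intro n
    rw [mem_sphere_zero_iff_norm, norm_smul, norm_inv, norm_norm, inv_mul_cancel₀ (norm_ne_zero_iff.2 (hzT n).2)]
  obtain ⟨w, hw, ψ, hψ, hlim⟩ := (isCompact_sphere (0 : Fin m → ℝ) 1).tendsto_subseq hsph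
  have hv : (∑ i, w i • A.f i) ∈ T.lieAlgebra V := by
    refine T.mem_lieAlgebra_of_Ad fun a ha => ?_
    -- Used for `b = a` and for `b = 1`: the two maps agree on the sequence `z n`, so their
    -- derivatives agree on the limiting direction `w`.
    have hd : ∀ b : G, ∃ D : (Fin m → ℝ) →L[ℝ] V, HasFDerivAt (fun z => extChartAt 𝓘(ℝ, V) (1 : G) (b * coordProd A.f z * b⁻¹)) D 0
        ∧ D w = (Ad b (∑ i, w i • A.f i) : V) := by
      intro b
      have hone : b * coordProd A.f (0 : Fin m → ℝ) * b⁻¹ = 1 := by rw [coordProd_zero]; simp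
      have h1 : MDifferentiableAt 𝓘(ℝ, Fin m → ℝ) 𝓘(ℝ, V) (fun z => b * coordProd A.f z * b⁻¹) 0 :=
        MDifferentiableAt.comp _ (g := fun x : G => b * x * b⁻¹) (mdifferentiableAt_conj (V := V) b _)
          ((contMDiff_coordProd A.f).mdifferentiableAt (by simp))
      have h2 : HasMFDerivAt 𝓘(ℝ, V) 𝓘(ℝ, V) (extChartAt 𝓘(ℝ, V) (1 : G)) (b * coordProd A.f (0 : Fin m → ℝ) * b⁻¹) (ContinuousLinearMap.id ℝ V) := by
        rw [hone]; exact hasMFDerivAt_extChartAt_self (V := V) G 1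
      have h3 := HasMFDerivAt.comp (0 : Fin m → ℝ) h2 h1.hasMFDerivAt
      refine ⟨_, hasMFDerivAt_iff_hasFDerivAt.1 h3, ?_⟩
      have h4 := modelDeriv_comp (V₁ := Fin m → ℝ) (V₂ := V) (V₃ := V) (f := (coordProd A.f : (Fin m → ℝ) → G))
        (g := fun x => b * x * b⁻¹) (x := 0) (y := 1) (coordProd_zero _) (mdifferentiableAt_conj (V := V) b _)
          ((contMDiff_coordProd A.f).mdifferentiableAt (by simp)) w
      rw [modelDeriv_coordProd_apply] at h4
      exact h4
    obtain ⟨D, hD, hDw⟩ := hd a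
    obtain ⟨D', hD', hDw'⟩ := hd 1
    rw [Ad_one] at hDw'
    refine hDw.symm.trans (Eq.trans ?_ hDw')
    have hz0 : Tendsto (fun n => z (ψ n)) atTop (𝓝 0) := hz.comp hψ.tendsto_atTop
    have l1 := (hD.hasFDerivWithinAt (s := Set.univ)).lim hz0 (by simp) hlim
    have l2 := (hD'.hasFDerivWithinAt (s := Set.univ)).lim hz0 (by simp) hlim
    refine tendsto_nhds_unique l1 (l2.congr fun n => ?_)
    have h5 : a * coordProd A.f (z (ψ n)) * a⁻¹ = coordProd A.f (z (ψ n)) := by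
      rw [T.comm a ha _ (hzT (ψ n)).1, mul_inv_cancel_right]
    simp only [zero_add]
    rw [h5, coordProd_zero]
    simp
  have := A.compl w hv
  rw [this] at hw
  simp at hw

/-- The image of `𝔱` is a subgroup. By the slice lemma it contains a neighbourhood of `1` in `T`,
and `T` is connected. -/
theorem exists_lieExp_eq {a : G} (ha : a ∈ T.toSubgroup) : ∃ ζ ∈ T.lieAlgebra V, lieExp ζ = a := by
  obtain ⟨r, m, -, -, ⟨A⟩⟩ := exists_adaptedCoord (T.lieAlgebra V)
  let K : Subgroup G :=
    { carrier := {g | ∃ ζ ∈ T.lieAlgebra V, lieExp ζ = g}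
      mul_mem' := by
        rintro _ _ ⟨x, hx, rfl⟩ ⟨y, hy, rfl⟩
        exact ⟨x + y, add_mem hx hy, T.lieExp_add hx hy⟩
      one_mem' := ⟨0, zero_mem _, lieExp_zero⟩
      inv_mem' := by
        rintro _ ⟨x, hx, rfl⟩
        exact ⟨-x, neg_mem hx, T.lieExp_neg hx⟩ }
  have hev : ∀ᶠ g in 𝓝 (1 : G), g ∈ T.toSubgroup → g ∈ K := by
    have hc : Tendsto (fun g => fun i => A.κ g (Fin.natAdd r i)) (𝓝 (1 : G)) (𝓝 (0 : Fin m → ℝ)) := by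
      have h1 : Continuous (fun g => fun i => A.κ g (Fin.natAdd r i)) :=
        continuous_pi fun i => (continuous_apply _).comp A.smooth.continuous
      have h2 := h1.tendsto 1
      have : (fun i => A.κ 1 (Fin.natAdd r i)) = (0 : Fin m → ℝ) := by rw [A.κ_one]; rfl
      rwa [this] at h2
    filter_upwards [A.right_inv, hc.eventually (T.eventually_eq_zero_of_coordProd_mem A)] with g hg hz hgT
    have h1 : Fin.append (fun i => A.κ g (Fin.castAdd m i)) (fun i => A.κ g (Fin.natAdd r i)) = A.κ g :=
      Fin.append_castAdd_natAdd
    rw [← h1, coordProd_append] at hg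
    have h2 := T.coordProd_mem A.mem (fun i => A.κ g (Fin.castAdd m i))
    have h3 := hz (by
      rw [← hg] at hgT
      exact (Subgroup.mul_mem_cancel_left _ h2).1 hgT)
    rw [h3, coordProd_zero, mul_one, ← T.lieExp_sum A.mem] at hg
    exact ⟨_, Submodule.sum_mem _ fun i _ => Submodule.smul_mem _ _ (A.mem i), hg⟩
  have : ConnectedSpace T.toSubgroup := isConnected_iff_connectedSpace.1 T.isConnected
  have h1 : ((K.subgroupOf T.toSubgroup : Subgroup T.toSubgroup) : Set T.toSubgroup) ∈ 𝓝 (1 : T.toSubgroup) := by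
    have h2 : Tendsto (Subtype.val : T.toSubgroup → G) (𝓝 1) (𝓝 1) := continuous_subtype_val.tendsto 1
    filter_upwards [h2.eventually hev] with g hg
    exact hg g.2
  have h2 := (K.subgroupOf T.toSubgroup).isOpen_of_mem_nhds h1
  have h3 : IsClopen ((K.subgroupOf T.toSubgroup : Subgroup T.toSubgroup) : Set T.toSubgroup) :=
    ⟨Subgroup.isClosed_of_isOpen _ h2, h2⟩
  have h4 : (⟨a, ha⟩ : T.toSubgroup) ∈ ((K.subgroupOf T.toSubgroup : Subgroup T.toSubgroup) : Set T.toSubgroup) := by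
    rw [h3.eq_univ ⟨1, one_mem _⟩]; trivial
  exact h4

theorem eventually_eq_zero_of_coordProd_eq_one {r m : ℕ} (A : AdaptedCoord (T.lieAlgebra V) r m) :
    ∀ᶠ y in 𝓝 (0 : Fin r → ℝ), (coordProd A.e y : G) = 1 → y = 0 := by
  have h1 : Tendsto (fun y : Fin r → ℝ => Fin.append y (0 : Fin m → ℝ)) (𝓝 0) (𝓝 0) := by
    have : Continuous fun y : Fin r → ℝ => (y, (0 : Fin m → ℝ)) := by fun_prop
    exact (tendsto_append_zero (r := r) (m := m)).comp (this.tendsto 0)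
  filter_upwards [h1.eventually A.left_inv] with y hx hx1
  rw [coordProd_append, coordProd_zero, mul_one, hx1, A.κ_one] at hx
  funext i
  have := congrFun hx (Fin.castAdd m i)
  simpa using this.symm

/-- A path in `𝔱` starting at `0` whose exponential is a loop that stays close to `1` is closed. -/
theorem exists_nhds_path_closed (V : Type*) [NormedAddCommGroup V] [NormedSpace ℝ V]
    [CompleteSpace V]
    [ChartedSpace V G] [LieGroup 𝓘(ℝ, V) ∞ G] [FiniteDimensional ℝ V] :
    ∃ N ∈ 𝓝 (1 : G), ∀ U : ℝ → V, Continuous U → U 0 = 0 → (∀ s, U s ∈ T.lieAlgebra V) →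
    (∀ s ∈ Icc (0 : ℝ) 1, (lieExp (U s : LieAlg V G) : G) ∈ N) →
    (lieExp (U 1 : LieAlg V G) : G) = 1 → U 1 = 0 := by
  obtain ⟨r, m, -, -, ⟨A⟩⟩ := exists_adaptedCoord (T.lieAlgebra V)
  obtain ⟨p, hp, -⟩ := A.exists_proj
  -- In coordinates, only the origin of the `ε`-ball maps to `1`. The neighbourhood `N` is the
  -- complement of the image of the sphere of radius `ε / 2`, so a path from `0` whose exponential
  -- stays in `N` cannot cross that sphere.
  obtain ⟨ε, hε, hball⟩ := Metric.eventually_nhds_iff.1 (T.eventually_eq_zero_of_coordProd_eq_one A)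
  have hcont := (contMDiff_coordProd A.e).continuous
  have hcomp : IsCompact ((coordProd A.e : (Fin r → ℝ) → G) '' Metric.sphere 0 (ε / 2)) :=
    (isCompact_sphere _ _).image hcont
  refine ⟨_, hcomp.isClosed.isOpen_compl.mem_nhds ?_, fun U hU h0 hUt hN h1 => ?_⟩
  · rintro ⟨y, hy, hy1⟩
    rw [mem_sphere_zero_iff_norm] at hy
    have := hball (y := y) (by rw [dist_zero_right, hy]; linarith) hy1
    rw [this, norm_zero] at hy
    linarith
  · have hexp : ∀ s, (lieExp (U s : LieAlg V G) : G) = coordProd A.e (p (U s)) := fun s => by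
      rw [← T.lieExp_sum A.mem]
      exact congrArg _ (hp _ (hUt s))
    have hne : ∀ s ∈ Icc (0 : ℝ) 1, ‖p (U s)‖ ≠ ε / 2 := by
      intro s hs hn
      refine hN s hs ?_
      rw [hexp]
      exact ⟨_, mem_sphere_zero_iff_norm.2 hn, rfl⟩
    have hlt : ‖p (U 1)‖ < ε / 2 := by
      by_contra hge
      have hc : ContinuousOn (fun s => ‖p (U s)‖) (Icc 0 1) := by fun_prop
      have := intermediate_value_Icc (zero_le_one (α := ℝ)) hc
      obtain ⟨s, hs, hs'⟩ := this ⟨by simp [h0]; linarith, not_lt.1 hge⟩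
      exact hne s hs hs'
    rw [hexp] at h1
    have h2 := hball (y := p (U 1)) (by rw [dist_zero_right]; linarith) h1
    have h3 := hp _ (hUt 1)
    rw [h2] at h3
    refine Eq.trans h3 ?_
    simp only [Pi.zero_apply, zero_smul, Finset.sum_const_zero]
    rfl

theorem integral_mem {u : ℝ → V} (hu : Continuous u) (hT : ∀ s, u s ∈ T.lieAlgebra V) (a b : ℝ) :
    (∫ s in a..b, u s) ∈ T.lieAlgebra V := by
  obtain ⟨r, m, -, -, ⟨A⟩⟩ := exists_adaptedCoord (T.lieAlgebra V)
  obtain ⟨p, hp, -⟩ := A.exists_proj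
  let q : V →L[ℝ] V := ∑ i, ((ContinuousLinearMap.proj i).comp p).smulRight (A.e i : V)
  have hq : ∀ x, q x = ((∑ i, p x i • A.e i : LieAlg V G) : V) := by
    intro x
    simp only [q, sum_apply]
    rfl
  have h1 := q.intervalIntegral_comp_comm (μ := MeasureTheory.volume) (hu.intervalIntegrable a b)
  have h2 : (fun s => q (u s)) = u := funext fun s => (hq _).trans (hp _ (hT s)).symm
  have h3 : (∫ s in a..b, u s) = q (∫ s in a..b, u s) := by
    rw [← h1, h2]
  rw [h3]
  have h4 : (∑ i, p (∫ s in a..b, u s) i • A.e i) ∈ T.lieAlgebra V :=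
    Submodule.sum_mem _ fun i _ => Submodule.smul_mem _ _ (A.mem i)
  exact (hq (∫ s in a..b, u s)) ▸ h4

theorem eq_mul_lieExp_integral {γ : ℝ → G} {u : ℝ → V} (hu : Continuous u)
    (hγ : ∀ s, γ s ∈ T.toSubgroup)
    (h : ∀ s, HasLogDerivAt γ (u s : LieAlg V G) s) (s : ℝ) :
    γ s = γ 0 * lieExp ((∫ r in (0 : ℝ)..s, u r : V) : LieAlg V G) := by
  have hT : ∀ s, u s ∈ T.lieAlgebra V := fun s => T.mem_lieAlgebra_of_hasLogDerivAt hγ (h s)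
  have h1 : ∀ s, HasLogDerivAt (fun s => γ 0 * lieExp ((∫ r in (0 : ℝ)..s, u r : V) : LieAlg V G)) (u s : LieAlg V G) s := by
    intro s
    refine HasLogDerivAt.const_mul (V := V) ?_ _
    exact T.hasLogDerivAt_lieExp_of_mem (fun s => T.integral_mem hu hT 0 s)
      (intervalIntegral.integral_hasDerivAt_right (hu.intervalIntegrable _ _)
        (hu.stronglyMeasurableAtFilter _ _) hu.continuousAt)
  have h2 := eq_of_hasLogDerivAt (u := fun s => (u s : LieAlg V G)) h h1 (t₀ := 0) (by
    rw [intervalIntegral.integral_same]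
    exact (mul_one (γ 0)).symm.trans (congrArg (γ 0 * ·) lieExp_zero_eq_one.symm))
  exact congrFun h2 s

end MaximalTorus

end

/-! ### Sobolev functions on the circle through their Fourier coefficients. -/

noncomputable section

open scoped Manifold ContDiff ENNReal Topology
open Set Filter

section SobolevCircle

/-- The Hilbert space of square-summable sequences of Fourier coefficients. -/
abbrev EllTwo : Type := lp (fun _ : ℤ => ℂ) 2

theorem memℓp_two_iff {f : ℤ → ℂ} : Memℓp f 2 ↔ Summable fun n => ‖f n‖ ^ 2 := by
  rw [memℓp_gen_iff (by simp)]
  simp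

/-- The weight `(1 + n²)^{-σ/2}`. -/
def sobolevWeight (σ : ℝ) (n : ℤ) : ℝ := (1 + (n : ℝ) ^ 2) ^ (-(σ / 2))

theorem sobolevWeight_pos (σ : ℝ) (n : ℤ) : 0 < sobolevWeight σ n := by
  unfold sobolevWeight; positivity

theorem sobolevWeight_le {σ : ℝ} (hσ : 0 < σ) {n : ℤ} (hn : n ≠ 0) :
    sobolevWeight σ n ≤ |(n : ℝ)| ^ (-σ) := by
  have hn' : 0 < |(n : ℝ)| := abs_pos.2 (by exact_mod_cast hn)
  have h1 : |(n : ℝ)| ^ (-σ) = (|(n : ℝ)| ^ (2 : ℝ)) ^ (-(σ / 2)) := by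
    rw [← Real.rpow_mul hn'.le]; congr 1; ring
  rw [h1, sobolevWeight]
  refine Real.rpow_le_rpow_of_nonpos (by positivity) ?_ (by linarith)
  rw [Real.rpow_two, sq_abs]
  linarith

theorem summable_weight_sq {σ : ℝ} (hσ : 1 / 2 < σ) :
    Summable fun n => (sobolevWeight σ n) ^ 2 := by
  refine Summable.of_norm_bounded_eventually (Real.summable_abs_int_rpow (b := 2 * σ) (by linarith)) ?_
  have : ({0}ᶜ : Set ℤ) ∈ cofinite := (Set.finite_singleton 0).compl_mem_cofinite
  filter_upwards [this] with n hn
  have hn0 : n ≠ 0 := hn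
  have h1 := sobolevWeight_le (σ := σ) (by linarith) hn0
  have h0 := (sobolevWeight_pos σ n).le
  rw [Real.norm_eq_abs, abs_of_nonneg (by positivity)]
  calc sobolevWeight σ n ^ 2 ≤ (|(n : ℝ)| ^ (-σ)) ^ 2 := by gcongr
    _ = |(n : ℝ)| ^ (-(2 * σ)) := by
      rw [← Real.rpow_natCast, ← Real.rpow_mul (abs_nonneg _)]; congr 1; push_cast; ring

theorem summable_mul_weight_sq {σ : ℝ} (hσ : 3 / 2 < σ) : Summable fun n :
    ℤ => (|(n : ℝ)| * sobolevWeight σ n) ^ 2 := by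
  refine Summable.of_norm_bounded_eventually (Real.summable_abs_int_rpow (b := 2 * σ - 2) (by linarith)) ?_
  have : ({0}ᶜ : Set ℤ) ∈ cofinite := (Set.finite_singleton 0).compl_mem_cofinite
  filter_upwards [this] with n hn
  have hn0 : n ≠ 0 := hn
  have hn' : 0 < |(n : ℝ)| := abs_pos.2 (by exact_mod_cast hn0)
  have h1 := sobolevWeight_le (σ := σ) (by linarith) hn0
  have h0 := (sobolevWeight_pos σ n).le
  rw [Real.norm_eq_abs, abs_of_nonneg (by positivity)]
  calc (|(n : ℝ)| * sobolevWeight σ n) ^ 2 ≤ (|(n : ℝ)| * |(n : ℝ)| ^ (-σ)) ^ 2 := by gcongr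
    _ = |(n : ℝ)| ^ (-(2 * σ - 2)) := by
      nth_rw 1 [← Real.rpow_one |(n : ℝ)|]
      rw [← Real.rpow_add hn', ← Real.rpow_natCast, ← Real.rpow_mul (abs_nonneg _)]; congr 1; push_cast; ring

theorem summable_mul_of_sq {f g : ℤ → ℝ} (hf : Summable fun n => f n ^ 2)
    (hg : Summable fun n => g n ^ 2) :
    Summable fun n => f n * g n := by
  refine Summable.of_norm_bounded (hf.add hg) fun n => ?_
  rw [Real.norm_eq_abs, abs_le]
  constructor <;> nlinarith [sq_nonneg (f n + g n), sq_nonneg (f n - g n), sq_nonneg (f n), sq_nonneg (g n)]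

theorem EllTwo.summable_sq (a : EllTwo) : Summable fun n => ‖a n‖ ^ 2 := memℓp_two_iff.1 (lp.memℓp a)

theorem norm_fourier_apply (n : ℤ) (s : UnitAddCircle) : ‖fourier n s‖ = 1 := by
  rw [fourier_apply]; exact Circle.norm_coe _

/-- The reproducing kernel of the Sobolev space of order `σ`. -/
def sobolevKernel {σ : ℝ} (hσ : 1 / 2 < σ) (s : UnitAddCircle) : EllTwo :=
  ⟨fun n => (sobolevWeight σ n : ℂ) * fourier (-n) s, memℓp_two_iff.2 <| by
    refine (summable_weight_sq hσ).congr fun n => ?_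
    rw [norm_mul, norm_fourier_apply, Complex.norm_real, Real.norm_eq_abs, mul_one, sq_abs]⟩

/-- Evaluation at `s` of the function with given weighted Fourier coefficients. -/
def sobolevEval {σ : ℝ} (hσ : 1 / 2 < σ) (s : UnitAddCircle) : EllTwo →L[ℝ] ℝ :=
  Complex.reCLM.comp ((innerSL ℂ (sobolevKernel hσ s)).restrictScalars ℝ)

theorem EllTwo.summable_weight {σ : ℝ} (hσ : 1 / 2 < σ) (a : EllTwo) :
    Summable fun n => ‖(sobolevWeight σ n : ℂ) * a n‖ := by
  refine (summable_mul_of_sq (summable_weight_sq hσ) a.summable_sq).congr fun n => ?_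
  rw [norm_mul, Complex.norm_real, Real.norm_eq_abs, abs_of_pos (sobolevWeight_pos σ n)]

theorem EllTwo.summable_mul_weight {σ : ℝ} (hσ : 3 / 2 < σ) (a : EllTwo) :
    Summable fun n : ℤ => |(n : ℝ)| * ‖(sobolevWeight σ n : ℂ) * a n‖ := by
  refine (summable_mul_of_sq (summable_mul_weight_sq hσ) a.summable_sq).congr fun n => ?_
  rw [norm_mul, Complex.norm_real, Real.norm_eq_abs, abs_of_pos (sobolevWeight_pos σ n), mul_assoc]

/-- By Cauchy–Schwarz the unweighted coefficients are absolutely summable. The Fourier series then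
converges uniformly, and pairing with the kernel evaluates it. -/
theorem EllTwo.hasSum_fourier {σ : ℝ} (hσ : 1 / 2 < σ) (a : EllTwo) :
    ∃ g : C(UnitAddCircle, ℂ), HasSum
    (fun m => ((sobolevWeight σ m : ℂ) * a m) • (fourier m : C(UnitAddCircle, ℂ))) g ∧
      ∀ s, sobolevEval hσ s a = (g s).re := by
  have h1 : Summable (fun m => ((sobolevWeight σ m : ℂ) * a m) • (fourier m : C(UnitAddCircle, ℂ))) := by
    refine Summable.of_norm ((a.summable_weight hσ).congr fun n => ?_)
    rw [norm_smul, fourier_norm, mul_one]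
  refine ⟨_, h1.hasSum, fun s => ?_⟩
  have h2 := lp.hasSum_inner (𝕜 := ℂ) (sobolevKernel hσ s) a
  have h3 := (ContinuousMap.evalCLM ℂ s).hasSum h1.hasSum
  have h5 : (fun i => inner ℂ (sobolevKernel hσ s i) (a i)) =
      fun b => (ContinuousMap.evalCLM ℂ s) (((sobolevWeight σ b : ℂ) * a b) • (fourier b : C(UnitAddCircle, ℂ))) := by
    funext n
    change a n * (starRingEnd ℂ) ((sobolevWeight σ n : ℂ) * fourier (-n) s) = ((sobolevWeight σ n : ℂ) * a n) * fourier n s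
    rw [map_mul, Complex.conj_ofReal, fourier_neg, Complex.conj_conj]
    ring
  rw [h5] at h2
  have h4 := h3.unique h2
  change (inner ℂ (sobolevKernel hσ s) a).re = _
  rw [← h4]; rfl

theorem norm_sobolevKernel {σ : ℝ} (hσ : 1 / 2 < σ) (s : UnitAddCircle) :
    ‖sobolevKernel hσ s‖ = ‖sobolevKernel hσ 0‖ := by
  rw [lp.norm_eq_tsum_rpow (by simp), lp.norm_eq_tsum_rpow (by simp)]
  congr 2
  funext n
  simp only [sobolevKernel, norm_mul, norm_fourier_apply]

theorem norm_sobolevEval_le {σ : ℝ} (hσ : 1 / 2 < σ) (s : UnitAddCircle) (a : EllTwo) :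
    ‖sobolevEval hσ s a‖ ≤ ‖sobolevKernel hσ 0‖ * ‖a‖ := by
  rw [← norm_sobolevKernel hσ s]
  refine le_trans ?_ (norm_inner_le_norm (𝕜 := ℂ) (sobolevKernel hσ s) a)
  exact Complex.abs_re_le_norm _

/-- Taking a Fourier coefficient is continuous on continuous functions, since it factors through
`L²`; it may be applied term by term. -/
theorem fourierCoeff_hasSum {c : ℤ → ℂ} {g : C(UnitAddCircle, ℂ)}
    (h : HasSum (fun m => c m • (fourier m : C(UnitAddCircle, ℂ))) g)
    (n : ℤ) : fourierCoeff g n = c n := by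
  let Φ : C(UnitAddCircle, ℂ) →L[ℂ] ℂ := (lp.evalCLM ℂ (fun _ : ℤ => ℂ) 2 n).comp
    ((fourierBasis (T := 1)).repr.toContinuousLinearEquiv.toContinuousLinearMap.comp
      (ContinuousMap.toLp (E := ℂ) 2 (AddCircle.haarAddCircle (T := 1)) ℂ))
  have hΦ : ∀ f : C(UnitAddCircle, ℂ), Φ f = fourierCoeff f n := by
    intro f
    rw [← fourierCoeff_toLp, ← fourierBasis_repr]
    rfl
  have h1 := Φ.hasSum h
  rw [← hΦ]
  refine h1.unique ?_
  have h2 : ∀ m, Φ (c m • (fourier m : C(UnitAddCircle, ℂ))) = if m = n then c n else 0 := by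
    intro m
    rw [map_smul, hΦ, fourierCoeff_fourier]
    by_cases hm : m = n
    · subst hm; simp
    · simp [hm, Ne.symm hm]
  simp only [h2]
  exact hasSum_ite_eq n (c n)

theorem weight_mul_sobolevCoeff (σ : ℝ) (u : UnitAddCircle → ℝ) (n : ℤ) :
    (sobolevWeight σ n : ℂ) * sobolevCoeff σ u n = fourierCoeff (fun s => (u s : ℂ)) n := by
  rw [sobolevCoeff, sobolevWeight, ← mul_assoc, ← Complex.ofReal_mul, ← Real.rpow_add (by positivity), neg_add_cancel]
  simp

/-- Summable Fourier coefficients make the series of a continuous function converge to that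
function. Point evaluation is thereby a continuous linear functional on the Sobolev space, through
which smoothness of the projection to `LG` becomes smoothness at each point of the circle. -/
theorem sobolevEval_coeff {σ : ℝ} (hσ : 1 / 2 < σ) {u : UnitAddCircle → ℝ} (hu : Continuous u)
    (h : Memℓp (sobolevCoeff σ u) 2) (s : UnitAddCircle) :
    sobolevEval hσ s ⟨sobolevCoeff σ u, h⟩ = u s := by
  obtain ⟨g, hg, hg2⟩ := EllTwo.hasSum_fourier hσ (⟨sobolevCoeff σ u, h⟩ : EllTwo)
  rw [hg2]
  let f : C(UnitAddCircle, ℂ) := ⟨fun s => (u s : ℂ), by fun_prop⟩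
  have h1 : Summable (fourierCoeff f) := by
    refine Summable.of_norm ((EllTwo.summable_weight hσ (⟨sobolevCoeff σ u, h⟩ : EllTwo)).congr fun n => ?_)
    exact congrArg _ (weight_mul_sobolevCoeff σ u n)
  have h2 := hasSum_fourier_series_of_summable h1
  have h4 : (fun m => ((sobolevWeight σ m : ℂ) * sobolevCoeff σ u m) • (fourier m : C(UnitAddCircle, ℂ))) =
      fun m => fourierCoeff f m • (fourier m : C(UnitAddCircle, ℂ)) := by
    funext m; rw [weight_mul_sobolevCoeff]; rfl
  have h3 : g = f := hg.unique (h4 ▸ h2)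
  rw [h3]; rfl

/-- Taking the real part symmetrizes the coefficients to `(a n + conj (a (-n))) / 2`, which is again
square-summable. -/
theorem memℓp_sobolevCoeff_eval {σ : ℝ} (hσ : 1 / 2 < σ) (a : EllTwo) :
    Continuous (fun s => sobolevEval hσ s a) ∧ Memℓp
    (sobolevCoeff σ (fun s => sobolevEval hσ s a)) 2 := by
  obtain ⟨g, hg, hg2⟩ := a.hasSum_fourier hσ
  have hv : (fun s => sobolevEval hσ s a) = fun s => (g s).re := funext hg2
  rw [hv]
  refine ⟨by fun_prop, ?_⟩
  have h1 := hg.star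
  have h2 := (Equiv.neg ℤ).hasSum_iff.2 h1
  have h3 := (hg.add h2).const_smul ((1 / 2 : ℂ))
  have h4 : HasSum (fun m => ((1 / 2 : ℂ) * ((sobolevWeight σ m : ℂ) * (a m + (starRingEnd ℂ) (a (-m))))) •
      (fourier m : C(UnitAddCircle, ℂ))) ((1 / 2 : ℂ) • (g + star g)) := by
    convert! h3 using 1
    funext m
    ext s
    have : sobolevWeight σ (-m) = sobolevWeight σ m := by simp [sobolevWeight]
    simp only [Function.comp_apply, Equiv.neg_apply, star_smul, ContinuousMap.smul_apply, ContinuousMap.add_apply,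
      smul_eq_mul, ContinuousMap.star_apply, this]
    rw [show star (fourier (-m) s) = fourier m s by rw [fourier_neg]; exact Complex.conj_conj _]
    simp
    ring
  have h5 : ∀ s, ((1 / 2 : ℂ) • (g + star g)) s = (((g s).re : ℝ) : ℂ) := by
    intro s
    simp only [ContinuousMap.smul_apply, ContinuousMap.add_apply, ContinuousMap.star_apply, smul_eq_mul]
    rw [Complex.re_eq_add_conj, Complex.star_def]
    ring
  have h6 := fourierCoeff_hasSum h4
  rw [memℓp_two_iff]
  have h7 : ∀ n, sobolevCoeff σ (fun s => (g s).re) n = (1 / 2 : ℂ) * (a n + (starRingEnd ℂ) (a (-n))) := by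
    intro n
    have h8 : fourierCoeff (fun s => (((g s).re : ℝ) : ℂ)) n = _ := (congrArg (fun f => fourierCoeff f n) (funext h5)).symm.trans (h6 n)
    rw [sobolevCoeff, h8, sobolevWeight]
    have h9 : (((1 + (n : ℝ) ^ 2) ^ (σ / 2) : ℝ) : ℂ) * (((1 + (n : ℝ) ^ 2) ^ (-(σ / 2)) : ℝ) : ℂ) = 1 := by
      rw [← Complex.ofReal_mul, ← Real.rpow_add (by positivity), add_neg_cancel]; simp
    linear_combination (1 / 2 : ℂ) * (a n + (starRingEnd ℂ) (a (-n))) * h9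
  have hs := a.summable_sq
  have hs' : Summable fun n => ‖a (-n)‖ ^ 2 := (Equiv.neg ℤ).summable_iff.2 hs
  refine Summable.of_nonneg_of_le (fun n => by positivity) (fun n => ?_) (hs.add hs')
  rw [h7, norm_mul]
  have e1 : ‖(1 / 2 : ℂ)‖ = 1 / 2 := by simp
  have e2 := norm_add_le (a n) ((starRingEnd ℂ) (a (-n)))
  rw [RCLike.norm_conj] at e2
  rw [e1]
  have e3 := norm_nonneg (a n + (starRingEnd ℂ) (a (-n)))
  have e4 : ‖a n + (starRingEnd ℂ) (a (-n))‖ ^ 2 ≤ (‖a n‖ + ‖a (-n)‖) ^ 2 := by gcongr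
  nlinarith [sq_nonneg (‖a n‖ - ‖a (-n)‖)]

/-- The Sobolev embedding into `C¹`: above order `3/2` the sequence `n ↦ |n| (1 + n²)^{-σ/2}` is
square-summable, so the series may be differentiated term by term. -/
theorem contDiff_sobolevEval {σ : ℝ} (hσ : 3 / 2 < σ) (a : EllTwo) :
    ContDiff ℝ 1 (fun r : ℝ => sobolevEval (σ := σ) (by linarith) (r : UnitAddCircle) a) := by
  obtain ⟨g, hg, hg2⟩ := a.hasSum_fourier (σ := σ) (by linarith)
  have h1 : ∀ r : ℝ, g (r : UnitAddCircle) = ∑' m, ((sobolevWeight σ m : ℂ) * a m) * fourier m (r : UnitAddCircle) := by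
    intro r
    have := (ContinuousMap.evalCLM ℂ (r : UnitAddCircle)).hasSum hg
    exact this.tsum_eq.symm
  have hder : ∀ (m : ℤ) (r : ℝ), HasDerivAt (fun r : ℝ => ((sobolevWeight σ m : ℂ) * a m) * fourier m (r : UnitAddCircle))
      (((sobolevWeight σ m : ℂ) * a m) * (2 * Real.pi * Complex.I * m / (1 : ℝ) * fourier m (r : UnitAddCircle))) r :=
    fun m r => (hasDerivAt_fourier 1 m r).const_mul _
  have h2 : ContDiff ℝ (1 : ℕ∞) (fun r : ℝ => ∑' m, ((sobolevWeight σ m : ℂ) * a m) * fourier m (r : UnitAddCircle)) := by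
    refine contDiff_tsum (v := fun k m => if k = 0 then ‖(sobolevWeight σ m : ℂ) * a m‖ else
      2 * Real.pi * (|(m : ℝ)| * ‖(sobolevWeight σ m : ℂ) * a m‖)) ?_ ?_ ?_
    · intro m
      have : (fun r : ℝ => ((sobolevWeight σ m : ℂ) * a m) * fourier m (r : UnitAddCircle)) =
        fun r : ℝ => ((sobolevWeight σ m : ℂ) * a m) * Complex.exp (2 * Real.pi * Complex.I * m * r / (1 : ℝ)) := by
        funext r; rw [fourier_coe_apply]
      rw [this]
      have h0 : ContDiff ℝ (1 : ℕ∞) fun r : ℝ => (r : ℂ) := Complex.ofRealCLM.contDiff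
      fun_prop
    · intro k hk
      by_cases hk0 : k = 0
      · simpa [hk0] using a.summable_weight (σ := σ) (by linarith)
      · simpa only [hk0, if_false] using (a.summable_mul_weight hσ).mul_left (2 * Real.pi)
    · intro k m r hk
      rw [norm_iteratedFDeriv_eq_norm_iteratedDeriv]
      have hk' : k ≤ 1 := by exact_mod_cast hk
      interval_cases k
      · rw [iteratedDeriv_zero, norm_mul, norm_fourier_apply, mul_one, if_pos rfl]
      · rw [iteratedDeriv_one, (hder m r).deriv]
        simp only [norm_mul, norm_fourier_apply]
        simp [abs_of_pos Real.pi_pos]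
        apply le_of_eq; ring
  have h3 : (fun r : ℝ => sobolevEval (σ := σ) (by linarith) (r : UnitAddCircle) a) =
      fun r : ℝ => Complex.reCLM (∑' m, ((sobolevWeight σ m : ℂ) * a m) * fourier m (r : UnitAddCircle)) := by
    funext r
    rw [hg2, h1]; rfl
  rw [h3]
  exact Complex.reCLM.contDiff.comp (by exact_mod_cast h2)

theorem liftIco_coe_comp (u : UnitAddCircle → ℂ) :
    AddCircle.liftIco 1 0 (fun r : ℝ => u r) = u := by
  funext x
  change u ((AddCircle.equivIco 1 0 x : ℝ) : UnitAddCircle) = u x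
  rw [AddCircle.coe_equivIco]

/-- Integration by parts: each derivative gains a factor `1/n`, and the boundary terms cancel by
periodicity. -/
theorem norm_fourierCoeff_smooth (k : ℕ) : ∀ u :
    UnitAddCircle → ℂ, ContDiff ℝ ∞ (fun r : ℝ => u r) →
    ∃ C : ℝ, ∀ n : ℤ, |(n : ℝ)| ^ k * ‖fourierCoeff u n‖ ≤ C := by
  induction k with
  | zero =>
    intro u hu
    obtain ⟨C, hC⟩ := isCompact_Icc.exists_bound_of_continuousOn (hu.continuous.continuousOn (s := Icc (0 : ℝ) 1))
    refine ⟨C, fun n => ?_⟩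
    rw [pow_zero, one_mul, fourierCoeff_eq_intervalIntegral u n 0]
    have h1 := intervalIntegral.norm_integral_le_of_norm_le_const (a := (0 : ℝ)) (b := 0 + 1)
      (f := fun x => fourier (-n) (x : UnitAddCircle) • u (x : UnitAddCircle)) (C := C) (fun x hx => by
        rw [norm_smul, norm_fourier_apply, one_mul]
        rw [zero_add, uIoc_of_le zero_le_one] at hx
        exact hC x ⟨hx.1.le, hx.2⟩)
    simpa using h1
  | succ k ih =>
    intro u hu
    have hper : Function.Periodic (deriv fun r : ℝ => u r) 1 := by
      intro x
      have : (fun r : ℝ => u ((r + 1 : ℝ) : UnitAddCircle)) = fun r : ℝ => u r := by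
        funext r
        rw [AddCircle.coe_add, AddCircle.coe_period, add_zero]
      rw [← deriv_comp_add_const]
      rw [this]
    let v : UnitAddCircle → ℂ := hper.lift
    have hv : (fun r : ℝ => v r) = deriv fun r : ℝ => u r := funext fun r => hper.lift_coe r
    obtain ⟨C, hC⟩ := ih v (by
      rw [hv]
      exact ((contDiff_infty_iff_deriv).1 hu).2)
    refine ⟨C, fun n => ?_⟩
    by_cases hn : n = 0
    · subst hn
      have := hC 0
      simp only [Int.cast_zero, abs_zero]
      rw [zero_pow (by omega), zero_mul]
      refine le_trans ?_ this
      positivity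
    · refine le_trans ?_ (hC n)
      have h1 : ∀ w : UnitAddCircle → ℂ, fourierCoeff w n = fourierCoeffOn (lt_add_of_pos_right (0 : ℝ) one_pos) (fun r : ℝ => w r) n := by
        intro w
        rw [← fourierCoeff_liftIco_eq, liftIco_coe_comp]
      have hd : ∀ x : ℝ, HasDerivAt (fun r : ℝ => u r) (v x) x := by
        intro x
        have := ((hu.differentiable (by simp)) x).hasDerivAt
        rwa [← hv] at this
      have h2 := fourierCoeffOn_of_hasDerivAt (lt_add_of_pos_right (0 : ℝ) one_pos) hn (f := fun r : ℝ => u r) (f' := fun r : ℝ => v r)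
        (fun x _ => hd x) (by
          have : Continuous fun r : ℝ => v r := by
            rw [hv]; exact hu.continuous_deriv (by simp)
          exact this.intervalIntegrable _ _)
      have h3 : u (((0 + 1 : ℝ)) : UnitAddCircle) = u ((0 : ℝ) : UnitAddCircle) := by
        rw [AddCircle.coe_add, AddCircle.coe_period, add_zero]
      rw [h3, sub_self, mul_zero, zero_sub, ← h1, ← h1] at h2
      rw [h2, norm_mul, norm_neg, norm_mul, norm_div, pow_succ]
      have hn' : 0 < |(n : ℝ)| := abs_pos.2 (by exact_mod_cast hn)
      have e1 : ‖(-2 * (Real.pi : ℂ) * Complex.I * (n : ℂ))‖ = 2 * Real.pi * |(n : ℝ)| := by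
        simp [abs_of_pos Real.pi_pos]
      rw [e1]
      have e2 : ‖(((0 + 1 : ℝ) : ℂ) - ((0 : ℝ) : ℂ))‖ = 1 := by simp
      rw [e2, norm_one, one_mul]
      have hpi : 1 ≤ 2 * Real.pi := by linarith [Real.pi_gt_three]
      calc |(n : ℝ)| ^ k * |(n : ℝ)| * (1 / (2 * Real.pi * |(n : ℝ)|) * ‖fourierCoeff v n‖)
          = |(n : ℝ)| ^ k * ‖fourierCoeff v n‖ * (1 / (2 * Real.pi)) := by
            field_simp
        _ ≤ |(n : ℝ)| ^ k * ‖fourierCoeff v n‖ * 1 := by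
            gcongr
            rw [div_le_one (by positivity)]; exact hpi
        _ = _ := mul_one _

theorem memℓp_sobolevCoeff_of_contDiff (σ : ℝ) {u : UnitAddCircle → ℝ}
    (hu : ContDiff ℝ ∞ (fun r : ℝ => u r)) :
    Memℓp (sobolevCoeff σ u) 2 := by
  -- Decay of order `|σ| + 1` beats the weight, leaving weighted coefficients of size `O(1/|n|)`,
  -- which are square-summable.
  obtain ⟨k, hk⟩ := exists_nat_ge (|σ| + 1)
  obtain ⟨C, hC⟩ := norm_fourierCoeff_smooth k (fun s => (u s : ℂ)) (Complex.ofRealCLM.contDiff.comp hu)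
  rw [memℓp_two_iff]
  have hs : Summable fun n : ℤ => (2 ^ (|σ| / 2) * C) ^ 2 * |(n : ℝ)| ^ (-(2 : ℝ)) :=
    (Real.summable_abs_int_rpow (b := 2) (by norm_num)).mul_left _
  refine Summable.of_norm_bounded_eventually hs ?_
  have : ({0}ᶜ : Set ℤ) ∈ cofinite := (Set.finite_singleton 0).compl_mem_cofinite
  filter_upwards [this] with n hn
  have hn1 : 1 ≤ |(n : ℝ)| := by exact_mod_cast Int.one_le_abs hn
  have hn0 : 0 < |(n : ℝ)| := by linarith
  rw [norm_pow, norm_norm]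
  have h1 : ‖sobolevCoeff σ u n‖ ≤ 2 ^ (|σ| / 2) * C * |(n : ℝ)| ^ (-(1 : ℝ)) := by
    rw [sobolevCoeff, norm_mul, Complex.norm_real, Real.norm_eq_abs, abs_of_nonneg (by positivity)]
    have h2 : (1 + (n : ℝ) ^ 2) ^ (σ / 2) ≤ 2 ^ (|σ| / 2) * |(n : ℝ)| ^ |σ| := by
      calc (1 + (n : ℝ) ^ 2) ^ (σ / 2) ≤ (1 + (n : ℝ) ^ 2) ^ (|σ| / 2) := by
            apply Real.rpow_le_rpow_of_exponent_le (by nlinarith [sq_nonneg (n : ℝ)])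
            linarith [le_abs_self σ]
        _ ≤ (2 * |(n : ℝ)| ^ (2 : ℝ)) ^ (|σ| / 2) := by
            apply Real.rpow_le_rpow (by positivity) _ (by positivity)
            rw [Real.rpow_two, sq_abs]
            nlinarith [sq_abs (n : ℝ)]
        _ = _ := by
            rw [Real.mul_rpow (by positivity) (by positivity), ← Real.rpow_mul hn0.le]
            congr 2; ring
    have h3 : |(n : ℝ)| ^ |σ| ≤ |(n : ℝ)| ^ k * |(n : ℝ)| ^ (-(1 : ℝ)) := by
      rw [← Real.rpow_natCast, ← Real.rpow_add hn0]
      exact Real.rpow_le_rpow_of_exponent_le hn1 (by linarith)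
    calc (1 + (n : ℝ) ^ 2) ^ (σ / 2) * ‖fourierCoeff (fun s => (u s : ℂ)) n‖
        ≤ (2 ^ (|σ| / 2) * (|(n : ℝ)| ^ k * |(n : ℝ)| ^ (-(1 : ℝ)))) * ‖fourierCoeff (fun s => (u s : ℂ)) n‖ := by
          gcongr
          exact h2.trans (by gcongr)
      _ = 2 ^ (|σ| / 2) * (|(n : ℝ)| ^ k * ‖fourierCoeff (fun s => (u s : ℂ)) n‖) * |(n : ℝ)| ^ (-(1 : ℝ)) := by ring
      _ ≤ _ := by gcongr; exact hC n
  calc ‖sobolevCoeff σ u n‖ ^ 2 ≤ (2 ^ (|σ| / 2) * C * |(n : ℝ)| ^ (-(1 : ℝ))) ^ 2 := by gcongr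
    _ = _ := by
      rw [mul_pow, ← Real.rpow_natCast (|(n : ℝ)| ^ (-(1 : ℝ))), ← Real.rpow_mul hn0.le]
      congr 2; push_cast; ring

end SobolevCircle

end

/-! ### Smooth functions on the group and evaluation of loops. -/

noncomputable section

open scoped Manifold ContDiff ENNReal Topology
open VectorField Set Filter
variable {V : Type*} [NormedAddCommGroup V] [NormedSpace ℝ V] [CompleteSpace V]
  {G : Type*} [TopologicalSpace G] [ChartedSpace V G] [Group G] [LieGroup 𝓘(ℝ, V) ∞ G]

section SmoothFunctions
variable [FiniteDimensional ℝ V] [T2Space G]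

theorem exists_smooth_bump (g₀ : G) {U : Set G} (hU : U ∈ 𝓝 g₀) :
    ∃ β : C^∞⟮𝓘(ℝ, V), G; ℝ⟯, (∀ᶠ g in 𝓝 g₀, β g = 1) ∧ ∀ g, β g ≠ 0 → g ∈ U := by
  obtain ⟨β, -, hβ⟩ := (SmoothBumpFunction.nhds_basis_tsupport (I := 𝓘(ℝ, V)) g₀).mem_iff.1 hU
  exact ⟨⟨β, β.contMDiff⟩, β.eventuallyEq_one, fun g hg => hβ (subset_tsupport _ hg)⟩

theorem exists_smooth_chart (g₀ : G) (p : V →L[ℝ] ℝ) :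
    ∃ f : C^∞⟮𝓘(ℝ, V), G; ℝ⟯, ∀ᶠ g in 𝓝 g₀, f g = p (extChartAt 𝓘(ℝ, V) g₀ g) := by
  obtain ⟨β⟩ : Nonempty (SmoothBumpFunction 𝓘(ℝ, V) g₀) := inferInstance
  have h1 : ContMDiffOn 𝓘(ℝ, V) 𝓘(ℝ, ℝ) ∞ (fun g => p (extChartAt 𝓘(ℝ, V) g₀ g)) (chartAt V g₀).source :=
    p.contDiff.contMDiff.comp_contMDiffOn contMDiffOn_extChartAt
  refine ⟨⟨_, β.contMDiff_smul h1⟩, ?_⟩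
  filter_upwards [β.eventuallyEq_one] with g hg
  change β g • p (extChartAt 𝓘(ℝ, V) g₀ g) = _
  rw [hg, Pi.one_apply, one_smul]

variable {P : Type*} [NormedAddCommGroup P] [NormedSpace ℝ P] {M : Type*} [TopologicalSpace M] [ChartedSpace P M]

/-- Bump functions force continuity. Cut-off coordinates are globally defined smooth functions that
agree with the chart near a given point, so regularity can be tested on them. -/
theorem contMDiff_of_smooth_functions {n : WithTop ℕ∞} (hn : n ≤ (∞ : WithTop ℕ∞)) {F : M → G}
    (h : ∀ f : C^∞⟮𝓘(ℝ, V), G; ℝ⟯, ContMDiff 𝓘(ℝ, P) 𝓘(ℝ, ℝ) n fun x => f (F x)) :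
    ContMDiff 𝓘(ℝ, P) 𝓘(ℝ, V) n F := by
  intro x₀
  have hc : ContinuousAt F x₀ := by
    intro U hU
    obtain ⟨β, hβ1, hβ⟩ := exists_smooth_bump (V := V) (F x₀) hU
    have h1 := (h β).continuous.continuousAt (x := x₀)
    have h2 : ∀ᶠ x in 𝓝 x₀, β (F x) ≠ 0 := by
      refine h1.eventually_ne ?_
      rw [hβ1.self_of_nhds]; exact one_ne_zero
    exact h2.mono fun x hx => hβ _ hx
  let b := Module.finBasis ℝ V
  choose f hf using fun i => exists_smooth_chart (F x₀) (LinearMap.toContinuousLinearMap (b.coord i))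
  have h1 : ContMDiffAt 𝓘(ℝ, P) 𝓘(ℝ, V) n (fun x => ∑ i, f i (F x) • b i) x₀ := by
    have : ContMDiff 𝓘(ℝ, P) 𝓘(ℝ, V) n (fun x => ∑ i, f i (F x) • b i) :=
      contMDiff_finsetSum fun i _ => (h (f i)).smul contMDiff_const
    exact this x₀
  have h2 : ∀ᶠ x in 𝓝 x₀, ∑ i, f i (F x) • b i = extChartAt 𝓘(ℝ, V) (F x₀) (F x) := by
    have : ∀ᶠ x in 𝓝 x₀, ∀ i, f i (F x) = b.coord i (extChartAt 𝓘(ℝ, V) (F x₀) (F x)) :=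
      eventually_all.2 fun i => hc.eventually (hf i)
    filter_upwards [this] with x hx
    simp only [hx]
    exact b.sum_repr _
  have h3 : ContMDiffAt 𝓘(ℝ, P) 𝓘(ℝ, V) n (fun x => (extChartAt 𝓘(ℝ, V) (F x₀)).symm (∑ i, f i (F x) • b i)) x₀ := by
    refine ContMDiffAt.comp x₀ (g := (extChartAt 𝓘(ℝ, V) (F x₀)).symm) ?_ h1
    rw [h2.self_of_nhds]
    exact ((contMDiffOn_extChartAt_symm (n := ∞) (F x₀)).contMDiffAt (extChartAt_target_mem_nhds (F x₀))).of_le hn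
  refine h3.congr_of_eventuallyEq ?_
  filter_upwards [h2, hc.eventually_mem (extChartAt_source_mem_nhds (I := 𝓘(ℝ, V)) (F x₀))] with x hx hxs
  rw [hx, (extChartAt 𝓘(ℝ, V) (F x₀)).left_inv hxs]

end SmoothFunctions

namespace LoopExtension
variable [IsTopologicalGroup G] {W : Type*} [NormedAddCommGroup W] [NormedSpace ℝ W] [CompleteSpace W]
  {E : Type*} [TopologicalSpace E] [ChartedSpace W E] [Group E] [LieGroup 𝓘(ℝ, W) ∞ E]
  {B : LinearMap.BilinForm ℝ (LieAlg V G)} {σ : ℝ} (L : LoopExtension W E B σ)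

/-- Evaluation of the loops at `s`. -/
def evalHom (s : UnitAddCircle) : E →* G where
  toFun x := L.π x s
  map_one' := by rw [map_one]; rfl
  map_mul' x y := by rw [map_mul]; rfl

theorem sobolevEval_comp (hσ : 3 / 2 < σ) (f : C^∞⟮𝓘(ℝ, V), G; ℝ⟯) (x : E) (s : UnitAddCircle) :
    sobolevEval (σ := σ) (by linarith) s (SobolevLoop.comp f (L.loop x)) = f (L.π x s) :=
  sobolevEval_coeff (by linarith) (u := fun s => f (L.π x s))
    (f.contMDiff.continuous.comp (L.π x).continuous) _ s

variable [FiniteDimensional ℝ V] [T2Space G]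

theorem contMDiff_evalHom (hσ : 3 / 2 < σ) (s : UnitAddCircle) :
    ContMDiff 𝓘(ℝ, W) 𝓘(ℝ, V) ∞ (L.evalHom s) := by
  refine contMDiff_of_smooth_functions le_rfl fun f => ?_
  have h := (sobolevEval (σ := σ) (by linarith) s).contDiff.contMDiff.comp (L.π_smooth f) (n := ∞)
  exact h.congr fun x => (L.sobolevEval_comp hσ f x s).symm

theorem contMDiff_loop (hσ : 3 / 2 < σ) (x : E) :
    ContMDiff 𝓘(ℝ, ℝ) 𝓘(ℝ, V) 1 (fun r : ℝ => L.π x (r : UnitAddCircle)) := by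
  refine contMDiff_of_smooth_functions (by simp) fun f => ?_
  have h := contDiff_sobolevEval hσ (SobolevLoop.comp f (L.loop x))
  refine h.contMDiff.congr fun r => ?_
  exact (L.sobolevEval_comp hσ f x r).symm

/-- Differentiate `x ↦ φ ∘ π x` as a map to the Sobolev space, where `φ` is a global function equal
to `p` composed with the chart near `1`. The derivative is a single Sobolev function, and the chain
rule identifies its value at every `s`. -/
theorem loopDeriv_eq_sobolevEval (hσ : 3 / 2 < σ) (X : LieAlg W E) (p : V →L[ℝ] ℝ) :
    ∃ a : EllTwo, ∀ s, p (loopDeriv L.π X s : LieAlg V G) = sobolevEval (σ := σ) (by linarith) s a := by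
  obtain ⟨f, hf⟩ := exists_smooth_chart (1 : G) p
  have hh := L.π_smooth f
  set h : E → EllTwo := fun x => SobolevLoop.comp f (L.loop x) with hhdef
  refine ⟨modelDeriv W EllTwo h 1 X, fun s => ?_⟩
  have h1 := modelDeriv_comp (V₁ := W) (V₂ := EllTwo) (V₃ := ℝ) (f := h) (g := sobolevEval (σ := σ) (by linarith) s) (x := 1)
    (y := h 1) rfl (sobolevEval (σ := σ) (by linarith) s).differentiableAt.mdifferentiableAt (hh.mdifferentiableAt (by simp)) X
  have h2 := modelDeriv_comp (V₁ := W) (V₂ := V) (V₃ := ℝ) (f := L.evalHom s) (g := f) (x := 1)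
    (y := 1) (map_one _) (f.contMDiff.mdifferentiableAt (by simp)) ((L.contMDiff_evalHom hσ s).mdifferentiableAt (by simp)) X
  have h3 : (fun z => sobolevEval (σ := σ) (by linarith) s (h z)) = fun z => f (L.evalHom s z) :=
    funext fun z => L.sobolevEval_comp hσ f z s
  rw [h3] at h1
  have h4 := h2.symm.trans h1
  have h5 : modelDeriv EllTwo ℝ (sobolevEval (σ := σ) (by linarith) s) (h 1) = sobolevEval (σ := σ) (by linarith) s :=
    (sobolevEval (σ := σ) (by linarith) s).hasFDerivAt.hasMFDerivAt.mfderiv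
  have h6 : modelDeriv V ℝ f (1 : G) = p := by
    have h7 := (p.hasFDerivAt (x := extChartAt 𝓘(ℝ, V) (1 : G) 1)).hasMFDerivAt.comp (1 : G) (hasMFDerivAt_extChartAt_self (V := V) G 1)
    exact (h7.congr_of_eventuallyEq hf).mfderiv
  rw [h5, h6] at h4
  exact h4

theorem isSobolevMap_loopDeriv (hσ : 3 / 2 < σ) (X : LieAlg W E) :
    IsSobolevMap σ (loopDeriv L.π X : UnitAddCircle → LieAlg V G) := by
  constructor
  · let b := Module.finBasis ℝ V
    choose a ha using fun i => L.loopDeriv_eq_sobolevEval hσ X (LinearMap.toContinuousLinearMap (b.coord i))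
    have h1 : (fun s => (loopDeriv L.π X s : V)) = fun s => ∑ i, sobolevEval (σ := σ) (by linarith) s (a i) • b i := by
      funext s
      refine (b.sum_repr (loopDeriv L.π X s : V)).symm.trans ?_
      refine Finset.sum_congr rfl fun i _ => ?_
      rw [← ha]; rfl
    have h2 : Continuous fun s => ∑ i, sobolevEval (σ := σ) (by linarith) s (a i) • b i :=
      continuous_finsetSum _ fun i _ => ((memℓp_sobolevCoeff_eval (σ := σ) (by linarith) (a i)).1).smul continuous_const
    rw [← h1] at h2
    exact h2
  · intro p
    obtain ⟨a, ha⟩ := L.loopDeriv_eq_sobolevEval hσ X p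
    have : (fun s => p (loopDeriv L.π X s : LieAlg V G)) = fun s => sobolevEval (σ := σ) (by linarith) s a := funext ha
    rw [this]
    exact (memℓp_sobolevCoeff_eval _ a).2

/-- The derivative of the projection to the loop group, with values in the model space. -/
def ld (X : LieAlg W E) (r : ℝ) : V := (loopDeriv L.π X (r : UnitAddCircle) : LieAlg V G)

theorem contDiff_ld (hσ : 3 / 2 < σ) (X : LieAlg W E) : ContDiff ℝ 1 (L.ld X) := by
  let b := Module.finBasis ℝ V
  choose a ha using fun i => L.loopDeriv_eq_sobolevEval hσ X (LinearMap.toContinuousLinearMap (b.coord i))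
  have h1 : L.ld X =
      fun r : ℝ => ∑ i, sobolevEval (σ := σ) (by linarith) (r : UnitAddCircle) (a i) • b i := by
    funext s
    refine (b.sum_repr (loopDeriv L.π X s : V)).symm.trans ?_
    refine Finset.sum_congr rfl fun i _ => ?_
    rw [← ha]; rfl
  rw [h1]
  exact ContDiff.sum fun i _ => (contDiff_sobolevEval hσ (a i)).smul contDiff_const

end LoopExtension

theorem IsSobolevMap.contDiff_const_smul {σ : ℝ} [FiniteDimensional ℝ V] {f : UnitAddCircle → ℝ}
    (hf : ContDiff ℝ ∞ fun r : ℝ => f r)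
    (X : LieAlg V G) : IsSobolevMap σ (fun s => f s • X) := by
  have hfc : Continuous f := continuous_coinduced_dom.2 hf.continuous
  refine ⟨hfc.smul continuous_const, fun p => ?_⟩
  refine memℓp_sobolevCoeff_of_contDiff σ ?_
  have : (fun r : ℝ => p (f r • X)) = fun r : ℝ => f r * p X := by
    funext r; rw [map_smul, smul_eq_mul]
  rw [this]
  exact hf.mul contDiff_const

theorem IsSobolevMap.clm_comp {σ : ℝ} {ξ : UnitAddCircle → LieAlg V G} (h : IsSobolevMap σ ξ)
    (q : LieAlg V G →L[ℝ] LieAlg V G) : IsSobolevMap σ (fun s => q (ξ s)) :=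
  ⟨q.continuous.comp h.1, fun p => h.2 (p.comp q)⟩

/-- The topology of the loop group is finer than that of uniform convergence. -/
theorem SobolevLoop.eventually_uniform [FiniteDimensional ℝ V] [T2Space G] [IsTopologicalGroup G]
    {σ : ℝ} (hσ : 1 / 2 < σ)
    (γ : SobolevLoop V G σ) {N : Set G} (hN : N ∈ 𝓝 (1 : G)) :
    ∀ᶠ γ' in 𝓝 γ, ∀ s, (γ.1 s)⁻¹ * γ'.1 s ∈ N := by
  obtain ⟨N', hN', hNN⟩ : ∃ N' ∈ 𝓝 (1 : G), ∀ a ∈ N', ∀ b ∈ N', a⁻¹ * b ∈ N := by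
    have : Tendsto (fun p : G × G => p.1⁻¹ * p.2) (𝓝 (1, 1)) (𝓝 1) := by
      have h : Continuous fun p : G × G => p.1⁻¹ * p.2 := by fun_prop
      simpa using h.tendsto (1, 1)
    have h2 := this hN
    rw [nhds_prod_eq, mem_map, mem_prod_same_iff] at h2
    obtain ⟨t, ht, hts⟩ := h2
    exact ⟨t, ht, fun a ha b hb => hts (mk_mem_prod ha hb)⟩
  have key : ∀ s₀ : UnitAddCircle, ∃ J ∈ 𝓝 s₀, ∀ᶠ γ' in 𝓝 γ, ∀ s ∈ J, (γ.1 s)⁻¹ * γ'.1 s ∈ N := by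
    intro s₀
    have hU : {g : G | (γ.1 s₀)⁻¹ * g ∈ N'} ∈ 𝓝 (γ.1 s₀) := by
      have : ContinuousAt (fun g : G => (γ.1 s₀)⁻¹ * g) (γ.1 s₀) := by fun_prop
      exact this.eventually_mem (by simpa using hN')
    obtain ⟨β, hβ1, hβ⟩ := exists_smooth_bump (V := V) (γ.1 s₀) hU
    refine ⟨{s | β (γ.1 s) = 1 ∧ (γ.1 s₀)⁻¹ * γ.1 s ∈ N'}, ?_, ?_⟩
    · have hc : ContinuousAt γ.1 s₀ := γ.1.continuous.continuousAt
      exact (hc.eventually hβ1).and (hc.eventually_mem hU)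
    · have hcont : Continuous (SobolevLoop.comp (σ := σ) β : SobolevLoop V G σ → _) :=
        continuous_iff_le_induced.2 (iInf_le _ β)
      -- The kernel norm bounds point values by the Sobolev norm. If `β ∘ γ'` is within distance one
      -- of `β ∘ γ`, which equals `1` on the set considered, then `β` is nonzero at `γ' s`, and this
      -- confines `γ' s` to the support neighbourhood.
      have h1 : ∀ᶠ γ' in 𝓝 γ, ‖sobolevKernel hσ 0‖ * ‖SobolevLoop.comp β γ' - SobolevLoop.comp β γ‖ < 1 := by
        have : Continuous fun γ' : SobolevLoop V G σ => ‖sobolevKernel hσ 0‖ * ‖SobolevLoop.comp β γ' - SobolevLoop.comp β γ‖ := by fun_prop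
        exact this.continuousAt.eventually_lt_const (by simp)
      filter_upwards [h1] with γ' hγ' s hs
      have h2 := norm_sobolevEval_le hσ s (SobolevLoop.comp β γ' - SobolevLoop.comp β γ)
      have ev : ∀ γ' : SobolevLoop V G σ, sobolevEval hσ s (SobolevLoop.comp β γ') = β (γ'.1 s) := fun γ' =>
        sobolevEval_coeff hσ (u := fun s => β (γ'.1 s)) (β.contMDiff.continuous.comp γ'.1.continuous) _ s
      rw [map_sub, ev, ev, hs.1] at h2
      have h3 : β (γ'.1 s) ≠ 0 := by
        intro h0
        rw [h0] at h2
        norm_num at h2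
        linarith
      have h4 := hNN _ hs.2 _ (hβ _ h3)
      simpa [mul_assoc] using h4
  choose J hJ hJγ using key
  obtain ⟨t, ht⟩ := CompactSpace.elim_nhds_subcover J hJ
  have h5 : ∀ᶠ γ' in 𝓝 γ, ∀ s₀ ∈ t, ∀ s ∈ J s₀, (γ.1 s)⁻¹ * γ'.1 s ∈ N :=
    (Filter.eventually_all_finset t).2 fun s₀ _ => hJγ s₀
  filter_upwards [h5] with γ' hγ' s
  have : s ∈ ⋃ x ∈ t, J x := by
    have h6 : s ∈ (⊤ : Set UnitAddCircle) := trivial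
    rwa [← ht] at h6
  obtain ⟨s₀, hs₀, hs⟩ := mem_iUnion₂.1 this
  exact hγ' s₀ hs₀ s hs

end

/-! ### The adjoint action on the central component. -/

noncomputable section

open scoped Manifold ContDiff ENNReal Topology
open VectorField Set Filter
variable {V : Type*} [NormedAddCommGroup V] [NormedSpace ℝ V] [CompleteSpace V]
  {G : Type*} [TopologicalSpace G] [ChartedSpace V G] [Group G] [LieGroup 𝓘(ℝ, V) ∞ G]

open Classical in
/-- The left logarithmic derivative `c⁻¹ c'` of a curve in `G`. -/
def leftLogDeriv (V : Type*) [NormedAddCommGroup V] [NormedSpace ℝ V] [CompleteSpace V]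
    [ChartedSpace V G] [LieGroup 𝓘(ℝ, V) ∞ G] (c : ℝ → G) (t : ℝ) : V :=
  if h : ∃ X : LieAlg V G, HasLogDerivAt c X t then (h.choose : LieAlg V G) else 0

theorem hasLogDerivAt_leftLogDeriv {c : ℝ → G} {t : ℝ} (h : MDifferentiableAt 𝓘(ℝ, ℝ) 𝓘(ℝ, V) c t) :
    HasLogDerivAt c (leftLogDeriv V c t : LieAlg V G) t := by
  have h1 := exists_hasLogDerivAt h
  have h2 : leftLogDeriv V c t = (h1.choose : LieAlg V G) := dif_pos h1
  have h3 : ∀ v : V, v = (h1.choose : LieAlg V G) → HasLogDerivAt c (v : LieAlg V G) t := by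
    rintro _ rfl
    exact h1.choose_spec
  exact h3 _ h2

theorem HasLogDerivAt.leftLogDeriv_eq {c : ℝ → G} {t : ℝ} {X : LieAlg V G}
    (h : HasLogDerivAt c X t) :
    leftLogDeriv V c t = (X : V) :=
  (hasLogDerivAt_leftLogDeriv h.mdifferentiableAt).unique h

theorem continuous_leftLogDeriv {c : ℝ → G} (hc : ContMDiff 𝓘(ℝ, ℝ) 𝓘(ℝ, V) 1 c) :
    Continuous (leftLogDeriv V c) := by
  have h : ContDiff ℝ 0 (leftLogDeriv V c) := contDiff_of_hasLogDerivAt (n := 0) (by simp) (by simpa using hc)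
    fun t => hasLogDerivAt_leftLogDeriv (hc.mdifferentiableAt (by simp))
  exact h.continuous

theorem HasLogDerivAt.modelDeriv_eq {c : ℝ → G} {t : ℝ} {X : LieAlg V G} (h : HasLogDerivAt c X t)
    (h1 : c t = 1) :
    modelDeriv ℝ V c t 1 = (X : V) := by
  have h2 : modelDeriv ℝ V c t 1 = (1 : ℝ) • (mulInvariantVectorField X (c t) : V) :=
    DFunLike.congr_fun (HasMFDerivAt.mfderiv h) (1 : ℝ)
  have h3 : ∀ g : G, g = 1 → (mulInvariantVectorField X g : V) = X := by
    rintro _ rfl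
    exact mulInvariantVectorField_one X
  rw [h2]
  exact (one_smul ℝ _).trans (h3 _ h1)

theorem bracketModel_add (X Y Z : V) :
    bracketModel V G X (Y + Z) = bracketModel V G X Y + bracketModel V G X Z :=
  lie_add (show LieAlg V G from X) (show LieAlg V G from Y) (show LieAlg V G from Z)

theorem bracketModel_smul (X Y : V) (r : ℝ) :
    bracketModel V G X (r • Y) = r • bracketModel V G X Y :=
  lie_smul r (show LieAlg V G from X) (show LieAlg V G from Y)

variable [FiniteDimensional ℝ V]

variable (V G) in
/-- The Lie bracket as a continuous bilinear map. -/
def bracketCLM : V →L[ℝ] V →L[ℝ] V :=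
  LinearMap.toContinuousLinearMap ((LinearMap.toContinuousLinearMap : (V →ₗ[ℝ] V) ≃ₗ[ℝ] V →L[ℝ] V).toLinearMap ∘ₗ
    (LinearMap.mk₂ ℝ (bracketModel V G)
      (fun X Y Z => add_lie (show LieAlg V G from X) (show LieAlg V G from Y) (show LieAlg V G from Z))
      (fun r X Y => smul_lie r (show LieAlg V G from X) (show LieAlg V G from Y))
      bracketModel_add (fun r X Y => bracketModel_smul X Y r)))

theorem bracketCLM_apply (X Y : V) : bracketCLM V G X Y = bracketModel V G X Y := rfl

theorem HasLogDerivAt.hasDerivAt_Ad_comp {c : ℝ → G} {X : V} {t : ℝ}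
    (h : HasLogDerivAt c (X : LieAlg V G) t)
    {Y : ℝ → V} {Y' : V} (hY : HasDerivAt Y Y' t) :
    HasDerivAt (fun s => AdL (c s) (Y s)) (AdL (c t) (bracketModel V G X (Y t) + Y')) t := by
  let b := Module.finBasis ℝ V
  have h1 : ∀ i, HasDerivAt (fun s => b.repr (Y s) i) (b.repr Y' i) t := fun i =>
    (LinearMap.toContinuousLinearMap (b.coord i)).hasFDerivAt.comp_hasDerivAt t hY
  have h2 : HasDerivAt (fun s => ∑ i, b.repr (Y s) i • AdL (c s) (b i))
      (∑ i, (b.repr (Y t) i • AdL (c t) (bracketModel V G X (b i)) + b.repr Y' i • AdL (c t) (b i))) t :=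
    HasDerivAt.fun_sum fun i _ => (h1 i).smul (h.hasDerivAt_Ad (b i))
  have h3 : ∀ s, ∑ i, b.repr (Y s) i • AdL (c s) (b i) = AdL (c s) (Y s) := by
    intro s
    conv_rhs => rw [← b.sum_repr (Y s)]
    simp only [map_sum, map_smul]
  have h4 : ∑ i, (b.repr (Y t) i • AdL (c t) (bracketModel V G X (b i)) + b.repr Y' i • AdL (c t) (b i)) =
      AdL (c t) (bracketModel V G X (Y t) + Y') := by
    rw [Finset.sum_add_distrib, map_add]
    congr 1
    · rw [← bracketCLM_apply]
      conv_rhs => rw [← b.sum_repr (Y t)]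
      simp only [map_sum, map_smul]
      rfl
    · conv_rhs => rw [← b.sum_repr Y']
      simp only [map_sum, map_smul]
  rw [h4] at h2
  exact h2.congr_of_eventuallyEq (Eventually.of_forall fun s => (h3 s).symm)

/-- A bilinear form on the Lie algebra as a continuous bilinear form on the model space. -/
def formCLM (B : LinearMap.BilinForm ℝ (LieAlg V G)) : V →L[ℝ] V →L[ℝ] ℝ :=
  LinearMap.toContinuousLinearMap
    ((LinearMap.toContinuousLinearMap : (V →ₗ[ℝ] ℝ) ≃ₗ[ℝ] V →L[ℝ] ℝ).toLinearMap ∘ₗ (B : V →ₗ[ℝ] V →ₗ[ℝ] ℝ))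

theorem formCLM_apply (B : LinearMap.BilinForm ℝ (LieAlg V G)) (X Y : LieAlg V G) : formCLM B X Y = B X Y := rfl

/-- If `𝔤 = [𝔤, 𝔤]`, then every element is a sum of brackets depending linearly on it. -/
theorem exists_bracket_section
    (h : Submodule.span ℝ {z : LieAlg V G | ∃ x y : LieAlg V G, ⁅x, y⁆ = z} = ⊤) :
    ∃ (n : ℕ) (a : Fin n → LieAlg V G)
    (q : Fin n → LieAlg V G →ₗ[ℝ] LieAlg V G), ∀ x, x = ∑ i, ⁅a i, q i x⁆ := by
  let b := Module.finBasis ℝ (LieAlg V G)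
  let Φ : (Fin (Module.finrank ℝ (LieAlg V G)) → LieAlg V G) →ₗ[ℝ] LieAlg V G :=
    ∑ i, (LieModule.toEnd ℝ (LieAlg V G) (LieAlg V G) (b i)) ∘ₗ LinearMap.proj i
  have hΦ : ∀ y, Φ y = ∑ i, ⁅b i, y i⁆ := fun y => by simp [Φ, LinearMap.sum_apply]
  have hs : LinearMap.range Φ = ⊤ := by
    rw [eq_top_iff, ← h, Submodule.span_le]
    rintro _ ⟨x, y, rfl⟩
    refine ⟨fun i => b.repr x i • y, ?_⟩
    rw [hΦ]
    conv_rhs => rw [← b.sum_repr x]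
    rw [sum_lie] 
    simp only [lie_smul, smul_lie]
  obtain ⟨Q, hQ⟩ := LinearMap.exists_rightInverse_of_surjective Φ hs
  refine ⟨_, b, fun i => LinearMap.proj i ∘ₗ Q, fun x => ?_⟩
  have := LinearMap.congr_fun hQ x
  simp only [LinearMap.comp_apply, LinearMap.id_apply] at this
  rw [hΦ] at this
  exact this.symm

namespace LoopExtension
variable [IsTopologicalGroup G] [T2Space G] [ConnectedSpace G]
  {W : Type*} [NormedAddCommGroup W] [NormedSpace ℝ W] [CompleteSpace W]
  {E : Type*} [TopologicalSpace E] [ChartedSpace W E] [Group E] [LieGroup 𝓘(ℝ, W) ∞ E] [T2Space E]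
  {B : LinearMap.BilinForm ℝ (LieAlg V G)} {σ : ℝ} (L : LoopExtension W E B σ)

/-- The loop of `x`, as a curve on the real line. -/
def path (x : E) (r : ℝ) : G := L.π x (r : UnitAddCircle)

theorem hasLogDerivAt_path (hσ : 3 / 2 < σ) (x : E) (r : ℝ) :
    HasLogDerivAt (L.path x) (leftLogDeriv V (L.path x) r : LieAlg V G) r :=
  hasLogDerivAt_leftLogDeriv ((L.contMDiff_loop hσ x).mdifferentiableAt (by simp))

theorem ld_Ad (hσ : 3 / 2 < σ) (x : E) (X : LieAlg W E) (r : ℝ) :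
    L.ld (Ad x X) r = AdL (L.path x r) (L.ld X r) :=
  lieMap_Ad (L.contMDiff_evalHom hσ r) x X

theorem ld_lie (hσ : 3 / 2 < σ) (X Y : LieAlg W E) (r : ℝ) :
    L.ld ⁅X, Y⁆ r = bracketModel V G (L.ld X r) (L.ld Y r) :=
  lieMap_lie (L.contMDiff_evalHom hσ r) X Y

theorem ld_add (X Y : LieAlg W E) (r : ℝ) : L.ld (X + Y) r = L.ld X r + L.ld Y r :=
  lieMap_add (L.evalHom r) X Y

theorem ld_smul (a : ℝ) (X : LieAlg W E) (r : ℝ) : L.ld (a • X) r = a • L.ld X r :=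
  lieMap_smul (L.evalHom r) a X

theorem hasLogDerivAt_centralCurve (t : ℝ) :
    HasLogDerivAt (fun r : ℝ => L.ι (Circle.exp (2 * Real.pi * r)))
    (centralGenerator L.ι : LieAlg W E) t := by
  refine hasLogDerivAt_of_hom (fun s t => ?_) ?_ t
  · rw [mul_add, Circle.exp_add, map_mul]
  have hd : MDifferentiableAt 𝓘(ℝ, ℝ) 𝓘(ℝ, W) (fun r : ℝ => L.ι (Circle.exp (2 * Real.pi * r))) 0 := by
    have h1 : ContMDiff 𝓘(ℝ, ℝ) 𝓘(ℝ, ℝ) ∞ (fun r : ℝ => 2 * Real.pi * r) := ContDiff.contMDiff (by fun_prop)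
    exact ((L.ι_smooth.comp (contMDiff_circleExp.comp h1)).mdifferentiableAt (by simp))
  obtain ⟨X, hX⟩ := exists_hasLogDerivAt hd
  have h2 : modelDeriv ℝ W (fun r : ℝ => L.ι (Circle.exp (2 * Real.pi * r))) 0 1 = (X : W) :=
    hX.modelDeriv_eq (by simp)
  have h3 : (centralGenerator L.ι : LieAlg W E) = X := h2
  rw [h3]
  exact hX

theorem Ad_centralGenerator (x : E) :
    Ad x (centralGenerator L.ι : LieAlg W E) = centralGenerator L.ι := by
  have h := (L.hasLogDerivAt_centralCurve 0).hom (contMDiff_conj x)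
  have e : (fun s : ℝ => (MulAut.conj x).toMonoidHom (L.ι (Circle.exp (2 * Real.pi * s)))) =
      fun r : ℝ => L.ι (Circle.exp (2 * Real.pi * r)) := by
    funext s
    change x * L.ι (Circle.exp (2 * Real.pi * s)) * x⁻¹ = _
    rw [← L.ι_central, mul_inv_cancel_right]
  rw [e] at h
  exact h.unique (L.hasLogDerivAt_centralCurve 0)

theorem lieExp_centralGenerator (r : ℝ) :
    (lieExp (r • (centralGenerator L.ι : LieAlg W E)) : E) = L.ι (Circle.exp (2 * Real.pi * r)) :=
  (isOneParam_of_hasLogDerivAt (by simp) L.hasLogDerivAt_centralCurve).lieExp_smul r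

theorem loopCocycle_eq (X Y : LieAlg W E) : loopCocycle B (loopDeriv L.π Y) (loopDeriv L.π X) =
    ∫ s in (0 : ℝ)..1, formCLM B (L.ld Y s) (deriv (L.ld X) s) := rfl

/-- Differentiating `Ad γ ξ` along the circle gives `Ad γ ([γ⁻¹γ', ξ] + ξ')`. Invariance of `B`
removes `Ad γ` from the cocycle, and moving the bracket across `B` turns the extra term into the
pairing of `γ⁻¹γ'` with `[ξ, η]`. -/
theorem alpha_Ad_lie (hσ : 3 / 2 < σ) (hinv : ∀ x y z, B ⁅x, y⁆ z = B x ⁅y, z⁆)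
    (hsymm : ∀ x y, B x y = B y x)
    {α : LieAlg W E →L[ℝ] ℝ}
    (hα : ∀ X Y : LieAlg W E, α ⁅X, Y⁆ = loopCocycle B (loopDeriv L.π Y) (loopDeriv L.π X)) (x : E)
    (X Y : LieAlg W E) :
    α (Ad x ⁅X, Y⁆) = α ⁅X, Y⁆ + ∫ s in (0 : ℝ)..1, formCLM B (leftLogDeriv V (L.path x) s)
    (L.ld ⁅X, Y⁆ s) := by
  rw [Ad_lie, hα, hα, loopCocycle_eq, loopCocycle_eq]
  have hd : ∀ s, HasDerivAt (L.ld X) (deriv (L.ld X) s) s := fun s =>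
    ((L.contDiff_ld hσ X).differentiable (by simp) s).hasDerivAt
  have h1 : ∀ s, deriv (L.ld (Ad x X)) s = AdL (L.path x s) (bracketModel V G (leftLogDeriv V (L.path x) s) (L.ld X s) + deriv (L.ld X) s) := by
    intro s
    have h2 : L.ld (Ad x X) = fun r => AdL (L.path x r) (L.ld X r) := funext fun r => L.ld_Ad hσ x X r
    rw [h2]
    exact ((L.hasLogDerivAt_path hσ x s).hasDerivAt_Ad_comp (hd s)).deriv
  have hAd : ∀ (g : G) (a b : V), formCLM B (AdL g a) (AdL g b) = formCLM B a b := fun g a b => Ad_invariant B hinv g a b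
  have h3 : ∀ s, formCLM B (L.ld (Ad x Y) s) (deriv (L.ld (Ad x X)) s) =
      formCLM B (L.ld Y s) (deriv (L.ld X) s) + formCLM B (leftLogDeriv V (L.path x) s) (L.ld ⁅X, Y⁆ s) := by
    intro s
    rw [h1, L.ld_Ad hσ, hAd, map_add, add_comm, L.ld_lie hσ]
    congr 1
    have e1 : formCLM B (bracketModel V G (leftLogDeriv V (L.path x) s) (L.ld X s)) (L.ld Y s) =
      formCLM B (leftLogDeriv V (L.path x) s) (bracketModel V G (L.ld X s) (L.ld Y s)) := hinv _ _ _
    have e2 : formCLM B (L.ld Y s) (bracketModel V G (leftLogDeriv V (L.path x) s) (L.ld X s)) =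
      formCLM B (bracketModel V G (leftLogDeriv V (L.path x) s) (L.ld X s)) (L.ld Y s) := hsymm _ _
    rw [e2, e1]
  have hcu : Continuous (leftLogDeriv V (L.path x)) := continuous_leftLogDeriv (L.contMDiff_loop hσ x)
  have hcld : ∀ Z, Continuous (L.ld Z) := fun Z => (L.contDiff_ld hσ Z).continuous
  have hcd : Continuous (deriv (L.ld X)) := (L.contDiff_ld hσ X).continuous_deriv (by simp)
  simp only [h3]
  refine intervalIntegral.integral_add ?_ ?_
  · have := hcld Y
    exact Continuous.intervalIntegrable (by fun_prop) _ _
  · have := hcld ⁅X, Y⁆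
    exact Continuous.intervalIntegrable (by fun_prop) _ _

theorem ld_centralGenerator (r : ℝ) : L.ld (centralGenerator L.ι) r = 0 := by
  have h := (L.exact_algebra (centralGenerator L.ι)).2 ⟨1, (one_smul _ _).symm⟩
  exact congrFun h r

theorem ld_eq_zero_iff (X : LieAlg W E) : (∀ r, L.ld X r = 0) ↔ ∃ a :
    ℝ, X = a • centralGenerator L.ι := by
  rw [← L.exact_algebra]
  refine ⟨fun h => ?_, fun h r => congrFun h r⟩
  funext s
  induction s using QuotientAddGroup.induction_on with
  | H r => exact h r

theorem exists_ld_eq {ξ : UnitAddCircle → LieAlg V G} (h : IsSobolevMap σ ξ) : ∃ X :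
    LieAlg W E, ∀ r : ℝ, L.ld X r = ξ r := by
  obtain ⟨X, hX⟩ := L.deriv_surjective ξ h
  exact ⟨X, fun r => congrFun hX r⟩

theorem ld_sum {n : ℕ} (X : Fin n → LieAlg W E) (r : ℝ) :
    L.ld (∑ i, X i) r = ∑ i, L.ld (X i) r := by
  let F : LieAlg W E →+ V := ⟨⟨fun X => L.ld X r, by have := L.ld_smul 0 0 r; simpa using this⟩, fun X Y => L.ld_add X Y r⟩
  exact map_sum F X _

/-- The adjoint action on the central component. -/
theorem alpha_Ad (hσ : 3 / 2 < σ) (hinv : ∀ x y z, B ⁅x, y⁆ z = B x ⁅y, z⁆)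
    (hsymm : ∀ x y, B x y = B y x)
    (hperf : Submodule.span ℝ {z : LieAlg V G | ∃ x y : LieAlg V G, ⁅x, y⁆ = z} = ⊤)
    {α : LieAlg W E →L[ℝ] ℝ}
    (hα : ∀ X Y : LieAlg W E, α ⁅X, Y⁆ = loopCocycle B (loopDeriv L.π Y) (loopDeriv L.π X)) (x : E)
    (X : LieAlg W E) :
    α (Ad x X) = α X + ∫ s in (0 : ℝ)..1, formCLM B (leftLogDeriv V (L.path x) s) (L.ld X s) := by
  -- Since `𝔤` is perfect, the loop of `X` is a sum of brackets of constant loops with Sobolev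
  -- loops. So `X` is a sum of brackets up to a central element, which is fixed by `Ad` and has zero
  -- loop.
  obtain ⟨n, a, q, haq⟩ := exists_bracket_section hperf
  have hA : ∀ i, ∃ A : LieAlg W E, ∀ r : ℝ, L.ld A r = a i := fun i => by
    have h1 : IsSobolevMap σ (fun _ : UnitAddCircle => (1 : ℝ) • a i) :=
      IsSobolevMap.contDiff_const_smul (f := fun _ => 1) contDiff_const (a i)
    obtain ⟨A, hA⟩ := L.exists_ld_eq h1
    exact ⟨A, fun r => (hA r).trans (one_smul _ _)⟩
  choose A hA using hA
  have hY : ∀ i, ∃ Y : LieAlg W E, ∀ r : ℝ, L.ld Y r = q i (L.ld X r) := fun i => by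
    let Q₀ : V →ₗ[ℝ] V := q i
    let Q : V →L[ℝ] V := LinearMap.toContinuousLinearMap Q₀
    exact L.exists_ld_eq ((L.isSobolevMap_loopDeriv hσ X).clm_comp Q)
  choose Y hY using hY
  have hsum : ∀ r, L.ld (∑ i, ⁅A i, Y i⁆) r = L.ld X r := by
    intro r
    rw [L.ld_sum]
    refine Eq.trans (Finset.sum_congr rfl fun i _ => ?_) (haq (L.ld X r)).symm
    rw [L.ld_lie hσ, hA, hY]
    rfl
  have hdiff : ∃ c : ℝ, X = (∑ i, ⁅A i, Y i⁆) + c • centralGenerator L.ι := by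
    obtain ⟨c, hc⟩ := (L.ld_eq_zero_iff (X + (-1 : ℝ) • ∑ i, ⁅A i, Y i⁆)).1 fun r => by
      rw [L.ld_add, L.ld_smul, hsum]; simp
    refine ⟨c, ?_⟩
    rw [← hc]
    simp
  obtain ⟨c, hc⟩ := hdiff
  have hcu : Continuous (leftLogDeriv V (L.path x)) := continuous_leftLogDeriv (L.contMDiff_loop hσ x)
  have hint : ∫ s in (0 : ℝ)..1, formCLM B (leftLogDeriv V (L.path x) s) (L.ld X s) =
      ∑ i, ∫ s in (0 : ℝ)..1, formCLM B (leftLogDeriv V (L.path x) s) (L.ld ⁅A i, Y i⁆ s) := by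
    rw [← intervalIntegral.integral_finsetSum]
    · refine intervalIntegral.integral_congr fun s _ => ?_
      rw [← hsum s, L.ld_sum, map_sum]
    · intro i _
      have := (L.contDiff_ld hσ ⁅A i, Y i⁆).continuous
      exact Continuous.intervalIntegrable (by fun_prop) _ _
  have hAdsum : Ad x (∑ i, ⁅A i, Y i⁆) = ∑ i, Ad x ⁅A i, Y i⁆ := by
    let F : LieAlg W E →+ LieAlg W E := ⟨⟨fun X => Ad x X, by have := Ad_smul x 0 (0 : LieAlg W E); simpa using this⟩, fun X Y => Ad_add x X Y⟩
    exact map_sum F (fun i => ⁅A i, Y i⁆) _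
  rw [hint, hc, Ad_add, Ad_smul, L.Ad_centralGenerator, hAdsum, map_add, map_add, map_sum, map_sum]
  simp only [L.alpha_Ad_lie hσ hinv hsymm hα, Finset.sum_add_distrib]
  ring

end LoopExtension

end

/-! ### Conjugation phases and the winding of loops in the torus. -/

noncomputable section

open scoped Manifold ContDiff ENNReal Topology
open VectorField Set Filter
variable {V : Type*} [NormedAddCommGroup V] [NormedSpace ℝ V] [CompleteSpace V]
  {G : Type*} [TopologicalSpace G] [ChartedSpace V G] [Group G] [LieGroup 𝓘(ℝ, V) ∞ G]
variable [FiniteDimensional ℝ V]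

namespace LoopExtension
variable [IsTopologicalGroup G] [T2Space G] [ConnectedSpace G]
  {W : Type*} [NormedAddCommGroup W] [NormedSpace ℝ W] [CompleteSpace W]
  {E : Type*} [TopologicalSpace E] [ChartedSpace W E] [Group E] [LieGroup 𝓘(ℝ, W) ∞ E] [T2Space E]
  {B : LinearMap.BilinForm ℝ (LieAlg V G)} {σ : ℝ} (L : LoopExtension W E B σ)

theorem lieExp_add_centralGenerator (X : LieAlg W E) (a : ℝ) :
    (lieExp (X + a • (centralGenerator L.ι : LieAlg W E)) : E) = L.ι
    (Circle.exp (2 * Real.pi * a)) * lieExp X := by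
  have h1 := isOneParam_lieExp (G := E) X
  have h2 := isOneParam_lieExp (G := E) (a • (centralGenerator L.ι : LieAlg W E))
  have h3 := h1.mul h2 fun s t => by
    rw [smul_smul, L.lieExp_centralGenerator, L.ι_central]
  rw [h3.lieExp_eq]
  simp only [one_smul]
  rw [L.lieExp_centralGenerator, L.ι_central]

/-- Conjugation by `x` multiplies `exp X` by a phase if `Ad` of the loop of `x` fixes the loop of `X`. -/
theorem conj_lieExp_of_fixed (hσ : 3 / 2 < σ) (hinv : ∀ x y z, B ⁅x, y⁆ z = B x ⁅y, z⁆)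
    (hsymm : ∀ x y, B x y = B y x)
    (hperf : Submodule.span ℝ {z : LieAlg V G | ∃ x y : LieAlg V G, ⁅x, y⁆ = z} = ⊤)
    (x : E) (X : LieAlg W E) (h : ∀ r, AdL (L.path x r) (L.ld X r) = L.ld X r) :
    x * lieExp X * x⁻¹ = L.ι (Circle.exp (2 * Real.pi *
      ∫ s in (0 : ℝ)..1, formCLM B (leftLogDeriv V (L.path x) s) (L.ld X s))) * lieExp X := by
  obtain ⟨α, hα1, hα⟩ := L.bracket
  have h1 := L.alpha_Ad hσ hinv hsymm hperf hα x X
  -- `Ad x X` and `X` lie over the same loop, so they differ by a multiple of the central generator;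
  -- applying `α` reads off the coefficient.
  obtain ⟨a, ha⟩ := (L.ld_eq_zero_iff (Ad x X + (-1 : ℝ) • X)).1 fun r => by
    rw [L.ld_add, L.ld_smul, L.ld_Ad hσ, h]; simp
  have h2 : Ad x X = X + a • (centralGenerator L.ι : LieAlg W E) := by
    rw [← ha]; simp
  rw [h2, map_add, map_smul, hα1] at h1
  have h3 : a = ∫ s in (0 : ℝ)..1, formCLM B (leftLogDeriv V (L.path x) s) (L.ld X s) := by
    simpa using h1
  rw [conj_lieExp, h2, L.lieExp_add_centralGenerator, h3]

theorem exists_loop_eq (γ : SobolevLoop V G σ) : ∃ x : E, L.loop x = γ := by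
  obtain ⟨x, hx⟩ := L.range_eq.superset γ.2
  exact ⟨x, Subtype.ext hx⟩

theorem eq_central_mul_of_π_eq {x y : E} (h : L.π x = L.π y) : ∃ z, x = L.ι z * y := by
  have h1 : x * y⁻¹ ∈ L.π.ker := by rw [MonoidHom.mem_ker, map_mul, map_inv, h, mul_inv_cancel]
  rw [L.exact_group] at h1
  obtain ⟨z, hz⟩ := h1
  exact ⟨z, by rw [hz]; simp⟩

end LoopExtension

namespace MaximalTorus
variable [IsTopologicalGroup G] [T2Space G] (T : MaximalTorus G)

/-- The integral of the logarithmic derivative of a loop in the torus is an element of the lattice. -/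
theorem neg_integral_mem_lattice {γ : ℝ → G} (hc : ContMDiff 𝓘(ℝ, ℝ) 𝓘(ℝ, V) 1 γ)
    (hγ : ∀ s, γ s ∈ T.toSubgroup) (h1 : γ 1 = γ 0) :
    ((-∫ s in (0 : ℝ)..1, leftLogDeriv V γ s : V) : LieAlg V G) ∈ T.lattice V := by
  have hd : ∀ s, HasLogDerivAt γ (leftLogDeriv V γ s : LieAlg V G) s := fun s =>
    hasLogDerivAt_leftLogDeriv (hc.mdifferentiableAt (by simp))
  have hcu := continuous_leftLogDeriv hc
  have hm := T.integral_mem hcu (fun s => T.mem_lieAlgebra_of_hasLogDerivAt hγ (hd s)) 0 1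
  have h2 := T.eq_mul_lieExp_integral hcu hγ hd 1
  rw [h1, left_eq_mul] at h2
  have h3 : ((∫ s in (0 : ℝ)..1, leftLogDeriv V γ s : V) : LieAlg V G) ∈ T.lattice V := ⟨hm, h2⟩
  exact neg_mem h3

theorem leftLogDeriv_latticeLoop (ξ : T.lattice V) (s : ℝ) :
    leftLogDeriv V (fun r : ℝ => T.latticeLoop V (.ofAdd ξ) (r : UnitAddCircle)) s =
    (-(ξ : LieAlg V G) : LieAlg V G) := by
  refine HasLogDerivAt.leftLogDeriv_eq ?_
  have h := hasLogDerivAt_lieExp (-(ξ : LieAlg V G)) s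
  refine h.congr (Eventually.of_forall fun r => ?_)
  exact congrArg lieExp (smul_neg r (ξ : LieAlg V G)).symm

/-- Loops in the torus that are close to each other have the same winding. -/
theorem exists_nhds_integral_eq (V : Type*) [NormedAddCommGroup V] [NormedSpace ℝ V]
    [CompleteSpace V]
    [ChartedSpace V G] [LieGroup 𝓘(ℝ, V) ∞ G] [FiniteDimensional ℝ V] :
    ∃ N ∈ 𝓝 (1 : G), ∀ γ γ' :
    ℝ → G, ContMDiff 𝓘(ℝ, ℝ) 𝓘(ℝ, V) 1 γ → ContMDiff 𝓘(ℝ, ℝ) 𝓘(ℝ, V) 1 γ' →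
    (∀ s, γ s ∈ T.toSubgroup) → (∀ s, γ' s ∈ T.toSubgroup) → γ 0 = 1 → γ 1 = 1 → γ' 0 = 1 →
    γ' 1 = 1 →
    (∀ s, (γ s)⁻¹ * γ' s ∈ N) → ∫ s in (0 : ℝ)..1, leftLogDeriv V γ s = ∫ s in
    (0 : ℝ)..1, leftLogDeriv V γ' s := by
  obtain ⟨N, hN, h⟩ := T.exists_nhds_path_closed V
  refine ⟨N, hN, fun γ γ' hc hc' hT hT' h0 h1 h0' h1' hn => ?_⟩
  have hd : ∀ s, HasLogDerivAt γ (leftLogDeriv V γ s : LieAlg V G) s := fun s =>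
    hasLogDerivAt_leftLogDeriv (hc.mdifferentiableAt (by simp))
  have hd' : ∀ s, HasLogDerivAt γ' (leftLogDeriv V γ' s : LieAlg V G) s := fun s =>
    hasLogDerivAt_leftLogDeriv (hc'.mdifferentiableAt (by simp))
  have hcu := continuous_leftLogDeriv hc
  have hcu' := continuous_leftLogDeriv hc'
  have hmT : ∀ s, leftLogDeriv V γ s ∈ T.lieAlgebra V := fun s => T.mem_lieAlgebra_of_hasLogDerivAt hT (hd s)
  have hmT' : ∀ s, leftLogDeriv V γ' s ∈ T.lieAlgebra V := fun s => T.mem_lieAlgebra_of_hasLogDerivAt hT' (hd' s)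
  -- By commutativity the quotient loop has the difference as its logarithmic derivative. Its
  -- primitive is a path in `𝔱` whose exponential is a loop near `1`, so the path closes up and the
  -- two integrals agree.
  have hδ : ∀ s, HasLogDerivAt (fun s => (γ s)⁻¹ * γ' s) ((leftLogDeriv V γ' s - leftLogDeriv V γ s : V) : LieAlg V G) s := by
    intro s
    have h2 := (hd s).inv.mul (hd' s)
    have e1 : Ad (γ s) (leftLogDeriv V γ s : LieAlg V G) = (leftLogDeriv V γ s : LieAlg V G) := T.Ad_eq_of_mem (hT s) (hmT s)
    have e2 : Ad (γ' s)⁻¹ (-Ad (γ s) (leftLogDeriv V γ s : LieAlg V G)) = -(leftLogDeriv V γ s : LieAlg V G) := by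
      refine (congrArg (fun v => Ad (γ' s)⁻¹ (-v)) e1).trans ?_
      exact T.Ad_eq_of_mem (inv_mem (hT' s)) (neg_mem (hmT s))
    have e3 : ∀ a : LieAlg V G, a = (-leftLogDeriv V γ s : V) →
        a + (show LieAlg V G from leftLogDeriv V γ' s) = ((leftLogDeriv V γ' s - leftLogDeriv V γ s : V) : LieAlg V G) := by
      rintro _ rfl
      exact (sub_eq_neg_add (leftLogDeriv V γ' s) (leftLogDeriv V γ s)).symm
    exact (e3 _ e2) ▸ h2
  have hcc : Continuous fun s => leftLogDeriv V γ' s - leftLogDeriv V γ s := hcu'.sub hcu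
  have hmm : ∀ s, leftLogDeriv V γ' s - leftLogDeriv V γ s ∈ T.lieAlgebra V := fun s => sub_mem (hmT' s) (hmT s)
  have h3 : ∀ s, (γ s)⁻¹ * γ' s = lieExp ((∫ r in (0 : ℝ)..s, (leftLogDeriv V γ' r - leftLogDeriv V γ r) : V) : LieAlg V G) := by
    intro s
    have h4 := T.eq_mul_lieExp_integral hcc (fun s => mul_mem (inv_mem (hT s)) (hT' s)) hδ s
    simpa [h0, h0'] using h4
  have h5 := h (fun s => ∫ r in (0 : ℝ)..s, (leftLogDeriv V γ' r - leftLogDeriv V γ r))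
    (intervalIntegral.continuous_primitive (fun a b => hcc.intervalIntegrable a b) 0) (by simp)
    (fun s => T.integral_mem hcc hmm 0 s) (fun s _ => by rw [← h3]; exact hn s) (by rw [← h3, h1, h1']; simp)
  rw [intervalIntegral.integral_sub (hcu'.intervalIntegrable _ _) (hcu.intervalIntegrable _ _)] at h5
  exact (sub_eq_zero.1 h5).symm

end MaximalTorus

namespace LoopExtension
variable [IsTopologicalGroup G] [T2Space G] [ConnectedSpace G]
  {W : Type*} [NormedAddCommGroup W] [NormedSpace ℝ W] [CompleteSpace W]
  {E : Type*} [TopologicalSpace E] [ChartedSpace W E] [Group E] [LieGroup 𝓘(ℝ, W) ∞ E] [T2Space E]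
  {B : LinearMap.BilinForm ℝ (LieAlg V G)} {σ : ℝ} (L : LoopExtension W E B σ) (T : MaximalTorus G)

/-- The element of the lattice that describes the connected component of a loop in the torus. -/
def winding (x : E) : V := -∫ s in (0 : ℝ)..1, leftLogDeriv V (L.path x) s

theorem path_one (x : E) : L.path x 1 = L.path x 0 := by
  have : ((1 : ℝ) : UnitAddCircle) = ((0 : ℝ) : UnitAddCircle) := by
    simp
  simp only [path, this]

theorem winding_mem (hσ : 3 / 2 < σ) {x : E} (hx : L.π x ∈ loopsIn T.toSubgroup) :
    L.winding x ∈ T.lattice V :=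
  T.neg_integral_mem_lattice (L.contMDiff_loop hσ x) (fun s => hx s) (L.path_one x)

theorem winding_latticeLoop {x : E} {ξ : T.lattice V} (hx : L.π x = T.latticeLoop V (.ofAdd ξ)) :
    L.winding x = (ξ : LieAlg V G) := by
  have h1 : ∀ s, leftLogDeriv V (L.path x) s = (-(ξ : LieAlg V G) : LieAlg V G) := fun s => by
    rw [← T.leftLogDeriv_latticeLoop ξ s, ← hx]
    rfl
  have h2 : (fun s => leftLogDeriv V (L.path x) s) = fun _ => ((-(ξ : LieAlg V G) : LieAlg V G) : V) := funext h1
  have h3 : ∀ v : V, -(∫ _ in (0 : ℝ)..1, v) = -v := fun v => by simp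
  rw [winding, h2]
  exact (h3 _).trans (neg_neg (show V from (ξ : LieAlg V G)))

/-- The Sobolev topology refines uniform convergence, for which winding is locally constant on based
loops in `T`; hence it is constant on preconnected sets. The relation propagated along the component
quantifies over all lifts, because `winding` is defined on `E`. -/
theorem winding_eq_of_mem_component (hσ : 3 / 2 < σ) {x y : E}
    (hx : L.π x ∈ basedLoopsIn T.toSubgroup)
    (h : L.loop y ∈ connectedComponentIn {γ' | γ'.1 ∈ basedLoopsIn T.toSubgroup} (L.loop x)) :
    L.winding y = L.winding x := by
  let S : Set (SobolevLoop V G σ) := {γ' | γ'.1 ∈ basedLoopsIn T.toSubgroup}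
  obtain ⟨N, hN, hw⟩ := T.exists_nhds_integral_eq V
  have hS : connectedComponentIn S (L.loop x) ⊆ S := connectedComponentIn_subset _ _
  refine isPreconnected_connectedComponentIn.induction₂ (fun γ γ' => ∀ x y, L.loop x = γ → L.loop y = γ' → L.winding y = L.winding x)
    (fun γ hγ => ?_) (fun a b c _ _ _ hab hbc x z hx hz => ?_) (fun a b _ _ hab x y hx hy => (hab y x hy hx).symm)
    (mem_connectedComponentIn hx) h x y rfl rfl
  · have h1 := γ.eventually_uniform (by linarith) hN
    filter_upwards [h1.filter_mono nhdsWithin_le_nhds, self_mem_nhdsWithin] with γ' hγ' hm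
    rintro x y rfl rfl
    have hxS := hS hγ
    have hyS := hS hm
    have h0 : ∀ z : E, L.π z ∈ basedLoopsIn T.toSubgroup → L.path z 0 = 1 := fun z hz => hz.2
    have := hw (L.path x) (L.path y) (L.contMDiff_loop hσ x) (L.contMDiff_loop hσ y) (fun s => hxS.1 s) (fun s => hyS.1 s)
      (h0 x hxS) ((L.path_one x).trans (h0 x hxS)) (h0 y hyS) ((L.path_one y).trans (h0 y hyS)) (fun s => hγ' s)
    rw [winding, winding, this]
  · obtain ⟨y, hy⟩ := L.exists_loop_eq b
    exact (hbc y z hy hz).trans (hab x y hx hy)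

theorem ld_lieMap {j : G →* E} (hσ : 3 / 2 < σ) (hj : L.IsConstLift j) (ζ : LieAlg V G) (r : ℝ) :
    L.ld (lieMap j ζ) r = ζ := by
  have h1 : modelDeriv V V (fun g : G => L.evalHom r (j g)) 1 ζ = modelDeriv W V (L.evalHom r) 1 (modelDeriv V W j 1 ζ) :=
    modelDeriv_comp (map_one j) ((L.contMDiff_evalHom hσ r).mdifferentiableAt (by simp)) (hj.smooth.mdifferentiableAt (by simp)) ζ
  have h2 : modelDeriv V V (fun g : G => L.evalHom r (j g)) 1 ζ = ζ := modelDeriv_eq_self (fun g => by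
    change L.π (j g) r = g
    rw [hj.lift]; rfl) _ _
  exact h1.symm.trans h2

/-- The conjugation action of the torus on the part of the extension over loops in the torus. -/
theorem conj_torus {j : G →* E} (hσ : 3 / 2 < σ) (hinv : ∀ x y z, B ⁅x, y⁆ z = B x ⁅y, z⁆)
    (hsymm : ∀ x y, B x y = B y x)
    (hperf : Submodule.span ℝ {z : LieAlg V G | ∃ x y : LieAlg V G, ⁅x, y⁆ = z} = ⊤)
    (hj : L.IsConstLift j)
    {x : E} (hx : L.π x ∈ loopsIn T.toSubgroup) {ζ : LieAlg V G} (hζ : ζ ∈ T.lieAlgebra V) :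
    j (lieExp ζ) * x * (j (lieExp ζ))⁻¹ = L.ι
    (Circle.exp (2 * Real.pi * B (L.winding x) ζ)) * x := by
  have h1 := L.conj_lieExp_of_fixed hσ hinv hsymm hperf x (lieMap j ζ) (fun r => by
    rw [L.ld_lieMap hσ hj]
    exact T.Ad_eq_of_mem (hx r) hζ)
  have hcu : Continuous (leftLogDeriv V (L.path x)) := continuous_leftLogDeriv (L.contMDiff_loop hσ x)
  -- The loop of `lieMap j ζ` is the constant `ζ`, so it comes out of the integral; the minus sign
  -- is the one in the definition of the winding.
  have h2 : ∫ s in (0 : ℝ)..1, formCLM B (leftLogDeriv V (L.path x) s) (L.ld (lieMap j ζ) s) = - B (L.winding x) ζ := by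
    simp only [L.ld_lieMap hσ hj]
    have h3 := ((formCLM B).flip (ζ : V)).intervalIntegral_comp_comm (μ := MeasureTheory.volume) (hcu.intervalIntegrable 0 1)
    refine h3.trans ?_
    have h4 : ∀ v : V, formCLM B v ζ = - B (-v : V) ζ := fun v => by
      have h5 : B ((-v : V) : LieAlg V G) ζ = - formCLM B v ζ := by
        refine Eq.trans ?_ (neg_apply (formCLM B v) (ζ : V))
        rw [← map_neg]; rfl
      rw [h5, neg_neg]
    exact h4 _
  rw [← hom_lieExp hj.smooth, h2] at h1
  -- The phase found so far belongs to `x (j t) x⁻¹`; passing to `(j t) x (j t)⁻¹` inverts it and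
  -- cancels the sign.
  have h6 : x * j (lieExp ζ) = L.ι (Circle.exp (2 * Real.pi * -B (L.winding x) ζ)) * j (lieExp ζ) * x := by
    rw [← h1]; simp
  have h7 : L.ι (Circle.exp (2 * Real.pi * B (L.winding x) ζ)) * (x * j (lieExp ζ)) = j (lieExp ζ) * x := by
    rw [h6, ← mul_assoc, ← mul_assoc, ← map_mul, ← Circle.exp_add, mul_neg, add_neg_cancel, Circle.exp_zero, map_one, one_mul]
  rw [← h7]; simp [mul_assoc]

end LoopExtension

end

/-! ### The extension over loops in the torus: parts (b) and (c). -/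

noncomputable section

open scoped Manifold ContDiff ENNReal Topology
open VectorField Set Filter
variable {V : Type*} [NormedAddCommGroup V] [NormedSpace ℝ V] [CompleteSpace V]
  {G : Type*} [TopologicalSpace G] [ChartedSpace V G] [Group G] [LieGroup 𝓘(ℝ, V) ∞ G]
variable [FiniteDimensional ℝ V]

namespace LoopExtension
variable [IsTopologicalGroup G] [T2Space G] [ConnectedSpace G]
  {W : Type*} [NormedAddCommGroup W] [NormedSpace ℝ W] [CompleteSpace W]
  {E : Type*} [TopologicalSpace E] [ChartedSpace W E] [Group E] [LieGroup 𝓘(ℝ, W) ∞ E] [T2Space E]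
  {B : LinearMap.BilinForm ℝ (LieAlg V G)} {σ : ℝ} (L : LoopExtension W E B σ) (T : MaximalTorus G)

theorem continuous_base (hσ : 3 / 2 < σ) : Continuous fun x : E => L.π x 0 :=
  (L.contMDiff_evalHom hσ 0).continuous

theorem mem_restrict {H : Subgroup C(UnitAddCircle, G)} {x : E} : x ∈ L.restrict H ↔ L.π x ∈ H := Iff.rfl

variable {L} in
theorem IsConstLift.apply {j : G →* E} (hj : L.IsConstLift j) (g : G) (s : UnitAddCircle) :
    L.π (j g) s = g := by
  rw [hj.lift]; rfl

variable {L} in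
theorem IsConstLift.conj_mem {j : G →* E} (hj : L.IsConstLift j) {t : G} (ht : t ∈ T.toSubgroup)
    {x : E}
    (hx : x ∈ L.restrict (basedLoopsIn T.toSubgroup)) :
    j t * x * (j t)⁻¹ ∈ L.restrict (basedLoopsIn T.toSubgroup) := by
  have h : L.π (j t * x * (j t)⁻¹) = L.π x := by
    ext s
    simp only [map_mul, map_inv, ContinuousMap.mul_apply, ContinuousMap.inv_apply, hj.apply]
    rw [T.comm t ht _ (hx.1 s), mul_inv_cancel_right]
  rw [mem_restrict, h]
  exact hx

variable {L} in
/-- The conjugation action of the torus on the extension of the based loops. -/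
def IsConstLift.conjAction {j : G →* E} (hj : L.IsConstLift j) :
    T.toSubgroup →* MulAut (L.restrict (basedLoopsIn T.toSubgroup)) where
  toFun t :=
    { toFun := fun x => ⟨j t * x * (j t)⁻¹, hj.conj_mem T t.2 x.2⟩
      invFun := fun x => ⟨j (t⁻¹ : T.toSubgroup) * x * (j (t⁻¹ : T.toSubgroup))⁻¹, hj.conj_mem T (t⁻¹).2 x.2⟩
      left_inv := fun x => Subtype.ext (by simp [mul_assoc])
      right_inv := fun x => Subtype.ext (by simp [mul_assoc])
      map_mul' := fun x y => Subtype.ext (by simp [mul_assoc]) }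
  map_one' := by
    ext x
    simp
  map_mul' s t := by
    ext x
    simp [mul_assoc]

variable {L} in
theorem IsConstLift.conjAction_apply {j : G →* E} (hj : L.IsConstLift j) (t : T.toSubgroup)
    (x : L.restrict (basedLoopsIn T.toSubgroup)) : (hj.conjAction T t x : E) = j t * x * (j t)⁻¹ := rfl

variable {L} in
theorem IsConstLift.mul_mem {j : G →* E} (hj : L.IsConstLift j) {S : Subgroup G}
    (hS : S ≤ T.toSubgroup) {x : E} {t : G}
    (hx : x ∈ L.restrict (basedLoopsIn T.toSubgroup)) (ht : t ∈ S) :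
    x * j t ∈ L.restrict (loopsInFrom T.toSubgroup S) := by
  refine ⟨fun s => ?_, ?_⟩
  · simp only [map_mul, ContinuousMap.mul_apply, hj.apply]
    exact Subgroup.mul_mem _ (hx.1 s) (hS ht)
  · have h0 : L.π x 0 = 1 := hx.2
    simp only [map_mul, ContinuousMap.mul_apply, hj.apply, h0, one_mul]
    exact ht

variable {L} in
theorem IsConstLift.mul_inv_mem {j : G →* E} (hj : L.IsConstLift j) {S : Subgroup G} {y : E}
    (hy : y ∈ L.restrict (loopsInFrom T.toSubgroup S)) :
    y * (j (L.π y 0))⁻¹ ∈ L.restrict (basedLoopsIn T.toSubgroup) := by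
  refine ⟨fun s => ?_, ?_⟩
  · simp only [map_mul, map_inv, ContinuousMap.mul_apply, ContinuousMap.inv_apply, hj.apply]
    exact Subgroup.mul_mem _ (hy.1 s) (inv_mem (hy.1 0))
  · simp only [map_mul, map_inv, ContinuousMap.mul_apply, ContinuousMap.inv_apply, hj.apply, mul_inv_cancel]
    rfl

theorem loopsInFrom_self (T : Subgroup G) : loopsInFrom T T = loopsIn T := by
  ext γ
  exact ⟨fun h => h.1, fun h => ⟨h, h 0⟩⟩

variable {L} in
/-- The extension over the loops with base point in `S` is the product of `S` and the extension of the based loops. -/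
def IsConstLift.prodHomeomorph {j : G →* E} (hσ : 3 / 2 < σ) (hj : L.IsConstLift j)
    {S : Subgroup G} (hS : S ≤ T.toSubgroup) :
    L.restrict (basedLoopsIn T.toSubgroup) × S ≃ₜ L.restrict (loopsInFrom T.toSubgroup S) where
  toFun p := ⟨p.1 * j p.2, hj.mul_mem T hS p.1.2 p.2.2⟩
  invFun y := (⟨y * (j (L.π y 0))⁻¹, hj.mul_inv_mem T y.2⟩, ⟨L.π y 0, y.2.2⟩)
  left_inv p := by
    have h0 : L.π (p.1 : E) 0 = 1 := p.1.2.2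
    refine Prod.ext (Subtype.ext ?_) (Subtype.ext ?_) <;>
    simp [h0, hj.apply]
  right_inv y := Subtype.ext (by simp)
  continuous_toFun := by
    have := topologicalGroup_of_lieGroup 𝓘(ℝ, W) ∞ (G := E)
    have := hj.smooth.continuous
    fun_prop
  continuous_invFun := by
    have := topologicalGroup_of_lieGroup 𝓘(ℝ, W) ∞ (G := E)
    have := hj.smooth.continuous
    have := L.continuous_base hσ
    refine Continuous.prodMk (Continuous.subtype_mk ?_ _) (Continuous.subtype_mk ?_ _)
    · exact continuous_subtype_val.mul (((hj.smooth.continuous).comp (this.comp continuous_subtype_val)).inv)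
    · exact this.comp continuous_subtype_val

-- The base point splits off: `y = (y (j t)⁻¹) (j t)` with `t = π y 0`. The phase of the action is
-- governed by the winding, which on the component in question takes its value `ξ` at the lattice
-- loop.
variable {L} in
theorem IsConstLift.torus_semidirect {j : G →* E} (hσ : 3 / 2 < σ)
    (hinv : ∀ x y z, B ⁅x, y⁆ z = B x ⁅y, z⁆) (hsymm : ∀ x y, B x y = B y x)
    (hperf : Submodule.span ℝ {z : LieAlg V G | ∃ x y : LieAlg V G, ⁅x, y⁆ = z} = ⊤)
    (hj : L.IsConstLift j) :
    ∃ φ : T.toSubgroup →* MulAut (L.restrict (basedLoopsIn T.toSubgroup)),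
        (∀ t x, (φ t x : E) = j t * x * (j t)⁻¹) ∧
        (∃ e : (L.restrict (basedLoopsIn T.toSubgroup)) ⋊[φ] T.toSubgroup ≃*
            L.restrict (loopsIn T.toSubgroup),
          (∀ p, (e p : E) = p.left * j p.right) ∧
          IsHomeomorph fun p : L.restrict (basedLoopsIn T.toSubgroup) × T.toSubgroup =>
            e ⟨p.1, p.2⟩) ∧
        ∀ (ξ : T.lattice V) (γ : SobolevLoop V G σ),
          γ.1 = T.latticeLoop V (.ofAdd ξ) →
          ∀ x : L.restrict (basedLoopsIn T.toSubgroup),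
            L.loop x ∈ connectedComponentIn {γ' | γ'.1 ∈ basedLoopsIn T.toSubgroup} γ →
            ∀ (t : T.toSubgroup) (ζ : T.lieAlgebra V), (t : G) = lieExp (ζ : LieAlg V G) →
              (φ t x : E) = L.ι (Circle.exp (2 * Real.pi *
                B (ξ : LieAlg V G) (ζ : LieAlg V G))) * x := by
  refine ⟨hj.conjAction T, fun _ _ => rfl, ?_, ?_⟩
  · let H := hj.prodHomeomorph T hσ le_rfl
    have e0 : ∀ y, y ∈ L.restrict (loopsInFrom T.toSubgroup T.toSubgroup) ↔ y ∈ L.restrict (loopsIn T.toSubgroup) := fun y => by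
      rw [loopsInFrom_self]
    let H' := H.trans (Homeomorph.subtype (p := fun y => y ∈ L.restrict (loopsInFrom T.toSubgroup T.toSubgroup))
      (q := fun y => y ∈ L.restrict (loopsIn T.toSubgroup)) (Homeomorph.refl E) e0)
    let e : (L.restrict (basedLoopsIn T.toSubgroup)) ⋊[hj.conjAction T] T.toSubgroup ≃ L.restrict (loopsIn T.toSubgroup) :=
      SemidirectProduct.equivProd.trans H'.toEquiv
    refine ⟨{ e with map_mul' := fun p q => Subtype.ext ?_ }, fun p => rfl, H'.isHomeomorph⟩
    change ((p.left * (hj.conjAction T p.right) q.left : L.restrict (basedLoopsIn T.toSubgroup)) : E) * j (p.right * q.right) =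
      (p.left * j p.right) * (q.left * j q.right)
    rw [Subgroup.coe_mul, hj.conjAction_apply, map_mul]
    simp only [mul_assoc, inv_mul_cancel_left]
  · intro ξ γ hγ x hx t ζ ht
    obtain ⟨y, hy⟩ := L.exists_loop_eq γ
    have hyT : L.π y = T.latticeLoop V (.ofAdd ξ) := by rw [← hγ, ← hy]; rfl
    have hyb : L.π y ∈ basedLoopsIn T.toSubgroup := by
      -- The component relative to a set is empty when its base point lies outside the set, so
      -- membership of the loop of `x` already forces `γ` to be a based loop in `T`.
      have hγm : γ ∈ {γ' : SobolevLoop V G σ | γ'.1 ∈ basedLoopsIn T.toSubgroup} := by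
        by_contra hn
        rw [connectedComponentIn_eq_empty hn] at hx
        exact hx
      rw [← hy] at hγm
      exact hγm
    rw [← hy] at hx
    have h1 := L.winding_eq_of_mem_component T hσ hyb hx
    have h2 := L.conj_torus T hσ hinv hsymm hperf hj (x := x) x.2.1 ζ.2
    rw [h1, L.winding_latticeLoop T hyT, ← ht] at h2
    exact h2

-- Windings lie in `Λ`, so the phase by which `exp ζ` acts is trivial when `B(ζ, Λ) ⊆ ℤ`. The lift
-- of the dual subgroup then commutes with the extension of the based loops, and the semidirect
-- product becomes direct.
variable {L} in
theorem IsConstLift.dual_product {j : G →* E} (hσ : 3 / 2 < σ)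
    (hinv : ∀ x y z, B ⁅x, y⁆ z = B x ⁅y, z⁆) (hsymm : ∀ x y, B x y = B y x)
    (hperf : Submodule.span ℝ {z : LieAlg V G | ∃ x y : LieAlg V G, ⁅x, y⁆ = z} = ⊤)
    (hj : L.IsConstLift j) :
    ∃ e : T.dualSubgroup B × L.restrict (basedLoopsIn T.toSubgroup) ≃ₜ*
            L.restrict (loopsInFrom T.toSubgroup (T.dualSubgroup B)),
          ∀ t x, (e (t, x) : E) = j t * x := by
  have hS : T.dualSubgroup B ≤ T.toSubgroup := by
    rintro _ ⟨ζ, hζ, -, rfl⟩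
    exact T.lieExp_mem hζ
  have hcomm : ∀ (t : T.dualSubgroup B) (x : L.restrict (basedLoopsIn T.toSubgroup)), j t * x = x * j t := by
    rintro ⟨_, ζ, hζ, hB, rfl⟩ x
    have h2 := L.conj_torus T hσ hinv hsymm hperf hj (x := x) x.2.1 hζ
    obtain ⟨n, hn⟩ := hB _ (L.winding_mem T hσ (x := x) x.2.1)
    have h3 : Circle.exp (2 * Real.pi * B (L.winding x : V) ζ) = 1 := by
      rw [(hsymm _ ζ).trans hn, mul_comm, Circle.exp_int_mul_two_pi]
    rw [h3, map_one, one_mul] at h2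
    exact mul_inv_eq_iff_eq_mul.1 h2
  let H := (Homeomorph.prodComm _ _).trans (hj.prodHomeomorph T hσ hS)
  refine ⟨{ H with map_mul' := fun p q => Subtype.ext ?_ }, fun t x => (hcomm t x).symm⟩
  change ((p.2 * q.2 : L.restrict (basedLoopsIn T.toSubgroup)) : E) * j (p.1 * q.1) = (p.2 * j p.1) * (q.2 * j q.1)
  rw [Subgroup.coe_mul, map_mul, mul_assoc, mul_assoc, ← mul_assoc (q.2 : E), ← hcomm p.1 q.2, mul_assoc]

end LoopExtension

end

/-! ### Splitting of the extension over the constant loops. -/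

noncomputable section

open scoped Manifold ContDiff ENNReal Topology
open VectorField Set Filter
variable {V : Type*} [NormedAddCommGroup V] [NormedSpace ℝ V] [CompleteSpace V]
  {G : Type*} [TopologicalSpace G] [ChartedSpace V G] [Group G] [LieGroup 𝓘(ℝ, V) ∞ G]
variable [FiniteDimensional ℝ V]

namespace LoopExtension
variable [IsTopologicalGroup G] [T2Space G] [ConnectedSpace G]
  {W : Type*} [NormedAddCommGroup W] [NormedSpace ℝ W] [CompleteSpace W]
  {E : Type*} [TopologicalSpace E] [ChartedSpace W E] [Group E] [LieGroup 𝓘(ℝ, W) ∞ E] [T2Space E]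
  {B : LinearMap.BilinForm ℝ (LieAlg V G)} {σ : ℝ} (L : LoopExtension W E B σ)

/-- `S` is the splitting of the Lie algebra extension over the constant loops whose central component vanishes. -/
structure IsConstSection (α : LieAlg W E →L[ℝ] ℝ) (S : LieAlg V G → LieAlg W E) : Prop where
  ld : ∀ v r, L.ld (S v) r = v
  alpha : ∀ v, α (S v) = 0

variable {L} {α : LieAlg W E →L[ℝ] ℝ} {S : LieAlg V G → LieAlg W E}

theorem exists_isConstSection (hα : α (centralGenerator L.ι) = 1) : ∃ S :
    LieAlg V G → LieAlg W E, L.IsConstSection α S := by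
  have h : ∀ v : LieAlg V G, ∃ X : LieAlg W E, (∀ r, L.ld X r = v) ∧ α X = 0 := by
    intro v
    have h1 : IsSobolevMap σ (fun _ : UnitAddCircle => (1 : ℝ) • v) :=
      IsSobolevMap.contDiff_const_smul (f := fun _ => 1) contDiff_const v
    obtain ⟨X, hX⟩ := L.exists_ld_eq h1
    refine ⟨X + (-α X) • centralGenerator L.ι, fun r => ?_, ?_⟩
    · rw [L.ld_add, L.ld_smul, L.ld_centralGenerator, smul_zero, add_zero, hX]
      exact one_smul _ _
    · rw [map_add, map_smul, hα]; simp
  choose S hS using h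
  exact ⟨S, fun v r => (hS v).1 r, fun v => (hS v).2⟩

/-- Elements with zero loop are central, and `α` detects the centre. This uniqueness yields
linearity and equivariance of the section. -/
theorem IsConstSection.eq_of (hα : α (centralGenerator L.ι) = 1) (hS : L.IsConstSection α S)
    {X : LieAlg W E} {v : LieAlg V G}
    (hX : ∀ r, L.ld X r = v) (h0 : α X = 0) : X = S v := by
  obtain ⟨a, ha⟩ := (L.ld_eq_zero_iff (X + (-1 : ℝ) • S v)).1 fun r => by
    rw [L.ld_add, L.ld_smul, hX, hS.ld]
    have h1 : ∀ a : V, a + (-1 : ℝ) • a = 0 := fun a => by simp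
    exact h1 v
  have h1 : α (X + (-1 : ℝ) • S v) = a := by rw [ha, map_smul, hα]; simp
  rw [map_add, map_smul, h0, hS.alpha] at h1
  have h2 : a = 0 := by simpa using h1.symm
  rw [h2, zero_smul] at ha
  simpa [add_neg_eq_zero] using ha

theorem IsConstSection.add (hα : α (centralGenerator L.ι) = 1) (hS : L.IsConstSection α S)
    (v w : LieAlg V G) : S (v + w) = S v + S w :=
  (hS.eq_of hα (fun r => by rw [L.ld_add, hS.ld, hS.ld]; rfl) (by rw [map_add, hS.alpha, hS.alpha, add_zero])).symm

theorem IsConstSection.smul (hα : α (centralGenerator L.ι) = 1) (hS : L.IsConstSection α S) (a : ℝ)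
    (v : LieAlg V G) : S (a • v) = a • S v :=
  (hS.eq_of hα (fun r => by rw [L.ld_smul, hS.ld]; rfl) (by rw [map_smul, hS.alpha, smul_zero])).symm

theorem leftLogDeriv_const (g : G) (s : ℝ) : leftLogDeriv V (fun _ : ℝ => g) s = 0 :=
  (hasLogDerivAt_const g s).leftLogDeriv_eq

/-- A constant loop has zero logarithmic derivative, so the correction in `alpha_Ad` vanishes and
the condition `α = 0` is preserved. -/
theorem IsConstSection.Ad (hσ : 3 / 2 < σ) (hinv : ∀ x y z, B ⁅x, y⁆ z = B x ⁅y, z⁆)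
    (hsymm : ∀ x y, B x y = B y x)
    (hperf : Submodule.span ℝ {z : LieAlg V G | ∃ x y : LieAlg V G, ⁅x, y⁆ = z} = ⊤)
    (hα : α (centralGenerator L.ι) = 1)
    (hα' : ∀ X Y : LieAlg W E, α ⁅X, Y⁆ = loopCocycle B (loopDeriv L.π Y) (loopDeriv L.π X))
    (hS : L.IsConstSection α S) {y : E} {g : G} (hy : ∀ s, L.π y s = g) (v : LieAlg V G) :
    Ad y (S v) = S (Ad g v) := by
  have hp : L.path y = fun _ => g := funext fun s => hy s
  refine hS.eq_of hα (fun r => ?_) ?_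
  · rw [L.ld_Ad hσ, hS.ld, hp]; rfl
  · rw [L.alpha_Ad hσ hinv hsymm hperf hα', hS.alpha, hp]
    simp [leftLogDeriv_const]

theorem IsConstSection.π_lieExp (hσ : 3 / 2 < σ) (hS : L.IsConstSection α S) (v : LieAlg V G)
    (s : UnitAddCircle) :
    L.π (lieExp (S v)) s = lieExp v := by
  induction s using QuotientAddGroup.induction_on with
  | H r =>
    have h := hom_lieExp (L.contMDiff_evalHom hσ r) (S v)
    have h2 : (lieMap (L.evalHom r) (S v) : LieAlg V G) = v := hS.ld v r
    rw [h2] at h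
    exact h

/-- The product rule involves only sums, multiples and adjoint actions of constant loops, all of
which the section respects. The lifted product therefore has the lifted logarithmic derivative. -/
theorem IsConstSection.hasLogDerivAt_expProd (hσ : 3 / 2 < σ)
    (hinv : ∀ x y z, B ⁅x, y⁆ z = B x ⁅y, z⁆) (hsymm : ∀ x y, B x y = B y x)
    (hperf : Submodule.span ℝ {z : LieAlg V G | ∃ x y : LieAlg V G, ⁅x, y⁆ = z} = ⊤)
    (hα : α (centralGenerator L.ι) = 1)
    (hα' : ∀ X Y : LieAlg W E, α ⁅X, Y⁆ = loopCocycle B (loopDeriv L.π Y) (loopDeriv L.π X))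
    (hS : L.IsConstSection α S) (l : List ((ℝ → ℝ) × LieAlg V G))
    (hl : ∀ p ∈ l, Differentiable ℝ p.1) (s : ℝ) :
    (∀ z, L.π (expProd (l.map fun p => (p.1, S p.2)) s) z = expProd l s) ∧
    ∃ u : LieAlg V G, HasLogDerivAt (expProd l) u s ∧ HasLogDerivAt
    (expProd (l.map fun p => (p.1, S p.2))) (S u) s := by
  induction l with
  | nil =>
    refine ⟨fun z => by simp [expProd], 0, hasLogDerivAt_const (1 : G) s, ?_⟩
    have h0 : S 0 = 0 := by have := hS.smul hα 0 0; simpa using this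
    rw [h0]
    exact hasLogDerivAt_const (1 : E) s
  | cons p l ih =>
    obtain ⟨h1, u, hu, hu'⟩ := ih fun q hq => hl q (List.mem_cons_of_mem _ hq)
    have hd := (hl p (List.mem_cons_self ..) s).hasDerivAt
    have h2 := ((hasLogDerivAt_lieExp p.2 (p.1 s)).scomp hd).mul hu
    have h3 := ((hasLogDerivAt_lieExp (S p.2) (p.1 s)).scomp hd).mul hu'
    have hinv1 : ∀ z, L.π (expProd (l.map fun p => (p.1, S p.2)) s)⁻¹ z = (expProd l s)⁻¹ := fun z => by
      rw [map_inv]; exact congrArg _ (h1 z)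
    rw [← hS.smul hα, hS.Ad hσ hinv hsymm hperf hα hα' hinv1, ← hS.add hα] at h3
    refine ⟨fun z => ?_, _, h2.congr (Eventually.of_forall fun r => expProd_cons p l r), h3.congr (Eventually.of_forall fun r => ?_)⟩
    · rw [List.map_cons, expProd_cons, expProd_cons, map_mul, ContinuousMap.mul_apply, h1]
      congr 1
      have := hS.π_lieExp hσ (p.1 s • p.2) z
      rwa [hS.smul hα] at this
    · rw [List.map_cons, expProd_cons]

/-- A relation between exponentials in `G` lifts to the extension. -/
theorem IsConstSection.prod_eq_one [SimplyConnectedSpace G] (hσ : 3 / 2 < σ)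
    (hinv : ∀ x y z, B ⁅x, y⁆ z = B x ⁅y, z⁆) (hsymm : ∀ x y, B x y = B y x)
    (hperf : Submodule.span ℝ {z : LieAlg V G | ∃ x y : LieAlg V G, ⁅x, y⁆ = z} = ⊤)
    (hα : α (centralGenerator L.ι) = 1)
    (hα' : ∀ X Y : LieAlg W E, α ⁅X, Y⁆ = loopCocycle B (loopDeriv L.π Y) (loopDeriv L.π X))
    (hS : L.IsConstSection α S) (l : List (LieAlg V G))
    (h : (l.map fun v => (lieExp v : G)).prod = 1) :
    (l.map fun v => (lieExp (S v) : E)).prod = 1 := by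
  let χ := Real.smoothTransition
  let l₀ : List ((ℝ → ℝ) × LieAlg V G) := l.map fun v => (id, v)
  have hl₀ : ∀ p ∈ l₀, ContDiff ℝ ∞ p.1 := by
    intro p hp
    obtain ⟨v, -, rfl⟩ := List.mem_map.1 hp
    exact contDiff_id
  have e1 : expProd l₀ 1 = (l.map fun v => (lieExp v : G)).prod := by
    simp [expProd, l₀, Function.comp_def]
  have e0 : (expProd l₀ 0 : G) = 1 := expProd_eq_one fun p hp => by
    obtain ⟨v, -, rfl⟩ := List.mem_map.1 hp
    rfl
  -- The relation closes up `s ↦ ∏ exp (s v_i)`. Its second factorization has coefficients vanishing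
  -- at both ends, so the lift of that one visibly ends at `1`.
  obtain ⟨l₁, hl₁, heq⟩ := exists_factorization (contMDiff_expProd hl₀) e0 (e1.trans h)
  -- The two factorizations agree only on `[0, 1]`; composition with the smooth transition makes
  -- them agree on the whole line.
  let res : List ((ℝ → ℝ) × LieAlg V G) → List ((ℝ → ℝ) × LieAlg V G) := fun l => l.map fun p => (fun s => p.1 (χ s), p.2)
  have hres : ∀ l s, (expProd (res l) s : G) = expProd l (χ s) := fun l s => by simp [expProd, res, Function.comp_def]
  have hres' : ∀ l s, (expProd ((res l).map fun p => (p.1, S p.2)) s : E) = expProd (l.map fun p => (p.1, S p.2)) (χ s) := fun l s => by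
    simp [expProd, res, Function.comp_def]
  have hdiff : ∀ l : List ((ℝ → ℝ) × LieAlg V G), (∀ p ∈ l, ContDiff ℝ ∞ p.1) → ∀ p ∈ res l, Differentiable ℝ p.1 := by
    intro l hl p hp
    obtain ⟨q, hq, rfl⟩ := List.mem_map.1 hp
    exact ((hl q hq).comp Real.smoothTransition.contDiff).differentiable (by simp)
  have hχ : ∀ s, χ s ∈ Icc (0 : ℝ) 1 := fun s => ⟨Real.smoothTransition.nonneg s, Real.smoothTransition.le_one s⟩
  have hG : (expProd (res l₀) : ℝ → G) = expProd (res l₁) := funext fun s => by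
    rw [hres, hres]; exact heq (hχ s)
  choose h0 u hu hu' using fun s => hS.hasLogDerivAt_expProd hσ hinv hsymm hperf hα hα' (res l₀) (hdiff l₀ hl₀) s
  choose k0 w hw hw' using fun s => hS.hasLogDerivAt_expProd hσ hinv hsymm hperf hα hα' (res l₁) (hdiff l₁ fun p hp => (hl₁ p hp).1) s
  -- Equal curves in `G` have equal logarithmic derivatives `u`; both lifts then have logarithmic
  -- derivative `S u` and start at `1`, so they coincide.
  have huw : u = w := funext fun s => (hu s).unique (hG ▸ hw s)
  subst huw
  have hE := eq_of_hasLogDerivAt (t₀ := 0) hu' hw' (by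
    rw [hres', hres']
    have hχ0 : χ 0 = 0 := Real.smoothTransition.zero
    rw [hχ0, expProd_eq_one, expProd_eq_one]
    · intro p hp
      obtain ⟨q, hq, rfl⟩ := List.mem_map.1 hp
      exact (hl₁ q hq).2.1
    · intro p hp
      obtain ⟨q, hq, rfl⟩ := List.mem_map.1 hp
      obtain ⟨v, -, rfl⟩ := List.mem_map.1 hq
      rfl)
  have hE1 := congrFun hE 1
  rw [hres', hres'] at hE1
  have hχ1 : χ 1 = 1 := Real.smoothTransition.one
  rw [hχ1, expProd_eq_one (l := l₁.map fun p => (p.1, S p.2))] at hE1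
  · rw [← hE1]
    simp [expProd, l₀, Function.comp_def]
  · intro p hp
    obtain ⟨q, hq, rfl⟩ := List.mem_map.1 hp
    exact (hl₁ q hq).2.2

/-- The extension splits over the constant loops. -/
theorem exists_isConstLift [SimplyConnectedSpace G] (L : LoopExtension W E B σ) (hσ : 3 / 2 < σ)
    (hinv : ∀ x y z, B ⁅x, y⁆ z = B x ⁅y, z⁆) (hsymm : ∀ x y, B x y = B y x)
    (hperf : Submodule.span ℝ {z : LieAlg V G | ∃ x y : LieAlg V G, ⁅x, y⁆ = z} = ⊤) :
    ∃ j : G →* E, L.IsConstLift j := by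
  obtain ⟨α, hα, hα'⟩ := L.bracket
  obtain ⟨S, hS⟩ := exists_isConstSection hα
  let J : Subgroup E := Subgroup.closure (range fun v => lieExp (S v))
  have hJ : ∀ y ∈ J, ∃ l : List (LieAlg V G), y = (l.map fun v => (lieExp (S v) : E)).prod := by
    intro y hy
    induction hy using Subgroup.closure_induction with
    | mem x hx =>
      obtain ⟨v, rfl⟩ := hx
      exact ⟨[v], by simp⟩
    | one => exact ⟨[], by simp⟩
    | mul x y _ _ hx hy =>
      obtain ⟨l, rfl⟩ := hx
      obtain ⟨l', rfl⟩ := hy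
      exact ⟨l ++ l', by simp⟩
    | inv x _ hx =>
      obtain ⟨l, rfl⟩ := hx
      refine ⟨(l.map fun v => -v).reverse, ?_⟩
      rw [List.prod_inv_reverse]
      have hneg : ∀ v, S (-v) = - S v := fun v => by have := hS.smul hα (-1) v; simpa using this
      simp [Function.comp_def, hneg, lieExp_neg']
  have hπ : ∀ (l : List (LieAlg V G)) z, L.π (l.map fun v => (lieExp (S v) : E)).prod z = (l.map fun v => (lieExp v : G)).prod := by
    intro l z
    have h1 : L.π (l.map fun v => (lieExp (S v) : E)).prod z = L.evalHom z (l.map fun v => (lieExp (S v) : E)).prod := rfl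
    rw [h1, map_list_prod, List.map_map]
    congr 1
    refine List.map_congr_left fun v _ => hS.π_lieExp hσ v z
  let F : J →* G := (L.evalHom 0).comp J.subtype
  -- An element of the kernel is a relation between exponentials in `G`, and such relations lift.
  have hFinj : Function.Injective F := by
    rw [injective_iff_map_eq_one]
    rintro ⟨y, hy⟩ h
    obtain ⟨l, rfl⟩ := hJ y hy
    refine Subtype.ext (hS.prod_eq_one hσ hinv hsymm hperf hα hα' l ?_)
    rw [← hπ l 0]; exact h
  have hFexp : ∀ v, F ⟨lieExp (S v), Subgroup.subset_closure ⟨v, rfl⟩⟩ = lieExp v := fun v => hS.π_lieExp hσ v 0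
  have hFsurj : Function.Surjective F := by
    rw [← MonoidHom.range_eq_top, eq_top_iff, ← closure_range_lieExp (V := V), Subgroup.closure_le]
    rintro _ ⟨v, rfl⟩
    exact ⟨_, hFexp v⟩
  let e : J ≃* G := MulEquiv.ofBijective F ⟨hFinj, hFsurj⟩
  let j : G →* E := J.subtype.comp e.symm.toMonoidHom
  have hjF : ∀ y : J, j (F y) = y := fun y => by
    change ((e.symm (e y) : J) : E) = y
    rw [e.symm_apply_apply]
  have hjexp : ∀ v : LieAlg V G, j (lieExp v) = lieExp (S v) := fun v => by
    rw [← hFexp v, hjF]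
  refine ⟨j, ?_, fun g => ?_⟩
  · obtain ⟨n, a, κ, hκ, hκ1, -⟩ := exists_coordinates V G
    -- In coordinates of the second kind `j` becomes a product of one-parameter subgroups of `E`;
    -- this shows smoothness near `1`, and translation carries it to every `g₀`.
    have hcoord : ∀ x : Fin n → ℝ, j (coordProd a x) = coordProd (fun i => S (a i)) x := by
      intro x
      rw [coordProd, coordProd, map_list_prod, List.map_ofFn]
      congr 2
      funext i
      change j (lieExp (x i • a i)) = _
      rw [hjexp, hS.smul hα]
    intro g₀
    have h1 : ContMDiff 𝓘(ℝ, V) 𝓘(ℝ, W) ∞ fun g : G => j g₀ * (coordProd (fun i => S (a i)) (κ (g₀⁻¹ * g)) : E) :=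
      (contMDiff_mul_left (I := 𝓘(ℝ, W)) (n := ∞)).comp ((contMDiff_coordProd _).comp (hκ.comp
        (contMDiff_mul_left (I := 𝓘(ℝ, V)) (n := ∞))))
    refine (h1 g₀).congr_of_eventuallyEq ?_
    have hc : Tendsto (fun g : G => g₀⁻¹ * g) (𝓝 g₀) (𝓝 1) := by
      have : Continuous (fun g : G => g₀⁻¹ * g) := by fun_prop
      simpa using this.tendsto g₀
    filter_upwards [hc.eventually hκ1] with g hg
    rw [← hcoord, hg, ← map_mul]; simp
  · obtain ⟨y, rfl⟩ := hFsurj g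
    rw [hjF]
    obtain ⟨l, hl⟩ := hJ y y.2
    ext z
    change L.π y z = L.π y 0
    rw [hl, hπ, hπ]

end LoopExtension

end

/-! ### The commutator of lifts of lattice elements: part (a). -/

noncomputable section

open scoped Manifold ContDiff ENNReal Topology
open VectorField Set Filter
variable {V : Type*} [NormedAddCommGroup V] [NormedSpace ℝ V] [CompleteSpace V]
  {G : Type*} [TopologicalSpace G] [ChartedSpace V G] [Group G] [LieGroup 𝓘(ℝ, V) ∞ G]
variable [FiniteDimensional ℝ V]

/-- The function is repeated by means of the fractional part. The only possible failure of
smoothness is at integers, where the hypothesis makes the two branches agree nearby. -/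
theorem exists_periodic_extension {g : ℝ → ℝ} (hg : ContDiff ℝ ∞ g)
    (h : ∀ᶠ s in 𝓝 0, g (s + 1) = g s) :
    ∃ F : UnitAddCircle → ℝ, ContDiff ℝ ∞ (fun r : ℝ => F r) ∧ ∀ s ∈ Icc (0 : ℝ) 1, F s = g s := by
  have hper : Function.Periodic (fun r : ℝ => g (Int.fract r)) 1 := fun r => by simp
  refine ⟨hper.lift, ?_, fun s hs => ?_⟩
  · refine contDiff_iff_contDiffAt.2 fun r => ?_
    have h1 : ContDiff ℝ ∞ fun s : ℝ => g (s - ⌊r⌋) := hg.comp (by fun_prop)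
    refine h1.contDiffAt.congr_of_eventuallyEq ?_
    change ∀ᶠ s in 𝓝 r, g (Int.fract s) = g (s - (⌊r⌋ : ℝ))
    rcases (Int.fract_nonneg r).eq_or_lt with h0 | h0
    · have hc : Tendsto (fun s : ℝ => s - (⌊r⌋ : ℝ)) (𝓝 r) (𝓝 0) := by
        have : Continuous fun s : ℝ => s - (⌊r⌋ : ℝ) := by fun_prop
        have h2 := this.tendsto r
        rwa [Int.self_sub_floor, ← h0] at h2
      have hball : ∀ᶠ s in 𝓝 r, |s - (⌊r⌋ : ℝ)| < 1 := by
        have h3 : ∀ᶠ x : ℝ in 𝓝 0, |x| < 1 := by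
          have := Metric.ball_mem_nhds (0 : ℝ) one_pos
          filter_upwards [this] with x hx
          simpa using hx
        exact hc.eventually h3
      filter_upwards [hc.eventually h, hball] with s hs hb
      rw [abs_lt] at hb
      rcases le_or_gt 0 (s - ⌊r⌋) with h4 | h4
      · have : ⌊s⌋ = ⌊r⌋ := Int.floor_eq_iff.2 ⟨by linarith, by linarith⟩
        rw [Int.fract, this]
      · have : ⌊s⌋ = ⌊r⌋ - 1 := Int.floor_eq_iff.2 ⟨by push_cast; linarith, by push_cast; linarith⟩
        rw [← hs, Int.fract, this]
        congr 1
        push_cast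
        ring
    · have h1 := Int.fract_lt_one r
      have e := Int.self_sub_floor r
      have hI : Ioo (⌊r⌋ : ℝ) (⌊r⌋ + 1) ∈ 𝓝 r := Ioo_mem_nhds (by linarith) (by linarith)
      filter_upwards [hI] with s hs
      have : ⌊s⌋ = ⌊r⌋ := Int.floor_eq_iff.2 ⟨hs.1.le, hs.2⟩
      rw [Int.fract, this]
  · change g (Int.fract s) = g s
    rcases hs.2.eq_or_lt with h1 | h1
    · have := h.self_of_nhds
      rw [h1]
      simpa using this.symm
    · rw [Int.fract_eq_self.2 ⟨hs.1, h1⟩]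

theorem circle_exp_int_mul_pi (n : ℤ) : Circle.exp (n * Real.pi) = (-1) ^ n := by
  have h : Circle.exp Real.pi = -1 := Circle.ext (by simp)
  rw [← zsmul_eq_mul, Circle.exp_zsmul, h]

/-- The integrand equals `s - U₁ - s U₁'`, the derivative of `s²/2 - s U₁`, on both halves: for `s ≤
1/2` because `U₂ = s`, for `s > 1/2` because `U₁' = 1`. Since `U₁ 1 = 0`, the integral is `1/2`;
this is the source of the sign in the commutator. -/
theorem integral_shifted_steps {U₁ U₂ ρ₁ ρ₂ : ℝ → ℝ} (hU₁ : ContDiff ℝ ∞ U₁) (hU₂ : ContDiff ℝ ∞ U₂)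
    (h₁ : ∀ s ∈ Icc (0 : ℝ) 1, U₁ s = s - ρ₁ s) (h₂ : ∀ s ∈ Icc (0 : ℝ) 1, U₂ s = s - ρ₂ s)
    (hρ₁ : ∀ s, 1 / 2 ≤ s → ρ₁ s = 1) (hρ₂ : ∀ s, s ≤ 1 / 2 → ρ₂ s = 0) :
    ∫ s in (0 : ℝ)..1, (U₂ s - U₁ s - deriv U₁ s * U₂ s) = 1 / 2 := by
  have hd : ∀ s, HasDerivAt U₁ (deriv U₁ s) s := fun s => ((hU₁.differentiable (by simp)) s).hasDerivAt
  have hcd : Continuous (deriv U₁) := hU₁.continuous_deriv (by simp)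
  have hc₁ := hU₁.continuous
  have hc₂ := hU₂.continuous
  rw [intervalIntegral.integral_eq_sub_of_hasDerivAt_of_le (f := fun s => s ^ 2 / 2 - s * U₁ s) zero_le_one]
  · rw [h₁ 1 (by simp), hρ₁ 1 (by norm_num)]
    norm_num
  · fun_prop
  · intro s hs
    have hΦ : HasDerivAt (fun s => s ^ 2 / 2 - s * U₁ s) (2 * s / 2 - (1 * U₁ s + s * deriv U₁ s)) s := by
      have h3 : HasDerivAt (fun s : ℝ => s ^ 2 / 2) (2 * s / 2) s := by
        have := (hasDerivAt_pow 2 s).div_const 2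
        simpa using this
      exact h3.sub ((hasDerivAt_id s).mul (hd s))
    suffices hE : U₂ s - U₁ s - deriv U₁ s * U₂ s = 2 * s / 2 - (1 * U₁ s + s * deriv U₁ s) by
      rw [hE]; exact hΦ
    have h4 := h₂ s ⟨hs.1.le, hs.2.le⟩
    rcases le_or_gt s (1 / 2) with h5 | h5
    · rw [h4, hρ₂ s h5]; ring
    · have h6 : deriv U₁ s = 1 := by
        have : U₁ =ᶠ[𝓝 s] fun s => s - 1 := by
          filter_upwards [Ioo_mem_nhds h5 hs.2] with r hr
          rw [h₁ r ⟨by linarith [hr.1], hr.2.le⟩, hρ₁ r hr.1.le]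
        rw [this.deriv_eq]
        simp
      rw [h6]; ring
  · exact Continuous.intervalIntegrable (by fun_prop) _ _

namespace LoopExtension
variable [IsTopologicalGroup G] [T2Space G] [ConnectedSpace G]
  {W : Type*} [NormedAddCommGroup W] [NormedSpace ℝ W] [CompleteSpace W]
  {E : Type*} [TopologicalSpace E] [ChartedSpace W E] [Group E] [LieGroup 𝓘(ℝ, W) ∞ E] [T2Space E]
  {B : LinearMap.BilinForm ℝ (LieAlg V G)} {σ : ℝ} (L : LoopExtension W E B σ) (T : MaximalTorus G)

theorem path_lieExp (hσ : 3 / 2 < σ) (X : LieAlg W E) (r : ℝ) :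
    L.path (lieExp X) r = lieExp (L.ld X r : LieAlg V G) :=
  hom_lieExp (L.contMDiff_evalHom hσ r) X

theorem path_mul (x y : E) (r : ℝ) : L.path (x * y) r = L.path x r * L.path y r := by
  simp [path]

theorem path_eq_path_fract (x : E) (r : ℝ) : L.path x r = L.path x (Int.fract r) := by
  rw [path, path]
  congr 1
  exact (AddCircle.coe_fract r).symm

theorem ld_fract (X : LieAlg W E) (r : ℝ) : L.ld X r = L.ld X (Int.fract r) := by
  rw [ld, ld, AddCircle.coe_fract]

theorem π_eq_of_path_eq {x y : E} (h : ∀ s ∈ Icc (0 : ℝ) 1, L.path x s = L.path y s) :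
    L.π x = L.π y := by
  ext s
  induction s using QuotientAddGroup.induction_on with
  | H r =>
    change L.path x r = L.path y r
    rw [L.path_eq_path_fract, L.path_eq_path_fract y]
    exact h _ ⟨Int.fract_nonneg r, (Int.fract_lt_one r).le⟩

theorem exists_ld_eq_smul {g : ℝ → ℝ} (hg : ContDiff ℝ ∞ g) (h : ∀ᶠ s in 𝓝 0, g (s + 1) = g s)
    (v : LieAlg V G) :
    ∃ (X : LieAlg W E) (U : ℝ → ℝ), ContDiff ℝ ∞ U ∧ (∀ s ∈ Icc (0 : ℝ) 1, U s = g s) ∧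
    ∀ r, L.ld X r = (U r • v : LieAlg V G) := by
  obtain ⟨F, hF, hFg⟩ := exists_periodic_extension hg h
  obtain ⟨X, hX⟩ := L.exists_ld_eq (IsSobolevMap.contDiff_const_smul (σ := σ) hF v)
  exact ⟨X, fun r => F r, hF, hFg, hX⟩

/-- Reparametrised factored curves are loops of products of exponentials. -/
theorem exists_list_path_eq (hσ : 3 / 2 < σ) {ρ : ℝ → ℝ} (hρ : ContDiff ℝ ∞ ρ)
    (h0 : ∀ᶠ s in 𝓝 0, ρ s = 0) (h1 : ∀ᶠ s in 𝓝 0, ρ (s + 1) = 1)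
    (l : List ((ℝ → ℝ) × LieAlg V G)) (hl : IsFactored V l) :
    ∃ l' : List (LieAlg W E),
    (∀ s ∈ Icc (0 : ℝ) 1, L.path (l'.map lieExp).prod s = expProd l (ρ s)) ∧
      ∀ X ∈ l', ∃ f : ℝ → ℝ, f 0 = 0 ∧ f 1 = 0 ∧ ∃ v :
    LieAlg V G, ∀ s ∈ Icc (0 : ℝ) 1, L.ld X s = (f (ρ s) • v : LieAlg V G) := by
  induction l with
  | nil => exact ⟨[], fun s _ => by simp [path, expProd], by simp⟩
  | cons p l ih =>
    obtain ⟨l', hl', hX⟩ := ih fun q hq => hl q (List.mem_cons_of_mem _ hq)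
    obtain ⟨hp, hp0, hp1⟩ := hl p (List.mem_cons_self ..)
    obtain ⟨X, U, -, hU, hXU⟩ := L.exists_ld_eq_smul (g := fun s => p.1 (ρ s)) (hp.comp hρ) (by
      filter_upwards [h0, h1] with s hs hs'
      rw [hs, hs', hp0, hp1]) p.2
    refine ⟨X :: l', fun s hs => ?_, ?_⟩
    · rw [List.map_cons, List.prod_cons, path_mul, hl' s hs, expProd_cons, L.path_lieExp hσ, hXU, hU s hs]
    · intro Y hY
      rcases List.mem_cons.1 hY with rfl | hY
      · exact ⟨p.1, hp0, hp1, p.2, fun s hs => by rw [hXU, hU s hs]⟩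
      · exact hX Y hY

/-- Exponentials of loops with disjoint supports commute. -/
theorem commute_lieExp (hσ : 3 / 2 < σ) {X Y : LieAlg W E}
    (hX : ∀ s ∈ Icc (0 : ℝ) 1, 1 / 2 ≤ s → L.ld X s = 0)
    (hY : ∀ s ∈ Icc (0 : ℝ) 1, s ≤ 1 / 2 → L.ld Y s = 0) (hY1 : L.ld Y 1 = 0) :
    Commute (lieExp X : E) (lieExp Y) := by
  obtain ⟨α, hα, hα'⟩ := L.bracket
  have hz : ∀ w : V, bracketModel V G w 0 = 0 := fun w => lie_zero (M := LieAlg V G) (show LieAlg V G from w)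
  have hz' : ∀ w : V, bracketModel V G 0 w = 0 := fun w => zero_lie (show LieAlg V G from w)
  have h1 : ∀ r, L.ld ⁅X, Y⁆ r = 0 := by
    intro r
    rw [L.ld_fract, L.ld_lie hσ]
    have hr : Int.fract r ∈ Icc (0 : ℝ) 1 := ⟨Int.fract_nonneg r, (Int.fract_lt_one r).le⟩
    rcases le_total (Int.fract r) (1 / 2) with h | h
    · rw [hY _ hr h, hz]
    · rw [hX _ hr h, hz']
  obtain ⟨a, ha⟩ := (L.ld_eq_zero_iff _).1 h1
  -- The bracket has zero loop because the supports are disjoint, and the cocycle vanishes for the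
  -- same reason. At `s = 1`, where `X` is not controlled from the right, the value of `Y` is zero.
  -- So the bracket is zero in `Lie E`, not merely central.
  have h2 : α ⁅X, Y⁆ = 0 := by
    rw [hα', L.loopCocycle_eq]
    refine (intervalIntegral.integral_congr (g := fun _ => (0 : ℝ)) fun s hs => ?_).trans (by simp)
    rw [uIcc_of_le zero_le_one] at hs
    change formCLM B (L.ld Y s) (deriv (L.ld X) s) = 0
    rcases le_or_gt s (1 / 2) with h | h
    · rw [hY s hs h]; simp
    rcases hs.2.eq_or_lt with h' | h'
    · rw [h', hY1]; simp
    · have : L.ld X =ᶠ[𝓝 s] fun _ => 0 := by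
        filter_upwards [Ioo_mem_nhds h h'] with r hr
        exact hX r ⟨by linarith [hr.1], hr.2.le⟩ hr.1.le
      rw [this.deriv_eq]; simp
  rw [ha, map_smul, hα] at h2
  have h3 : a = 0 := by simpa using h2
  rw [h3, zero_smul] at ha
  have h4 : Ad (lieExp X : E) Y = Y := by
    have := Ad_lieExp_of_lie_eq_zero (G := E) ha 1
    rwa [one_smul] at this
  have h5 := conj_lieExp (lieExp X : E) Y
  rw [h4] at h5
  exact mul_inv_eq_iff_eq_mul.1 h5

/-- Lifts of the loops `exp(-ρ ξ)`, `exp(-ρ' ξ')` with `ρ`, `ρ'` increasing on different halves of the interval commute. -/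
theorem commute_of_steps [SimplyConnectedSpace G] (hσ : 3 / 2 < σ) {ρ₁ ρ₂ : ℝ → ℝ}
    (hρ₁ : ContDiff ℝ ∞ ρ₁) (hρ₂ : ContDiff ℝ ∞ ρ₂)
    (h01 : ∀ s, s ≤ 1 / 4 → ρ₁ s = 0) (h11 : ∀ s, 1 / 2 ≤ s → ρ₁ s = 1)
    (h02 : ∀ s, s ≤ 1 / 2 → ρ₂ s = 0) (h12 : ∀ s, 3 / 4 ≤ s → ρ₂ s = 1)
    (hI₁ : ∀ s, ρ₁ s ∈ Icc (0 : ℝ) 1) (hI₂ : ∀ s, ρ₂ s ∈ Icc (0 : ℝ) 1) (ξ ξ' : T.lattice V)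
    {x y : E}
    (hx : ∀ s ∈ Icc (0 : ℝ) 1, L.path x s = lieExp (-(ρ₁ s • (ξ : LieAlg V G))))
    (hy : ∀ s ∈ Icc (0 : ℝ) 1, L.path y s = lieExp (-(ρ₂ s • (ξ' : LieAlg V G)))) :
    Commute x y := by
  have hev : ∀ᶠ s : ℝ in 𝓝 0, |s| < 1 / 4 := by
    filter_upwards [Metric.ball_mem_nhds (0 : ℝ) (by norm_num : (0 : ℝ) < 1 / 4)] with s hs
    simpa using hs
  have key : ∀ (ρ : ℝ → ℝ), ContDiff ℝ ∞ ρ → (∀ s, s ≤ 1 / 4 → ρ s = 0) → (∀ s, 3 / 4 ≤ s → ρ s = 1) → (∀ s, ρ s ∈ Icc (0 : ℝ) 1) →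
      ∀ (ξ : T.lattice V) (x : E), (∀ s ∈ Icc (0 : ℝ) 1, L.path x s = lieExp (-(ρ s • (ξ : LieAlg V G)))) →
      ∃ (l' : List (LieAlg W E)) (z : Circle), x = L.ι z * (l'.map lieExp).prod ∧
      ∀ X ∈ l', ∃ f : ℝ → ℝ, f 0 = 0 ∧ f 1 = 0 ∧ ∃ v : LieAlg V G, ∀ s ∈ Icc (0 : ℝ) 1, L.ld X s = (f (ρ s) • v : LieAlg V G) := by
    intro ρ hρ h0 h1 hI ξ x hx
    have hsm := contMDiff_lieExp_smul (-(ξ : LieAlg V G))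
    -- The loop `t ↦ exp (-t ξ)` factors with coefficients vanishing at `0` and `1`. Composed with
    -- `ρ`, each coefficient is supported where `ρ` lies strictly between `0` and `1`, so factors
    -- belonging to `ρ₁` and `ρ₂` have disjoint supports.
    obtain ⟨l, hl, heq⟩ := exists_factorization hsm (by rw [zero_smul, lieExp_zero_eq_one]) (by
      rw [one_smul, lieExp_neg', ξ.2.2, inv_one])
    obtain ⟨l', hl', hX⟩ := L.exists_list_path_eq hσ hρ (by filter_upwards [hev] with s hs; exact h0 s (abs_lt.1 hs).2.le)
      (by filter_upwards [hev] with s hs; exact h1 _ (by linarith [(abs_lt.1 hs).1])) l hl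
    obtain ⟨z, hz⟩ := L.eq_central_mul_of_π_eq (x := x) (y := (l'.map lieExp).prod) (L.π_eq_of_path_eq fun s hs => by
      rw [hl' s hs, ← heq (hI s), hx s hs]
      exact congrArg lieExp (smul_neg _ _).symm)
    exact ⟨l', z, hz, hX⟩
  obtain ⟨l₁, z₁, rfl, hl₁⟩ := key ρ₁ hρ₁ h01 (fun s hs => h11 s (by linarith)) hI₁ ξ x hx
  obtain ⟨l₂, z₂, rfl, hl₂⟩ := key ρ₂ hρ₂ (fun s hs => h02 s (by linarith)) h12 hI₂ ξ' y hy
  have hc : ∀ z (w : E), Commute (L.ι z) w := fun z w => L.ι_central z w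
  refine ((hc _ _).mul_left ((hc z₂ _).symm.mul_right ?_))
  refine Commute.list_prod_left _ _ fun a ha => Commute.list_prod_right _ _ fun b hb => ?_
  obtain ⟨X, hX, rfl⟩ := List.mem_map.1 ha
  obtain ⟨Y, hY, rfl⟩ := List.mem_map.1 hb
  obtain ⟨f, hf0, hf1, v, hfX⟩ := hl₁ X hX
  obtain ⟨g, hg0, hg1, w, hgY⟩ := hl₂ Y hY
  refine L.commute_lieExp hσ (fun s hs h => ?_) (fun s hs h => ?_) ?_
  · rw [hfX s hs, h11 s h, hf1]; exact zero_smul ℝ v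
  · rw [hgY s hs, h02 s h, hg0]; exact zero_smul ℝ w
  · rw [hgY 1 (by simp), h12 1 (by norm_num), hg1]; exact zero_smul ℝ w

/-- Pure bookkeeping with central phases: `a p` and `b q` commute, and moving `p` and `q` past the
other elements leaves the commutator of `a` and `b`. -/
theorem commutator_of_relations (L : LoopExtension W E B σ) {a b p q : E} {z₁ z₂ z₃ : Circle}
    (h₁ : a * q * a⁻¹ = L.ι z₁ * q)
    (h₂ : b * p * b⁻¹ = L.ι z₂ * p) (h₃ : p * q * p⁻¹ = L.ι z₃ * q)
    (h : a * p * (b * q) = b * q * (a * p)) :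
    a * b * a⁻¹ * b⁻¹ = L.ι (z₂ * z₃⁻¹ * z₁⁻¹) := by
  have c : ∀ z (w : E), L.ι z * w = w * L.ι z := L.ι_central
  have h₁' : a * q = L.ι z₁ * (q * a) := by rw [← mul_assoc, ← h₁]; simp
  have h₂' : b * p = L.ι z₂ * (p * b) := by rw [← mul_assoc, ← h₂]; simp
  have h₃' : p * q = L.ι z₃ * (q * p) := by rw [← mul_assoc, ← h₃]; simp
  have e1 : L.ι z₂ * (a * p * (b * q)) = L.ι z₃ * (a * b * (q * p)) := by
    calc L.ι z₂ * (a * p * (b * q)) = a * (L.ι z₂ * (p * b)) * q := by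
          rw [← mul_assoc, ← mul_assoc, ← mul_assoc, c z₂ a]; simp only [mul_assoc]
      _ = a * b * (p * q) := by rw [← h₂']; simp only [mul_assoc]
      _ = L.ι z₃ * (a * b * (q * p)) := by
          rw [h₃', ← mul_assoc (a * b), ← c z₃ (a * b), mul_assoc]
  have e2 : L.ι z₁ * (b * q * (a * p)) = b * a * (q * p) := by
    calc L.ι z₁ * (b * q * (a * p)) = b * (L.ι z₁ * (q * a)) * p := by
          rw [← mul_assoc, ← mul_assoc, ← mul_assoc, c z₁ b]; simp only [mul_assoc]
      _ = b * a * (q * p) := by rw [← h₁']; simp only [mul_assoc]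
  have e3 : L.ι z₁ * (L.ι z₃ * (a * b * (q * p))) = L.ι z₂ * (b * a * (q * p)) := by
    rw [← e1, ← e2, h, ← mul_assoc, c z₁ (L.ι z₂), mul_assoc]
  have e4 : L.ι z₁ * L.ι z₃ * (a * b) = L.ι z₂ * (b * a) :=
    mul_right_cancel (b := q * p) (by simpa only [mul_assoc] using e3)
  have e5 : a * b = L.ι (z₂ * z₃⁻¹ * z₁⁻¹) * (b * a) := by
    have e6 : L.ι (z₁ * z₃) * (a * b) = L.ι z₂ * (b * a) := by rw [map_mul]; exact e4
    have e7 : z₂ * z₃⁻¹ * z₁⁻¹ = (z₁ * z₃)⁻¹ * z₂ := by rw [mul_inv, mul_comm, mul_comm z₂, mul_assoc]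
    rw [e7, map_mul, mul_assoc, ← e6, map_inv, inv_mul_cancel_left]
  rw [e5]
  simp [mul_assoc]

/-- The commutator of lifts of two elements of the lattice. -/
theorem commutator_lattice [SimplyConnectedSpace G] (hσ : 3 / 2 < σ)
    (hinv : ∀ x y z, B ⁅x, y⁆ z = B x ⁅y, z⁆) (hsymm : ∀ x y, B x y = B y x)
    (hperf : Submodule.span ℝ {z : LieAlg V G | ∃ x y : LieAlg V G, ⁅x, y⁆ = z} = ⊤)
    (ξ ξ' : T.lattice V) {x x' : E} (hx : L.π x = T.latticeLoop V (.ofAdd ξ))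
    (hx' : L.π x' = T.latticeLoop V (.ofAdd ξ')) :
    ∃ n : ℤ, B (ξ : LieAlg V G) (ξ' : LieAlg V G) = n ∧ x * x' * x⁻¹ * x'⁻¹ = L.ι ((-1) ^ n) := by
  have hpath : ∀ {x : E} {ξ : T.lattice V}, L.π x = T.latticeLoop V (.ofAdd ξ) → ∀ r, L.path x r = lieExp (-(r • (ξ : LieAlg V G))) :=
    fun hx r => by rw [path, hx]; rfl
  have hloops : ∀ {x : E} {ξ : T.lattice V}, L.π x = T.latticeLoop V (.ofAdd ξ) → L.π x ∈ loopsIn T.toSubgroup := by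
    intro x ξ hx s
    induction s using QuotientAddGroup.induction_on with
    | H r =>
      change L.path x r ∈ _
      rw [hpath hx]
      exact T.lieExp_mem (neg_mem (Submodule.smul_mem _ _ ξ.2.1))
  have hlog : ∀ {x : E} {ξ : T.lattice V}, L.π x = T.latticeLoop V (.ofAdd ξ) → ∀ s, leftLogDeriv V (L.path x) s = (-(ξ : LieAlg V G) : LieAlg V G) :=
    fun {x ξ} hx s => by rw [← T.leftLogDeriv_latticeLoop ξ s, ← hx]; rfl
  set β := B (ξ : LieAlg V G) (ξ' : LieAlg V G) with hβ
  -- Since `exp ξ' = 1`, conjugation by `j (exp ξ')` is trivial, whereas the torus action says that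
  -- it is the phase `exp (2πi β)`. So integrality is forced by the existence of the extension.
  have hint : ∃ n : ℤ, β = n := by
    obtain ⟨j, hj⟩ := L.exists_isConstLift hσ hinv hsymm hperf
    have h1 := L.conj_torus T hσ hinv hsymm hperf hj (hloops hx) ξ'.2.1
    rw [ξ'.2.2, L.winding_latticeLoop T hx, map_one, one_mul, inv_one, mul_one] at h1
    have h2 : L.ι (Circle.exp (2 * Real.pi * β)) = 1 := by rwa [right_eq_mul] at h1
    have h3 : Circle.exp (2 * Real.pi * β) = 1 := L.ι_injective (h2.trans (map_one _).symm)
    obtain ⟨n, hn⟩ := Circle.exp_eq_one.1 h3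
    refine ⟨n, ?_⟩
    have := Real.pi_pos
    have h4 : (2 * Real.pi) * β = (2 * Real.pi) * n := by rw [hn]; ring
    exact mul_left_cancel₀ (by positivity) h4
  obtain ⟨n, hn⟩ := hint
  refine ⟨n, hn, ?_⟩
  -- `ρ₁` climbs on `[1/4, 1/2]` and `ρ₂` on `[1/2, 3/4]`. Both are flat near the ends of `[0, 1]`,
  -- so `s - ρ` has a smooth periodic extension.
  let ρ₁ : ℝ → ℝ := fun s => Real.smoothTransition (4 * s - 1)
  let ρ₂ : ℝ → ℝ := fun s => Real.smoothTransition (4 * s - 2)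
  have hρ₁ : ContDiff ℝ ∞ ρ₁ := Real.smoothTransition.contDiff.comp (by fun_prop)
  have hρ₂ : ContDiff ℝ ∞ ρ₂ := Real.smoothTransition.contDiff.comp (by fun_prop)
  have h01 : ∀ s, s ≤ 1 / 4 → ρ₁ s = 0 := fun s hs => Real.smoothTransition.zero_of_nonpos (by linarith)
  have h11 : ∀ s, 1 / 2 ≤ s → ρ₁ s = 1 := fun s hs => Real.smoothTransition.one_of_one_le (by linarith)
  have h02 : ∀ s, s ≤ 1 / 2 → ρ₂ s = 0 := fun s hs => Real.smoothTransition.zero_of_nonpos (by linarith)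
  have h12 : ∀ s, 3 / 4 ≤ s → ρ₂ s = 1 := fun s hs => Real.smoothTransition.one_of_one_le (by linarith)
  have hI : ∀ t, Real.smoothTransition t ∈ Icc (0 : ℝ) 1 := fun t => ⟨Real.smoothTransition.nonneg t, Real.smoothTransition.le_one t⟩
  have hev : ∀ᶠ s : ℝ in 𝓝 0, |s| < 1 / 4 := by
    filter_upwards [Metric.ball_mem_nhds (0 : ℝ) (by norm_num : (0 : ℝ) < 1 / 4)] with s hs
    simpa using hs
  obtain ⟨X₁, U₁, hU₁, hU₁', hX₁⟩ := L.exists_ld_eq_smul (g := fun s => s - ρ₁ s) (contDiff_id.sub hρ₁) (by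
    filter_upwards [hev] with s hs
    rw [abs_lt] at hs
    rw [h01 s hs.2.le, h11 (s + 1) (by linarith)]; ring) (ξ : LieAlg V G)
  obtain ⟨X₂, U₂, hU₂, hU₂', hX₂⟩ := L.exists_ld_eq_smul (g := fun s => s - ρ₂ s) (contDiff_id.sub hρ₂) (by
    filter_upwards [hev] with s hs
    rw [abs_lt] at hs
    rw [h02 s (by linarith), h12 (s + 1) (by linarith)]; ring) (ξ' : LieAlg V G)
  -- Multiplying a lift of `exp (-s ξ)` by the exponential of `(s - ρ) ξ` moves all the rotation to
  -- where `ρ` climbs.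
  have hcomb : ∀ {x : E} {ξ : T.lattice V} {X : LieAlg W E} {U ρ : ℝ → ℝ}, L.π x = T.latticeLoop V (.ofAdd ξ) →
      (∀ s ∈ Icc (0 : ℝ) 1, U s = s - ρ s) → (∀ r, L.ld X r = (U r • (ξ : LieAlg V G) : LieAlg V G)) →
      ∀ s ∈ Icc (0 : ℝ) 1, L.path (x * lieExp X) s = lieExp (-(ρ s • (ξ : LieAlg V G))) := by
    intro x ξ X U ρ hx hU hX s hs
    rw [L.path_mul, hpath hx, L.path_lieExp hσ, hX, ← T.lieExp_add (neg_mem (Submodule.smul_mem _ _ ξ.2.1)) (Submodule.smul_mem _ _ ξ.2.1),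
      hU s hs, sub_smul]
    congr 1
    abel
  have hcommute := L.commute_of_steps T hσ hρ₁ hρ₂ h01 h11 h02 h12 (fun s => hI _) (fun s => hI _) ξ ξ' (hcomb hx hU₁' hX₁) (hcomb hx' hU₂' hX₂)
  have hfix : ∀ {x : E} {ξ : T.lattice V} {X : LieAlg W E} {U : ℝ → ℝ}, L.π x ∈ loopsIn T.toSubgroup →
      (∀ r, L.ld X r = (U r • (ξ : LieAlg V G) : LieAlg V G)) → ∀ r, AdL (L.path x r) (L.ld X r) = L.ld X r := by
    intro x ξ X U hx hX r
    rw [hX]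
    exact T.Ad_eq_of_mem (hx r) (Submodule.smul_mem _ _ ξ.2.1)
  have hp : L.π (lieExp X₁ : E) ∈ loopsIn T.toSubgroup := by
    intro s
    induction s using QuotientAddGroup.induction_on with
    | H r =>
      change L.path _ r ∈ _
      rw [L.path_lieExp hσ, hX₁]
      exact T.lieExp_mem (Submodule.smul_mem _ _ ξ.2.1)
  have k₁ := L.conj_lieExp_of_fixed hσ hinv hsymm hperf x X₂ (hfix (hloops hx) hX₂)
  have k₂ := L.conj_lieExp_of_fixed hσ hinv hsymm hperf x' X₁ (hfix (hloops hx') hX₁)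
  have k₃ := L.conj_lieExp_of_fixed hσ hinv hsymm hperf (lieExp X₁) X₂ (hfix hp hX₂)
  have hlogp : ∀ s, leftLogDeriv V (L.path (lieExp X₁ : E)) s = (deriv U₁ s • (ξ : LieAlg V G) : LieAlg V G) := by
    intro s
    refine HasLogDerivAt.leftLogDeriv_eq ?_
    have h1 := (hasLogDerivAt_lieExp (ξ : LieAlg V G) (U₁ s)).scomp ((hU₁.differentiable (by simp) s).hasDerivAt)
    refine h1.congr (Eventually.of_forall fun r => ?_)
    rw [L.path_lieExp hσ, hX₁]
  have i₁ : ∫ s in (0 : ℝ)..1, formCLM B (leftLogDeriv V (L.path x) s) (L.ld X₂ s) = - (β * ∫ s in (0 : ℝ)..1, U₂ s) := by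
    rw [← intervalIntegral.integral_const_mul, ← intervalIntegral.integral_neg]
    refine intervalIntegral.integral_congr fun s _ => ?_
    change formCLM B (leftLogDeriv V (L.path x) s) (L.ld X₂ s) = -(β * U₂ s)
    rw [hlog hx, hX₂]
    refine (formCLM_apply B (-(ξ : LieAlg V G)) (U₂ s • (ξ' : LieAlg V G))).trans ?_
    rw [map_neg, LinearMap.neg_apply, map_smul, smul_eq_mul, mul_comm]
  have i₂ : ∫ s in (0 : ℝ)..1, formCLM B (leftLogDeriv V (L.path x') s) (L.ld X₁ s) = - (β * ∫ s in (0 : ℝ)..1, U₁ s) := by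
    rw [← intervalIntegral.integral_const_mul, ← intervalIntegral.integral_neg]
    refine intervalIntegral.integral_congr fun s _ => ?_
    change formCLM B (leftLogDeriv V (L.path x') s) (L.ld X₁ s) = -(β * U₁ s)
    rw [hlog hx', hX₁]
    refine (formCLM_apply B (-(ξ' : LieAlg V G)) (U₁ s • (ξ : LieAlg V G))).trans ?_
    rw [map_neg, LinearMap.neg_apply, map_smul, smul_eq_mul, mul_comm, hsymm]
  have i₃ : ∫ s in (0 : ℝ)..1, formCLM B (leftLogDeriv V (L.path (lieExp X₁ : E)) s) (L.ld X₂ s) = β * ∫ s in (0 : ℝ)..1, deriv U₁ s * U₂ s := by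
    rw [← intervalIntegral.integral_const_mul]
    refine intervalIntegral.integral_congr fun s _ => ?_
    change formCLM B (leftLogDeriv V (L.path (lieExp X₁ : E)) s) (L.ld X₂ s) = β * (deriv U₁ s * U₂ s)
    rw [hlogp, hX₂]
    refine (formCLM_apply B (deriv U₁ s • (ξ : LieAlg V G)) (U₂ s • (ξ' : LieAlg V G))).trans ?_
    rw [map_smul, map_smul, LinearMap.smul_apply, smul_eq_mul, smul_eq_mul, ← hβ]
    ring
  rw [i₁] at k₁
  rw [i₂] at k₂
  rw [i₃] at k₃
  rw [L.commutator_of_relations k₁ k₂ k₃ hcommute]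
  congr 1
  rw [← Circle.exp_neg, ← Circle.exp_neg, ← Circle.exp_add, ← Circle.exp_add]
  have hI := integral_shifted_steps hU₁ hU₂ hU₁' hU₂' h11 h02
  have hcd : Continuous (deriv U₁) := hU₁.continuous_deriv (by simp)
  have hc₁ := hU₁.continuous
  have hc₂ := hU₂.continuous
  rw [intervalIntegral.integral_sub (Continuous.intervalIntegrable (by fun_prop) _ _) (Continuous.intervalIntegrable (by fun_prop) _ _),
    intervalIntegral.integral_sub (Continuous.intervalIntegrable (by fun_prop) _ _) (Continuous.intervalIntegrable (by fun_prop) _ _)] at hI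
  -- The three phases add up to `2π β` times the integral of `integral_shifted_steps`, that is, to
  -- `π β`.
  have hfin : 2 * Real.pi * -(β * ∫ s in (0 : ℝ)..1, U₁ s) + -(2 * Real.pi * (β * ∫ s in (0 : ℝ)..1, deriv U₁ s * U₂ s)) +
      -(2 * Real.pi * -(β * ∫ s in (0 : ℝ)..1, U₂ s)) = n * Real.pi := by
    rw [← hn]
    linear_combination (2 * Real.pi * β) * hI
  rw [hfin]
  exact circle_exp_int_mul_pi n

end LoopExtension

end

/-! ### Root vectors, coroots and reflections. -/

noncomputable section

open scoped Manifold ContDiff ENNReal Topology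
open VectorField Set Filter
variable {V : Type*} [NormedAddCommGroup V] [NormedSpace ℝ V] [CompleteSpace V]
  {G : Type*} [TopologicalSpace G] [ChartedSpace V G] [Group G] [LieGroup 𝓘(ℝ, V) ∞ G]

theorem exists_eigenvector_of_symmetric {L : Type*} [AddCommGroup L] [Module ℝ L]
    [FiniteDimensional ℝ L] [Nontrivial L]
    {B : LinearMap.BilinForm ℝ L} (hs : ∀ x y, B x y = B y x) (hp : ∀ x, x ≠ 0 → 0 < B x x)
    {A : L →ₗ[ℝ] L}
    (hA : ∀ x y, B (A x) y = B x (A y)) : ∃ (c : ℝ) (x : L), x ≠ 0 ∧ A x = c • x := by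
  let core : InnerProductSpace.Core ℝ L :=
    { inner := fun x y => B x y
      conj_inner_symm := fun x y => hs y x
      re_inner_nonneg := fun x => by
        rcases eq_or_ne x 0 with rfl | h
        · simp
        · exact (hp x h).le
      add_left := fun x y z => by simp
      smul_left := fun x y r => by simp
      definite := fun x h => by
        by_contra hx
        exact (hp x hx).ne' h }
  let _ := core.toNormedAddCommGroup
  let _ := InnerProductSpace.ofCore core.toCore
  by_contra! hc
  have h1 : ∀ μ : ℝ, Module.End.eigenspace A μ = ⊥ := by
    intro μ
    rw [eq_bot_iff]
    intro x hx
    rw [Module.End.mem_eigenspace_iff] at hx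
    by_contra h0
    exact hc μ x h0 hx
  have hsym : LinearMap.IsSymmetric (𝕜 := ℝ) A := fun x y => hA x y
  have := hsym.subsingleton_of_no_eigenvalue_finiteDimensional h1
  exact not_subsingleton L this

variable [FiniteDimensional ℝ V]

/-- An invariant inner product on a Lie algebra. -/
structure IsInvariantInner {L : Type*} [LieRing L] [LieAlgebra ℝ L] (B : LinearMap.BilinForm ℝ L) :
    Prop where
  symm : ∀ x y, B x y = B y x
  inv : ∀ x y z, B ⁅x, y⁆ z = B x ⁅y, z⁆
  pos : ∀ x, x ≠ 0 → 0 < B x x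

section InvariantForm
variable {L : Type*} [LieRing L] [LieAlgebra ℝ L] {B : LinearMap.BilinForm ℝ L}

theorem bilin_lie_skew (hinv : ∀ x y z, B ⁅x, y⁆ z = B x ⁅y, z⁆) (h x y : L) :
    B ⁅h, x⁆ y = - B x ⁅h, y⁆ := by
  rw [← lie_skew, map_neg, LinearMap.neg_apply, hinv]

theorem IsInvariantInner.eq_zero (hB : IsInvariantInner B) {x : L} (h : B x x = 0) : x = 0 := by
  by_contra hx
  exact (hB.pos x hx).ne' h

end InvariantForm

/-- `Ad (exp (-sH))` applied to a solution of `Z' = [H, Z]` is constant. Explicit trigonometric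
solutions thus give the adjoint action on invariant planes. -/
theorem AdL_lieExp_of_hasDerivAt [T2Space G] {H : LieAlg V G} {Z : ℝ → V}
    (hZ : ∀ s, HasDerivAt Z (bracketModel V G H (Z s)) s) (s : ℝ) :
    AdL (lieExp (s • H) : G) (Z 0) = Z s := by
  have h1 : ∀ s, HasDerivAt (fun s => AdL (lieExp (s • -H) : G) (Z s)) 0 s := by
    intro s
    have h2 := (hasLogDerivAt_lieExp (G := G) (-H) s).hasDerivAt_Ad_comp (hZ s)
    have h3 : bracketModel V G (-H : LieAlg V G) (Z s) + bracketModel V G H (Z s) = 0 := by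
      have : bracketModel V G (-H : LieAlg V G) (Z s) = - bracketModel V G H (Z s) :=
        neg_lie H (show LieAlg V G from Z s)
      rw [this, neg_add_cancel]
    rw [h3, map_zero] at h2
    exact h2
  have h4 := is_const_of_deriv_eq_zero (fun s => (h1 s).differentiableAt) (fun s => (h1 s).deriv) 0 s
  have h5 : AdL (lieExp ((0 : ℝ) • -H) : G) (Z 0) = Z 0 := by
    rw [zero_smul, lieExp_zero_eq_one]
    exact Ad_one (Z 0 : LieAlg V G)
  simp only [h5] at h4
  rw [h4]
  have h6 : lieExp (s • H) = (lieExp (s • -H) : G)⁻¹ := by rw [smul_neg, lieExp_neg', inv_inv]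
  rw [h6]
  exact Ad_inv_Ad (lieExp (s • -H) : G) (Z s : LieAlg V G)

namespace MaximalTorus
variable [T2Space G] [IsTopologicalGroup G] (T : MaximalTorus G)

theorem mem_lieAlgebra_of_lie_eq_zero {v : LieAlg V G} (h : ∀ H ∈ T.lieAlgebra V, ⁅H, v⁆ = 0) :
    v ∈ T.lieAlgebra V := by
  refine T.mem_lieAlgebra_of_Ad fun a ha => ?_
  obtain ⟨ζ, hζ, rfl⟩ := T.exists_lieExp_eq (V := V) ha
  have := Ad_lieExp_of_lie_eq_zero (h ζ hζ) 1
  rwa [one_smul] at this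

theorem lie_lie_comm {H H' : LieAlg V G} (hH : H ∈ T.lieAlgebra V) (hH' : H' ∈ T.lieAlgebra V)
    (x : LieAlg V G) :
    ⁅H, ⁅H', x⁆⁆ = ⁅H', ⁅H, x⁆⁆ := by
  rw [leibniz_lie, T.lie_eq_zero hH hH', zero_lie, zero_add]

variable {T} {B : LinearMap.BilinForm ℝ (LieAlg V G)}

/-- Every nonzero subspace of `𝔱^⊥` that is invariant under `𝔱` contains root vectors. -/
theorem exists_rootPair (hB : IsInvariantInner B) {S₀ : Submodule ℝ (LieAlg V G)} (h0 : S₀ ≠ ⊥)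
    (hinv : ∀ H ∈ T.lieAlgebra V, ∀ x ∈ S₀, ⁅H, x⁆ ∈ S₀)
    (hort : ∀ x ∈ S₀, ∀ H ∈ T.lieAlgebra V, B x H = 0) :
    ∃ α X Y, X ∈ S₀ ∧ Y ∈ S₀ ∧ α ≠ 0 ∧ T.IsRootPair (V := V) ⊤ α X Y := by
  let 𝒮 : Set (Submodule ℝ (LieAlg V G)) := {S | S ≠ ⊥ ∧ S ≤ S₀ ∧ ∀ H ∈ T.lieAlgebra V, ∀ x ∈ S, ⁅H, x⁆ ∈ S}
  -- A minimal invariant subspace plays the role of a real root plane. The operators `ad H ad H'`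
  -- are symmetric and commute with the torus, hence act on it by scalars.
  obtain ⟨S, ⟨hS0, hSS, hSinv⟩, hmin⟩ := WellFounded.has_min (wellFounded_lt (α := Submodule ℝ (LieAlg V G))) 𝒮 ⟨S₀, h0, le_rfl, hinv⟩
  have hnt : Nontrivial S := Submodule.nontrivial_iff_ne_bot.2 hS0
  -- symmetric operators commuting with the torus are scalar on a minimal subspace
  have hscal : ∀ A : LieAlg V G →ₗ[ℝ] LieAlg V G, (∀ x y, B (A x) y = B x (A y)) → (∀ x ∈ S, A x ∈ S) →
      (∀ H ∈ T.lieAlgebra V, ∀ x, A ⁅H, x⁆ = ⁅H, A x⁆) → ∃ c : ℝ, ∀ x ∈ S, A x = c • x := by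
    intro A hA hAS hAc
    obtain ⟨c, x, hx, hcx⟩ := exists_eigenvector_of_symmetric (L := S) (B := B.domRestrict₁₂ S S) (fun x y => hB.symm _ _)
      (fun x hx => hB.pos _ (by simpa using hx)) (A := A.restrict hAS) (fun x y => hA _ _)
    refine ⟨c, ?_⟩
    let S' : Submodule ℝ (LieAlg V G) := S ⊓ LinearMap.ker (A - c • LinearMap.id)
    have hS' : ∀ y, y ∈ S' ↔ y ∈ S ∧ A y = c • y := fun y => by
      simp [S', sub_eq_zero]
    have hmem : S' ∈ 𝒮 := by
      refine ⟨?_, inf_le_left.trans hSS, fun H hH y hy => ?_⟩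
      · intro hb
        have h1 : (x : LieAlg V G) ∈ S' := (hS' _).2 ⟨x.2, by simpa using congrArg Subtype.val hcx⟩
        rw [hb, Submodule.mem_bot] at h1
        exact hx (Subtype.ext h1)
      · rw [hS'] at hy ⊢
        exact ⟨hSinv H hH y hy.1, by rw [hAc H hH, hy.2, lie_smul]⟩
    intro y hy
    have h2 : S' = S := by
      by_contra hne
      exact hmin S' hmem (lt_of_le_of_ne inf_le_left hne)
    rw [← h2, hS'] at hy
    exact hy.2
  let ad : LieAlg V G → LieAlg V G →ₗ[ℝ] LieAlg V G := fun H => LieModule.toEnd ℝ (LieAlg V G) (LieAlg V G) H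
  have had : ∀ H x, ad H x = ⁅H, x⁆ := fun H x => rfl
  have hscal2 : ∀ H ∈ T.lieAlgebra V, ∀ H' ∈ T.lieAlgebra V, ∃ c : ℝ, ∀ x ∈ S, ⁅H, ⁅H', x⁆⁆ = c • x := by
    intro H hH H' hH'
    refine hscal (ad H ∘ₗ ad H') (fun x y => ?_) (fun x hx => ?_) (fun K hK x => ?_)
    · simp only [LinearMap.comp_apply, had]
      rw [bilin_lie_skew hB.inv, bilin_lie_skew hB.inv, neg_neg, T.lie_lie_comm hH' hH]
    · exact hSinv H hH _ (hSinv H' hH' x hx)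
    · simp only [LinearMap.comp_apply, had]
      rw [T.lie_lie_comm hH' hK, T.lie_lie_comm hH hK]
  obtain ⟨H₀, hH₀, x₀, hx₀, hne⟩ : ∃ H₀ ∈ T.lieAlgebra V, ∃ x ∈ S, ⁅H₀, x⁆ ≠ 0 := by
    by_contra! hall
    obtain ⟨x, hx, hx0⟩ := Submodule.exists_mem_ne_zero_of_ne_bot hS0
    have h1 := T.mem_lieAlgebra_of_lie_eq_zero fun H hH => hall H hH x hx
    exact hx0 (hB.eq_zero (hort x (hSS hx) x h1))
  have hx₀0 : x₀ ≠ 0 := fun h => hne (by rw [h, lie_zero])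
  obtain ⟨c, hc⟩ := hscal2 H₀ hH₀ H₀ hH₀
  -- `ad H₀` is skew, so its square is negative. Normalizing by `w = √(-c)` makes `ad H₀` a rotation
  -- with frequency `w` in the plane of `x₀` and `Y`.
  have hcneg : c < 0 := by
    have h1 := bilin_lie_skew hB.inv H₀ ⁅H₀, x₀⁆ x₀
    rw [hc x₀ hx₀, map_smul, LinearMap.smul_apply, smul_eq_mul] at h1
    have h2 := hB.pos _ hne
    have h3 := hB.pos _ hx₀0
    nlinarith
  let w := Real.sqrt (-c)
  have hw : 0 < w := Real.sqrt_pos.2 (by linarith)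
  have hw2 : w * w = -c := Real.mul_self_sqrt (by linarith)
  obtain ⟨Y, hYdef⟩ : ∃ Y, Y = w⁻¹ • ⁅H₀, x₀⁆ := ⟨_, rfl⟩
  have hY0 : Y ≠ 0 := hYdef ▸ smul_ne_zero (inv_ne_zero hw.ne') hne
  have hYS : Y ∈ S := hYdef ▸ S.smul_mem _ (hSinv _ hH₀ _ hx₀)
  have hlam : ∀ H ∈ T.lieAlgebra V, ∃ lam : ℝ, ⁅H, x₀⁆ = lam • Y ∧ ⁅H, Y⁆ = -(lam • x₀) := by
    intro H hH
    obtain ⟨d, hd⟩ := hscal2 H hH H₀ hH₀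
    have hxY : x₀ = -(w⁻¹ • ⁅H₀, Y⁆) := by
      rw [hYdef, lie_smul, hc x₀ hx₀, smul_smul, smul_smul, ← neg_smul]
      have : -(w⁻¹ * w⁻¹ * c) = 1 := by
        have : c = -(w * w) := by linarith
        rw [this]; field_simp
      rw [this, one_smul]
    refine ⟨-(w⁻¹ * d), ?_, ?_⟩
    · have h1 : ⁅H, x₀⁆ = ⁅H, -(w⁻¹ • ⁅H₀, Y⁆)⁆ := congrArg _ hxY
      rw [h1, lie_neg, lie_smul, hd Y hYS, smul_smul, ← neg_smul]
    · rw [hYdef, lie_smul, hd x₀ hx₀, smul_smul, neg_smul, neg_neg]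
  have hYY := hB.pos Y hY0
  let α : Module.Dual ℝ (T.lieAlgebra V) :=
    { toFun := fun H => B ⁅(H : LieAlg V G), x₀⁆ Y / (2 * Real.pi * B Y Y)
      map_add' := fun H K => by simp [add_div]
      map_smul' := fun r H => by simp [mul_div_assoc] }
  have hα : ∀ (H : T.lieAlgebra V) lam, ⁅(H : LieAlg V G), x₀⁆ = lam • Y → 2 * Real.pi * α H = lam := by
    intro H lam h
    change 2 * Real.pi * (B ⁅(H : LieAlg V G), x₀⁆ Y / (2 * Real.pi * B Y Y)) = lam
    rw [h, map_smul, LinearMap.smul_apply, smul_eq_mul]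
    have := Real.pi_pos
    field_simp
  refine ⟨α, x₀, Y, hSS hx₀, hSS hYS, ?_, ⟨trivial, trivial, hx₀0, fun H => ?_, fun H => ?_⟩⟩
  · intro h
    have h1 := hα ⟨H₀, hH₀⟩ w (by rw [hYdef, smul_smul, mul_inv_cancel₀ hw.ne', one_smul])
    rw [h] at h1
    simp at h1
    exact hw.ne h1
  · obtain ⟨lam, h1, -⟩ := hlam H H.2
    rw [hα H lam h1, h1]
  · obtain ⟨lam, h1, h2⟩ := hlam H H.2
    rw [hα H lam h1, h2]

section RootPair
variable {I : LieIdeal ℝ (LieAlg V G)} {α : Module.Dual ℝ (T.lieAlgebra V)} {X Y : LieAlg V G}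

theorem IsRootPair.form_eq {b : LinearMap.BilinForm ℝ (LieAlg V G)}
    (hinv : ∀ x y z, b ⁅x, y⁆ z = b x ⁅y, z⁆)
    (h : T.IsRootPair I α X Y) (H : T.lieAlgebra V) : b ⁅X, Y⁆ H = 2 * Real.pi * α H * b X X := by
  rw [hinv, ← lie_skew, h.lie_right, neg_neg, map_smul, smul_eq_mul]

theorem IsRootPair.lie_mem (h : T.IsRootPair I α X Y) : ⁅X, Y⁆ ∈ T.lieAlgebra V := by
  refine T.mem_lieAlgebra_of_lie_eq_zero fun H hH => ?_
  have h1 := h.lie_left ⟨H, hH⟩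
  have h2 := h.lie_right ⟨H, hH⟩
  simp only at h1 h2
  rw [leibniz_lie, h1, h2, smul_lie, lie_neg, lie_smul, lie_self, lie_self]
  simp

theorem IsRootPair.norm_eq (hB : IsInvariantInner B) (hα : α ≠ 0) (h : T.IsRootPair I α X Y) :
    B Y Y = B X X ∧ B X Y = 0 := by
  obtain ⟨H, hH⟩ : ∃ H, α H ≠ 0 := by
    by_contra! hc
    exact hα (LinearMap.ext hc)
  have hp := Real.pi_pos
  have ha : 2 * Real.pi * α H ≠ 0 := by positivity
  constructor
  · have h1 := bilin_lie_skew hB.inv H X Y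
    rw [h.lie_left, h.lie_right, map_smul, LinearMap.smul_apply, map_neg, map_smul, smul_eq_mul, smul_eq_mul, neg_neg] at h1
    exact mul_left_cancel₀ ha h1
  · have h1 := bilin_lie_skew hB.inv H X X
    rw [h.lie_left, map_smul, LinearMap.smul_apply, map_smul, smul_eq_mul, smul_eq_mul, hB.symm Y X] at h1
    have h2 : (2 * Real.pi * α H) * B X Y = 0 := by linarith
    exact (mul_eq_zero.1 h2).resolve_left ha

/-- By `form_eq`, `[X, Y]` is a positive multiple of the vector that represents `α` under `B`;
evaluating `α` on it gives a positive multiple of a squared length. -/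
theorem IsRootPair.apply_lie_pos (hB : IsInvariantInner B) (hα : α ≠ 0)
    (h : T.IsRootPair I α X Y) : 0 < α ⟨⁅X, Y⁆, h.lie_mem⟩ := by
  obtain ⟨H, hH⟩ : ∃ H, α H ≠ 0 := by
    by_contra! hc
    exact hα (LinearMap.ext hc)
  have hp := Real.pi_pos
  have hX := hB.pos X h.ne_zero
  have h1 := h.form_eq hB.inv H
  have h2 : ⁅X, Y⁆ ≠ 0 := fun h0 => by
    rw [h0] at h1
    have : 2 * Real.pi * α H * B X X ≠ 0 := by positivity
    exact this (by rw [← h1]; simp)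
  have h3 := hB.pos _ h2
  have h4 := h.form_eq hB.inv ⟨⁅X, Y⁆, h.lie_mem⟩
  simp only at h4
  rw [h4] at h3
  by_contra hc
  have : 2 * Real.pi * α ⟨⁅X, Y⁆, h.lie_mem⟩ * B X X ≤ 0 :=
    mul_nonpos_of_nonpos_of_nonneg (mul_nonpos_of_nonneg_of_nonpos (by positivity) (not_lt.1 hc)) hX.le
  linarith

theorem IsRootPair.exists_coroot (hB : IsInvariantInner B) (hα : α ≠ 0)
    (h : T.IsRootPair I α X Y) : ∃ H, T.IsCoroot I α H := by
  have h1 := h.apply_lie_pos hB hα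
  refine ⟨(2 / α ⟨⁅X, Y⁆, h.lie_mem⟩) • ⟨⁅X, Y⁆, h.lie_mem⟩, ?_, X, Y, h, _, rfl⟩
  rw [map_smul, smul_eq_mul, div_mul_cancel₀ _ h1.ne']

/-- The coroot is a multiple of `[X, Y]`, which every invariant form pairs with `𝔱` proportionally
to `α`; the factor follows by inserting `H = h`, where `α h = 2`. Positivity of the form plays no
role, so this applies to each basic form extended by zero. -/
theorem IsCoroot.form_eq {b : LinearMap.BilinForm ℝ (LieAlg V G)}
    (hinv : ∀ x y z, b ⁅x, y⁆ z = b x ⁅y, z⁆)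
    {h : T.lieAlgebra V} (hh : T.IsCoroot I α h) (H : T.lieAlgebra V) :
    b h H = b h h / 2 * α H := by
  obtain ⟨h2, X, Y, hXY, r, hr⟩ := hh
  have h1 : ∀ H : T.lieAlgebra V, b h H = r * (2 * Real.pi * α H * b X X) := fun H => by
    rw [hr, map_smul, LinearMap.smul_apply, smul_eq_mul, hXY.form_eq hinv]
  rw [h1 H, h1 h, h2]
  ring

/-- The torus acts on a root plane by rotations. -/
theorem IsRootPair.Ad_lieExp (h : T.IsRootPair I α X Y) (H : T.lieAlgebra V) :
    Ad (lieExp (H : LieAlg V G) : G) X = Real.cos (2 * Real.pi * α H) • X + Real.sin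
    (2 * Real.pi * α H) • Y := by
  set a := 2 * Real.pi * α H with ha
  let H' : V := (H : LieAlg V G)
  let X' : V := X
  let Y' : V := Y
  have hX : bracketModel V G H' X' = a • Y' := h.lie_left H
  have hY : bracketModel V G H' Y' = -(a • X') := h.lie_right H
  have hZ : ∀ s : ℝ, HasDerivAt (fun s : ℝ => Real.cos (a * s) • X' + Real.sin (a * s) • Y')
      (bracketModel V G H' (Real.cos (a * s) • X' + Real.sin (a * s) • Y')) s := by
    intro s
    have hm : HasDerivAt (fun s : ℝ => a * s) a s := by simpa using (hasDerivAt_id s).const_mul a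
    have h1 := ((hm.cos).smul_const X').add ((hm.sin).smul_const Y')
    have h2 : bracketModel V G H' (Real.cos (a * s) • X' + Real.sin (a * s) • Y') =
        (-Real.sin (a * s) * a) • X' + (Real.cos (a * s) * a) • Y' := by
      rw [bracketModel_add, bracketModel_smul, bracketModel_smul, hX, hY, smul_smul, smul_neg, smul_smul, neg_mul, neg_smul, add_comm]
    rw [h2]
    exact h1
  have h3 := AdL_lieExp_of_hasDerivAt (H := (H : LieAlg V G)) hZ 1
  simp only [mul_zero, Real.cos_zero, Real.sin_zero, one_smul, zero_smul, add_zero, mul_one] at h3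
  exact h3

theorem IsRootPair.Ad_lieExp_eq_iff (h : T.IsRootPair I α X Y) (hB : IsInvariantInner B)
    (hα : α ≠ 0) (H : T.lieAlgebra V) :
    Ad (lieExp (H : LieAlg V G) : G) X = X ↔ ∃ n : ℤ, α H = n := by
  rw [h.Ad_lieExp]
  have hX := hB.pos X h.ne_zero
  obtain ⟨-, hXY⟩ := h.norm_eq hB hα
  have hp := Real.pi_pos
  constructor
  · intro h1
    have h2 := congrArg (fun v => B v X) h1
    simp only [map_add, LinearMap.add_apply, map_smul, LinearMap.smul_apply, smul_eq_mul, hB.symm Y X, hXY, mul_zero, add_zero] at h2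
    have h3 : Real.cos (2 * Real.pi * α H) = 1 := by
      have : (Real.cos (2 * Real.pi * α H) - 1) * B X X = 0 := by linarith
      rcases mul_eq_zero.1 this with h | h
      · linarith
      · exact absurd h hX.ne'
    obtain ⟨n, hn⟩ := (Real.cos_eq_one_iff _).1 h3
    refine ⟨n, ?_⟩
    have h4 : (2 * Real.pi) * α H = (2 * Real.pi) * n := by rw [← hn]; ring
    exact mul_left_cancel₀ (by positivity) h4
  · rintro ⟨n, hn⟩
    have h1 : 2 * Real.pi * α H = n * (2 * Real.pi) := by rw [hn]; ring
    rw [h1, Real.cos_int_mul_two_pi]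
    have : Real.sin (n * (2 * Real.pi)) = 0 := by
      have := Real.sin_int_mul_pi (n * 2)
      rw [← this]; push_cast; ring_nf
    rw [this]; simp

theorem IsRootPair.apply_lattice (h : T.IsRootPair I α X Y) (hB : IsInvariantInner B) (hα : α ≠ 0)
    {ξ : LieAlg V G} (hξ : ξ ∈ T.lattice V) :
    ∃ n : ℤ, α ⟨ξ, hξ.1⟩ = n := by
  rw [← h.Ad_lieExp_eq_iff hB hα ⟨ξ, hξ.1⟩]
  simp only
  rw [hξ.2]
  exact Ad_one X

end RootPair

/-- The reflection in a root is implemented by an element of the group, and the coroot lies in the lattice. -/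
theorem IsCoroot.exists_reflection (hB : IsInvariantInner B) {I : LieIdeal ℝ (LieAlg V G)}
    {α : Module.Dual ℝ (T.lieAlgebra V)} (hα : α ≠ 0)
    {h : T.lieAlgebra V} (hh : T.IsCoroot I α h) :
    (∃ n : G, ∀ H : T.lieAlgebra V, Ad n (H : LieAlg V G) = (H : LieAlg V G) - α H • (h : LieAlg V G)) ∧
      lieExp (h : LieAlg V G) = (1 : G) := by
  obtain ⟨h2, X, Y, hXY, r, hr⟩ := hh
  have hpos := hXY.apply_lie_pos hB hα
  set Z : T.lieAlgebra V := ⟨⁅X, Y⁆, hXY.lie_mem⟩ with hZdef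
  have hhZ : h = r • Z := Subtype.ext hr
  have hr2 : r * α Z = 2 := by rw [← h2, hhZ, map_smul, smul_eq_mul]
  have hrpos : 0 < r := by
    by_contra hc
    have : r * α Z ≤ 0 := mul_nonpos_of_nonpos_of_nonneg (not_lt.1 hc) hpos.le
    linarith
  have hp := Real.pi_pos
  -- On the plane of `h` and `Y`, `ad X` sends `h` to `-4πY` and `Y` to `h / r`, so it rotates with
  -- squared frequency `4π / r`. Time `π / w` is a half turn and sends `h` to `-h`.
  let w := Real.sqrt (4 * Real.pi / r)
  have hw : 0 < w := Real.sqrt_pos.2 (by positivity)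
  have hw2 : w * w = 4 * Real.pi / r := Real.mul_self_sqrt (by positivity)
  let X' : V := X
  let h' : V := (h : LieAlg V G)
  let Y' : V := Y
  have e1 : bracketModel V G X' h' = -((4 * Real.pi) • Y') := by
    have h3 : ⁅X, (h : LieAlg V G)⁆ = -((4 * Real.pi) • Y) := by
      rw [← lie_skew, hXY.lie_left, h2]; congr 2; ring
    exact h3
  have e2 : bracketModel V G X' Y' = r⁻¹ • h' := by
    have h3 : ⁅X, Y⁆ = r⁻¹ • (h : LieAlg V G) := by rw [hr, smul_smul, inv_mul_cancel₀ hrpos.ne', one_smul]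
    exact h3
  have hode : ∀ s : ℝ, HasDerivAt (fun s : ℝ => Real.cos (w * s) • h' - (4 * Real.pi / w * Real.sin (w * s)) • Y')
      (bracketModel V G X' (Real.cos (w * s) • h' - (4 * Real.pi / w * Real.sin (w * s)) • Y')) s := by
    intro s
    have hm : HasDerivAt (fun s : ℝ => w * s) w s := by simpa using (hasDerivAt_id s).const_mul w
    have h1 := ((hm.cos).smul_const h').sub (((hm.sin).const_mul (4 * Real.pi / w)).smul_const Y')
    have h3 : bracketModel V G X' (Real.cos (w * s) • h' - (4 * Real.pi / w * Real.sin (w * s)) • Y') =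
        (-Real.sin (w * s) * w) • h' - (4 * Real.pi / w * (Real.cos (w * s) * w)) • Y' := by
      rw [sub_eq_add_neg, ← neg_smul, bracketModel_add, bracketModel_smul, bracketModel_smul, e1, e2, smul_neg, smul_smul, smul_smul]
      have c1 : -(4 * Real.pi / w * Real.sin (w * s)) * r⁻¹ = -Real.sin (w * s) * w := by
        have : 4 * Real.pi / r / w = w := by rw [← hw2]; field_simp
        calc _ = -Real.sin (w * s) * (4 * Real.pi / r / w) := by ring
          _ = _ := by rw [this]
      have c2 : Real.cos (w * s) * (4 * Real.pi) = 4 * Real.pi / w * (Real.cos (w * s) * w) := by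
        field_simp
      rw [c1, c2, sub_eq_add_neg, add_comm]
    rw [h3]
    exact h1
  have hrefl := AdL_lieExp_of_hasDerivAt (H := X) hode (Real.pi / w)
  have hwπ : w * (Real.pi / w) = Real.pi := by field_simp
  simp only [mul_zero, Real.cos_zero, Real.sin_zero, one_smul, zero_smul, sub_zero, hwπ, Real.cos_pi, Real.sin_pi] at hrefl
  have hnh : Ad (lieExp ((Real.pi / w) • X) : G) (h : LieAlg V G) = -(h : LieAlg V G) := by
    refine Eq.trans hrefl ?_
    exact (neg_one_smul ℝ h')
  refine ⟨⟨lieExp ((Real.pi / w) • X), fun H => ?_⟩, ?_⟩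
  · set H₁ : T.lieAlgebra V := H - (α H / 2) • h with hH₁
    have hα1 : α H₁ = 0 := by rw [hH₁, map_sub, map_smul, h2, smul_eq_mul]; ring
    have hfix : Ad (lieExp ((Real.pi / w) • X) : G) (H₁ : LieAlg V G) = H₁ := by
      refine Ad_lieExp_of_lie_eq_zero ?_ _
      rw [← lie_skew, hXY.lie_left, hα1]; simp
    have hH : (H : LieAlg V G) = (H₁ : LieAlg V G) + (α H / 2) • (h : LieAlg V G) := by
      rw [hH₁]; simp
    conv_lhs => rw [hH]
    rw [Ad_add, Ad_smul, hfix, hnh, hH₁]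
    simp only [Submodule.coe_sub, Submodule.coe_smul]
    rw [smul_neg]
    have : α H • (h : LieAlg V G) = (α H / 2) • (h : LieAlg V G) + (α H / 2) • (h : LieAlg V G) := by rw [← add_smul]; ring_nf
    rw [this]
    abel
  -- Put `k = exp (h/2)`. As `α (h/2) = 1`, `k` fixes `X` and commutes with the reflecting element;
  -- but the reflection sends `h` to `-h`, so conjugation also inverts `k`. Hence `k² = 1`.
  · let k : G := lieExp (((1 / 2 : ℝ) • h : T.lieAlgebra V) : LieAlg V G)
    have hkX : Ad k X = X := (hXY.Ad_lieExp_eq_iff hB hα _).2 ⟨1, by rw [map_smul, h2]; norm_num⟩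
    have hcomm : k * lieExp ((Real.pi / w) • X) * k⁻¹ = lieExp ((Real.pi / w) • X) := by
      rw [conj_lieExp, Ad_smul, hkX]
    have hconj : lieExp ((Real.pi / w) • X) * k * (lieExp ((Real.pi / w) • X))⁻¹ = k⁻¹ := by
      have h5 : Ad (lieExp ((Real.pi / w) • X) : G) (((1 / 2 : ℝ) • h : T.lieAlgebra V) : LieAlg V G) =
          -(((1 / 2 : ℝ) • h : T.lieAlgebra V) : LieAlg V G) := by
        rw [Submodule.coe_smul, Ad_smul, hnh, smul_neg]
      change lieExp ((Real.pi / w) • X) * lieExp _ * _ = _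
      rw [conj_lieExp, h5, lieExp_neg']
    have h6 : k = k⁻¹ := by
      rw [← hconj, mul_inv_eq_iff_eq_mul.1 hcomm |>.symm]
      simp
    have h7 : (h : LieAlg V G) = (((1 / 2 : ℝ) • h : T.lieAlgebra V) : LieAlg V G) + (((1 / 2 : ℝ) • h : T.lieAlgebra V) : LieAlg V G) := by
      rw [← Submodule.coe_add, ← add_smul]; norm_num
    rw [h7, T.lieExp_add (Subtype.property _) (Subtype.property _)]
    change k * k = 1
    nth_rewrite 2 [h6]
    exact mul_inv_cancel k

end MaximalTorus

end

/-! ### Finiteness of the roots and regular elements of the torus. -/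

noncomputable section

open scoped Manifold ContDiff ENNReal Topology
open VectorField Set Filter
variable {V : Type*} [NormedAddCommGroup V] [NormedSpace ℝ V] [CompleteSpace V]
  {G : Type*} [TopologicalSpace G] [ChartedSpace V G] [Group G] [LieGroup 𝓘(ℝ, V) ∞ G]
variable [FiniteDimensional ℝ V]

namespace MaximalTorus
variable [T2Space G] [IsTopologicalGroup G] {T : MaximalTorus G} {B : LinearMap.BilinForm ℝ (LieAlg V G)}

theorem IsRootPair.right_ne_zero {I : LieIdeal ℝ (LieAlg V G)} {α : Module.Dual ℝ (T.lieAlgebra V)}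
    {X Y : LieAlg V G}
    (h : T.IsRootPair I α X Y) (hB : IsInvariantInner B) (hα : α ≠ 0) : Y ≠ 0 := by
  rintro rfl
  have := (h.norm_eq hB hα).1
  rw [map_zero] at this
  exact absurd this (hB.pos X h.ne_zero).ne

theorem IsRootPair.neg {I : LieIdeal ℝ (LieAlg V G)} {α : Module.Dual ℝ (T.lieAlgebra V)}
    {X Y : LieAlg V G}
    (h : T.IsRootPair I α X Y) : T.IsRootPair I (-α) X (-Y) := by
  refine ⟨h.mem_left, neg_mem h.mem_right, h.ne_zero, fun H => ?_, fun H => ?_⟩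
  · rw [h.lie_left, LinearMap.neg_apply]; module
  · rw [lie_neg, h.lie_right, LinearMap.neg_apply]; module

theorem IsRoot.neg {I : LieIdeal ℝ (LieAlg V G)} {α : Module.Dual ℝ (T.lieAlgebra V)}
    (h : T.IsRoot I α) : T.IsRoot I (-α) :=
  ⟨neg_ne_zero.2 h.1, h.2.choose, -h.2.choose_spec.choose, h.2.choose_spec.choose_spec.neg⟩

/-- Root vectors of roots that are not proportional by a sign are orthogonal. -/
theorem IsRootPair.orthogonal (hB : IsInvariantInner B) {α β : Module.Dual ℝ (T.lieAlgebra V)}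
    {X Y X' Y' : LieAlg V G}
    {I J : LieIdeal ℝ (LieAlg V G)}
    (h : T.IsRootPair I α X Y) (h' : T.IsRootPair J β X' Y') (h1 : α ≠ β) (h2 : α ≠ -β) :
    B X X' = 0 := by
  by_contra hX
  -- Comparing the eigenvalues of the symmetric operator `(ad H)²` gives `α(H)² = β(H)²`. A product
  -- of two linear functionals vanishes identically only if one of them does.
  have key : ∀ H : T.lieAlgebra V, (α H - β H) * (α H + β H) = 0 := by
    intro H
    have e1 : B ⁅(H : LieAlg V G), ⁅(H : LieAlg V G), X⁆⁆ X' = B X ⁅(H : LieAlg V G), ⁅(H : LieAlg V G), X'⁆⁆ := by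
      rw [bilin_lie_skew hB.inv, bilin_lie_skew hB.inv, neg_neg]
    rw [h.lie_left, h'.lie_left, lie_smul, lie_smul, h.lie_right, h'.lie_right] at e1
    simp only [map_smul, map_neg, LinearMap.smul_apply, LinearMap.neg_apply, smul_eq_mul] at e1
    have hπ := Real.pi_pos
    have e2 : (4 * Real.pi ^ 2 * B X X') * ((α H - β H) * (α H + β H)) = 0 := by linear_combination -e1
    exact (mul_eq_zero.1 e2).resolve_left (by positivity)
  obtain ⟨H1, e1⟩ : ∃ H, α H - β H ≠ 0 := by
    by_contra! hc
    exact h1 (LinearMap.ext fun H => sub_eq_zero.1 (hc H))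
  obtain ⟨H2, e2⟩ : ∃ H, α H + β H ≠ 0 := by
    by_contra! hc
    exact h2 (LinearMap.ext fun H => eq_neg_of_add_eq_zero_left (hc H))
  have f1 := (mul_eq_zero.1 (key H1)).resolve_left e1
  have f2 := (mul_eq_zero.1 (key H2)).resolve_right e2
  have f3 := key (H1 + H2)
  simp only [map_add] at f3
  rcases mul_eq_zero.1 f3 with h | h
  · exact e1 (by linarith)
  · exact e2 (by linarith)

/-- Root vectors for distinct roots positive on `δ` are orthogonal, hence linearly independent, so
there are finitely many such roots; the others are their negatives. -/
theorem finite_roots (hB : IsInvariantInner B) {δ : T.lieAlgebra V}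
    (hδ : ∀ α, T.IsRoot ⊤ α → α δ ≠ 0) :
    {α : Module.Dual ℝ (T.lieAlgebra V) | T.IsRoot ⊤ α}.Finite := by
  let P := {α : Module.Dual ℝ (T.lieAlgebra V) // T.IsRoot ⊤ α ∧ 0 < α δ}
  choose X Y hXY using fun α : P => α.2.1.2
  have hli : LinearIndependent ℝ X := by
    refine LinearMap.linearIndependent_of_isOrthoᵢ (B := B) ?_ fun α h => (hB.pos _ (hXY α).ne_zero).ne' h
    rw [LinearMap.isOrthoᵢ_def]
    intro α β hαβ
    refine (hXY α).orthogonal hB (hXY β) (fun h => hαβ (Subtype.ext h)) fun h => ?_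
    have h1 := α.2.2
    rw [h, LinearMap.neg_apply] at h1
    linarith [β.2.2]
  have hfin : Finite P := hli.finite
  have h1 : (range fun α : P => (α : Module.Dual ℝ (T.lieAlgebra V))).Finite := finite_range _
  have h2 : (range fun α : P => -(α : Module.Dual ℝ (T.lieAlgebra V))).Finite := finite_range _
  refine (h1.union h2).subset fun α hα => ?_
  rcases lt_or_gt_of_ne (hδ α hα) with h | h
  · exact Or.inr ⟨⟨-α, hα.neg, by simpa using h⟩, by simp⟩
  · exact Or.inl ⟨⟨α, hα, h⟩, rfl⟩

/-- An element of the torus is regular if its centralizer has the Lie algebra of the torus. -/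
def IsRegular (V : Type*) [NormedAddCommGroup V] [NormedSpace ℝ V] [CompleteSpace V]
    [ChartedSpace V G] [LieGroup 𝓘(ℝ, V) ∞ G] (T : MaximalTorus G) (t : G) : Prop :=
  ∀ v : LieAlg V G, Ad t v = v → v ∈ T.lieAlgebra V

theorem IsRootPair.not_mem {I : LieIdeal ℝ (LieAlg V G)} {α : Module.Dual ℝ (T.lieAlgebra V)}
    {X Y : LieAlg V G}
    (h : T.IsRootPair I α X Y) (hB : IsInvariantInner B) (hα : α ≠ 0) : X ∉ T.lieAlgebra V := by
  intro hX
  refine hα (LinearMap.ext fun H => ?_)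
  have h1 := h.lie_left H
  rw [T.lie_eq_zero H.2 hX, eq_comm, smul_eq_zero] at h1
  have h2 := h1.resolve_right (h.right_ne_zero hB hα)
  simpa [Real.pi_ne_zero] using h2

/-- If `exp ζ` fixes some `v` outside `𝔱`, then some `[H, v]` is a nonzero fixed vector orthogonal
to `𝔱`. The space of such vectors is invariant under `𝔱` and so contains a root vector, whose root
must be integral on `ζ`. -/
theorem isRegular_lieExp_iff (hB : IsInvariantInner B) (ζ : T.lieAlgebra V) :
    T.IsRegular V (lieExp (ζ : LieAlg V G) : G) ↔ ∀ α, T.IsRoot ⊤ α → ∀ n : ℤ, α ζ ≠ n := by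
  constructor
  · rintro h α ⟨hα, X, Y, hXY⟩ n hn
    exact hXY.not_mem hB hα (h X ((hXY.Ad_lieExp_eq_iff hB hα ζ).2 ⟨n, hn⟩))
  · intro h v hv
    by_contra hvT
    obtain ⟨H, hH, hHv⟩ : ∃ H ∈ T.lieAlgebra V, ⁅H, v⁆ ≠ 0 := by
      by_contra! hc
      exact hvT (T.mem_lieAlgebra_of_lie_eq_zero hc)
    have hfix : ∀ H ∈ T.lieAlgebra V, Ad (lieExp (ζ : LieAlg V G) : G) H = H := fun H hH =>
      T.Ad_eq_of_mem (T.lieExp_mem ζ.2) hH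
    let S : Submodule ℝ (LieAlg V G) :=
      { carrier := {x | Ad (lieExp (ζ : LieAlg V G) : G) x = x ∧ ∀ H ∈ T.lieAlgebra V, B x H = 0}
        add_mem' := fun {x y} hx hy => ⟨by rw [Ad_add, hx.1, hy.1], fun H hH => by
          rw [map_add, LinearMap.add_apply, hx.2 H hH, hy.2 H hH, add_zero]⟩
        zero_mem' := ⟨by simpa using Ad_smul (lieExp (ζ : LieAlg V G) : G) 0 (0 : LieAlg V G), fun H hH => by simp⟩
        smul_mem' := fun r x hx => ⟨by rw [Ad_smul, hx.1], fun H hH => by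
          rw [map_smul, LinearMap.smul_apply, hx.2 H hH, smul_zero]⟩ }
    obtain ⟨α, X, Y, hX, -, hα, hXY⟩ := exists_rootPair hB (S₀ := S) (T := T) (fun hS => hHv (by
        have : ⁅H, v⁆ ∈ S := ⟨by rw [Ad_lie, hfix H hH, hv], fun H' hH' => by
          rw [bilin_lie_skew hB.inv, T.lie_eq_zero hH hH', map_zero, neg_zero]⟩
        rw [hS] at this
        exact this)) (fun H hH x hx => ⟨by rw [Ad_lie, hfix H hH, hx.1], fun H' hH' => by
          rw [bilin_lie_skew hB.inv, T.lie_eq_zero hH hH', map_zero, neg_zero]⟩) (fun x hx => hx.2)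
    obtain ⟨n, hn⟩ := (hXY.Ad_lieExp_eq_iff hB hα ζ).1 hX.1
    exact h α ⟨hα, X, Y, hXY⟩ n hn

theorem isClosed_not_isRegular (hB : IsInvariantInner B) {δ : T.lieAlgebra V}
    (hδ : ∀ α, T.IsRoot ⊤ α → α δ ≠ 0) :
    IsClosed {t : T.toSubgroup | ¬ T.IsRegular V (t : G)} := by
  choose! X hX using fun α (h : T.IsRoot (V := V) ⊤ α) => h.2
  let Z : Module.Dual ℝ (T.lieAlgebra V) → V := fun α => X α
  have : {t : T.toSubgroup | ¬ T.IsRegular V (t : G)} =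
      ⋃ α ∈ {α : Module.Dual ℝ (T.lieAlgebra V) | T.IsRoot ⊤ α}, {t : T.toSubgroup | AdL (t : G) (Z α) = Z α} := by
    ext t
    obtain ⟨ζ, hζ, ht⟩ := T.exists_lieExp_eq (V := V) t.2
    simp only [mem_ofPred_eq, mem_iUnion, exists_prop, ← ht]
    rw [isRegular_lieExp_iff hB ⟨ζ, hζ⟩]
    push Not
    refine exists_congr fun α => and_congr_right fun hα => ?_
    obtain ⟨Y, hY⟩ := hX α hα
    exact (hY.Ad_lieExp_eq_iff hB hα.1 ⟨ζ, hζ⟩).symm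
  rw [this]
  refine (finite_roots hB hδ).isClosed_biUnion fun α _ => ?_
  exact isClosed_eq ((contMDiff_Ad (Z α)).continuous.comp continuous_subtype_val) continuous_const

/-- Regularity is invariant under conjugation. -/
theorem IsRegular.of_conj {t t' g : G} (ht' : t' ∈ T.toSubgroup) (h : T.IsRegular V t)
    (e : t' = g * t * g⁻¹) : T.IsRegular V t' := by
  intro v hv
  let A : LieAlg V G →ₗ[ℝ] LieAlg V G := { toFun := Ad g⁻¹, map_add' := Ad_add _, map_smul' := fun r x => Ad_smul _ r x }
  have hfix : ∀ w, Ad t' w = w → A w ∈ T.lieAlgebra V := by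
    intro w hw
    refine h _ ?_
    change Ad t (Ad g⁻¹ w) = Ad g⁻¹ w
    rw [← Ad_mul]
    have : t * g⁻¹ = g⁻¹ * t' := by rw [e]; group
    rw [this, Ad_mul, hw]
  have hinj : Function.Injective A := fun x y hxy => by
    have := congrArg (Ad g) hxy
    change Ad g (Ad g⁻¹ x) = Ad g (Ad g⁻¹ y) at this
    rwa [Ad_Ad_inv, Ad_Ad_inv] at this
  -- `Ad g⁻¹` carries all vectors fixed by `t'` into `𝔱`, in particular `𝔱` itself; by dimension `𝔱`
  -- already fills the target, and injectivity leaves no room for further fixed vectors.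
  have hle : (T.lieAlgebra V).map A ≤ T.lieAlgebra V := by
    rintro _ ⟨w, hw, rfl⟩
    exact hfix w (T.Ad_eq_of_mem ht' hw)
  have heq : (T.lieAlgebra V).map A = T.lieAlgebra V :=
    Submodule.eq_of_le_of_finrank_eq hle (LinearEquiv.finrank_eq (Submodule.equivMapOfInjective A hinj _)).symm
  have := hfix v hv
  rw [← heq] at this
  obtain ⟨w, hw, hwv⟩ := this
  exact hinj hwv ▸ hw

end MaximalTorus

end

/-! ### The conjugation map `G/T × T → G` as a covering over the regular set. -/

noncomputable section

open scoped Manifold ContDiff ENNReal Topology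
open VectorField Set Filter
variable {V : Type*} [NormedAddCommGroup V] [NormedSpace ℝ V] [CompleteSpace V]
  {G : Type*} [TopologicalSpace G] [ChartedSpace V G] [Group G] [LieGroup 𝓘(ℝ, V) ∞ G]
variable [FiniteDimensional ℝ V]

section Covering
variable {E X : Type*} [TopologicalSpace E] [TopologicalSpace X] {p : E → X} {s : Set X}

theorem IsCoveringMapOn.lift_unique (hp : IsCoveringMapOn p s) {F F' : C(ℝ, E)}
    (hF : ∀ t, p (F t) = p (F' t)) (hs : ∀ t, p (F t) ∈ s)
    (hpc : Continuous fun t => p (F t)) {a : ℝ} (h : F a = F' a) : F = F' := by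
  obtain ⟨F₀, -, hu⟩ := hp.existsUnique_continuousMap_lifts ⟨fun t => p (F t), hpc⟩ (a₀ := a) (e₀ := F a) rfl hs
  rw [hu F ⟨rfl, rfl⟩, hu F' ⟨h.symm, funext fun t => (hF t).symm⟩]

/-- The lift of a closed curve is closed if the lift of a freely homotopic closed curve is. -/
theorem IsCoveringMapOn.exists_lift_closed (hp : IsCoveringMapOn p s) (K : C(ℝ × ℝ, X))
    (hK : ∀ x, K x ∈ s)
    (F : C(ℝ, E)) (h0 : ∀ t, p (F t) = K (0, t)) (hc : ∀ u, K (u, 0) = K (u, 1)) :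
    ∃ F' : C(ℝ, E), (∀ t, p (F' t) = K (1, t)) ∧ (F' 0 = F' 1 → F 0 = F 1) := by
  obtain ⟨L, ⟨hL0, hL⟩, -⟩ := hp.existsUnique_continuousMap_lifts K (a₀ := (0, 0)) (e₀ := F 0) (h0 0) hK
  have hL' : ∀ x, p (L x) = K x := fun x => congrFun hL x
  let row : ℝ → C(ℝ, E) := fun u => ⟨fun t => L (u, t), by fun_prop⟩
  let col : ℝ → C(ℝ, E) := fun t => ⟨fun u => L (u, t), by fun_prop⟩
  have hrow : row 0 = F := by
    refine hp.lift_unique (a := 0) (fun t => ?_) (fun t => ?_) ?_ hL0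
    · exact (hL' _).trans (h0 t).symm
    · exact (hL' (0, t)).symm ▸ hK _
    · have : (fun t => p (row 0 t)) = fun t => K (0, t) := funext fun t => hL' _
      rw [this]; fun_prop
  refine ⟨row 1, fun t => hL' _, fun h => ?_⟩
  -- The two boundary columns lift the same path. If they agree at `u = 1`, unique lifting makes
  -- them agree at `u = 0`.
  have hcol : col 0 = col 1 := by
    refine hp.lift_unique (a := 1) (fun u => ?_) (fun u => ?_) ?_ h
    · exact (hL' _).trans ((hc u).trans (hL' _).symm)
    · exact (hL' (u, 0)).symm ▸ hK _
    · have : (fun u => p (col 0 u)) = fun u => K (u, 0) := funext fun t => hL' _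
      rw [this]; fun_prop
  rw [← hrow]
  exact DFunLike.congr_fun hcol 0

theorem isLocalHomeomorphOn_of_nhds {f : E → X} {U : Set E} (hf : Continuous f) (hU : IsOpen U)
    (hopen : ∀ x ∈ U, 𝓝 (f x) ≤ map f (𝓝 x)) (hinj : ∀ x ∈ U, ∃ N ∈ 𝓝 x, InjOn f N) :
    IsLocalHomeomorphOn f U := by
  refine IsLocalHomeomorphOn.mk f U fun x hx => ?_
  obtain ⟨N, hN, hNi⟩ := hinj x hx
  obtain ⟨O, hO, hOo, hxO⟩ := mem_nhds_iff.1 (inter_mem hN (hU.mem_nhds hx))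
  have hi : InjOn f O := hNi.mono (hO.trans inter_subset_left)
  have : Nonempty E := ⟨x⟩
  have hop : IsOpenMap (O.domRestrict f) := by
    rw [isOpenMap_iff_nhds_le]
    rintro ⟨y, hy⟩
    have h1 := hopen y (hO hy).2
    have h2 : map (O.domRestrict f) (𝓝 ⟨y, hy⟩) = map f (𝓝 y) := by
      rw [show O.domRestrict f = f ∘ Subtype.val from rfl, ← Filter.map_map, map_nhds_subtype_coe_eq_nhds hy (hOo.mem_nhds hy)]
    rw [h2]; exact h1
  exact ⟨OpenPartialHomeomorph.ofContinuousOpenRestrict (hi.toPartialEquiv) hf.continuousOn hop hOo, hxO, fun _ _ => rfl⟩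

end Covering

namespace MaximalTorus
variable [T2Space G] [IsTopologicalGroup G] {T : MaximalTorus G} {B : LinearMap.BilinForm ℝ (LieAlg V G)}

/-- The conjugation map `G/T × T → G`. -/
def conjMap (T : MaximalTorus G) (x : (G ⧸ T.toSubgroup) × T.toSubgroup) : G :=
  Quotient.liftOn' x.1 (fun k => k * x.2 * k⁻¹) (by
    intro a b hab
    rw [QuotientGroup.leftRel_apply] at hab
    have h := T.comm _ hab _ x.2.2
    have e : a⁻¹ * b * (x.2 : G) * b⁻¹ * a = x.2 := by
      rw [h]; group
    calc a * (x.2 : G) * a⁻¹ = a * (a⁻¹ * b * (x.2 : G) * b⁻¹ * a) * a⁻¹ := by rw [e]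
      _ = b * x.2 * b⁻¹ := by group)

theorem conjMap_mk (k : G) (t : T.toSubgroup) : T.conjMap (QuotientGroup.mk k, t) = k * t * k⁻¹ := rfl

theorem continuous_conjMap (T : MaximalTorus G) : Continuous T.conjMap := by
  have h : IsOpenQuotientMap (Prod.map (QuotientGroup.mk : G → G ⧸ T.toSubgroup) (id : T.toSubgroup → T.toSubgroup)) :=
    QuotientGroup.isOpenQuotientMap_mk.prodMap IsOpenQuotientMap.id
  rw [h.isQuotientMap.continuous_iff]
  have : T.conjMap ∘ Prod.map (QuotientGroup.mk : G → G ⧸ T.toSubgroup) (id : T.toSubgroup → T.toSubgroup) =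
    fun x : G × T.toSubgroup => x.1 * x.2 * x.1⁻¹ := rfl
  rw [this]
  fun_prop

theorem hasLogDerivAt_coordProd_line {n : ℕ} (e : Fin n → LieAlg V G) (w : Fin n → ℝ) :
    HasLogDerivAt (fun s : ℝ => (coordProd e (s • w) : G)) (∑ i, w i • e i) 0 := by
  have hl : MDifferentiableAt 𝓘(ℝ, ℝ) 𝓘(ℝ, Fin n → ℝ) (fun s : ℝ => s • w) 0 := by
    have : DifferentiableAt ℝ (fun s : ℝ => s • w) 0 := by fun_prop
    exact this.mdifferentiableAt
  have hc : MDifferentiableAt 𝓘(ℝ, Fin n → ℝ) 𝓘(ℝ, V) (coordProd e : (Fin n → ℝ) → G) 0 :=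
    (contMDiff_coordProd e).mdifferentiableAt (by simp)
  have hd : MDifferentiableAt 𝓘(ℝ, ℝ) 𝓘(ℝ, V) (fun s : ℝ => (coordProd e (s • w) : G)) 0 := by
    refine MDifferentiableAt.comp (I' := 𝓘(ℝ, Fin n → ℝ)) 0 (g := (coordProd e : (Fin n → ℝ) → G)) ?_ hl
    rw [zero_smul]; exact hc
  obtain ⟨X, hX⟩ := exists_hasLogDerivAt hd
  have h1 := hX.modelDeriv_eq (by rw [zero_smul, coordProd_zero])
  have h2 := modelDeriv_comp (V₁ := ℝ) (V₂ := Fin n → ℝ) (V₃ := V) (f := fun s : ℝ => s • w)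
    (g := (coordProd e : (Fin n → ℝ) → G)) (x := 0) (y := 0) (zero_smul _ _) hc hl 1
  have h3 : modelDeriv ℝ (Fin n → ℝ) (fun s : ℝ => s • w) 0 1 = w := by
    have : HasDerivAt (fun s : ℝ => s • w) ((1 : ℝ) • w) 0 := (hasDerivAt_id (0 : ℝ)).smul_const w
    rw [one_smul] at this
    have h4 := (hasMFDerivAt_iff_hasFDerivAt.2 this.hasFDerivAt).mfderiv
    have h5 : modelDeriv ℝ (Fin n → ℝ) (fun s : ℝ => s • w) 0 = ContinuousLinearMap.toSpanSingleton ℝ w := h4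
    rw [h5]; simp
  rw [h3, modelDeriv_coordProd_apply] at h2
  have h6 : X = ∑ i, w i • e i := h1.symm.trans h2
  exact h6 ▸ hX

variable {r m : ℕ}

/-- The conjugation map near a point `(T, c)`, in coordinates. -/
def conjChart (A : AdaptedCoord (T.lieAlgebra V) r m) (c : G) (p : (Fin m → ℝ) × (Fin r → ℝ)) : G :=
  (coordProd A.f p.1)⁻¹ * (c * (coordProd A.e p.2 * coordProd A.f p.1) * c⁻¹)

theorem contMDiff_conjChart (A : AdaptedCoord (T.lieAlgebra V) r m) (c : G) :
    ContMDiff 𝓘(ℝ, (Fin m → ℝ) × (Fin r → ℝ)) 𝓘(ℝ, V) ∞ (conjChart A c) := by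
  have h1 : ContMDiff 𝓘(ℝ, (Fin m → ℝ) × (Fin r → ℝ)) 𝓘(ℝ, V) ∞
      (fun p : (Fin m → ℝ) × (Fin r → ℝ) => (coordProd A.f p.1 : G)) :=
    (contMDiff_coordProd A.f).comp contDiff_fst.contMDiff
  have h2 : ContMDiff 𝓘(ℝ, (Fin m → ℝ) × (Fin r → ℝ)) 𝓘(ℝ, V) ∞
      (fun p : (Fin m → ℝ) × (Fin r → ℝ) => (coordProd A.e p.2 : G)) :=
    (contMDiff_coordProd A.e).comp contDiff_snd.contMDiff
  exact h1.inv.mul ((contMDiff_const.mul (h2.mul h1)).mul contMDiff_const)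

/-- With `X` in the complement and `H ∈ 𝔱`, a kernel vector satisfies `H = X - Ad c X`. Since `Ad c`
is orthogonal and fixes `H`, this makes `H` orthogonal to itself, so `H = 0` and `Ad c X = X`.
Regularity puts `X` into `𝔱`, whence `X = 0`; surjectivity is a dimension count. -/
theorem bijective_modelDeriv_conjChart [ConnectedSpace G] (hB : IsInvariantInner B)
    (hrm : r + m = Module.finrank ℝ V)
    (A : AdaptedCoord (T.lieAlgebra V) r m)
    {c : G} (hc : c ∈ T.toSubgroup) (hreg : T.IsRegular V c) :
    Function.Bijective (modelDeriv ((Fin m → ℝ) × (Fin r → ℝ)) V (conjChart A c) 0) := by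
  have hval : ∀ w v, modelDeriv ((Fin m → ℝ) × (Fin r → ℝ)) V (conjChart A c) 0 (w, v) =
      ((-(∑ i, w i • A.f i) + Ad c (∑ i, v i • A.e i + ∑ i, w i • A.f i) : LieAlg V G) : V) := by
    intro w v
    have hf := hasLogDerivAt_coordProd_line A.f w
    have he := hasLogDerivAt_coordProd_line A.e v
    have hcur : HasLogDerivAt (fun s : ℝ => conjChart A c (s • (w, v)))
      (-(∑ i, w i • A.f i) + Ad c (∑ i, v i • A.e i + ∑ i, w i • A.f i)) 0 := by
      have h1 := hf.inv.mul (((he.mul hf).const_mul c).mul (hasLogDerivAt_const c⁻¹ 0))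
      have h0 : ∀ x : LieAlg V G, Ad (1 : G) x = x := Ad_one
      simp only [zero_smul, coordProd_zero, inv_one, mul_one, inv_inv, mul_inv_cancel, h0, add_zero] at h1
      exact h1
    have hl : MDifferentiableAt 𝓘(ℝ, ℝ) 𝓘(ℝ, (Fin m → ℝ) × (Fin r → ℝ)) (fun s : ℝ => s • (w, v)) 0 := by
      have : DifferentiableAt ℝ (fun s : ℝ => s • (w, v)) 0 := by fun_prop
      exact this.mdifferentiableAt
    have h1 := hcur.modelDeriv_eq (by simp [conjChart, coordProd_zero])
    have h2 := modelDeriv_comp (V₁ := ℝ) (V₂ := (Fin m → ℝ) × (Fin r → ℝ)) (V₃ := V) (f := fun s : ℝ => s • (w, v))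
      (g := conjChart A c) (x := 0) (y := 0) (zero_smul _ _) ((contMDiff_conjChart A c).mdifferentiableAt (by simp)) hl 1
    have h3 : modelDeriv ℝ ((Fin m → ℝ) × (Fin r → ℝ)) (fun s : ℝ => s • (w, v)) 0 1 = (w, v) := by
      have : HasDerivAt (fun s : ℝ => s • (w, v)) ((1 : ℝ) • (w, v)) 0 := (hasDerivAt_id (0 : ℝ)).smul_const (w, v)
      rw [one_smul] at this
      have h4 := (hasMFDerivAt_iff_hasFDerivAt.2 this.hasFDerivAt).mfderiv
      have h5 : modelDeriv ℝ ((Fin m → ℝ) × (Fin r → ℝ)) (fun s : ℝ => s • (w, v)) 0 = ContinuousLinearMap.toSpanSingleton ℝ (w, v) := h4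
      rw [h5]; simp
    rw [h3] at h2
    exact h2.symm.trans h1
  have hinj : Function.Injective (modelDeriv ((Fin m → ℝ) × (Fin r → ℝ)) V (conjChart A c) 0) := by
    rw [injective_iff_map_eq_zero]
    rintro ⟨w, v⟩ h
    have h1 : (-(∑ i, w i • A.f i) + Ad c (∑ i, v i • A.e i + ∑ i, w i • A.f i) : LieAlg V G) = 0 := (hval w v).symm.trans h
    set X : LieAlg V G := ∑ i, w i • A.f i with hX
    set H : LieAlg V G := ∑ i, v i • A.e i with hH
    have hHT : H ∈ T.lieAlgebra V := Submodule.sum_mem _ fun i _ => Submodule.smul_mem _ _ (A.mem i)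
    rw [Ad_add, T.Ad_eq_of_mem hc hHT] at h1
    have h2 : H = X - Ad c X := by
      rw [eq_sub_iff_add_eq]; exact (neg_add_eq_zero.1 h1).symm
    have h3 : B H H = 0 := by
      have h4 := Ad_invariant B hB.inv c X H
      rw [T.Ad_eq_of_mem hc hHT] at h4
      have h5 : B H H = B (X - Ad c X) H := congrArg (fun z => B z H) h2
      rw [h5, map_sub, LinearMap.sub_apply, h4, sub_self]
    have h4 := hB.eq_zero h3
    rw [h4] at h2
    have h5 : X ∈ T.lieAlgebra V := hreg X (sub_eq_zero.1 h2.symm).symm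
    exact Prod.ext (A.compl w h5) (A.indep v h4)
  refine ⟨hinj, ?_⟩
  have hd : Module.finrank ℝ ((Fin m → ℝ) × (Fin r → ℝ)) = Module.finrank ℝ V := by
    simp [← hrm, add_comm]
  exact (LinearMap.injective_iff_surjective_of_finrank_eq_finrank (f := (modelDeriv ((Fin m → ℝ) × (Fin r → ℝ)) V (conjChart A c) 0 : _ →ₗ[ℝ] V)) hd).1 hinj

theorem _root_.AdaptedCoord.eventually_eq {S : Submodule ℝ (LieAlg V G)} (A : AdaptedCoord S r m) :
    ∀ᶠ g in 𝓝 (1 : G), g = coordProd A.e (fun i => A.κ g (Fin.castAdd m i)) * coordProd A.f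
    (fun i => A.κ g (Fin.natAdd r i)) := by
  filter_upwards [A.right_inv] with g hg
  rw [← coordProd_append, Fin.append_castAdd_natAdd, hg]

theorem _root_.AdaptedCoord.tendsto_right {S : Submodule ℝ (LieAlg V G)} (A : AdaptedCoord S r m) :
    Tendsto (fun g i => A.κ g (Fin.natAdd r i)) (𝓝 (1 : G)) (𝓝 (0 : Fin m → ℝ)) := by
  have h : Continuous fun (g : G) (i : Fin m) => A.κ g (Fin.natAdd r i) :=
    continuous_pi fun i => (continuous_apply _).comp A.smooth.continuous
  have := h.tendsto 1
  simp only [A.κ_one] at this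
  exact this

theorem _root_.AdaptedCoord.tendsto_left {S : Submodule ℝ (LieAlg V G)} (A : AdaptedCoord S r m) :
    Tendsto (fun g i => A.κ g (Fin.castAdd m i)) (𝓝 (1 : G)) (𝓝 (0 : Fin r → ℝ)) := by
  have h : Continuous fun (g : G) (i : Fin r) => A.κ g (Fin.castAdd m i) :=
    continuous_pi fun i => (continuous_apply _).comp A.smooth.continuous
  have := h.tendsto 1
  simp only [A.κ_one] at this
  exact this

/-- Near `k`, write `(k⁻¹ g)⁻¹` as a torus element times a slice element. The torus part disappears
in the quotient, so the slice alone covers a neighbourhood. -/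
theorem nhds_quotient_le (A : AdaptedCoord (T.lieAlgebra V) r m) (k : G) :
    𝓝 (QuotientGroup.mk k : G ⧸ T.toSubgroup) ≤
      map (fun z : Fin m → ℝ => (QuotientGroup.mk (k * (coordProd A.f z)⁻¹) : G ⧸ T.toSubgroup))
    (𝓝 0) := by
  rw [QuotientGroup.nhds_eq]
  have hc : Tendsto (fun g : G => (k⁻¹ * g)⁻¹) (𝓝 k) (𝓝 1) := by
    have : Continuous fun g : G => (k⁻¹ * g)⁻¹ := by fun_prop
    simpa using this.tendsto k
  intro U hU
  rw [mem_map] at hU ⊢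
  filter_upwards [hc.eventually A.eventually_eq, (A.tendsto_right.comp hc).eventually hU] with g h1 h2
  have e : (QuotientGroup.mk g : G ⧸ T.toSubgroup) = QuotientGroup.mk (k * (coordProd A.f (fun i => A.κ (k⁻¹ * g)⁻¹ (Fin.natAdd r i)))⁻¹) := by
    refine QuotientGroup.eq.2 ?_
    have h3 : g⁻¹ * (k * (coordProd A.f (fun i => A.κ (k⁻¹ * g)⁻¹ (Fin.natAdd r i)))⁻¹) =
        coordProd A.e (fun i => A.κ (k⁻¹ * g)⁻¹ (Fin.castAdd m i)) := by
      rw [← mul_assoc, mul_inv_eq_iff_eq_mul, ← h1]; group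
    rw [h3]
    exact T.coordProd_mem A.mem _
  rw [mem_preimage, e]
  exact h2

theorem nhds_torus_le (A : AdaptedCoord (T.lieAlgebra V) r m) (c : T.toSubgroup) :
    𝓝 c ≤ map (fun y : Fin r → ℝ => c * ⟨coordProd A.e y, T.coordProd_mem A.mem y⟩) (𝓝 0) := by
  have hc : Tendsto (fun g : T.toSubgroup => (c : G)⁻¹ * g) (𝓝 c) (𝓝 1) := by
    have : Continuous fun g : T.toSubgroup => (c : G)⁻¹ * g := by fun_prop
    simpa using this.tendsto c
  intro U hU
  rw [mem_map] at hU
  filter_upwards [hc.eventually A.eventually_eq, (A.tendsto_left.comp hc).eventually hU,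
    (A.tendsto_right.comp hc).eventually (T.eventually_eq_zero_of_coordProd_mem A)] with g h1 h2 h3
  simp only [Function.comp_apply] at h2 h3
  have h4 := h3 (by
    have h5 := Subgroup.mul_mem _ (inv_mem c.2) g.2
    rw [h1] at h5
    exact (Subgroup.mul_mem_cancel_left _ (T.coordProd_mem A.mem _)).1 h5)
  rw [h4, coordProd_zero, mul_one] at h1
  have e : g = c * ⟨coordProd A.e (fun i => A.κ ((c : G)⁻¹ * g) (Fin.castAdd m i)), T.coordProd_mem A.mem _⟩ := by
    exact Subtype.ext (inv_mul_eq_iff_eq_mul.1 h1)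
  rw [e]
  exact h2

/-- Through the parametrization `ψ` of the source, the map is a translate and conjugate of
`conjChart`, which is locally invertible at a regular point. It is enough that `ψ` is continuous and
covers neighbourhoods: openness and local injectivity transfer without `ψ` being a chart. -/
theorem isLocalHomeomorphOn_conjMap [ConnectedSpace G] (hB : IsInvariantInner B)
    {δ : T.lieAlgebra V} (hδ : ∀ α, T.IsRoot ⊤ α → α δ ≠ 0) :
    IsLocalHomeomorphOn T.conjMap {x | T.IsRegular V (x.2 : G)} := by
  obtain ⟨r, m, -, hrm, ⟨A⟩⟩ := exists_adaptedCoord (T.lieAlgebra V)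
  have hU : IsOpen {x : (G ⧸ T.toSubgroup) × T.toSubgroup | T.IsRegular V (x.2 : G)} := by
    have := (isClosed_not_isRegular hB hδ).isOpen_compl.preimage (continuous_snd (X := G ⧸ T.toSubgroup))
    convert this using 1
    ext x; simp
  have key : ∀ (k : G) (c : T.toSubgroup), T.IsRegular V (c : G) → ∃ κ : G → (Fin m → ℝ) × (Fin r → ℝ),
      (∀ᶠ g in 𝓝 1, conjChart A (c : G) (κ g) = g) ∧ (∀ᶠ x in 𝓝 0, κ (conjChart A (c : G) x) = x) ∧ ContinuousAt κ 1 ∧ κ 1 = 0 := by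
    intro k c hc
    have h0 : conjChart A (c : G) 0 = 1 := by simp [conjChart, coordProd_zero]
    obtain ⟨κ, h1, h2, h3⟩ := exists_smooth_localInverse (contMDiff_conjChart A (c : G)) h0 (bijective_modelDeriv_conjChart hB hrm A c.2 hc)
    exact ⟨κ, h2, h3, h1.continuous.continuousAt, by simpa [h0] using h3.self_of_nhds⟩
  let ψ : G → T.toSubgroup → (Fin m → ℝ) × (Fin r → ℝ) → (G ⧸ T.toSubgroup) × T.toSubgroup := fun k c p =>
    (QuotientGroup.mk (k * (coordProd A.f p.1)⁻¹), c * ⟨coordProd A.e p.2, T.coordProd_mem A.mem p.2⟩)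
  have hψ : ∀ k c, 𝓝 ((QuotientGroup.mk k : G ⧸ T.toSubgroup), c) ≤ map (ψ k c) (𝓝 0) := by
    intro k c
    rw [nhds_prod_eq]
    refine (Filter.prod_mono (nhds_quotient_le A k) (nhds_torus_le A c)).trans ?_
    rw [prod_map_map_eq, ← nhds_prod_eq]
    exact le_rfl
  have hpψ : ∀ k c p, T.conjMap (ψ k c p) = k * (conjChart A (c : G) p * c) * k⁻¹ := by
    intro k c p
    simp only [ψ, conjMap_mk, conjChart, Subgroup.coe_mul]
    group
  have hψc : ∀ k c, Tendsto (ψ k c) (𝓝 0) (𝓝 ((QuotientGroup.mk k : G ⧸ T.toSubgroup), c)) := by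
    intro k c
    have hcf := (contMDiff_coordProd A.f).continuous
    have hce := (contMDiff_coordProd A.e).continuous
    have : Continuous (ψ k c) := by
      refine Continuous.prodMk (QuotientGroup.continuous_mk.comp ?_) ?_
      · exact continuous_const.mul (hcf.comp continuous_fst).inv
      · exact continuous_const.mul ((hce.comp continuous_snd).subtype_mk _)
    have h := this.tendsto 0
    have e : ψ k c 0 = ((QuotientGroup.mk k : G ⧸ T.toSubgroup), c) := by
      simp [ψ, coordProd_zero]
    rwa [e] at h
  refine isLocalHomeomorphOn_of_nhds T.continuous_conjMap hU ?_ ?_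
  · rintro ⟨q, c⟩ hc
    induction q using QuotientGroup.induction_on with
    | H k =>
      obtain ⟨κ, h1, h2, h3, h4⟩ := key k c hc
      refine le_trans ?_ (map_mono (hψc k c))
      rw [Filter.map_map]
      intro U hU
      rw [mem_map] at hU
      have ht : Tendsto (fun g : G => k⁻¹ * g * k * (c : G)⁻¹) (𝓝 (T.conjMap ((k : G ⧸ T.toSubgroup), c))) (𝓝 1) := by
        have h5 : Continuous fun g : G => k⁻¹ * g * k * (c : G)⁻¹ := by fun_prop
        have h6 := h5.tendsto (T.conjMap ((k : G ⧸ T.toSubgroup), c))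
        have h7 : k⁻¹ * (T.conjMap ((k : G ⧸ T.toSubgroup), c)) * k * (c : G)⁻¹ = 1 := by rw [conjMap_mk]; group
        rwa [h7] at h6
      have h8 : Tendsto κ (𝓝 1) (𝓝 0) := h4 ▸ h3
      filter_upwards [ht.eventually h1, (h8.comp ht).eventually hU] with g hg hgU
      simp only [Function.comp_apply] at hgU
      change T.conjMap (ψ k c _) ∈ U at hgU
      rw [hpψ, hg] at hgU
      have e : k * (k⁻¹ * g * k * (c : G)⁻¹ * c) * k⁻¹ = g := by group
      rwa [e] at hgU
  · rintro ⟨q, c⟩ hc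
    induction q using QuotientGroup.induction_on with
    | H k =>
      obtain ⟨κ, h1, h2, h3, h4⟩ := key k c hc
      refine ⟨ψ k c '' {x | κ (conjChart A (c : G) x) = x}, hψ k c (image_mem_map h2), ?_⟩
      rintro _ ⟨x, hx, rfl⟩ _ ⟨y, hy, rfl⟩ hxy
      rw [hpψ, hpψ, mul_left_inj, mul_right_inj, mul_left_inj] at hxy
      have : x = y := by
        rw [← (show κ (conjChart A (c : G) x) = x from hx), hxy]; exact hy
      rw [this]

/-- The conjugates of the non-regular elements of the torus. -/
def singularSet (V : Type*) [NormedAddCommGroup V] [NormedSpace ℝ V] [CompleteSpace V]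
    [ChartedSpace V G] [LieGroup 𝓘(ℝ, V) ∞ G] (T : MaximalTorus G) : Set G :=
  {g | ∃ k t, t ∈ T.toSubgroup ∧ ¬ T.IsRegular V t ∧ g = k * t * k⁻¹}

theorem singularSet_eq (T : MaximalTorus G) :
    T.singularSet V = T.conjMap '' {x | ¬ T.IsRegular V (x.2 : G)} := by
  ext g
  constructor
  · rintro ⟨k, t, ht, h, rfl⟩
    exact ⟨((k : G ⧸ T.toSubgroup), ⟨t, ht⟩), h, rfl⟩
  · rintro ⟨⟨q, t⟩, h, rfl⟩
    induction q using QuotientGroup.induction_on with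
    | H k => exact ⟨k, t, t.2, h, rfl⟩

theorem IsRegular.conj_not_mem {t : G} (h : T.IsRegular V t) (k : G) :
    k * t * k⁻¹ ∉ T.singularSet V := by
  rintro ⟨k', t', ht', h', e⟩
  refine h' (h.of_conj (g := k'⁻¹ * k) ht' ?_)
  calc t' = k'⁻¹ * (k' * t' * k'⁻¹) * k' := by group
    _ = _ := by rw [← e]; group

variable [CompactSpace G]

theorem isClosed_singularSet (hB : IsInvariantInner B) {δ : T.lieAlgebra V}
    (hδ : ∀ α, T.IsRoot ⊤ α → α δ ≠ 0) :
    IsClosed (T.singularSet V) := by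
  have hcl : IsClosed (T.toSubgroup : Set G) := T.isClosed
  have : CompactSpace T.toSubgroup := isCompact_iff_compactSpace.1 hcl.isCompact
  rw [singularSet_eq]
  refine (IsCompact.image (IsClosed.isCompact ?_) T.continuous_conjMap).isClosed
  exact (isClosed_not_isRegular hB hδ).preimage (continuous_snd (X := G ⧸ T.toSubgroup))

/-- The source is compact and every point over the complement of the singular set is regular; a
local homeomorphism from a compact space is a covering there. -/
theorem isCoveringMapOn_conjMap [ConnectedSpace G] (hB : IsInvariantInner B) {δ : T.lieAlgebra V}
    (hδ : ∀ α, T.IsRoot ⊤ α → α δ ≠ 0) :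
    IsCoveringMapOn T.conjMap (T.singularSet V)ᶜ := by
  have hcl : IsClosed (T.toSubgroup : Set G) := T.isClosed
  have : CompactSpace T.toSubgroup := isCompact_iff_compactSpace.1 hcl.isCompact
  refine IsCoveringMapOn.of_isLocalHomeomorphOn T.continuous_conjMap ((isLocalHomeomorphOn_conjMap hB hδ).mono fun x hx => ?_)
  by_contra h
  exact hx ((T.singularSet_eq (V := V)).symm ▸ ⟨x, h, rfl⟩)

end MaximalTorus

end

/-! ### Codimension of the singular set and injectivity on alcoves. -/

noncomputable section

open scoped Manifold ContDiff ENNReal Topology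
open VectorField Set Filter
variable {V : Type*} [NormedAddCommGroup V] [NormedSpace ℝ V] [CompleteSpace V]
  {G : Type*} [TopologicalSpace G] [ChartedSpace V G] [Group G] [LieGroup 𝓘(ℝ, V) ∞ G]
variable [FiniteDimensional ℝ V]

namespace MaximalTorus
variable [T2Space G] [IsTopologicalGroup G] {T : MaximalTorus G} {B : LinearMap.BilinForm ℝ (LieAlg V G)}

theorem IsRootPair.form_torus {I : LieIdeal ℝ (LieAlg V G)} {α : Module.Dual ℝ (T.lieAlgebra V)}
    {X Y : LieAlg V G}
    (h : T.IsRootPair I α X Y) (hB : IsInvariantInner B) (hα : α ≠ 0) {H : LieAlg V G}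
    (hH : H ∈ T.lieAlgebra V) :
    B X H = 0 ∧ B Y H = 0 := by
  obtain ⟨H₀, h0⟩ : ∃ H₀, α H₀ ≠ 0 := by
    by_contra! hc; exact hα (LinearMap.ext hc)
  have hz : ∀ Z, B ⁅(H₀ : LieAlg V G), Z⁆ H = 0 := fun Z => by
    rw [bilin_lie_skew hB.inv, T.lie_eq_zero H₀.2 hH, map_zero, neg_zero]
  have h1 := hz X
  have h2 := hz Y
  rw [h.lie_left, map_smul, LinearMap.smul_apply, smul_eq_mul] at h1
  rw [h.lie_right, map_neg, map_smul, LinearMap.neg_apply, LinearMap.smul_apply, smul_eq_mul, neg_eq_zero] at h2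
  have hne : 2 * Real.pi * α H₀ ≠ 0 := mul_ne_zero (by positivity) h0
  exact ⟨(mul_eq_zero.1 h2).resolve_left hne, (mul_eq_zero.1 h1).resolve_left hne⟩

theorem IsRootPair.finrank_le {I : LieIdeal ℝ (LieAlg V G)} {α : Module.Dual ℝ (T.lieAlgebra V)}
    {X Y : LieAlg V G}
    (h : T.IsRootPair I α X Y) (hB : IsInvariantInner B) (hα : α ≠ 0) :
    Module.finrank ℝ (T.lieAlgebra V) + 2 ≤ Module.finrank ℝ
    (T.lieAlgebra V ⊔ Submodule.span ℝ {X, Y} : Submodule ℝ (LieAlg V G)) := by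
  let F : T.lieAlgebra V × ℝ × ℝ →ₗ[ℝ] LieAlg V G :=
    (T.lieAlgebra V).subtype.coprod ((LinearMap.toSpanSingleton ℝ _ X).coprod (LinearMap.toSpanSingleton ℝ _ Y))
  have hF : ∀ H a b, F (H, a, b) = (H : LieAlg V G) + (a • X + b • Y) := fun H a b => rfl
  have hmem : ∀ x, F x ∈ (T.lieAlgebra V ⊔ Submodule.span ℝ {X, Y} : Submodule ℝ (LieAlg V G)) := by
    rintro ⟨H, a, b⟩
    rw [hF]
    refine Submodule.add_mem_sup H.2 (add_mem (Submodule.smul_mem _ _ (Submodule.subset_span ?_)) (Submodule.smul_mem _ _ (Submodule.subset_span ?_))) <;> simp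
  have hinj : Function.Injective (F.codRestrict _ hmem) := by
    rw [injective_iff_map_eq_zero]
    rintro ⟨H, a, b⟩ h0
    have h1 : (H : LieAlg V G) + (a • X + b • Y) = 0 := congrArg Subtype.val h0
    obtain ⟨n1, n2⟩ := h.norm_eq hB hα
    have hX := (h.form_torus hB hα H.2).1
    have hY := (h.form_torus hB hα H.2).2
    have h2 : B X ((H : LieAlg V G) + (a • X + b • Y)) = 0 := by rw [h1, map_zero]
    have h3 : B Y ((H : LieAlg V G) + (a • X + b • Y)) = 0 := by rw [h1, map_zero]
    simp only [map_add, map_smul, smul_eq_mul, hX, n2, hY, hB.symm Y X, n1] at h2 h3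
    have hp := hB.pos X h.ne_zero
    have ha : a = 0 := by
      have : a * B X X = 0 := by linarith
      exact (mul_eq_zero.1 this).resolve_right hp.ne'
    have hb : b = 0 := by
      have : b * B X X = 0 := by linarith
      exact (mul_eq_zero.1 this).resolve_right hp.ne'
    subst ha hb
    simp only [zero_smul, add_zero, ZeroMemClass.coe_eq_zero] at h1
    rw [h1]; rfl
  have h1 := LinearMap.finrank_le_finrank_of_injective hinj
  simpa [Module.finrank_prod] using h1

/-- The conjugates of the elements `exp ζ`, `α ζ = n`, of the torus depend on few parameters. -/
theorem IsRootPair.exists_slice [CompactSpace G] {I : LieIdeal ℝ (LieAlg V G)}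
    {α : Module.Dual ℝ (T.lieAlgebra V)} {X Y : LieAlg V G}
    (h : T.IsRootPair I α X Y) (hB : IsInvariantInner B) (hα : α ≠ 0) :
    ∃ (K : Finset G) (q : ℕ) (f : Fin q → LieAlg V G), q +
    (Module.finrank ℝ (T.lieAlgebra V) + 2) ≤ Module.finrank ℝ V ∧
      ∀ (n : ℤ) (ζ : T.lieAlgebra V), α ζ = n → ∀ k : G, ∃ k' ∈ K, ∃ z : Fin q → ℝ,
        k * lieExp (ζ : LieAlg V G) * k⁻¹ = k' *
    ((coordProd f z)⁻¹ * lieExp (ζ : LieAlg V G) * coordProd f z) * k'⁻¹ := by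
  obtain ⟨r, q, hr, hrq, ⟨A⟩⟩ := exists_adaptedCoord (G := G) (T.lieAlgebra V ⊔ Submodule.span ℝ {X, Y})
  have hfin := h.finrank_le hB hα
  let U : Set G := {g | g⁻¹ = coordProd A.e (fun i => A.κ g⁻¹ (Fin.castAdd q i)) * coordProd A.f (fun i => A.κ g⁻¹ (Fin.natAdd r i))}
  have hU : U ∈ 𝓝 (1 : G) := by
    have hc : Tendsto (fun g : G => g⁻¹) (𝓝 1) (𝓝 1) := by simpa using (continuous_inv (G := G)).tendsto 1
    exact hc.eventually A.eventually_eq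
  obtain ⟨K, hK⟩ := compact_covered_by_mul_left_translates (isCompact_univ (X := G)) (V := U) ⟨1, mem_interior_iff_mem_nhds.2 hU⟩
  classical
  refine ⟨K.image (·⁻¹), q, A.f, by omega, fun n ζ hζ k => ?_⟩
  have hk := hK (mem_univ k)
  simp only [mem_iUnion, mem_preimage, exists_prop] at hk
  obtain ⟨g, hgK, hg⟩ := hk
  refine ⟨g⁻¹, Finset.mem_image_of_mem _ hgK, fun i => A.κ (g * k)⁻¹ (Fin.natAdd r i), ?_⟩
  -- When `α ζ` is an integer, `exp ζ` centralizes `𝔱` and the root plane. Conjugation then depends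
  -- only on the coordinates transverse to that larger space, two fewer than those transverse to
  -- `𝔱`. The finite set `K` compensates for these coordinates being local.
  have hfix : ∀ x ∈ (T.lieAlgebra V ⊔ Submodule.span ℝ {X, Y} : Submodule ℝ (LieAlg V G)), Ad (lieExp (ζ : LieAlg V G) : G) x = x := by
    let S : Submodule ℝ (LieAlg V G) :=
      { carrier := {x | Ad (lieExp (ζ : LieAlg V G) : G) x = x}
        add_mem' := fun {x y} hx hy => (Ad_add _ _ _).trans (congrArg₂ _ hx hy)
        zero_mem' := by simpa using Ad_smul (lieExp (ζ : LieAlg V G) : G) 0 (0 : LieAlg V G)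
        smul_mem' := fun r x hx => (Ad_smul _ _ _).trans (congrArg _ hx) }
    have hle : (T.lieAlgebra V ⊔ Submodule.span ℝ {X, Y} : Submodule ℝ (LieAlg V G)) ≤ S := by
      refine sup_le (fun x hx => T.Ad_eq_of_mem (T.lieExp_mem ζ.2) hx) (Submodule.span_le.2 ?_)
      rintro x (rfl | rfl)
      · exact (h.Ad_lieExp_eq_iff hB hα ζ).2 ⟨n, hζ⟩
      · exact ((show T.IsRootPair I α x (-X) from ⟨h.mem_right, neg_mem h.mem_left, h.right_ne_zero hB hα,
          fun H => by rw [h.lie_right, smul_neg], fun H => by rw [lie_neg, h.lie_left]⟩).Ad_lieExp_eq_iff hB hα ζ).2 ⟨n, hζ⟩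
    exact fun x hx => hle hx
  have hcomm : ∀ y, Commute (lieExp (ζ : LieAlg V G)) (coordProd A.e y : G) := by
    intro y
    refine Commute.list_prod_right _ _ fun g hg => ?_
    obtain ⟨i, rfl⟩ := List.mem_ofFn.1 hg
    have := conj_lieExp (lieExp (ζ : LieAlg V G) : G) (y i • A.e i)
    rw [Ad_smul, hfix _ (A.mem i)] at this
    exact mul_inv_eq_iff_eq_mul.1 this
  have hg' : (g * k)⁻¹ = _ := hg
  have hk : k = g⁻¹ * ((coordProd A.e (fun i => A.κ (g * k)⁻¹ (Fin.castAdd q i)) * coordProd A.f (fun i => A.κ (g * k)⁻¹ (Fin.natAdd r i))))⁻¹ := by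
    rw [← hg']; group
  generalize (fun i => A.κ (g * k)⁻¹ (Fin.castAdd q i)) = y at hk
  generalize (fun i => A.κ (g * k)⁻¹ (Fin.natAdd r i)) = z at hk ⊢
  have hy := (hcomm y).eq
  have hy' : (coordProd A.e y)⁻¹ * lieExp (ζ : LieAlg V G) * coordProd A.e y = lieExp (ζ : LieAlg V G) := by
    rw [mul_assoc, hy]; group
  rw [hk]
  calc _ = g⁻¹ * ((coordProd A.f z)⁻¹ * ((coordProd A.e y)⁻¹ * lieExp (ζ : LieAlg V G) * coordProd A.e y) * coordProd A.f z) * g⁻¹⁻¹ := by group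
    _ = _ := by rw [hy']

/-- The singular set is avoided by a general translate of a surface. -/
theorem exists_translate_not_mem_singularSet [CompactSpace G] (hB : IsInvariantInner B)
    {δ : T.lieAlgebra V} (hδ : ∀ α, T.IsRoot ⊤ α → α δ ≠ 0)
    {n : ℕ} (hn : n = Module.finrank ℝ V) {e : Fin n → LieAlg V G} {κ : G → Fin n → ℝ}
    (hκ : ContMDiff 𝓘(ℝ, V) 𝓘(ℝ, Fin n → ℝ) ∞ κ)
    (hκe : ∀ᶠ x in 𝓝 0, κ (coordProd e x) = x) {H : ℝ × ℝ → G}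
    (hH : ContMDiff 𝓘(ℝ, ℝ × ℝ) 𝓘(ℝ, V) ∞ H)
    {U : Set (Fin n → ℝ)} (hU : U ∈ 𝓝 0) : ∃ x ∈ U, ∀ s, coordProd e x * H s ∉ T.singularSet V := by
  choose! X Y hXY using fun α (h : T.IsRoot (V := V) ⊤ α) => h.2
  choose! K q f hq hK using fun α (h : T.IsRoot (V := V) ⊤ α) => (hXY α h).exists_slice hB h.1
  choose r m hr hrm A using fun α : Module.Dual ℝ (T.lieAlgebra V) => exists_adaptedCoord (G := G) ((LinearMap.ker α).map (T.lieAlgebra V).subtype)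
  let A' := fun α => (A α).some
  have hAT : ∀ α i, (A' α).e i ∈ T.lieAlgebra V := fun α i => by
    obtain ⟨y, -, hy⟩ := (A' α).mem i
    rw [← hy]; exact y.2
  have hsol : ∀ α, T.IsRoot (V := V) ⊤ α → ∀ n : ℤ, ∃ ζ, α ζ = n := fun α hα n => by
    refine ⟨((n : ℝ) / α δ) • δ, ?_⟩
    rw [map_smul, smul_eq_mul, div_mul_cancel₀ _ (hδ α hα)]
  choose! ζ₀ hζ₀ using hsol
  -- These maps parametrize all `g (H s)⁻¹` with `g` singular, in the coordinates `κ`. A translate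
  -- that meets the singular set has its parameter in the range of one of them.
  let Φ : (α : Module.Dual ℝ (T.lieAlgebra V)) → ℤ → G → (Fin (q α) → ℝ) × (Fin (r α) → ℝ) × (ℝ × ℝ) → Fin n → ℝ := fun α n k p =>
    κ (k * ((coordProd (f α) p.1)⁻¹ * (lieExp (ζ₀ α n : LieAlg V G) * coordProd (A' α).e p.2.1) * coordProd (f α) p.1) * k⁻¹ * (H p.2.2)⁻¹)
  have hΦ : ∀ α n k, ContDiff ℝ 1 (Φ α n k) := by
    intro α n k
    have h1 : ContMDiff 𝓘(ℝ, (Fin (q α) → ℝ) × (Fin (r α) → ℝ) × (ℝ × ℝ)) 𝓘(ℝ, V) ∞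
        (fun p : (Fin (q α) → ℝ) × (Fin (r α) → ℝ) × (ℝ × ℝ) => (coordProd (f α) p.1 : G)) :=
      (contMDiff_coordProd _).comp contDiff_fst.contMDiff
    have h2 : ContMDiff 𝓘(ℝ, (Fin (q α) → ℝ) × (Fin (r α) → ℝ) × (ℝ × ℝ)) 𝓘(ℝ, V) ∞
        (fun p : (Fin (q α) → ℝ) × (Fin (r α) → ℝ) × (ℝ × ℝ) => (coordProd (A' α).e p.2.1 : G)) :=
      (contMDiff_coordProd _).comp (contDiff_fst.comp contDiff_snd).contMDiff
    have h3 : ContMDiff 𝓘(ℝ, (Fin (q α) → ℝ) × (Fin (r α) → ℝ) × (ℝ × ℝ)) 𝓘(ℝ, V) ∞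
        (fun p : (Fin (q α) → ℝ) × (Fin (r α) → ℝ) × (ℝ × ℝ) => H p.2.2) :=
      hH.comp (contDiff_snd.comp contDiff_snd).contMDiff
    have h4 := hκ.comp (((contMDiff_const (c := k)).mul ((h1.inv.mul ((contMDiff_const (c := (lieExp (ζ₀ α n : LieAlg V G) : G))).mul h2)).mul h1)).mul (contMDiff_const (c := k⁻¹)) |>.mul h3.inv)
    exact (contMDiff_iff_contDiff.1 h4).of_le (by exact_mod_cast le_top)
  let R := {α : Module.Dual ℝ (T.lieAlgebra V) | T.IsRoot ⊤ α}
  have hR : R.Countable := (finite_roots hB hδ).countable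
  let Bad : Set (Fin n → ℝ) := ⋃ α ∈ R, ⋃ n : ℤ, ⋃ k ∈ (K α : Set G), range (Φ α n k)
  have hrk : ∀ α ∈ R, r α + 1 = Module.finrank ℝ (T.lieAlgebra V) := fun α hα => by
    have h1 : r α = Module.finrank ℝ (LinearMap.ker α) := by
      rw [hr α]
      exact (LinearEquiv.finrank_eq (Submodule.equivMapOfInjective _ (T.lieAlgebra V).subtype_injective _)).symm
    rw [h1]
    have h2 := Module.Dual.finrank_ker_add_one_of_ne_zero hα.1
    exact h2
  have hsing : ∀ g ∈ T.singularSet V, ∃ k, ∃ ζ, ∃ α ∈ R, ∃ j : ℤ, α ζ = j ∧ g = k * lieExp (ζ : LieAlg V G) * k⁻¹ := by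
    rintro g ⟨k, t, ht, hreg, hkt⟩
    obtain ⟨ζ, hζ, rfl⟩ := T.exists_lieExp_eq (V := V) ht
    rw [isRegular_lieExp_iff hB ⟨ζ, hζ⟩] at hreg
    push Not at hreg
    obtain ⟨α, hα, j, hj⟩ := hreg
    exact ⟨k, ⟨ζ, hζ⟩, α, hα, j, hj, hkt⟩
  rcases R.eq_empty_or_nonempty with hne | hne
  · refine ⟨0, mem_of_mem_nhds hU, fun s hs => ?_⟩
    obtain ⟨k, ζ, α, hα, -⟩ := hsing _ hs
    rw [hne] at hα
    exact hα
  -- The parameters number at most `(n - dim 𝔱 - 2) + (dim 𝔱 - 1) + 2 = n - 1`. The last `2` is the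
  -- surface, so the singular set behaves as one of codimension three and a general translate misses
  -- it.
  have hdim : dimH Bad < Module.finrank ℝ (Fin n → ℝ) := by
    have h1 : dimH Bad ≤ ((n - 1 : ℕ) : ENNReal) := by
      rw [dimH_bUnion hR]
      refine iSup₂_le fun α hα => ?_
      rw [dimH_iUnion]
      refine iSup_le fun j => ?_
      rw [dimH_bUnion (K α).countable_toSet]
      refine iSup₂_le fun k _ => (hΦ α j k).dimH_range_le.trans ?_
      have := hq α hα
      have := hrk α hα
      simp only [Module.finrank_prod, Module.finrank_fin_fun, Module.finrank_self]
      exact_mod_cast (by omega)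
    refine h1.trans_lt ?_
    obtain ⟨α, hα⟩ := hne
    have := hq α hα
    rw [Module.finrank_fin_fun]
    exact_mod_cast (by omega : n - 1 < n)
  obtain ⟨x, hx, hxB⟩ := (dense_compl_of_dimH_lt_finrank hdim).inter_nhds_nonempty (inter_mem hU hκe)
  refine ⟨x, hxB.1, fun s hs => hx ?_⟩
  obtain ⟨k, ⟨ζ, hζ⟩, α, hα, j, hj, hkt⟩ := hsing _ hs
  obtain ⟨k', hk', z, hz⟩ := hK α hα j ⟨ζ, hζ⟩ hj k
  have hker : ζ - (ζ₀ α j : LieAlg V G) ∈ (LinearMap.ker α).map (T.lieAlgebra V).subtype :=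
    ⟨⟨ζ, hζ⟩ - ζ₀ α j, by rw [SetLike.mem_coe, LinearMap.mem_ker, map_sub, hj, hζ₀ α hα, sub_self], rfl⟩
  obtain ⟨y, hy⟩ := (A' α).span _ hker
  have hexp : lieExp ζ = lieExp (ζ₀ α j : LieAlg V G) * coordProd (A' α).e y := by
    rw [← T.lieExp_sum (hAT α), ← hy, ← T.lieExp_add (ζ₀ α j).2 (sub_mem hζ (ζ₀ α j).2), add_sub_cancel]
  refine mem_biUnion hα (mem_iUnion.2 ⟨j, mem_biUnion hk' ⟨(z, y, s), ?_⟩⟩)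
  simp only [Φ]
  rw [← hexp, ← hz]
  change κ (k * lieExp ζ * k⁻¹ * (H s)⁻¹) = x
  rw [← hkt, mul_inv_cancel_right]
  exact hxB.2

/-- A nonzero range of `ad H` would contain a root vector `X`. The roots vanish on `H`, so `ad H`
kills `X`; by skewness the kernel is orthogonal to the range, so `X` is orthogonal to itself. -/
theorem eq_zero_of_root_eq_zero (hB : IsInvariantInner B)
    (hcent : ∀ x : LieAlg V G, (∀ y : LieAlg V G, ⁅x, y⁆ = 0) → x = 0)
    (H : T.lieAlgebra V) (h : ∀ α, T.IsRoot ⊤ α → α H = 0) : H = 0 := by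
  refine Subtype.ext (hcent _ fun y => ?_)
  by_contra hy
  let S := LinearMap.range (LieModule.toEnd ℝ (LieAlg V G) (LieAlg V G) (H : LieAlg V G))
  have hS : ∀ x, x ∈ S ↔ ∃ z, ⁅(H : LieAlg V G), z⁆ = x := fun x => Iff.rfl
  obtain ⟨α, X, Y, hX, -, hα, hXY⟩ := exists_rootPair hB (S₀ := S) (T := T)
    (fun hb => hy (by
      have : ⁅(H : LieAlg V G), y⁆ ∈ S := ⟨y, rfl⟩
      rw [hb] at this; exact this))
    (by
      rintro H' hH' _ ⟨z, rfl⟩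
      exact ⟨⁅H', z⁆, T.lie_lie_comm H.2 hH' z⟩)
    (by
      rintro _ ⟨z, rfl⟩ H' hH'
      change B ⁅(H : LieAlg V G), z⁆ H' = 0
      rw [bilin_lie_skew hB.inv, T.lie_eq_zero H.2 hH', map_zero, neg_zero])
  obtain ⟨z, hz⟩ := (hS X).1 hX
  have h1 := hXY.lie_left H
  rw [h α ⟨hα, X, Y, hXY⟩, mul_zero, zero_smul] at h1
  have h2 : B X X = 0 := by
    have := bilin_lie_skew hB.inv (H : LieAlg V G) z X
    rw [hz, h1, map_zero, neg_zero] at this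
    exact this
  exact hXY.ne_zero (hB.eq_zero h2)

theorem contMDiff_expProd_scaled {l : List ((ℝ → ℝ) × LieAlg V G)} (h : ∀ p ∈ l, ContDiff ℝ ∞ p.1) :
    ContMDiff 𝓘(ℝ, ℝ × ℝ) 𝓘(ℝ, V) ∞
    (fun s : ℝ × ℝ => ((l.map fun p => (lieExp ((s.1 * p.1 s.2) • p.2) : G)).prod)) := by
  induction l with
  | nil => simpa using contMDiff_const
  | cons p l ih =>
    simp only [List.map_cons, List.prod_cons]
    have hp : ContDiff ℝ ∞ fun s : ℝ × ℝ => s.1 * p.1 s.2 := by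
      have := h p (by simp)
      fun_prop
    exact ((contMDiff_lieExp_smul p.2).comp hp.contMDiff).mul (ih fun q hq => h q (by simp [hq]))

theorem exists_list_lieExp [ConnectedSpace G] (k : G) : ∃ l :
    List (LieAlg V G), k = (l.map fun v => (lieExp v : G)).prod := by
  have hk : k ∈ Subgroup.closure (range fun X : LieAlg V G => (lieExp X : G)) := by
    rw [closure_range_lieExp]; trivial
  induction hk using Subgroup.closure_induction with
  | mem x hx =>
    obtain ⟨v, rfl⟩ := hx
    exact ⟨[v], by simp⟩
  | one => exact ⟨[], by simp⟩
  | mul x y _ _ hx hy =>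
    obtain ⟨l, rfl⟩ := hx
    obtain ⟨l', rfl⟩ := hy
    exact ⟨l ++ l', by simp⟩
  | inv x _ hx =>
    obtain ⟨l, rfl⟩ := hx
    refine ⟨(l.map fun v => -v).reverse, ?_⟩
    rw [List.prod_inv_reverse]
    simp [Function.comp_def, lieExp_neg']

/-- In a simply connected group, two elements of an open alcove with conjugate exponentials are equal. -/
theorem eq_of_conj_lieExp [CompactSpace G] [SimplyConnectedSpace G] (hB : IsInvariantInner B)
    {δ : T.lieAlgebra V} (hδ : ∀ α, T.IsRoot ⊤ α → α δ ≠ 0)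
    (hcent : ∀ x : LieAlg V G, (∀ y : LieAlg V G, ⁅x, y⁆ = 0) → x = 0) {ζ ζ' : T.lieAlgebra V}
    (hreg : ∀ α, T.IsRoot ⊤ α → ∀ n : ℤ, α ζ ≠ n) (hreg' : ∀ α, T.IsRoot ⊤ α → ∀ n : ℤ, α ζ' ≠ n)
    (hfl : ∀ α, T.IsRoot ⊤ α → ⌊α ζ⌋ = ⌊α ζ'⌋) {k : G}
    (hk : k * lieExp (ζ' : LieAlg V G) * k⁻¹ = lieExp (ζ : LieAlg V G)) : ζ' = ζ := by
  have hconn : ConnectedSpace G := inferInstance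
  obtain ⟨vs, hvs⟩ := exists_list_lieExp (V := V) k
  let l₀ : List ((ℝ → ℝ) × LieAlg V G) := vs.map fun v => (id, v)
  have hl₀ : ∀ p ∈ l₀, ContDiff ℝ ∞ p.1 := by
    intro p hp
    obtain ⟨v, -, rfl⟩ := List.mem_map.1 hp
    exact contDiff_id
  let kk : ℝ → G := expProd l₀
  have hkk : ContMDiff 𝓘(ℝ, ℝ) 𝓘(ℝ, V) ∞ kk := contMDiff_expProd hl₀
  have hkk0 : kk 0 = 1 := expProd_eq_one fun p hp => by
    obtain ⟨v, -, rfl⟩ := List.mem_map.1 hp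
    rfl
  have hkk1 : kk 1 = k := by rw [hvs]; simp [kk, expProd, l₀, Function.comp_def]
  let η : T.lieAlgebra V := ζ' - ζ
  let tt : ℝ → G := fun t => lieExp (ζ : LieAlg V G) * lieExp (t • (η : LieAlg V G))
  have htt : ContMDiff 𝓘(ℝ, ℝ) 𝓘(ℝ, V) ∞ tt := contMDiff_const.mul (contMDiff_lieExp_smul _)
  have htt' : ∀ t, tt t = lieExp ((ζ + t • η : T.lieAlgebra V) : LieAlg V G) := fun t =>
    (T.lieExp_add ζ.2 (t • η).2).symm
  have htT : ∀ t, tt t ∈ T.toSubgroup := fun t => htt' t ▸ T.lieExp_mem (ζ + t • η).2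
  have htt0 : tt 0 = lieExp (ζ : LieAlg V G) := by rw [htt']; simp
  have htt1 : tt 1 = lieExp (ζ' : LieAlg V G) := by rw [htt']; simp [η]
  -- The image in `G` of a path in `G/T × T` from `(T, exp ζ)` to `(kT, exp ζ')` through regular
  -- elements. It is a loop; the aim is to show that its lift is closed too.
  let q : ℝ → G := fun t => kk t * tt t * (kk t)⁻¹
  have hq : ContMDiff 𝓘(ℝ, ℝ) 𝓘(ℝ, V) ∞ q := (hkk.mul htt).mul hkk.inv
  have hq0 : q 0 = lieExp (ζ : LieAlg V G) := by simp only [q]; rw [hkk0, htt0]; simp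
  have hq1 : q 1 = lieExp (ζ : LieAlg V G) := by simp only [q]; rw [hkk1, htt1, hk]
  have htreg : ∀ t ∈ Icc (0 : ℝ) 1, T.IsRegular V (tt t) := by
    intro t ht
    rw [htt', isRegular_lieExp_iff hB]
    intro α hα n hn
    have e : α (ζ + t • η) = (1 - t) * α ζ + t * α ζ' := by simp [η]; ring
    rw [e] at hn
    have f1 : (⌊α ζ⌋ : ℝ) < α ζ := lt_of_le_of_ne (Int.floor_le _) (hreg α hα _).symm
    have f2 : α ζ < (⌊α ζ⌋ : ℝ) + 1 := Int.lt_floor_add_one _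
    have f3 : (⌊α ζ⌋ : ℝ) < α ζ' := by
      rw [hfl α hα]; exact lt_of_le_of_ne (Int.floor_le _) (hreg' α hα _).symm
    have f4 : α ζ' < (⌊α ζ⌋ : ℝ) + 1 := by rw [hfl α hα]; exact Int.lt_floor_add_one _
    obtain ⟨g1, g2⟩ := convex_Ioo (⌊α ζ⌋ : ℝ) (⌊α ζ⌋ + 1) ⟨f1, f2⟩ ⟨f3, f4⟩ (sub_nonneg.2 ht.2) ht.1 (by ring)
    rw [smul_eq_mul, smul_eq_mul, hn] at g1 g2
    have g3 : ⌊α ζ⌋ < n := by exact_mod_cast g1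
    have g4 : n < ⌊α ζ⌋ + 1 := by exact_mod_cast g2
    omega
  have hqD : ∀ t ∈ Icc (0 : ℝ) 1, q t ∈ (T.singularSet V)ᶜ := fun t ht => (htreg t ht).conj_not_mem (kk t)
  obtain ⟨l, hl, hlq⟩ := exists_factorization (γ := fun t => (lieExp (ζ : LieAlg V G))⁻¹ * q t) (contMDiff_const.mul hq)
    (by simp [hq0]) (by simp [hq1])
  -- Scaling the coefficients of a factorization gives a contraction of the loop that is smooth in
  -- both variables, as the dimension argument requires.
  let H : ℝ × ℝ → G := fun s => lieExp (ζ : LieAlg V G) * (l.map fun p => (lieExp ((s.1 * p.1 s.2) • p.2) : G)).prod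
  have hH : ContMDiff 𝓘(ℝ, ℝ × ℝ) 𝓘(ℝ, V) ∞ H := contMDiff_const.mul (contMDiff_expProd_scaled fun p hp => (hl p hp).1)
  have hH1 : ∀ t ∈ Icc (0 : ℝ) 1, H (1, t) = q t := by
    intro t ht
    have h1 := hlq ht
    simp only [H, one_mul]
    change _ * expProd l t = _
    rw [← h1, mul_inv_cancel_left]
  have hHone : ∀ s : ℝ × ℝ, (∀ p ∈ l, s.1 * p.1 s.2 = 0) → H s = lieExp (ζ : LieAlg V G) := by
    intro s hs
    have : (l.map fun p => (lieExp ((s.1 * p.1 s.2) • p.2) : G)).prod = 1 := by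
      refine List.prod_eq_one fun g hg => ?_
      obtain ⟨p, hp, rfl⟩ := List.mem_map.1 hg
      rw [hs p hp, zero_smul, lieExp_zero_eq_one]
    simp only [H, this, mul_one]
  let b := Module.finBasis ℝ V
  let e : Fin (Module.finrank ℝ V) → LieAlg V G := fun i => (b i : V)
  obtain ⟨κ, hκ, -, hκe⟩ := exists_coordinates_of_basis (G := G) b (e := e) fun i => rfl
  obtain ⟨U₀, hU₀, hU₀D⟩ := compact_open_separated_mul_left (isCompact_Icc.image hq.continuous)
    (isClosed_singularSet hB hδ).isOpen_compl (image_subset_iff.2 hqD)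
  have hcp : Tendsto (coordProd e : (Fin (Module.finrank ℝ V) → ℝ) → G) (𝓝 0) (𝓝 1) := by
    have := (contMDiff_coordProd e).continuous.tendsto 0
    rwa [coordProd_zero] at this
  obtain ⟨ε, hε, hball⟩ := Metric.mem_nhds_iff.1 (hcp hU₀)
  obtain ⟨x, hx, hxH⟩ := exists_translate_not_mem_singularSet hB hδ rfl hκ hκe hH (Metric.ball_mem_nhds 0 hε)
  have hx' : ∀ u ∈ Icc (0 : ℝ) 1, coordProd e (u • x) ∈ U₀ := by
    intro u hu
    refine hball ?_
    rw [mem_ball_zero_iff] at hx ⊢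
    rw [norm_smul, Real.norm_of_nonneg hu.1]
    nlinarith [hu.2, norm_nonneg x]
  let cl : ℝ → ℝ := fun u => max 0 (min 1 u)
  have hcl : Continuous cl := by fun_prop
  have hclI : ∀ u, cl u ∈ Icc (0 : ℝ) 1 := fun u => ⟨le_max_left _ _, max_le zero_le_one (min_le_left _ _)⟩
  have hcl0 : cl 0 = 0 := by simp [cl]
  have hcl1 : cl 1 = 1 := by simp [cl]
  have hcov := isCoveringMapOn_conjMap hB hδ
  let F : C(ℝ, (G ⧸ T.toSubgroup) × T.toSubgroup) := ⟨fun t => (QuotientGroup.mk (kk (cl t)), ⟨tt (cl t), htT _⟩), by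
    refine Continuous.prodMk (QuotientGroup.continuous_mk.comp (hkk.continuous.comp hcl)) ?_
    exact (htt.continuous.comp hcl).subtype_mk _⟩
  have hcpc := (contMDiff_coordProd e : ContMDiff _ 𝓘(ℝ, V) ∞ (coordProd e : _ → G)).continuous
  -- `K` pushes the loop by small translations inside the regular set; `M` then contracts the
  -- translated loop while avoiding the singular set. Clamping by `cl` extends both to the plane.
  let K : C(ℝ × ℝ, G) := ⟨fun s => coordProd e (cl s.1 • x) * q (cl s.2), by
    have := hq.continuous
    exact (hcpc.comp (by fun_prop)).mul (this.comp (by fun_prop))⟩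
  let M : C(ℝ × ℝ, G) := ⟨fun s => coordProd e x * H (1 - cl s.1, cl s.2), by
    have := hH.continuous
    exact continuous_const.mul (this.comp (by fun_prop))⟩
  obtain ⟨F', hF', hFF'⟩ := hcov.exists_lift_closed K (fun s => hU₀D (mul_mem_mul (hx' _ (hclI _)) (mem_image_of_mem _ (hclI _)))) F
    (fun t => by
      change q (cl t) = coordProd e (cl 0 • x) * q (cl t)
      rw [hcl0, zero_smul, coordProd_zero, one_mul])
    (fun u => by
      change coordProd e (cl u • x) * q (cl 0) = coordProd e (cl u • x) * q (cl 1)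
      rw [hcl0, hcl1, hq0, hq1])
  obtain ⟨F'', hF'', hFF''⟩ := hcov.exists_lift_closed M (fun s => hxH _) F'
    (fun t => by
      rw [hF']
      change coordProd e (cl 1 • x) * q (cl t) = coordProd e x * H (1 - cl 0, cl t)
      rw [hcl0, hcl1, one_smul, sub_zero, hH1 _ (hclI t)])
    (fun u => by
      change coordProd e x * H (1 - cl u, cl 0) = coordProd e x * H (1 - cl u, cl 1)
      rw [hHone, hHone]
      · intro p hp; simp only [hcl1]; rw [(hl p hp).2.2, mul_zero]
      · intro p hp; simp only [hcl0]; rw [(hl p hp).2.1, mul_zero])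
  have hM1 : ∀ t, M (1, t) = coordProd e x * lieExp (ζ : LieAlg V G) := fun t => by
    change coordProd e x * H (1 - cl 1, cl t) = _
    rw [hHone]
    intro p hp; simp [hcl1]
  -- After the contraction the loop is constant, so its lift is constant and in particular closed.
  -- Closedness is carried back through both homotopies to the original lift.
  have hFc : F'' = ContinuousMap.const ℝ (F'' 0) := by
    refine hcov.lift_unique (a := 0) (fun t => ?_) (fun t => ?_) ?_ rfl
    · rw [ContinuousMap.const_apply, hF'', hF'', hM1, hM1]
    · rw [hF'']; exact hxH _
    · simp only [hF'', hM1]; exact continuous_const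
  have hF01 : F 0 = F 1 := hFF' (hFF'' (by
    have := DFunLike.congr_fun hFc 1
    exact this.symm))
  have h2 : tt (cl 0) = tt (cl 1) := congrArg (fun z : (G ⧸ T.toSubgroup) × T.toSubgroup => (z.2 : G)) hF01
  rw [hcl0, hcl1, htt0, htt1] at h2
  -- Now `ζ' - ζ` lies in `Λ`, so roots take integer values on it; being in the same alcove bounds
  -- them strictly between `-1` and `1`.
  have hη : (η : LieAlg V G) ∈ T.lattice V := by
    refine ⟨η.2, ?_⟩
    have : (η : LieAlg V G) = (ζ' : LieAlg V G) + -(ζ : LieAlg V G) := sub_eq_add_neg _ _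
    rw [this, T.lieExp_add ζ'.2 (neg_mem ζ.2), T.lieExp_neg ζ.2, ← h2, mul_inv_cancel]
  refine sub_eq_zero.1 (eq_zero_of_root_eq_zero hB hcent η ?_)
  rintro α ⟨hα, X, Y, hXY⟩
  have hR : T.IsRoot ⊤ α := ⟨hα, X, Y, hXY⟩
  obtain ⟨n, hn⟩ := hXY.apply_lattice hB hα hη
  have hn' : α ζ' - α ζ = n := by rw [← map_sub]; exact hn
  have f1 := Int.floor_le (α ζ)
  have f2 := Int.lt_floor_add_one (α ζ)
  have f3 := Int.floor_le (α ζ')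
  have f4 := Int.lt_floor_add_one (α ζ')
  rw [← hfl α hR] at f3 f4
  have g1 : (n : ℝ) < 1 := by linarith
  have g2 : (-1 : ℝ) < n := by linarith
  have g3 : n < 1 := by exact_mod_cast g1
  have g4 : -1 < n := by exact_mod_cast g2
  have : n = 0 := by omega
  rw [this] at hn
  simpa using hn

end MaximalTorus

end

/-! ### The integral lattice is spanned by the coroots. -/

noncomputable section

open scoped Manifold ContDiff ENNReal Topology
open VectorField Set Filter
variable {V : Type*} [NormedAddCommGroup V] [NormedSpace ℝ V] [CompleteSpace V]
  {G : Type*} [TopologicalSpace G] [ChartedSpace V G] [Group G] [LieGroup 𝓘(ℝ, V) ∞ G]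
variable [FiniteDimensional ℝ V]

theorem Set.Finite.exists_pos_le {ι : Type*} {s : Set ι} (hs : s.Finite) {f : ι → ℝ}
    (hf : ∀ i ∈ s, 0 < f i) :
    ∃ ε > 0, ∀ i ∈ s, ε ≤ f i := by
  rcases s.eq_empty_or_nonempty with rfl | hne
  · exact ⟨1, one_pos, by simp⟩
  · obtain ⟨i, hi, hmin⟩ := exists_min_image s f hs hne
    exact ⟨f i, hf i hi, hmin⟩

namespace MaximalTorus
variable [T2Space G] [IsTopologicalGroup G] {T : MaximalTorus G} {B : LinearMap.BilinForm ℝ (LieAlg V G)}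

theorem IsRootPair.reflect {I : LieIdeal ℝ (LieAlg V G)} {α β : Module.Dual ℝ (T.lieAlgebra V)}
    {X Y : LieAlg V G}
    (hβ : T.IsRootPair I β X Y) {h : T.lieAlgebra V} (h2 : α h = 2) {n : G}
    (hn : ∀ H : T.lieAlgebra V, Ad n (H : LieAlg V G) = (H : LieAlg V G) - α H • (h : LieAlg V G)) :
    T.IsRootPair ⊤ (β - β h • α) (Ad n X) (Ad n Y) := by
  have hinv : ∀ H : T.lieAlgebra V, (H : LieAlg V G) = Ad n ((H - α H • h : T.lieAlgebra V) : LieAlg V G) := by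
    intro H
    rw [hn, map_sub, map_smul, h2]
    push_cast
    module
  have hs : ∀ H, β (H - α H • h) = (β - β h • α) H := fun H => by simp; ring
  refine ⟨trivial, trivial, fun h0 => hβ.ne_zero ?_, fun H => ?_, fun H => ?_⟩
  · rw [← Ad_inv_Ad n X, h0]
    simpa using Ad_smul n⁻¹ 0 (0 : LieAlg V G)
  · rw [hinv H, ← Ad_lie, hβ.lie_left, Ad_smul, hs]
  · rw [hinv H, ← Ad_lie, hβ.lie_right, ← neg_smul, Ad_smul, hs, neg_smul]

theorem IsCoroot.mem_lattice (hB : IsInvariantInner B) {I : LieIdeal ℝ (LieAlg V G)}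
    {α : Module.Dual ℝ (T.lieAlgebra V)} (hα : α ≠ 0)
    {h : T.lieAlgebra V} (hh : T.IsCoroot I α h) : (h : LieAlg V G) ∈ T.lattice V :=
  ⟨h.2, (hh.exists_reflection hB hα).2⟩

theorem IsRoot.reflect (hB : IsInvariantInner B) {I J : LieIdeal ℝ (LieAlg V G)}
    {α β : Module.Dual ℝ (T.lieAlgebra V)} (hα : α ≠ 0)
    {h : T.lieAlgebra V} (hh : T.IsCoroot I α h) (hβ : T.IsRoot J β) :
    T.IsRoot ⊤ (β - β h • α) := by
  obtain ⟨⟨n, hn⟩, -⟩ := hh.exists_reflection hB hα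
  obtain ⟨hβ0, X, Y, hXY⟩ := hβ
  refine ⟨fun h0 => hβ0 (LinearMap.ext fun H => ?_), _, _, hXY.reflect hh.1 hn⟩
  have h1 : (β - β h • α) (H - α H • h) = 0 := by rw [h0]; rfl
  simp only [LinearMap.sub_apply, LinearMap.smul_apply, map_sub, map_smul, smul_eq_mul, hh.1] at h1
  have : β H = 0 := by linear_combination h1
  simpa using this

theorem IsRoot.apply_lattice (hB : IsInvariantInner B) {I : LieIdeal ℝ (LieAlg V G)}
    {α : Module.Dual ℝ (T.lieAlgebra V)}
    (hα : T.IsRoot I α) {ξ : T.lieAlgebra V} (hξ : (ξ : LieAlg V G) ∈ T.lattice V) : ∃ n :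
    ℤ, α ξ = n := by
  obtain ⟨h0, X, Y, h⟩ := hα
  exact h.apply_lattice hB h0 hξ

/-- The lattice spanned by the coroots. -/
def corootLattice (V : Type*) [NormedAddCommGroup V] [NormedSpace ℝ V] [CompleteSpace V]
    [ChartedSpace V G] [LieGroup 𝓘(ℝ, V) ∞ G] (T : MaximalTorus G) : AddSubgroup (T.lieAlgebra V) :=
  AddSubgroup.closure {h | ∃ α, T.IsRoot ⊤ α ∧ T.IsCoroot ⊤ α h}

theorem corootLattice_le (hB : IsInvariantInner B) {x : T.lieAlgebra V}
    (hx : x ∈ T.corootLattice V) : (x : LieAlg V G) ∈ T.lattice V := by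
  induction hx using AddSubgroup.closure_induction with
  | mem x hx =>
    obtain ⟨α, hα, hh⟩ := hx
    exact hh.mem_lattice hB hα.1
  | zero => exact zero_mem _
  | add x y _ _ hx hy => exact add_mem hx hy
  | neg x _ hx => exact neg_mem hx

/-- In a simply connected group the integral lattice is spanned by the coroots. -/
theorem mem_corootLattice [CompactSpace G] [SimplyConnectedSpace G] (hB : IsInvariantInner B)
    {δ : T.lieAlgebra V} (hδ : ∀ α, T.IsRoot ⊤ α → α δ ≠ 0)
    (hcent : ∀ x : LieAlg V G, (∀ y : LieAlg V G, ⁅x, y⁆ = 0) → x = 0) {ξ : T.lieAlgebra V}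
    (hξ : (ξ : LieAlg V G) ∈ T.lattice V) : ξ ∈ T.corootLattice V := by
  let N : T.lieAlgebra V → ℝ := fun x => B x x
  have hCS : ∀ x y : LieAlg V G, B x y ^ 2 ≤ B x x * B y y := fun x y =>
    LinearMap.BilinForm.apply_sq_le_of_symm B (fun z => by
      rcases eq_or_ne z 0 with rfl | hz
      · simp
      · exact (hB.pos z hz).le) ⟨hB.symm⟩ x y
  let R := {α : Module.Dual ℝ (T.lieAlgebra V) | T.IsRoot ⊤ α}
  have hR : R.Finite := finite_roots hB hδ
  choose! h hh using fun α (hα : α ∈ R) => hα.2.choose_spec.choose_spec.exists_coroot hB hα.1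
  have hform : ∀ α ∈ R, ∀ x : T.lieAlgebra V, B (h α) x = B (h α) (h α) / 2 * α x := fun α hα x => (hh α hα).form_eq hB.inv x
  have hpos : ∀ α ∈ R, 0 < B (h α) (h α) := fun α hα => hB.pos _ fun h0 => by
    have h1 := (hh α hα).1
    have h2 : h α = 0 := Subtype.ext h0
    rw [h2, map_zero] at h1
    norm_num at h1
  -- Cauchy–Schwarz for `h α` and `x`: vectors short compared with the coroots have all root values
  -- of absolute value less than one.
  have hbound : ∀ α ∈ R, ∀ x : T.lieAlgebra V, (α x) ^ 2 * B (h α) (h α) ≤ 4 * N x := fun α hα x => by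
    have h1 := hCS (h α) x
    rw [hform α hα] at h1
    have h2 := hpos α hα
    have h3 : B (h α) (h α) * ((α x) ^ 2 * B (h α) (h α)) ≤ B (h α) (h α) * (4 * N x) := by
      change _ ≤ B (h α) (h α) * (4 * B x x)
      nlinarith
    exact le_of_mul_le_mul_left h3 h2
  obtain ⟨ρ, hρ, hρh⟩ := hR.exists_pos_le hpos
  -- a small regular element
  obtain ⟨ζ₀, hζN, hζreg⟩ : ∃ ζ₀ : T.lieAlgebra V, 16 * N ζ₀ < ρ ∧ ∀ α ∈ R, ∀ n : ℤ, α ζ₀ ≠ n := by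
    obtain ⟨a, ha, ha'⟩ : ∃ a : ℝ, 0 < a ∧ 16 * (a ^ 2 * N δ) < ρ := by
      have ht : Tendsto (fun a : ℝ => 16 * (a ^ 2 * N δ)) (𝓝[>] 0) (𝓝 0) := by
        have : Continuous fun a : ℝ => 16 * (a ^ 2 * N δ) := by fun_prop
        have h1 := this.tendsto 0
        simp only [ne_eq, OfNat.ofNat_ne_zero, not_false_eq_true, zero_pow, zero_mul, mul_zero] at h1
        exact h1.mono_left nhdsWithin_le_nhds
      obtain ⟨a, h1, h2⟩ := ((ht.eventually (gt_mem_nhds hρ)).and self_mem_nhdsWithin).exists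
      exact ⟨a, h2, h1⟩
    have hN : N (a • δ) = a ^ 2 * N δ := by simp [N]; ring
    refine ⟨a • δ, by rw [hN]; exact ha', fun α hα n hn => ?_⟩
    have h1 := hbound α hα (a • δ)
    rw [hN] at h1
    have h2 := hρh α hα
    have h3 : (α (a • δ)) ^ 2 < 1 := by
      by_contra! hc
      nlinarith
    rw [hn] at h3
    have h4 : n = 0 := by
      have : n ^ 2 < 1 := by exact_mod_cast h3
      nlinarith
    rw [h4, map_smul, smul_eq_mul, Int.cast_zero] at hn
    exact (mul_ne_zero ha.ne' (hδ α hα)) hn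
  obtain ⟨ε, hε, hεR⟩ := hR.exists_pos_le (f := fun α => |α ζ₀ - round (α ζ₀)|) fun α hα =>
    abs_pos.2 (sub_ne_zero.2 (hζreg α hα _))
  -- A substitute for the orbit of `ζ₀ + ξ` under the affine Weyl group. It records what is needed
  -- later: conjugacy of exponentials to `exp ζ₀`, a uniform distance `ε` from all walls, and a
  -- decomposition `w + ξ` modulo coroots with `w` of the length of `ζ₀`.
  let O : Set (T.lieAlgebra V) := {o | (∃ g : G, g * lieExp (o : LieAlg V G) * g⁻¹ = lieExp (ζ₀ : LieAlg V G)) ∧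
    (∀ α ∈ R, ∀ n : ℤ, ε ≤ |α o - n|) ∧ ∃ w, N w = N ζ₀ ∧ o - w - ξ ∈ T.corootLattice V}
  have hO : ζ₀ + ξ ∈ O := by
    refine ⟨⟨1, ?_⟩, fun α hα n => ?_, ζ₀, rfl, by simp⟩
    · have : ((ζ₀ + ξ : T.lieAlgebra V) : LieAlg V G) = (ζ₀ : LieAlg V G) + ξ := rfl
      rw [this, T.lieExp_add ζ₀.2 hξ.1, hξ.2]; simp
    · obtain ⟨m, hm⟩ := IsRoot.apply_lattice hB hα hξ
      have h1 : α (ζ₀ + ξ) - n = α ζ₀ - ((n - m : ℤ) : ℝ) := by rw [map_add, hm]; push_cast; ring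
      rw [h1]
      exact (hεR α hα).trans (round_le _ _)
  have hrefl : ∀ o ∈ O, ∀ α ∈ R, ∀ m : ℤ, o - (α o - m) • h α ∈ O := by
    rintro o ⟨⟨g, hg⟩, ho, w, hw, hwQ⟩ α hα m
    obtain ⟨⟨n, hn⟩, he⟩ := (hh α hα).exists_reflection hB hα.1
    refine ⟨⟨g * n⁻¹, ?_⟩, fun β hβ j => ?_, w - α w • h α, ?_, ?_⟩
    · have h1 : ((o - (α o - m) • h α : T.lieAlgebra V) : LieAlg V G) = Ad n (o : LieAlg V G) + ((m • h α : T.lieAlgebra V) : LieAlg V G) := by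
        rw [hn]; push_cast
        rw [← Int.cast_smul_eq_zsmul ℝ m (h α : LieAlg V G)]
        module
      have h2 : ((m • h α : T.lieAlgebra V) : LieAlg V G) ∈ T.lattice V := by
        push_cast
        exact zsmul_mem ((hh α hα).mem_lattice hB hα.1) m
      have h3 : Ad n (o : LieAlg V G) ∈ T.lieAlgebra V := by rw [hn]; exact (o - α o • h α).2
      rw [h1, T.lieExp_add h3 h2.1, h2.2, mul_one, ← conj_lieExp, ← hg]
      group
    · obtain ⟨i, hi⟩ := IsRoot.apply_lattice hB hβ ((hh α hα).mem_lattice hB hα.1)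
      have h1 := ho _ (IsRoot.reflect hB hα.1 (hh α hα) hβ) (j - m * i)
      have h2 : β (o - (α o - m) • h α) - j = (β - β (h α) • α) o - ((j - m * i : ℤ) : ℝ) := by
        simp only [map_sub, map_smul, LinearMap.sub_apply, LinearMap.smul_apply, smul_eq_mul, hi]
        push_cast; ring
      rw [h2]; exact h1
    · have h1 := hform α hα w
      change B ((w : LieAlg V G) - α w • (h α : LieAlg V G)) ((w : LieAlg V G) - α w • (h α : LieAlg V G)) = N ζ₀
      rw [← hw]
      simp only [map_sub, map_smul, LinearMap.sub_apply, LinearMap.smul_apply, smul_eq_mul, hB.symm w (h α), h1, N]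
      ring
    · obtain ⟨i, hi⟩ := IsRoot.apply_lattice (ξ := o - w - ξ + ξ) hB hα (add_mem (corootLattice_le hB hwQ) hξ)
      have h1 : α o - α w = i := by rw [← hi]; simp
      have h2 : o - (α o - m) • h α - (w - α w • h α) - ξ = (o - w - ξ) - (i - m) • h α := by
        rw [← Int.cast_smul_eq_zsmul ℝ (i - m) (h α)]
        push_cast
        rw [← h1]
        module
      have h3 : h α ∈ T.corootLattice V := AddSubgroup.subset_closure ⟨α, hα, hh α hα⟩
      rw [h2]
      exact sub_mem hwQ (zsmul_mem h3 _)
  let D : Set ℝ := (fun o => N (o - ζ₀)) '' O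
  have hNn : ∀ x, 0 ≤ N x := fun x => by
    rcases eq_or_ne (x : LieAlg V G) 0 with hx | hx
    · simp [N, hx]
    · exact (hB.pos _ hx).le
  have hD : BddBelow D := ⟨0, by rintro _ ⟨o, -, rfl⟩; exact hNn _⟩
  -- A near-minimizer of the distance to `ζ₀` is enough: reflection in a wall that separates the two
  -- points lowers the squared distance by at least `ε² ρ`, so no wall can separate them.
  obtain ⟨_, ⟨o, hoO, rfl⟩, hlt⟩ := exists_lt_of_csInf_lt (s := D) ⟨_, _, hO, rfl⟩ (lt_add_of_pos_right (sInf D) (show 0 < ε ^ 2 * ρ by positivity))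
  have hred : ∀ α ∈ R, ∀ m : ℤ, 0 ≤ (α o - m) * (α ζ₀ - m) := by
    intro α hα m
    by_contra! hneg
    have h1 := csInf_le hD ⟨_, hrefl o hoO α hα m, rfl⟩
    have h2 := hform α hα (o - ζ₀)
    have h3 : N (o - (α o - m) • h α - ζ₀) = N (o - ζ₀) + (α o - m) * (α ζ₀ - m) * B (h α) (h α) := by
      have e : o - (α o - m) • h α - ζ₀ = (o - ζ₀) - (α o - m) • h α := by module
      rw [e]
      change B (((o - ζ₀ : T.lieAlgebra V) : LieAlg V G) - (α o - m) • (h α : LieAlg V G)) (((o - ζ₀ : T.lieAlgebra V) : LieAlg V G) - (α o - m) • (h α : LieAlg V G)) = _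
      simp only [map_sub, map_smul, LinearMap.sub_apply, LinearMap.smul_apply, smul_eq_mul, hB.symm ((o - ζ₀ : T.lieAlgebra V) : LieAlg V G) (h α)]
      rw [h2, map_sub]
      simp only [N]
      ring
    have h4 : ε ^ 2 ≤ -((α o - m) * (α ζ₀ - m)) := by
      rw [← abs_of_neg hneg, abs_mul, sq]
      exact mul_le_mul (hoO.2.1 α hα m) ((hεR α hα).trans (round_le _ _)) hε.le (abs_nonneg _)
    have h5 := hρh α hα
    have h6 : ε ^ 2 * ρ ≤ -((α o - m) * (α ζ₀ - m)) * B (h α) (h α) := mul_le_mul h4 h5 hρ.le (by linarith)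
    simp only at h1 hlt
    rw [h3] at h1
    linarith
  have horeg : ∀ α ∈ R, ∀ n : ℤ, α o ≠ n := fun α hα n hn => by
    have := hoO.2.1 α hα n
    rw [hn, sub_self, abs_zero] at this
    linarith
  have hfl : ∀ α ∈ R, ⌊α ζ₀⌋ = ⌊α o⌋ := by
    intro α hα
    have key : ∀ x y : ℝ, (∀ n : ℤ, x ≠ n) → (∀ n : ℤ, y ≠ n) → (∀ m : ℤ, 0 ≤ (x - m) * (y - m)) → ⌊x⌋ ≤ ⌊y⌋ := by
      intro x y hx hy hxy
      by_contra! hc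
      have h1 := hxy ⌊x⌋
      have h2 : (⌊x⌋ : ℝ) < x := lt_of_le_of_ne (Int.floor_le x) (hx _).symm
      have h3 : y < ⌊x⌋ := Int.floor_lt.1 hc
      nlinarith
    refine le_antisymm (key _ _ (hζreg α hα) (horeg α hα) fun m => ?_) (key _ _ (horeg α hα) (hζreg α hα) (hred α hα))
    rw [mul_comm]; exact hred α hα m
  obtain ⟨⟨g, hg⟩, -, w, hw, hwQ⟩ := hoO
  have hoζ := eq_of_conj_lieExp hB hδ hcent hζreg horeg hfl hg
  subst hoζ
  have hl : ((o - w : T.lieAlgebra V) : LieAlg V G) ∈ T.lattice V := by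
    have := add_mem (corootLattice_le hB hwQ) hξ
    simpa using this
  -- With `o = ζ₀` the vector `o - w` lies in `Λ`, and its length is at most twice that of `ζ₀`. The
  -- choice `16 N ζ₀ < ρ` makes all root values smaller than one, hence zero.
  have hz : o - w = 0 := by
    refine eq_zero_of_root_eq_zero hB hcent _ fun α hα => ?_
    obtain ⟨i, hi⟩ := IsRoot.apply_lattice hB hα hl
    have h1 := hbound α hα (o - w)
    have h2 : N (o - w) ≤ 4 * N o := by
      have h3 := hNn (o + w)
      change 0 ≤ B ((o : LieAlg V G) + w) ((o : LieAlg V G) + w) at h3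
      change B ((o : LieAlg V G) - w) ((o : LieAlg V G) - w) ≤ 4 * B o o
      change B w w = B o o at hw
      simp only [map_sub, map_add, LinearMap.sub_apply, LinearMap.add_apply] at h3 ⊢
      linarith
    have h3 := hρh α hα
    have h4 : (α (o - w)) ^ 2 < 1 := by
      by_contra! hc
      nlinarith
    rw [hi] at h4 ⊢
    have h5 : i ^ 2 < 1 := by exact_mod_cast h4
    have h6 : i = 0 := by nlinarith
    rw [h6]; simp
  rw [hz, zero_sub] at hwQ
  simpa using hwQ

end MaximalTorus

end

/-! ### Simple factors and integrality of the basic inner products. -/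

noncomputable section

open scoped Manifold ContDiff ENNReal Topology
open VectorField Set Filter
variable {V : Type*} [NormedAddCommGroup V] [NormedSpace ℝ V] [CompleteSpace V]
  {G : Type*} [TopologicalSpace G] [ChartedSpace V G] [Group G] [LieGroup 𝓘(ℝ, V) ∞ G]
variable [FiniteDimensional ℝ V]

/-- In a compact simple Lie algebra, no product `ad h ad h'` of nonzero commuting elements vanishes. -/
theorem LieIdeal.eq_zero_of_lie_lie_eq_zero {L : Type*} [LieRing L] [LieAlgebra ℝ L]
    [FiniteDimensional ℝ L]
    {B : LinearMap.BilinForm ℝ L} (hB : IsInvariantInner B) {I : LieIdeal ℝ L}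
    [LieAlgebra.IsSimple ℝ I] {h h' : L} (hI : h ∈ I) (hI' : h' ∈ I)
    (hc : ⁅h, h'⁆ = 0) (h0 : ∀ x : L, ⁅h, ⁅h', x⁆⁆ = 0) (hne : h' ≠ 0) : h = 0 := by
  have hcomm : ∀ x : L, ⁅h', ⁅h, x⁆⁆ = 0 := fun x => by
    rw [leibniz_lie, ← lie_skew h' h, hc, neg_zero, zero_lie, zero_add, h0]
  let A : L →ₗ[ℝ] L := LieModule.toEnd ℝ L L h
  have hA : ∀ x, A x = ⁅h, x⁆ := fun x => rfl
  -- `ad h` is skew, so its kernel and range are complementary. The splitting is what shows that `M`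
  -- below is stable under brackets with arbitrary elements.
  have hdec : ∀ y : L, ∃ y₀ y₁ : L, ⁅h, y₀⁆ = 0 ∧ y = y₀ + ⁅h, y₁⁆ := by
    have hdis : Disjoint (LinearMap.ker A) (LinearMap.range A) := by
      rw [Submodule.disjoint_def]
      rintro _ hx ⟨z, rfl⟩
      refine hB.eq_zero ?_
      rw [LinearMap.mem_ker, hA] at hx
      have := bilin_lie_skew hB.inv h z (A z)
      rw [hx, map_zero, neg_zero] at this
      exact this
    have htop : LinearMap.ker A ⊔ LinearMap.range A = ⊤ := Submodule.eq_top_of_disjoint _ _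
      (by rw [add_comm]; exact (LinearMap.finrank_range_add_finrank_ker A).ge) hdis
    intro y
    have hy : y ∈ LinearMap.ker A ⊔ LinearMap.range A := by rw [htop]; trivial
    obtain ⟨y₀, h1, z, ⟨y₁, rfl⟩, h2⟩ := Submodule.mem_sup.1 hy
    exact ⟨y₀, y₁, h1, h2.symm⟩
  let M : LieIdeal ℝ L :=
    { carrier := {m | ⁅m, h⁆ = 0 ∧ ∀ x : L, ⁅m, ⁅h, x⁆⁆ = 0}
      add_mem' := fun {x y} hx hy => ⟨by rw [add_lie, hx.1, hy.1, add_zero], fun z => by rw [add_lie, hx.2, hy.2, add_zero]⟩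
      zero_mem' := ⟨by simp, fun z => by simp⟩
      smul_mem' := fun r x hx => ⟨by rw [smul_lie, hx.1, smul_zero], fun z => by rw [smul_lie, hx.2, smul_zero]⟩
      lie_mem := by
        rintro y m ⟨h1, h2⟩
        have key : ∀ x : L, ⁅m, ⁅y, ⁅h, x⁆⁆⁆ = 0 := by
          intro x
          obtain ⟨y₀, y₁, h3, rfl⟩ := hdec y
          rw [add_lie, lie_add]
          have e1 : ⁅y₀, ⁅h, x⁆⁆ = ⁅h, ⁅y₀, x⁆⁆ := by
            rw [leibniz_lie, ← lie_skew y₀ h, h3, neg_zero, zero_lie, zero_add]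
          rw [e1, h2, leibniz_lie, h2, zero_lie, h2, lie_zero, add_zero, add_zero]
        refine ⟨?_, fun x => ?_⟩
        · rw [lie_lie, h1, lie_zero, zero_sub, ← lie_skew y h, lie_neg, h2, neg_zero, neg_zero]
        · rw [lie_lie, h2, lie_zero, zero_sub, key, neg_zero] }
  have hM : h' ∈ M := ⟨by rw [← lie_skew, hc, neg_zero], hcomm⟩
  -- `M` contains the nonzero `h'`, so by simplicity it contains all of `I`; then `h` is central in
  -- `I` and vanishes.
  rcases LieAlgebra.IsSimple.eq_bot_or_eq_top (R := ℝ) (M.comap I.incl) with hb | ht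
  · have : (⟨h', hI'⟩ : I) ∈ M.comap I.incl := hM
    rw [hb] at this
    exact absurd (congrArg Subtype.val ((LieSubmodule.mem_bot _).1 this)) hne
  · have hz : (⟨h, hI⟩ : I) ∈ LieAlgebra.center ℝ I := by
      rw [LieModule.mem_maxTrivSubmodule]
      intro x
      have : x ∈ M.comap I.incl := ht ▸ LieSubmodule.mem_top x
      exact Subtype.ext this.1
    rw [LieAlgebra.center_eq_bot] at hz
    exact congrArg Subtype.val ((LieSubmodule.mem_bot _).1 hz)

namespace MaximalTorus
variable [T2Space G] [IsTopologicalGroup G] {T : MaximalTorus G} {s : ℕ} {𝔤 : Fin s → LieIdeal ℝ (LieAlg V G)}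
  {δ : T.lieAlgebra V} {b : Fin s → LinearMap.BilinForm ℝ (LieAlg V G)}

theorem _root_.IsSimpleDecomposition.exists_sum {L : Type*} [LieRing L] [LieAlgebra ℝ L]
    {𝔤 : Fin s → LieIdeal ℝ L} (h𝔤 : IsSimpleDecomposition 𝔤) (x : L) :
    ∃ f : Fin s → L, (∀ j, f j ∈ 𝔤 j) ∧ x = ∑ j, f j := by
  have hx : x ∈ LieSubmodule.toSubmodule (⨆ j, 𝔤 j) := by rw [h𝔤.span]; trivial
  rw [LieSubmodule.iSup_toSubmodule, Submodule.mem_iSup_iff_exists_finsupp] at hx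
  obtain ⟨f, hf, hs⟩ := hx
  exact ⟨f, hf, by rw [← hs, Finsupp.sum_fintype _ _ fun _ => rfl]⟩

theorem form_sum (hb : ∀ j, T.IsBasicForm 𝔤 δ j (b j)) {f : Fin s → LieAlg V G}
    (hf : ∀ j, f j ∈ 𝔤 j) (j : Fin s) (y : LieAlg V G) :
    b j (∑ i, f i) y = b j (f j) y := by
  rw [map_sum, LinearMap.sum_apply, Finset.sum_eq_single j]
  · exact fun i _ hij => (hb j).off i hij _ (hf i) y
  · simp

theorem form_nonneg (h𝔤 : IsSimpleDecomposition 𝔤) (hb : ∀ j, T.IsBasicForm 𝔤 δ j (b j))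
    (j : Fin s) (x : LieAlg V G) : 0 ≤ b j x x := by
  obtain ⟨f, hf, rfl⟩ := h𝔤.exists_sum x
  rw [form_sum hb hf, (hb j).symm, form_sum hb hf]
  rcases eq_or_ne (f j) 0 with h | h
  · simp [h]
  · exact ((hb j).pos _ (hf j) h).le

theorem isInvariantInner_sum (h𝔤 : IsSimpleDecomposition 𝔤) (hb : ∀ j, T.IsBasicForm 𝔤 δ j (b j)) :
    IsInvariantInner (∑ j, b j) := by
  refine ⟨fun x y => ?_, fun x y z => ?_, fun x hx => ?_⟩
  · simp only [LinearMap.sum_apply]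
    exact Finset.sum_congr rfl fun j _ => (hb j).symm x y
  · simp only [LinearMap.sum_apply]
    exact Finset.sum_congr rfl fun j _ => (hb j).invariant x y z
  · simp only [LinearMap.sum_apply]
    refine Finset.sum_pos' (fun j _ => form_nonneg h𝔤 hb j x) ?_
    obtain ⟨f, hf, rfl⟩ := h𝔤.exists_sum x
    obtain ⟨j, -, hj⟩ := Finset.exists_ne_zero_of_sum_ne_zero hx
    refine ⟨j, Finset.mem_univ j, ?_⟩
    rw [form_sum hb hf, (hb j).symm, form_sum hb hf]
    exact (hb j).pos _ (hf j) hj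

theorem eq_zero_of_mem_of_mem (hb : ∀ j, T.IsBasicForm 𝔤 δ j (b j)) {i j : Fin s} (hij : i ≠ j)
    {x : LieAlg V G}
    (hi : x ∈ 𝔤 i) (hj : x ∈ 𝔤 j) : x = 0 := by
  by_contra h
  exact ((hb j).pos x hj h).ne' ((hb j).off i hij x hi x)

theorem lie_eq_zero_of_ne (hb : ∀ j, T.IsBasicForm 𝔤 δ j (b j)) {i j : Fin s} (hij : i ≠ j)
    {x y : LieAlg V G}
    (hi : x ∈ 𝔤 i) (hj : y ∈ 𝔤 j) : ⁅x, y⁆ = 0 :=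
  eq_zero_of_mem_of_mem hb hij (lie_mem_left ℝ (LieAlg V G) (𝔤 i) x y hi) (lie_mem_right ℝ (LieAlg V G) (𝔤 j) x y hj)

theorem eq_zero_of_central (h𝔤 : IsSimpleDecomposition 𝔤) (hb : ∀ j, T.IsBasicForm 𝔤 δ j (b j))
    {x : LieAlg V G}
    (hx : ∀ y : LieAlg V G, ⁅x, y⁆ = 0) : x = 0 := by
  obtain ⟨f, hf, rfl⟩ := h𝔤.exists_sum x
  refine Finset.sum_eq_zero fun j _ => ?_
  have := h𝔤.simple j
  have hz : (⟨f j, hf j⟩ : 𝔤 j) ∈ LieAlgebra.center ℝ (𝔤 j) := by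
    rw [LieModule.mem_maxTrivSubmodule]
    intro y
    refine Subtype.ext ?_
    change ⁅(y : LieAlg V G), f j⁆ = 0
    have h1 := hx y
    rw [sum_lie, Finset.sum_eq_single j (fun i _ hij => lie_eq_zero_of_ne hb hij (hf i) y.2) (by simp)] at h1
    rw [← lie_skew, h1, neg_zero]
  rw [LieAlgebra.center_eq_bot] at hz
  exact congrArg Subtype.val ((LieSubmodule.mem_bot _).1 hz)

/-- A functional that vanishes on brackets is `B(x, ·)` for some `x`. Then `B([x, y], [x, y]) = B(x,
[y, [x, y]]) = 0`, so `x` is central and the functional is zero. -/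
theorem _root_.IsInvariantInner.span_lie_eq_top {L : Type*} [LieRing L] [LieAlgebra ℝ L]
    [FiniteDimensional ℝ L] {B : LinearMap.BilinForm ℝ L}
    (hB : IsInvariantInner B) (hcent : ∀ x : L, (∀ y : L, ⁅x, y⁆ = 0) → x = 0) :
    Submodule.span ℝ {z | ∃ x y : L, ⁅x, y⁆ = z} = ⊤ := by
  by_contra hne
  obtain ⟨φ, hφ, hle⟩ := Submodule.exists_le_ker_of_lt_top _ (lt_top_iff_ne_top.2 hne)
  have hinj : Function.Injective (B : L →ₗ[ℝ] Module.Dual ℝ L) := by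
    rw [injective_iff_map_eq_zero]
    intro x hx
    exact hB.eq_zero (by rw [hx]; rfl)
  have hsurj := (LinearMap.injective_iff_surjective_of_finrank_eq_finrank (Subspace.dual_finrank_eq (K := ℝ) (V := L)).symm).1 hinj
  obtain ⟨x, rfl⟩ := hsurj φ
  refine hφ ?_
  rw [hcent x fun y => ?_, map_zero]
  refine hB.eq_zero ?_
  rw [hB.inv]
  exact hle (Submodule.subset_span ⟨y, ⁅x, y⁆, rfl⟩)

/-! ### Roots of the simple factors -/

theorem IsRootPair.mem_of_apply_ne_zero {I J : LieIdeal ℝ (LieAlg V G)}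
    {α : Module.Dual ℝ (T.lieAlgebra V)} {X Y : LieAlg V G}
    (h : T.IsRootPair I α X Y) {H : T.lieAlgebra V} (hH : (H : LieAlg V G) ∈ J) (hα : α H ≠ 0) :
    T.IsRootPair J α X Y := by
  have hne : 2 * Real.pi * α H ≠ 0 := mul_ne_zero (by positivity) hα
  refine ⟨?_, ?_, h.ne_zero, h.lie_left, h.lie_right⟩
  · have h1 := lie_mem_left ℝ (LieAlg V G) J _ Y hH
    rw [h.lie_right, neg_mem_iff] at h1
    exact (Submodule.smul_mem_iff (J : Submodule ℝ (LieAlg V G)) hne).1 h1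
  · have h1 := lie_mem_left ℝ (LieAlg V G) J _ X hH
    rw [h.lie_left] at h1
    exact (Submodule.smul_mem_iff (J : Submodule ℝ (LieAlg V G)) hne).1 h1

/-- The components in the simple ideals of an element of `𝔱` again lie in `𝔱`. One of them has
nonzero value under `α`, and then root vectors, being multiples of brackets with it, lie in that
ideal. -/
theorem exists_factor (h𝔤 : IsSimpleDecomposition 𝔤) (hb : ∀ j, T.IsBasicForm 𝔤 δ j (b j))
    {α : Module.Dual ℝ (T.lieAlgebra V)} (hα : α ≠ 0) :
    ∃ j, ∀ I X Y, T.IsRootPair I α X Y → T.IsRootPair (𝔤 j) α X Y := by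
  obtain ⟨H, hH⟩ : ∃ H, α H ≠ 0 := by
    by_contra! hc; exact hα (LinearMap.ext hc)
  obtain ⟨f, hf, hs⟩ := h𝔤.exists_sum (H : LieAlg V G)
  have hfT : ∀ j, f j ∈ T.lieAlgebra V := fun j => T.mem_lieAlgebra_of_lie_eq_zero fun H' hH' => by
    by_contra hne
    have hmem : ⁅H', f j⁆ ∈ 𝔤 j := lie_mem_right ℝ (LieAlg V G) (𝔤 j) _ _ (hf j)
    have h1 := form_sum (f := fun i => ⁅H', f i⁆) hb (fun i => lie_mem_right ℝ (LieAlg V G) (𝔤 i) _ _ (hf i)) j ⁅H', f j⁆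
    rw [← lie_sum, ← hs, T.lie_eq_zero hH' H.2, map_zero, LinearMap.zero_apply] at h1
    exact ((hb j).pos _ hmem hne).ne h1
  have hs' : H = ∑ j, (⟨f j, hfT j⟩ : T.lieAlgebra V) := Subtype.ext (by rw [hs]; push_cast; rfl)
  rw [hs', map_sum] at hH
  obtain ⟨j, -, hj⟩ := Finset.exists_ne_zero_of_sum_ne_zero hH
  exact ⟨j, fun I X Y h => h.mem_of_apply_ne_zero (hf j) hj⟩


theorem IsCoroot.mem {I : LieIdeal ℝ (LieAlg V G)} {α : Module.Dual ℝ (T.lieAlgebra V)}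
    {h : T.lieAlgebra V} (hh : T.IsCoroot I α h) :
    (h : LieAlg V G) ∈ I := by
  obtain ⟨-, X, Y, hXY, r, hr⟩ := hh
  rw [hr]
  exact I.smul_mem r (lie_mem_left ℝ (LieAlg V G) I X Y hXY.mem_left)

theorem IsCoroot.neg {I : LieIdeal ℝ (LieAlg V G)} {α : Module.Dual ℝ (T.lieAlgebra V)}
    {h : T.lieAlgebra V} (hh : T.IsCoroot I α h) :
    T.IsCoroot I (-α) (-h) := by
  obtain ⟨h2, X, Y, hXY, r, hr⟩ := hh
  refine ⟨by simpa using h2, X, -Y, hXY.neg, r, ?_⟩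
  rw [lie_neg, smul_neg, ← hr]; rfl

theorem IsCoroot.reflect {B : LinearMap.BilinForm ℝ (LieAlg V G)} (hB : IsInvariantInner B)
    {I : LieIdeal ℝ (LieAlg V G)}
    {α β : Module.Dual ℝ (T.lieAlgebra V)} {h g : T.lieAlgebra V}
    (hα : α ≠ 0) (hh : T.IsCoroot I α h) (hg : T.IsCoroot I β g) :
    T.IsCoroot I (β - β h • α) (g - α g • h) := by
  obtain ⟨⟨n, hn⟩, -⟩ := hh.exists_reflection hB hα
  obtain ⟨-, X, Y, hXY, r, hr⟩ := id hg
  have h2 : (β - β h • α) (g - α g • h) = 2 := by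
    simp only [LinearMap.sub_apply, LinearMap.smul_apply, map_sub, map_smul, smul_eq_mul, hh.1, hg.1]; ring
  refine ⟨h2, Ad n X, Ad n Y, (hXY.reflect hh.1 hn).mem_of_apply_ne_zero (H := g - α g • h)
    (sub_mem hg.mem (I.smul_mem _ hh.mem)) (by rw [h2]; norm_num), r, ?_⟩
  rw [← Ad_lie, ← Ad_smul, ← hr, hn]; rfl

theorem IsCoroot.isRoot {I : LieIdeal ℝ (LieAlg V G)} {α : Module.Dual ℝ (T.lieAlgebra V)}
    {h : T.lieAlgebra V} (hh : T.IsCoroot I α h) :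
    T.IsRoot I α := by
  obtain ⟨h2, X, Y, hXY, -⟩ := hh
  exact ⟨fun h0 => by rw [h0] at h2; norm_num at h2, X, Y, hXY⟩

theorem IsCoroot.apply_int {B : LinearMap.BilinForm ℝ (LieAlg V G)} (hB : IsInvariantInner B)
    {I J : LieIdeal ℝ (LieAlg V G)}
    {α β : Module.Dual ℝ (T.lieAlgebra V)} {h g : T.lieAlgebra V}
    (hh : T.IsCoroot I α h) (hg : T.IsCoroot J β g) : ∃ n : ℤ, α g = n :=
  hh.isRoot.apply_lattice hB (hg.mem_lattice hB hg.isRoot.1)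

/-- Put `p = β(g)` and `q = θ(h)`, negative integers. The form gives `q / p = b(h, h) / 2`, and
Cauchy–Schwarz gives `p q ≤ 4`. The ratio is an integer unless `q = -1` and `p < -1`, which would
make `β` longer than the highest root; reflections then produce roots contradicting that `θ` is
highest. -/
theorem half_form_coroot_of_neg (h𝔤 : IsSimpleDecomposition 𝔤)
    (hb : ∀ j, T.IsBasicForm 𝔤 δ j (b j)) (hδ : ∀ j α, T.IsRoot (𝔤 j) α → α δ ≠ 0)
    {j : Fin s} {θ β : Module.Dual ℝ (T.lieAlgebra V)} {g h : T.lieAlgebra V}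
    (hθ : T.IsHighestRoot (𝔤 j) δ θ) (hg : T.IsCoroot (𝔤 j) θ g)
    (hN : b j g g = 2) (hh : T.IsCoroot (𝔤 j) β h) (hneg : β g < 0) : ∃ n : ℤ, b j h h = 2 * n := by
  have hB := isInvariantInner_sum h𝔤 hb
  obtain ⟨p, hp⟩ := hh.apply_int hB hg
  obtain ⟨q, hq⟩ := hg.apply_int hB hh
  have e1 := hh.form_eq (hb j).invariant g
  have e2 := hg.form_eq (hb j).invariant h
  rw [hN, hq, div_self two_ne_zero, one_mul] at e2
  rw [(hb j).symm, e2, hp] at e1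
  rw [hp] at hneg
  have hNpos : 0 < b j h h := (hb j).pos _ hh.mem fun h0 => by
    have h1 := hh.1
    rw [show h = 0 from Subtype.ext h0, map_zero] at h1
    norm_num at h1
  have hq0 : (q : ℝ) < 0 := by rw [e1]; exact mul_neg_of_pos_of_neg (by linarith) hneg
  have hcs := LinearMap.BilinForm.apply_sq_le_of_symm (b j) (form_nonneg h𝔤 hb j) ⟨(hb j).symm⟩ (g : LieAlg V G) (h : LieAlg V G)
  rw [e2, hN] at hcs
  have hpq : (p : ℝ) * q ≤ 4 := by
    have h1 : (q : ℝ) * (4 - p * q) ≤ 0 := by nlinarith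
    by_contra! hc
    nlinarith
  have ip : p < 0 := by exact_mod_cast hneg
  have iq : q < 0 := by exact_mod_cast hq0
  have ipq : p * q ≤ 4 := by exact_mod_cast hpq
  by_cases hp1 : p = -1
  · exact ⟨-q, by rw [hp1] at e1; push_cast at e1 ⊢; linarith⟩
  by_cases hq1 : q = -1
  swap
  · have hp2 : p ≤ -2 := by omega
    have hq2 : q ≤ -2 := by omega
    have h1 : p = -2 := le_antisymm hp2 (by by_contra! hc; nlinarith)
    have h2 : q = -2 := le_antisymm hq2 (by by_contra! hc; nlinarith)
    exact ⟨1, by rw [h1, h2] at e1; push_cast at e1 ⊢; linarith⟩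
  exfalso
  have hp4 : -4 ≤ p := by rw [hq1] at ipq; linarith
  -- Since `θ(h) = -1`, reflecting `θ` in `β` gives the root `θ + β`. Maximality of `θ` then forces
  -- `β` to be negative and `θ + β` to be positive.
  have hμ : T.IsRoot (𝔤 j) (θ + β) := by
    have h1 := (hh.reflect hB hh.isRoot.1 hg).isRoot
    rw [hq, hq1] at h1
    convert h1 using 1
    push_cast; module
  rcases lt_or_gt_of_ne (hδ j β hh.isRoot) with hβδ | hβδ
  swap
  · exact hθ.2.2 β hh.isRoot hβδ hμ
  rcases lt_or_gt_of_ne (hδ j _ hμ) with hμδ | hμδ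
  · refine hθ.2.2 (-(θ + β)) hμ.neg (by rw [LinearMap.neg_apply]; linarith) ?_
    have : θ + -(θ + β) = -β := by abel
    rw [this]; exact hh.isRoot.neg
  -- For `p = -3` or `p = -2`, a reflection in `θ` yields `θ + (θ + β)`, a root higher than `θ`. For
  -- `p = -4` equality in Cauchy–Schwarz gives `β = -2θ`, which contradicts positivity of `θ + β`.
  have hcor : T.IsCoroot (𝔤 j) (θ + β) (g - β g • h) → False := by
    intro hcμ
    by_cases hp3 : p = -3
    · have h1 := (hg.reflect hB hθ.1.1 hcμ).isRoot
      rw [LinearMap.add_apply, hg.1, hp, hp3] at h1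
      refine hθ.2.2 (θ + β) hμ hμδ ?_
      convert h1 using 1
      push_cast; module
    by_cases hp2 : p = -2
    · have h1 := (hg.reflect hB hθ.1.1 hh).isRoot
      rw [hp, hp2] at h1
      refine hθ.2.2 (θ + β) hμ hμδ ?_
      convert h1 using 1
      push_cast; module
    have hp4' : p = -4 := by omega
    have hz : (g : LieAlg V G) + (2 : ℝ) • (h : LieAlg V G) = 0 := by
      by_contra hne
      have h1 := (hb j).pos _ (add_mem hg.mem ((𝔤 j).smul_mem 2 hh.mem)) hne
      simp only [map_add, map_smul, LinearMap.add_apply, LinearMap.smul_apply, smul_eq_mul, (hb j).symm h g, e2, hN] at h1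
      rw [hp4', hq1] at e1
      rw [hq1] at h1
      push_cast at e1 h1
      linarith
    have hβ : ∀ H, β H = -2 * θ H := by
      intro H
      have h1 := hh.form_eq (hb j).invariant H
      have h2 := hg.form_eq (hb j).invariant H
      have h3 : b j ((g : LieAlg V G) + (2 : ℝ) • (h : LieAlg V G)) H = 0 := by rw [hz]; simp
      rw [map_add, map_smul, LinearMap.add_apply, LinearMap.smul_apply, smul_eq_mul, h1, h2, hN] at h3
      rw [hp4', hq1] at e1
      push_cast at e1
      have h4 : b j h h = 1 / 2 := by linarith
      rw [h4] at h3
      linarith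
    have h5 := hθ.2.1
    rw [LinearMap.add_apply, hβ] at hμδ
    linarith
  have h1 := hh.reflect hB hh.isRoot.1 hg
  rw [hq, hq1] at h1
  refine hcor ?_
  convert h1 using 1
  push_cast; module

/-- Coroots not orthogonal to that of the highest root are settled directly, up to sign. An
orthogonal one is first reflected in a root `γ` nonzero on both coroots, which preserves its length.
Such a `γ` exists: otherwise `ad g ad h` would vanish, which is impossible in a simple factor. -/
theorem half_form_coroot (h𝔤 : IsSimpleDecomposition 𝔤) (hb : ∀ j, T.IsBasicForm 𝔤 δ j (b j))
    (hδ : ∀ j α, T.IsRoot (𝔤 j) α → α δ ≠ 0)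
    {j : Fin s} {β : Module.Dual ℝ (T.lieAlgebra V)} {h : T.lieAlgebra V}
    (hh : T.IsCoroot (𝔤 j) β h) : ∃ n : ℤ, b j h h = 2 * n := by
  have hB := isInvariantInner_sum h𝔤 hb
  obtain ⟨θ, g, hθ, hg, hN⟩ := (hb j).normalized
  have step : ∀ β h, T.IsCoroot (𝔤 j) β h → β g ≠ 0 → ∃ n : ℤ, b j h h = 2 * n := by
    intro β h hh hne
    rcases lt_or_gt_of_ne hne with hlt | hlt
    · exact half_form_coroot_of_neg h𝔤 hb hδ hθ hg hN hh hlt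
    · obtain ⟨n, hn⟩ := half_form_coroot_of_neg h𝔤 hb hδ hθ hg hN hh.neg (by simpa using hlt)
      exact ⟨n, by simpa using hn⟩
  by_cases hβ : β g = 0
  swap
  · exact step β h hh hβ
  by_cases hex : ∃ γ k, T.IsCoroot (𝔤 j) γ k ∧ γ g ≠ 0 ∧ γ h ≠ 0
  · obtain ⟨γ, k, hk, h1, h2⟩ := hex
    have e1 := hh.form_eq (hb j).invariant k
    have e2 := hk.form_eq (hb j).invariant h
    have hk0 : 0 < b j k k := (hb j).pos _ hk.mem fun h0 => by
      have h1 := hk.1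
      rw [show k = 0 from Subtype.ext h0, map_zero] at h1
      norm_num at h1
    have hβk : β k ≠ 0 := by
      intro h0
      rw [h0, mul_zero, (hb j).symm, e2] at e1
      exact (mul_ne_zero (by linarith) h2) e1
    obtain ⟨n, hn⟩ := step _ _ (hk.reflect hB hk.isRoot.1 hh) (by
      rw [LinearMap.sub_apply, LinearMap.smul_apply, hβ, zero_sub, neg_ne_zero, smul_eq_mul]
      exact mul_ne_zero hβk h1)
    refine ⟨n, ?_⟩
    rw [← hn]
    push_cast
    simp only [map_sub, map_smul, LinearMap.sub_apply, LinearMap.smul_apply, smul_eq_mul, (hb j).symm h k, e2]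
    ring
  · exfalso
    push Not at hex
    have := h𝔤.simple j
    have hh0 : (h : LieAlg V G) ≠ 0 := fun h0 => by
      have h1 := hh.1
      rw [show h = 0 from Subtype.ext h0, map_zero] at h1
      norm_num at h1
    have hg0 : (g : LieAlg V G) = 0 := by
      refine LieIdeal.eq_zero_of_lie_lie_eq_zero hB hg.mem hh.mem (T.lie_eq_zero g.2 h.2) (fun x => ?_) hh0
      by_contra hx
      let A : LieAlg V G →ₗ[ℝ] LieAlg V G := LieModule.toEnd ℝ (LieAlg V G) (LieAlg V G) (g : LieAlg V G) ∘ₗ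
        LieModule.toEnd ℝ (LieAlg V G) (LieAlg V G) (h : LieAlg V G)
      have hA : ∀ z, A z = ⁅(g : LieAlg V G), ⁅(h : LieAlg V G), z⁆⁆ := fun z => rfl
      obtain ⟨α, X, Y, ⟨z, hz⟩, -, hα, hXY⟩ := exists_rootPair hB (S₀ := LinearMap.range A) (T := T)
        (fun hbot => hx (by
          have : A x ∈ LinearMap.range A := ⟨x, rfl⟩
          rw [hbot] at this; exact this))
        (by
          rintro H hH _ ⟨z, rfl⟩
          exact ⟨⁅H, z⁆, by rw [hA, hA, T.lie_lie_comm h.2 hH, T.lie_lie_comm g.2 hH]⟩)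
        (by
          rintro _ ⟨z, rfl⟩ H hH
          rw [hA, bilin_lie_skew hB.inv, T.lie_eq_zero g.2 hH, map_zero, neg_zero])
      have hAX : ⁅(h : LieAlg V G), ⁅(g : LieAlg V G), X⁆⁆ = 0 := by
        rw [hXY.lie_left, lie_smul, hXY.lie_right]
        by_cases h1 : α g = 0
        · rw [h1]; simp
        · obtain ⟨k, hk⟩ := (hXY.mem_of_apply_ne_zero hg.mem h1).exists_coroot hB hα
          rw [hex α k hk h1]; simp
      refine hXY.ne_zero (hB.eq_zero ?_)
      nth_rewrite 1 [← hz]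
      rw [hA, bilin_lie_skew hB.inv, bilin_lie_skew hB.inv, hAX, map_zero, neg_zero, neg_zero]
    rw [hg0] at hN
    norm_num at hN

theorem root_apply_ne_zero (h𝔤 : IsSimpleDecomposition 𝔤) (hb : ∀ j, T.IsBasicForm 𝔤 δ j (b j))
    (hδ : ∀ j α, T.IsRoot (𝔤 j) α → α δ ≠ 0)
    {α : Module.Dual ℝ (T.lieAlgebra V)} (hα : T.IsRoot ⊤ α) : α δ ≠ 0 := by
  obtain ⟨hα, X, Y, hXY⟩ := hα
  obtain ⟨i, hi⟩ := exists_factor h𝔤 hb hα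
  exact hδ i α ⟨hα, X, Y, hi _ X Y hXY⟩

/-- The basic inner products are integral on the integral lattice of a simply connected group. -/
theorem form_lattice_int [CompactSpace G] [SimplyConnectedSpace G] (h𝔤 : IsSimpleDecomposition 𝔤)
    (hb : ∀ j, T.IsBasicForm 𝔤 δ j (b j))
    (hδ : ∀ j α, T.IsRoot (𝔤 j) α → α δ ≠ 0) (j : Fin s) {ξ ξ' : LieAlg V G} (hξ : ξ ∈ T.lattice V)
    (hξ' : ξ' ∈ T.lattice V) :
    ∃ n : ℤ, b j ξ ξ' = n := by
  have hB := isInvariantInner_sum h𝔤 hb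
  have hmem := mem_corootLattice hB (fun α hα => root_apply_ne_zero h𝔤 hb hδ hα) (fun x hx => eq_zero_of_central h𝔤 hb hx) (ξ := ⟨ξ, hξ.1⟩) hξ
  have key : ∀ x ∈ T.corootLattice V, ∃ n : ℤ, b j (x : LieAlg V G) ξ' = n := by
    intro x hx
    induction hx using AddSubgroup.closure_induction with
    | mem h hh =>
      obtain ⟨α, hα, h2, X, Y, hXY, r, hr⟩ := hh
      obtain ⟨i, hi⟩ := exists_factor h𝔤 hb hα.1
      have hc : T.IsCoroot (𝔤 i) α h := ⟨h2, X, Y, hi _ X Y hXY, r, hr⟩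
      by_cases hij : i = j
      · subst hij
        -- For a coroot `h` of the same factor, `b(h, ξ') = (b(h, h) / 2) α(ξ')` is a product of two
        -- integers.
        obtain ⟨n, hn⟩ := half_form_coroot h𝔤 hb hδ hc
        obtain ⟨m, hm⟩ := IsRoot.apply_lattice (ξ := ⟨ξ', hξ'.1⟩) hB hα hξ'
        refine ⟨n * m, ?_⟩
        have := hc.form_eq (hb i).invariant ⟨ξ', hξ'.1⟩
        rw [hn, hm] at this
        rw [this]; push_cast; ring
      · exact ⟨0, by rw [(hb j).off i hij _ hc.mem]; simp⟩
    | zero => exact ⟨0, by simp⟩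
    | add x y _ _ hx hy =>
      obtain ⟨m, hm⟩ := hx
      obtain ⟨n, hn⟩ := hy
      exact ⟨m + n, by push_cast; rw [map_add, LinearMap.add_apply, hm, hn]⟩
    | neg x _ hx =>
      obtain ⟨m, hm⟩ := hx
      exact ⟨-m, by push_cast; rw [map_neg, LinearMap.neg_apply, hm]⟩
  exact key _ hmem

end MaximalTorus

end

/-! ### Splitting over the lattice and the final assembly. -/

noncomputable section

open scoped Manifold ContDiff ENNReal Topology
open VectorField Set Filter
variable {V : Type*} [NormedAddCommGroup V] [NormedSpace ℝ V] [CompleteSpace V]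
  {G : Type*} [TopologicalSpace G] [ChartedSpace V G] [Group G] [LieGroup 𝓘(ℝ, V) ∞ G]
variable [FiniteDimensional ℝ V]

/-- A homomorphism from a free abelian group lifts along `π` if it lifts elementwise and all lifts commute. -/
theorem exists_monoidHom_lift {E M A : Type*} [Group E] [Group M] [AddCommGroup A]
    [Module.Projective ℤ A] (π : E →* M)
    (φ : Multiplicative A →* M) (hlift : ∀ a, ∃ x, π x = φ a)
    (hcomm : ∀ x y a b, π x = φ a → π y = φ b → x * y = y * x) :
    ∃ τ : Multiplicative A →* E, π.comp τ = φ := by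
  -- The pulled-back extension of `A`. It is commutative because all lifts commute, so the section
  -- of its projection exists as soon as `A` is projective.
  let P : Subgroup (E × Multiplicative A) := (π.comp (MonoidHom.fst _ _)).eqLocus (φ.comp (MonoidHom.snd _ _))
  let _ : CommGroup P := { (inferInstance : Group P) with
    mul_comm := fun p q => Subtype.ext (Prod.ext (hcomm _ _ _ _ p.2 q.2) (mul_comm _ _)) }
  let f : Additive P →ₗ[ℤ] A := (MonoidHom.toAdditiveLeft ((MonoidHom.snd E (Multiplicative A)).comp P.subtype)).toIntLinearMap
  have hf : Function.Surjective f := fun a => by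
    obtain ⟨x, hx⟩ := hlift (.ofAdd a)
    exact ⟨.ofMul ⟨(x, .ofAdd a), hx⟩, rfl⟩
  obtain ⟨s, hs⟩ := Module.projective_lifting_property f LinearMap.id hf
  refine ⟨((MonoidHom.fst E (Multiplicative A)).comp P.subtype).comp (AddMonoidHom.toMultiplicativeLeft s.toAddMonoidHom), ?_⟩
  refine MonoidHom.ext fun a => ?_
  have h1 : f (s a.toAdd) = a.toAdd := LinearMap.congr_fun hs a.toAdd
  have h2 := (s a.toAdd).toMul.2
  refine Eq.trans h2 ?_
  exact congrArg φ h1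

namespace MaximalTorus
variable [IsTopologicalGroup G] [T2Space G] {T : MaximalTorus G} {B : LinearMap.BilinForm ℝ (LieAlg V G)}

/-- The roots have integer values on `Λ` and separate its points, so `Λ` embeds into a finite power
of `ℤ` and is free. -/
theorem projective_lattice [CompactSpace G] [ConnectedSpace G] (hB : IsInvariantInner B)
    {δ : T.lieAlgebra V} (hδ : ∀ α, T.IsRoot ⊤ α → α δ ≠ 0)
    (hcent : ∀ x : LieAlg V G, (∀ y : LieAlg V G, ⁅x, y⁆ = 0) → x = 0) :
    Module.Projective ℤ (T.lattice V) := by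
  have : Finite {α : Module.Dual ℝ (T.lieAlgebra V) // T.IsRoot ⊤ α} := finite_roots hB hδ
  have key : ∀ (α : {α : Module.Dual ℝ (T.lieAlgebra V) // T.IsRoot ⊤ α}) (ξ : T.lattice V), ∃ n : ℤ, α.1 ⟨ξ, ξ.2.1⟩ = n :=
    fun α ξ => IsRoot.apply_lattice (ξ := ⟨ξ, ξ.2.1⟩) hB α.2 ξ.2
  choose n hn using key
  let f : T.lattice V →ₗ[ℤ] {α : Module.Dual ℝ (T.lieAlgebra V) // T.IsRoot ⊤ α} → ℤ := AddMonoidHom.toIntLinearMap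
    (AddMonoidHom.mk' (fun ξ α => n α ξ) fun ξ η => by
      funext α
      have h1 : (n α (ξ + η) : ℝ) = n α ξ + n α η := by
        rw [← hn, ← hn, ← hn, ← map_add]; rfl
      exact_mod_cast h1)
  have hf : Function.Injective f := by
    rw [injective_iff_map_eq_zero]
    intro ξ hξ
    have h1 : (⟨ξ, ξ.2.1⟩ : T.lieAlgebra V) = 0 := eq_zero_of_root_eq_zero hB hcent _ fun α hα => by
      rw [hn ⟨α, hα⟩, show n ⟨α, hα⟩ ξ = 0 from congrFun hξ ⟨α, hα⟩, Int.cast_zero]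
    exact Subtype.ext (congrArg (fun x : T.lieAlgebra V => (x : LieAlg V G)) h1)
  have : Module.Free ℤ (T.lattice V) := Module.Free.of_equiv (LinearEquiv.ofInjective f hf).symm
  infer_instance

theorem isSobolevLoop_latticeLoop (T : MaximalTorus G) (σ : ℝ) (ξ : Multiplicative (T.lattice V)) :
    IsSobolevLoop V σ (T.latticeLoop V ξ) := by
  intro φ
  refine memℓp_sobolevCoeff_of_contDiff σ ?_
  have h1 : ContMDiff 𝓘(ℝ, ℝ) 𝓘(ℝ, V) ∞ fun r : ℝ => (lieExp (r • (-(ξ.toAdd : LieAlg V G))) : G) := contMDiff_lieExp_smul _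
  have h2 := (φ.contMDiff.comp h1).contDiff
  convert h2 using 2 with r
  exact congrArg φ (congrArg lieExp (smul_neg _ _).symm)

variable {s : ℕ} {𝔤 : Fin s → LieIdeal ℝ (LieAlg V G)} {δ : T.lieAlgebra V} {b : Fin s → LinearMap.BilinForm ℝ (LieAlg V G)}

theorem levelForm_symm (hb : ∀ j, T.IsBasicForm 𝔤 δ j (b j)) (l : Fin s → ℤ) (x y : LieAlg V G) :
    levelForm b l x y = levelForm b l y x := by
  simp only [levelForm, LinearMap.sum_apply, LinearMap.smul_apply]
  exact Finset.sum_congr rfl fun j _ => by rw [(hb j).symm]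

theorem levelForm_invariant (hb : ∀ j, T.IsBasicForm 𝔤 δ j (b j)) (l : Fin s → ℤ)
    (x y z : LieAlg V G) :
    levelForm b l ⁅x, y⁆ z = levelForm b l x ⁅y, z⁆ := by
  simp only [levelForm, LinearMap.sum_apply, LinearMap.smul_apply]
  exact Finset.sum_congr rfl fun j _ => by rw [(hb j).invariant]

/-- The level form is even on the integral lattice if all levels are even. -/
theorem exists_levelForm_eq_even [CompactSpace G] [SimplyConnectedSpace G]
    (h𝔤 : IsSimpleDecomposition 𝔤) (hb : ∀ j, T.IsBasicForm 𝔤 δ j (b j))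
    (hδ : ∀ j α, T.IsRoot (𝔤 j) α → α δ ≠ 0) {l : Fin s → ℤ} (hl : ∀ j, Even (l j))
    {ξ ξ' : LieAlg V G} (hξ : ξ ∈ T.lattice V) (hξ' : ξ' ∈ T.lattice V) :
    ∃ n : ℤ, Even n ∧ levelForm b l ξ ξ' = n := by
  choose n hn using fun j => form_lattice_int h𝔤 hb hδ j hξ hξ'
  refine ⟨∑ j, l j * n j, Finset.even_sum _ fun j _ => (hl j).mul_right _, ?_⟩
  simp only [levelForm, LinearMap.sum_apply, LinearMap.smul_apply, hn, smul_eq_mul]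
  push_cast; rfl

end MaximalTorus

end

theorem proposition4p1
    -- a compact simply connected Lie group
    {V : Type*} [NormedAddCommGroup V] [NormedSpace ℝ V] [FiniteDimensional ℝ V] [CompleteSpace V]
    {G : Type*} [TopologicalSpace G] [ChartedSpace V G] [Group G] [LieGroup 𝓘(ℝ, V) ∞ G]
    [IsTopologicalGroup G] [T2Space G] [CompactSpace G] [SimplyConnectedSpace G]
    -- a maximal torus, the simple factors, a system of positive roots, the basic inner products
    (T : MaximalTorus G) {s : ℕ} (𝔤 : Fin s → LieIdeal ℝ (LieAlg V G))
    (h𝔤 : IsSimpleDecomposition 𝔤)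
    (δ : T.lieAlgebra V) (hδ : ∀ j α, T.IsRoot (𝔤 j) α → α δ ≠ 0)
    (b : Fin s → LinearMap.BilinForm ℝ (LieAlg V G)) (hb : ∀ j, T.IsBasicForm 𝔤 δ j (b j))
    -- the Sobolev level, the level, and the central extension
    (f : ℝ) (hf : 1 < f) (l : Fin s → ℤ)
    {W : Type*} [NormedAddCommGroup W] [NormedSpace ℝ W] [CompleteSpace W]
    {E : Type*} [TopologicalSpace E] [ChartedSpace W E] [Group E] [LieGroup 𝓘(ℝ, W) ∞ E]
    (L : LoopExtension W E (levelForm b l) (f + 1 / 2)) :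
    -- (a)
    ((∀ (ξ ξ' : T.lattice V) (x x' : E), L.π x = T.latticeLoop V (.ofAdd ξ) →
        L.π x' = T.latticeLoop V (.ofAdd ξ') →
        ∃ n : ℤ, levelForm b l (ξ : LieAlg V G) (ξ' : LieAlg V G) = n ∧
          x * x' * x⁻¹ * x'⁻¹ = L.ι ((-1) ^ n)) ∧
      ((∀ j, Even (l j)) →
        ∃ τ : Multiplicative (T.lattice V) →* E, L.π.comp τ = T.latticeLoop V)) ∧
    -- the embedding of `G` in the extension
    (∃ j : G →* E, L.IsConstLift j) ∧
    ∀ j : G →* E, L.IsConstLift j →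
      -- (b)
      (∃ φ : T.toSubgroup →* MulAut (L.restrict (basedLoopsIn T.toSubgroup)),
        (∀ t x, (φ t x : E) = j t * x * (j t)⁻¹) ∧
        (∃ e : (L.restrict (basedLoopsIn T.toSubgroup)) ⋊[φ] T.toSubgroup ≃*
            L.restrict (loopsIn T.toSubgroup),
          (∀ p, (e p : E) = p.left * j p.right) ∧
          IsHomeomorph fun p : L.restrict (basedLoopsIn T.toSubgroup) × T.toSubgroup =>
            e ⟨p.1, p.2⟩) ∧
        ∀ (ξ : T.lattice V) (γ : SobolevLoop V G (f + 1 / 2)),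
          γ.1 = T.latticeLoop V (.ofAdd ξ) →
          ∀ x : L.restrict (basedLoopsIn T.toSubgroup),
            L.loop x ∈ connectedComponentIn {γ' | γ'.1 ∈ basedLoopsIn T.toSubgroup} γ →
            ∀ (t : T.toSubgroup) (ζ : T.lieAlgebra V), (t : G) = lieExp (ζ : LieAlg V G) →
              (φ t x : E) = L.ι (Circle.exp (2 * Real.pi *
                levelForm b l (ξ : LieAlg V G) (ζ : LieAlg V G))) * x) ∧
      -- (c)
      ((∀ j, 0 < l j) →
        ∃ e : T.dualSubgroup (levelForm b l) × L.restrict (basedLoopsIn T.toSubgroup) ≃ₜ*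
            L.restrict (loopsInFrom T.toSubgroup (T.dualSubgroup (levelForm b l))),
          ∀ t x, (e (t, x) : E) = j t * x) := by
  have hσ : 3 / 2 < f + 1 / 2 := by linarith
  have hinv := MaximalTorus.levelForm_invariant hb l
  have hsymm := MaximalTorus.levelForm_symm hb l
  have hcent : ∀ x : LieAlg V G, (∀ y : LieAlg V G, ⁅x, y⁆ = 0) → x = 0 := fun x hx =>
    MaximalTorus.eq_zero_of_central h𝔤 hb hx
  have hB := MaximalTorus.isInvariantInner_sum h𝔤 hb
  have hperf := hB.span_lie_eq_top hcent
  have : T2Space E := t2Space_of_lieGroup W E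
  refine ⟨⟨fun ξ ξ' x x' hx hx' => L.commutator_lattice T hσ hinv hsymm hperf ξ ξ' hx hx',
    fun hl => ?_⟩, L.exists_isConstLift hσ hinv hsymm hperf, fun j hj =>
      ⟨LoopExtension.IsConstLift.torus_semidirect T hσ hinv hsymm hperf hj,
        fun _ => LoopExtension.IsConstLift.dual_product T hσ hinv hsymm hperf hj⟩⟩
  have := MaximalTorus.projective_lattice hB
    (fun α hα => MaximalTorus.root_apply_ne_zero h𝔤 hb hδ hα) hcent
  refine exists_monoidHom_lift L.π (T.latticeLoop V)
    (fun ξ => L.range_eq.superset (T.isSobolevLoop_latticeLoop _ ξ)) fun x y ξ ξ' hx hy => ?_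
  -- The commutator of two lifts is `(-1)` to the power `B_l(ξ, ξ')`. For even levels this exponent
  -- is even, so the lifts commute and the abstract lifting lemma applies.
  obtain ⟨n, hn, hc⟩ := L.commutator_lattice T hσ hinv hsymm hperf ξ.toAdd ξ'.toAdd hx hy
  obtain ⟨m, hm, hm'⟩ := MaximalTorus.exists_levelForm_eq_even h𝔤 hb hδ hl ξ.toAdd.2 ξ'.toAdd.2
  have hmn : n = m := by exact_mod_cast hn.symm.trans hm'
  rw [hmn, hm.neg_one_zpow, map_one] at hc
  rwa [mul_inv_eq_one, mul_inv_eq_iff_eq_mul] at hc
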